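/- Let $b>0$, $A_0(x)=\frac b2(-x_2,x_1)$, $\Pi_j=-i\partial_{x_j}-A_{0,j}$ ($j=1,2$), and let $\Lambda_q=b(2q+1)$, $q\in\{0,1,2,\dots\}$, be the Landau levels, $\Lambda_{-1}:=-\infty$. Let $m(x)=\{m_{jk}(x)\}_{j,k=1,2}$, $x\in\mathbb R^2$, be a non-negative Hermitian $2\times2$ matrix whose entries are smooth and bounded on $\mathbb R^2$ together with all their derivatives, and let $m_<(x)\le m_>(x)$ be its eigenvalues. Let $$H_\pm=\sum_{j,k=1,2}\Pi_j(\delta_{jk}\pm m_{jk})\Pi_k$$ be the corresponding self-adjoint operators in $L^2(\mathbb R^2)$ (the Friedrichs extensions from $C_0^\infty(\mathbb R^2)$: the domain consists of the $u\in L^2$ such that $\Pi_1u,\Pi_2u\in L^2$ and $\sum_{j,k}\Pi_j(\delta_{jk}\pm m_{jk})\Pi_ku\in L^2$ in the sense of distributions); in the case of $H_-$ assume in addition $\sup_x|m(x)|=\sup_x m_>(x)<1$. Assume that there are constants $\beta>0$, $\gamma>0$ such that, for both $m_<$ and $m_>$, $$\ln m_\gtrless(x)=-\gamma|x|^{2\beta}+O(\ln|x|),\qquad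 |x|\to\infty,$$ and put $\mu=\gamma(2/b)^\beta$. *Coefficients.* If $\beta\in(0,1)$ then, for small real $|\epsilon|$, the equation $s=1-\epsilon\beta\mu s^\beta$ has a unique positive solution $s_<(\epsilon)$, the function $f(\epsilon)=s_<(\epsilon)-\ln s_<(\epsilon)+\epsilon\mu s_<(\epsilon)^\beta$ is real analytic near $0$, and we set $f_j=f^{(j)}(0)/j!$; in particular $f_1=\mu$. If $\beta>1$ then, for small real $|\epsilon|$, the equation $\beta\mu s^\beta=1-\epsilon s$ has a unique positive solution $s_>(\epsilon)$, the function $g(\epsilon)=\mu s_>(\epsilon)^\beta-\ln s_>(\epsilon)+\epsilon s_>(\epsilon)$ is real analytic near $0$, and we set $g_j=g^{(j)}(0)/j!$. Thus $f_j$, $g_j$ depend only on $\beta$ and $\mu$. *Theorem.* Fix $q\in\{0,1,2,\dots\}$. The eigenvalues of $H_+$ in $(\Lambda_q,\Lambda_{q+1})$, counted with multiplicities, form an infinite sequence $\{\lambda^+_{k,q}\}_{k\ge0}$ when enumerated in decreasing order; the eigenvalues of $H_-$ in $(\Lambda_{q-1},\Lambda_q)$, counted with multiplicities, form an infinite sequence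 $\{\lambda^-_{k,q}\}_{k\ge0}$ when enumerated in increasing order; and, as $k\to\infty$, (i) if $\beta\in(0,1)$, $$\ln\big(\pm(\lambda^\pm_{k,q}-\Lambda_q)\big)=-\sum_{1\le j<\frac1{1-\beta}}f_j\,k^{(\beta-1)j+1}+O(\ln k);$$ (ii) if $\beta=1$, $$\ln\big(\pm(\lambda^\pm_{k,q}-\Lambda_q)\big)=-\ln(1+\mu)\,k+O(\ln k);$$ (iii) if $\beta>1$, $$\ln\big(\pm(\lambda^\pm_{k,q}-\Lambda_q)\big)=-\frac{\beta-1}{\beta}\,k\ln k+\frac{\beta-1-\ln(\mu\beta)}{\beta}\,k-\sum_{1\le j<\frac{\beta}{\beta-1}}g_j\,k^{(\frac1\beta-1)j+1}+O(\ln k).$$ -/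

import Mathlib

open MeasureTheory Filter Topology Asymptotics
open scoped ContDiff ENNReal ComplexOrder

noncomputable section

namespace MetricLandau

/-- The Euclidean plane. -/
abbrev Plane : Type := EuclideanSpace ℝ (Fin 2)

/-- The Hilbert space of square integrable complex functions on the plane (Lebesgue measure). -/
abbrev L2 : Type := Lp ℂ 2 (volume : Measure Plane)

/-- Smooth compactly supported complex functions on the plane. -/
def IsTest (φ : Plane → ℂ) : Prop := ContDiff ℝ ∞ φ ∧ HasCompactSupport φ

/-- The magnetic potential `(b / 2) (-x₂, x₁)`. -/
def potential (b : ℝ) (x : Plane) (j : Fin 2) : ℝ :=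
  if j = 0 then -(b / 2) * x 1 else (b / 2) * x 0

/-- The magnetic momentum `Π_j = -i ∂_j - A_j`, acting on differentiable functions. -/
def momentum (b : ℝ) (j : Fin 2) (φ : Plane → ℂ) (x : Plane) : ℂ :=
  -Complex.I * fderiv ℝ φ x (EuclideanSpace.single j 1) - (potential b x j : ℂ) * φ x

theorem IsTest.memLp {φ : Plane → ℂ} (h : IsTest φ) :
    MemLp φ 2 (volume : Measure Plane) :=
  h.1.continuous.memLp_of_hasCompactSupport h.2

/-- A test function, as an element of the Hilbert space. -/
def IsTest.toL2 {φ : Plane → ℂ} (h : IsTest φ) : L2 := h.memLp.toLp φ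

theorem IsTest.momentum {φ : Plane → ℂ} (h : IsTest φ) (b : ℝ) (j : Fin 2) :
    IsTest (momentum b j φ) := by
  obtain ⟨h1, h2⟩ := h
  have hp : ContDiff ℝ ∞ (fun x : Plane => (potential b x j : ℂ)) := by
    have : ContDiff ℝ ∞ (fun x : Plane => potential b x j) := by
      unfold potential
      split_ifs <;> fun_prop
    exact Complex.ofRealCLM.contDiff.comp this
  have hd : ContDiff ℝ ∞ (fun x : Plane => fderiv ℝ φ x (EuclideanSpace.single j 1)) :=
    (h1.fderiv_right (m := ∞) (by norm_num)).clm_apply contDiff_const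
  refine ⟨(contDiff_const.mul hd).sub (hp.mul h1), ?_⟩
  have hs : HasCompactSupport (fun x : Plane => fderiv ℝ φ x (EuclideanSpace.single j 1)) :=
    h2.fderiv_apply ℝ _
  exact (HasCompactSupport.mul_left (f := fun _ => -Complex.I) hs).sub
    (HasCompactSupport.mul_left (f := fun x => (potential b x j : ℂ)) h2)

/-- `Π_j u = w` in the sense of distributions, with both `u` and `w` square integrable. -/
def WeakMomentum (b : ℝ) (j : Fin 2) (u w : L2) : Prop :=
  ∀ (φ : Plane → ℂ) (h : IsTest φ), inner ℂ h.toL2 w = inner ℂ (h.momentum b j).toL2 u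

/-- The graph of `∑ j k, Π_j g_jk Π_k` in the Hilbert space: the pairs `(u, v)` such that the
weak momenta `w k = Π_k u` are square integrable, and `v = ∑ j, Π_j (∑ k, g_jk (w k))` in the sense
of distributions. For a bounded smooth uniformly positive definite Hermitian `g` this is the
self-adjoint operator attached to the closed quadratic form `∑ j k, ⟨Π_j u, g_jk Π_k u⟩`
(the Friedrichs extension of the operator on test functions). -/
def metricGraph (b : ℝ) (g : Plane → Matrix (Fin 2) (Fin 2) ℂ) : Submodule ℂ (L2 × L2) where
  carrier := {p | ∃ w y : Fin 2 → L2, (∀ k, WeakMomentum b k p.1 (w k)) ∧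
    (∀ j, (y j : Plane → ℂ) =ᵐ[volume] fun x => ∑ k, g x j k * (w k : Plane → ℂ) x) ∧
    ∀ (φ : Plane → ℂ) (h : IsTest φ),
      inner ℂ h.toL2 p.2 = ∑ j, inner ℂ (h.momentum b j).toL2 (y j)}
  zero_mem' := by
    refine ⟨0, 0, fun k φ h => by simp, fun j => ?_, fun φ h => by simp⟩
    filter_upwards [Lp.coeFn_zero ℂ 2 (volume : Measure Plane)] with x hx
    simp
  add_mem' := by
    rintro p p' ⟨w, y, h1, h2, h3⟩ ⟨w', y', h1', h2', h3'⟩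
    refine ⟨w + w', y + y', fun k φ h => ?_, fun j => ?_, fun φ h => ?_⟩
    · simp [inner_add_right, h1 k φ h, h1' k φ h]
    · filter_upwards [h2 j, h2' j, Lp.coeFn_add (y j) (y' j), Lp.coeFn_add (w 0) (w' 0),
        Lp.coeFn_add (w 1) (w' 1)] with x e e' a a0 a1
      simp only [Pi.add_apply, Fin.sum_univ_two] at *
      rw [a, a0, a1, e, e']
      ring
    · simp [inner_add_right, h3 φ h, h3' φ h, Finset.sum_add_distrib]
  smul_mem' := by
    rintro c p ⟨w, y, h1, h2, h3⟩
    refine ⟨c • w, c • y, fun k φ h => ?_, fun j => ?_, fun φ h => ?_⟩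
    · simp [inner_smul_right, h1 k φ h]
    · filter_upwards [h2 j, Lp.coeFn_smul c (y j), Lp.coeFn_smul c (w 0),
        Lp.coeFn_smul c (w 1)] with x e a a0 a1
      simp only [Pi.smul_apply, Fin.sum_univ_two, smul_eq_mul] at *
      rw [a, a0, a1, e]
      ring
    · simp [inner_smul_right, h3 φ h, mul_add]

theorem eq_zero_of_inner_test {u : L2}
    (hu : ∀ (φ : Plane → ℂ) (h : IsTest φ), inner ℂ h.toL2 u = 0) : u = 0 := by
  have hd := Lp.dense_hasCompactSupport_contDiff (E := Plane) (F := ℂ) (μ := volume)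
    (p := 2) (by norm_num)
  refine hd.eq_zero_of_inner_right ℂ ?_
  rintro v ⟨φ, h1, h2, h3⟩
  have : v = IsTest.toL2 ⟨h3, h2⟩ := by
    refine Lp.ext (h1.trans ?_)
    exact (MemLp.coeFn_toLp (IsTest.memLp ⟨h3, h2⟩)).symm
  rw [this]
  exact hu φ _

theorem metricGraph_snd_eq_zero (b : ℝ) (g : Plane → Matrix (Fin 2) (Fin 2) ℂ)
    (p : L2 × L2) (hp : p ∈ metricGraph b g) (h0 : p.1 = 0) : p.2 = 0 := by
  obtain ⟨w, y, h1, h2, h3⟩ := hp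
  have hw : ∀ k, w k = 0 := fun k =>
    eq_zero_of_inner_test fun φ h => by rw [h1 k φ h, h0, inner_zero_right]
  have hy : ∀ j, y j = 0 := by
    intro j
    refine Lp.ext ?_
    filter_upwards [h2 j, Lp.coeFn_zero ℂ 2 (volume : Measure Plane)] with x e z
    rw [e, z]
    simp [hw]
  exact eq_zero_of_inner_test fun φ h => by simp [h3 φ h, hy]

/-- The operator `∑ j k, Π_j g_jk Π_k` in the Hilbert space. -/
def metricOperator (b : ℝ) (g : Plane → Matrix (Fin 2) (Fin 2) ℂ) : L2 →ₗ.[ℂ] L2 :=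
  (metricGraph b g).toLinearPMap

theorem metricOperator_graph (b : ℝ) (g : Plane → Matrix (Fin 2) (Fin 2) ℂ) :
    (metricOperator b g).graph = metricGraph b g :=
  Submodule.toLinearPMap_graph_eq _ (metricGraph_snd_eq_zero b g)

/-- The operator `H₊`, with metric `1 + m`. -/
def HPlus (b : ℝ) (m : Plane → Matrix (Fin 2) (Fin 2) ℂ) : L2 →ₗ.[ℂ] L2 :=
  metricOperator b fun x => 1 + m x

/-- The operator `H₋`, with metric `1 - m`. -/
def HMinus (b : ℝ) (m : Plane → Matrix (Fin 2) (Fin 2) ℂ) : L2 →ₗ.[ℂ] L2 :=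
  metricOperator b fun x => 1 - m x

/-- The space of all `u` in the domain of `T` with `T u = E u`. -/
def eigenspace (T : L2 →ₗ.[ℂ] L2) (E : ℝ) : Submodule ℂ L2 :=
  T.graph.comap (LinearMap.id.prod ((E : ℂ) • LinearMap.id))

/-- The sequence `lam` lists exactly the eigenvalues of `T` in the set `I`, each one repeated
according to its multiplicity. -/
def ListsEigenvalues (T : L2 →ₗ.[ℂ] L2) (I : Set ℝ) (lam : ℕ → ℝ) : Prop :=
  (∀ k, lam k ∈ I) ∧
    ∀ E ∈ I, Cardinal.mk {k : ℕ // lam k = E} = Module.rank ℂ (eigenspace T E)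

/-- The Landau level `b (2 q + 1)`. -/
def landauLevel (b : ℝ) (q : ℕ) : ℝ := b * (2 * q + 1)

/-- The open gap directly below the Landau level of index `q` (a half-line if `q = 0`). -/
def gapBelow (b : ℝ) : ℕ → Set ℝ
  | 0 => Set.Iio (landauLevel b 0)
  | q + 1 => Set.Ioo (landauLevel b q) (landauLevel b (q + 1))

/-- The open gap directly above the Landau level of index `q`. -/
def gapAbove (b : ℝ) (q : ℕ) : Set ℝ := Set.Ioo (landauLevel b q) (landauLevel b (q + 1))

/-- Smooth functions that are bounded together with all their derivatives. -/
def SmoothBounded (f : Plane → ℂ) : Prop :=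
  ContDiff ℝ ∞ f ∧ ∀ n : ℕ, ∃ C : ℝ, ∀ x, ‖iteratedFDeriv ℝ n f x‖ ≤ C

/-- The smaller eigenvalue of a Hermitian matrix. -/
def minEigenvalue (M : Matrix (Fin 2) (Fin 2) ℂ) : ℝ := sInf (spectrum ℝ M)

/-- The larger eigenvalue of a Hermitian matrix. -/
def maxEigenvalue (M : Matrix (Fin 2) (Fin 2) ℂ) : ℝ := sSup (spectrum ℝ M)

/-- `F(s; ε) = s - ln s + ε μ s^β`. -/
def phaseF (β μ s ε : ℝ) : ℝ := s - Real.log s + ε * μ * s ^ β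

/-- `s` is a positive solution of `s = 1 - ε β μ s^β`. -/
def IsCriticalF (β μ ε s : ℝ) : Prop := 0 < s ∧ s = 1 - ε * β * μ * s ^ β

/-- `f(ε) = F(s(ε); ε)`, where `s(ε)` is the positive solution of `s = 1 - ε β μ s^β`. -/
def critF (β μ ε : ℝ) : ℝ := phaseF β μ (Classical.epsilon (IsCriticalF β μ ε)) ε

/-- The Taylor coefficients of `critF` at zero. -/
def coeffF (β μ : ℝ) (j : ℕ) : ℝ := iteratedDeriv j (critF β μ) 0 / (j.factorial : ℝ)

/-- `G(s; ε) = μ s^β - ln s + ε s`. -/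
def phaseG (β μ s ε : ℝ) : ℝ := μ * s ^ β - Real.log s + ε * s

/-- `s` is a positive solution of `β μ s^β = 1 - ε s`. -/
def IsCriticalG (β μ ε s : ℝ) : Prop := 0 < s ∧ β * μ * s ^ β = 1 - ε * s

/-- `g(ε) = G(s(ε); ε)`, where `s(ε)` is the positive solution of `β μ s^β = 1 - ε s`. -/
def critG (β μ ε : ℝ) : ℝ := phaseG β μ (Classical.epsilon (IsCriticalG β μ ε)) ε

/-- The Taylor coefficients of `critG` at zero. -/
def coeffG (β μ : ℝ) (j : ℕ) : ℝ := iteratedDeriv j (critG β μ) 0 / (j.factorial : ℝ)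

/-- The three-regime asymptotic law for `ln d_k` as `k → ∞`, with remainder `O(ln k)`.
The index set `Finset.Ico 1 ⌈r⌉₊` consists of the natural numbers `j` with `1 ≤ j < r`. -/
def LogAsymptotics (β μ : ℝ) (d : ℕ → ℝ) : Prop :=
  (β < 1 → (fun k : ℕ => Real.log (d k) -
      (-∑ j ∈ Finset.Ico 1 ⌈1 / (1 - β)⌉₊, coeffF β μ j * (k : ℝ) ^ ((β - 1) * j + 1)))
      =O[atTop] fun k : ℕ => Real.log (k : ℝ)) ∧
  (β = 1 → (fun k : ℕ => Real.log (d k) - (-(Real.log (1 + μ)) * k))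
      =O[atTop] fun k : ℕ => Real.log (k : ℝ)) ∧
  (1 < β → (fun k : ℕ => Real.log (d k) -
      (-((β - 1) / β) * (k * Real.log k) + ((β - 1 - Real.log (μ * β)) / β) * k -
        ∑ j ∈ Finset.Ico 1 ⌈β / (β - 1)⌉₊, coeffG β μ j * (k : ℝ) ^ ((1 / β - 1) * j + 1)))
      =O[atTop] fun k : ℕ => Real.log (k : ℝ))

end MetricLandau

end

/-! Let `L` be the Landau Hamiltonian and `S = L^{-1/2}`. The magnetic gradient factors through an
isometry, so the form of `H_±` is that of `L^{1/2} (1 + σ M) L^{1/2}`, where `σ = ±1` and `M ≥ 0` is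
the bounded operator `metricForm`. Writing `(1 + σ M)⁻¹ = 1 - σ N`, where `N = M / (1 + σ M)` is
comparable with `M`, gives `-σ H⁻¹ = -σ L⁻¹ + S N S`. For both signs this is an operator with
spectrum in the explicit points `-σ / Λ_n` and their limit `0`, plus a compact non-negative
perturbation. Eigenvalues of `H_±` near `Λ_q` become eigenvalues just above `-σ / Λ_q`
(`mem_metricGraph_iff`, `eigenspace_metricOperator_eq`).

In such a gap `(lam, lam')`, the eigenvalues of `X₀ + R²` are counted by its form on `ker (X₀ -
lam)` alone, up to constant factors and a bounded error in the count (`exists_finrank_le`,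
`exists_le_finrank`). The tool is the quadratic form `Re ⟨(X - a) u, (X - c) u⟩`: it is `≤ 0` on
eigenvectors with eigenvalue in `[a, c)` and coercive away from a finite-dimensional space and the
two end eigenspaces. Constant factors and index shifts cost only `O(ln k)` on the logarithmic scale.

On one Landau level, `M` lies between forms of scalar radial weights behaving like `e^{-μ t^β}` up
to powers, with `t = b |x|² / 2`. Rotation invariance makes those forms diagonal in the angular
momentum basis, and their entries are moments of the weight against `t^{k-n} e^{-t}` times the
square of a polynomial of degree `n`. Up to powers of `k` each normalized moment is `e^{max (k ln t
- t - μ t^β)} / k!`. The upper bound is pointwise; the lower bound uses a window of width of order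
`1 / k` at the saddle, where a polynomial with leading coefficient `±1` cannot be small in mean
square (`le_integral_sq_eval`).

Finally the saddle equation is rescaled: `t = k s` when `β < 1` and `t = k^{1/β} s` when `β > 1`.
This expresses the maximum through `critF` or `critG` at a negative power of `k`. The implicit
critical point is analytic, so Taylor's formula together with Stirling's formula gives the
expansions; `β = 1` is explicit. -/

namespace MetricLandau

/-! ### Coercivity of a quadratic form in a spectral gap -/

section Abstract

variable {E : Type*} [NormedAddCommGroup E] [InnerProductSpace ℂ E]

/-- The dimension count behind every min-max argument below: a space too large for the constraints
contains a nonzero vector satisfying all of them. -/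
theorem exists_ne_zero_mem_orthogonal_of_finrank_lt (W R : Submodule ℂ E) [FiniteDimensional ℂ W]
    [FiniteDimensional ℂ R] (h : Module.finrank ℂ R < Module.finrank ℂ W) :
    ∃ u ∈ W, u ∈ Rᗮ ∧ u ≠ 0 := by
  let f : W →ₗ[ℂ] R := (R.orthogonalProjectionOnto : E →ₗ[ℂ] R) ∘ₗ W.subtype
  obtain ⟨x, hx, hx0⟩ := (Submodule.ne_bot_iff _).1 (LinearMap.ker_ne_bot_of_finrank_lt (f := f) h)
  refine ⟨x, x.2, ?_, fun h => hx0 (Subtype.ext h)⟩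
  have : R.orthogonalProjectionOnto (x : E) = 0 := by simpa [f] using hx
  exact R.orthogonalProjectionOnto_eq_zero_iff.1 this

variable [CompleteSpace E]

/-- A compact self-adjoint operator is small on the orthogonal complement of a finite-dimensional
subspace. -/
theorem exists_finiteDimensional_norm_le (K : E →L[ℂ] E) (hK : IsSelfAdjoint K)
    (hc : IsCompactOperator K) {ε : ℝ} (hε : 0 < ε) :
    ∃ Z : Submodule ℂ E, FiniteDimensional ℂ Z ∧ ∀ u ∈ Zᗮ, ‖K u‖ ≤ ε * ‖u‖ := by
  have hcomp : IsCompact (closure (K '' Metric.closedBall 0 1)) :=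
    hc.isCompact_closure_image_closedBall (f := (K : E →ₗ[ℂ] E)) 1
  obtain ⟨t, ht, hcov⟩ := Metric.totallyBounded_iff.1
    (hcomp.totallyBounded.subset subset_closure) ε hε
  refine ⟨Submodule.span ℂ t, FiniteDimensional.span_of_finite ℂ ht, fun u hu => ?_⟩
  by_cases h0 : K u = 0
  · rw [h0, norm_zero]; positivity
  -- By symmetry `⟨K x, u⟩ = ‖K u‖` for this unit vector. The net point near `K x` is orthogonal to
  -- `u`, so only the distance to the net survives.
  set x : E := ((‖K u‖⁻¹ : ℝ) : ℂ) • K u with hx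
  have hn : 0 < ‖K u‖ := norm_pos_iff.2 h0
  have hx1 : ‖x‖ ≤ 1 := by
    rw [hx, norm_smul, Complex.norm_real, norm_inv, norm_norm, inv_mul_cancel₀ hn.ne']
  have hmem : K x ∈ K '' Metric.closedBall 0 1 := ⟨x, by simpa using hx1, rfl⟩
  obtain ⟨y, hy, hxy⟩ := Set.mem_iUnion₂.1 (hcov hmem)
  have h1 : inner ℂ y u = 0 := hu y (Submodule.subset_span hy)
  have h2 : inner ℂ (K x) u = (‖K u‖ : ℂ) := by
    have : inner ℂ (K x) u = inner ℂ x (K u) := by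
      rw [← ContinuousLinearMap.adjoint_inner_right, hK.adjoint_eq]
    rw [this, hx, inner_smul_left, inner_self_eq_norm_sq_to_K]
    have : (‖K u‖ : ℂ) ≠ 0 := by exact_mod_cast hn.ne'
    rw [Complex.conj_ofReal, Complex.ofReal_inv]
    field_simp
    rfl
  calc ‖K u‖ = ‖inner ℂ (K x - y) u‖ := by
        rw [inner_sub_left, h1, sub_zero, h2]; simp
    _ ≤ ‖K x - y‖ * ‖u‖ := norm_inner_le_norm _ _
    _ ≤ ε * ‖u‖ := by
        gcongr
        rw [← dist_eq_norm]; exact hxy.le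

/-- Only `R²` is assumed compact, and `‖R u‖² = ⟨R² u, u⟩`. Adding `R Z` to `Z` forces `R u ⊥ Z` as
well, so the same estimate applies to `R u`. -/
theorem exists_finiteDimensional_sq_norm_le (R : E →L[ℂ] E) (hR : IsSelfAdjoint R)
    (hc : IsCompactOperator (R * R)) {δ : ℝ} (hδ : 0 < δ) :
    ∃ Z : Submodule ℂ E, FiniteDimensional ℂ Z ∧ ∀ u ∈ Zᗮ, ‖R u‖ ^ 2 ≤ δ * ‖u‖ ^ 2 ∧
      ‖R (R u)‖ ^ 2 ≤ δ * ‖R u‖ ^ 2 := by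
  obtain ⟨Z, hZ, h⟩ := exists_finiteDimensional_norm_le (R * R)
    (by simp [IsSelfAdjoint, hR.star_eq]) hc hδ
  have key : ∀ u ∈ Zᗮ, ‖R u‖ ^ 2 ≤ δ * ‖u‖ ^ 2 := by
    intro u hu
    have h1 : (‖R u‖ ^ 2 : ℝ) = RCLike.re (inner ℂ ((R * R) u) u) := by
      have : inner ℂ ((R * R) u) u = inner ℂ (R u) (R u) := by
        rw [mul_apply_eq_comp, ← ContinuousLinearMap.adjoint_inner_right,
          hR.adjoint_eq]
      rw [this, inner_self_eq_norm_sq]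
    rw [h1]
    calc _ ≤ ‖(R * R) u‖ * ‖u‖ := re_inner_le_norm _ _
      _ ≤ δ * ‖u‖ * ‖u‖ := by gcongr; exact h u hu
      _ = _ := by ring
  refine ⟨Z ⊔ Z.map (R : E →ₗ[ℂ] E), inferInstance, fun u hu => ?_⟩
  rw [← Submodule.inf_orthogonal] at hu
  refine ⟨key u hu.1, key _ ?_⟩
  intro z hz
  have := hu.2 (R z) ⟨z, hz, rfl⟩
  rwa [← ContinuousLinearMap.adjoint_inner_right, hR.adjoint_eq] at this

/-- The form is that of the polynomial `(t - a) (t - c)` of `X`, so functional calculus translates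
its sign into the absence of spectrum in `(a, c)`. -/
theorem nonneg_quadratic_iff_spectrum (X : E →L[ℂ] E) (hX : IsSelfAdjoint X) (a c : ℝ) :
    (∀ u, 0 ≤ RCLike.re (inner ℂ (X u - (a : ℂ) • u) (X u - (c : ℂ) • u))) ↔
      ∀ t ∈ spectrum ℝ X, 0 ≤ (t - a) * (t - c) := by
  have h1 : cfc (fun t : ℝ => (t - a) * (t - c)) X =
      (X - algebraMap ℝ _ a) * (X - algebraMap ℝ _ c) := by
    rw [cfc_mul (fun t : ℝ => t - a) (fun t : ℝ => t - c) X,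
      cfc_sub (fun t : ℝ => t) (fun _ => a) X, cfc_sub (fun t : ℝ => t) (fun _ => c) X,
      cfc_id' ℝ X, cfc_const a X, cfc_const c X]
  rw [← cfc_nonneg_iff (fun t : ℝ => (t - a) * (t - c)) X (by fun_prop) hX,
    ContinuousLinearMap.nonneg_iff_isPositive, ContinuousLinearMap.isPositive_def', h1]
  have hs : ∀ r : ℝ, IsSelfAdjoint (X - algebraMap ℝ (E →L[ℂ] E) r) := fun r =>
    hX.sub (IsSelfAdjoint.algebraMap _ (IsSelfAdjoint.all r))
  have happ : ∀ (r : ℝ) (u : E), (X - algebraMap ℝ (E →L[ℂ] E) r) u = X u - (r : ℂ) • u := by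
    intro r u
    rw [sub_apply, Algebra.algebraMap_eq_smul_one]
    simp
  have hinner : ∀ u, ((X - algebraMap ℝ _ a) * (X - algebraMap ℝ _ c)).reApplyInnerSelf u =
      RCLike.re (inner ℂ (X u - (a : ℂ) • u) (X u - (c : ℂ) • u)) := by
    intro u
    rw [ContinuousLinearMap.reApplyInnerSelf_apply, mul_apply_eq_comp,
      ← ContinuousLinearMap.adjoint_inner_right, (hs a).adjoint_eq, happ, happ,
      ← inner_conj_symm, RCLike.conj_re]
  constructor
  · intro h
    refine ⟨?_, fun u => by rw [hinner]; exact h u⟩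
    rw [← h1]
    exact cfc_predicate _ _
  · rintro ⟨-, h⟩ u
    rw [← hinner]; exact h u

/-- The algebraic identity behind the perturbation analysis in a spectral gap: `u = p + p' + v`
with `p`, `p'`, `v` in the kernel of `X₀ - lam`, the kernel of `X₀ - lam'`, and the rest. -/
theorem gap_form_identity (R : E →L[ℂ] E) (hR : IsSelfAdjoint R) (p p' v y : E) (s g : ℝ)
    (hpp : inner ℂ p p' = 0) (hpv : inner ℂ p v = 0) (hpv' : inner ℂ p' v = 0)
    (hpy : inner ℂ p y = 0) (hpy' : inner ℂ p' y = 0) :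
    RCLike.re (inner ℂ ((g : ℂ) • p' + y + R (R (p + p' + v)) - (s : ℂ) • (p + p' + v))
      (y + R (R (p + p' + v)) - (g : ℂ) • p - (g : ℂ) • v)) =
    ‖y‖ ^ 2 - g * RCLike.re (inner ℂ y v) - s * RCLike.re (inner ℂ v y) +
      s * g * (‖p‖ ^ 2 + ‖v‖ ^ 2) + g * ‖R p'‖ ^ 2 - g * ‖R p + R v‖ ^ 2 +
      2 * RCLike.re (inner ℂ y (R (R (p + p' + v)))) + ‖R (R (p + p' + v))‖ ^ 2 -
      s * ‖R p + R p' + R v‖ ^ 2 := by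
  have hs : ∀ x z, inner ℂ x (R z) = inner ℂ (R x) z := fun x z => by
    rw [← ContinuousLinearMap.adjoint_inner_left, hR.adjoint_eq]
  have c1 : inner ℂ p' p = 0 := inner_eq_zero_symm.1 hpp
  have c2 : inner ℂ v p = 0 := inner_eq_zero_symm.1 hpv
  have c3 : inner ℂ v p' = 0 := inner_eq_zero_symm.1 hpv'
  have c4 : inner ℂ y p = 0 := inner_eq_zero_symm.1 hpy
  have c5 : inner ℂ y p' = 0 := inner_eq_zero_symm.1 hpy'
  set k := R (R (p + p' + v)) with hk
  have e1 : ∀ x, inner ℂ x k = inner ℂ (R x) (R p + R p' + R v) := fun x => by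
    rw [hk, hs, map_add, map_add]
  have e2 : ∀ x, inner ℂ k x = inner ℂ (R p + R p' + R v) (R x) := fun x => by
    rw [← inner_conj_symm, e1, inner_conj_symm]
  have n1 : ∀ x : E, ‖x‖ ^ 2 = RCLike.re (inner ℂ x x) := fun x =>
    (inner_self_eq_norm_sq (𝕜 := ℂ) x).symm
  have sy : ∀ x z : E, RCLike.re (inner ℂ x z) = RCLike.re (inner ℂ z x) := fun x z =>
    inner_re_symm x z
  simp only [n1, inner_add_left, inner_add_right, inner_sub_left, inner_sub_right,
    inner_smul_left, inner_smul_right, hpv, hpv', hpy, hpy', c1, c2, c4, map_add,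
    map_sub, Complex.conj_ofReal]
  have ky : RCLike.re (inner ℂ k y) = RCLike.re (inner ℂ y k) := sy _ _
  have hp_k := e1 p
  have hp_k' := e1 p'
  have hv_k := e1 v
  have k_p := e2 p
  have k_p' := e2 p'
  have k_v := e2 v
  simp only [inner_add_right, inner_add_left] at hp_k hp_k' hv_k k_p k_p' k_v
  simp only [hp_k, hp_k', hv_k, k_p, k_v]
  simp only [RCLike.re_to_complex, Complex.add_re, Complex.sub_re, Complex.mul_re,
    Complex.ofReal_re, Complex.ofReal_im, mul_zero, zero_mul, sub_zero, add_zero, zero_add,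
    Complex.zero_re] at *
  have s1 := sy (R p) (R p')
  have s2 := sy (R p) (R v)
  have s3 := sy (R p') (R v)
  have s4 := sy y v
  rw [ky, s1, s2, s3, s4]
  ring

/-- The coercivity estimate behind the counting bounds in a spectral gap. -/
theorem gap_form_lower_bound (R : E →L[ℂ] E) (hR : IsSelfAdjoint R) (p p' v y : E)
    {s g κ Y δ : ℝ} (hg : 0 < g) (hκ : 0 < κ)
    (hs0 : 0 ≤ s) (hs1 : s ≤ g / 12) (hs2 : s * Y ≤ κ / 4)
    (hδ1 : 4 * Y ^ 2 * δ ≤ κ * (g / 12)) (hδ2 : 16 * g * δ ≤ κ)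
    (hpp : inner ℂ p p' = 0) (hpv : inner ℂ p v = 0) (hpv' : inner ℂ p' v = 0)
    (hpy : inner ℂ p y = 0) (hpy' : inner ℂ p' y = 0)
    (hy : ‖y‖ ≤ Y * ‖v‖) (hyv : κ * ‖v‖ ^ 2 ≤ ‖y‖ ^ 2 - g * RCLike.re (inner ℂ y v))
    (hu : ‖R (R (p + p' + v))‖ ^ 2 ≤ δ * ‖R (p + p' + v)‖ ^ 2)
    (hv : ‖R v‖ ^ 2 ≤ δ * ‖v‖ ^ 2) :
    κ / 8 * ‖v‖ ^ 2 + s * g * ‖p‖ ^ 2 + g / 2 * ‖R p'‖ ^ 2 - 5 / 2 * g * ‖R p‖ ^ 2 ≤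
    RCLike.re (inner ℂ ((g : ℂ) • p' + y + R (R (p + p' + v)) - (s : ℂ) • (p + p' + v))
      (y + R (R (p + p' + v)) - (g : ℂ) • p - (g : ℂ) • v)) := by
  rw [gap_form_identity R hR p p' v y s g hpp hpv hpv' hpy hpy']
  have hRu : R (p + p' + v) = R p + R p' + R v := by rw [map_add, map_add]
  rw [hRu] at hu ⊢
  set k := R (R p + R p' + R v) with hk
  have h1 : RCLike.re (inner ℂ v y) ≤ Y * ‖v‖ ^ 2 := by
    calc _ ≤ ‖v‖ * ‖y‖ := re_inner_le_norm _ _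
      _ ≤ ‖v‖ * (Y * ‖v‖) := by gcongr
      _ = _ := by ring
  have h2 : -(Y * ‖v‖ * ‖k‖) ≤ RCLike.re (inner ℂ y k) := by
    have : |RCLike.re (inner ℂ y k)| ≤ ‖y‖ * ‖k‖ := (RCLike.abs_re_le_norm _).trans (norm_inner_le_norm _ _)
    have h := neg_le_of_abs_le this
    have : ‖y‖ * ‖k‖ ≤ Y * ‖v‖ * ‖k‖ := by gcongr
    linarith
  have h3 : ‖R p + R v‖ ^ 2 ≤ 2 * ‖R p‖ ^ 2 + 2 * ‖R v‖ ^ 2 := by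
    have := norm_add_le (R p) (R v)
    have h0 := norm_nonneg (R p + R v)
    nlinarith [sq_nonneg (‖R p‖ - ‖R v‖)]
  have h4 : ‖R p + R p' + R v‖ ^ 2 ≤ 3 * (‖R p‖ ^ 2 + ‖R p'‖ ^ 2 + ‖R v‖ ^ 2) := by
    have := norm_add₃_le (a := R p) (b := R p') (c := R v)
    have h0 := norm_nonneg (R p + R p' + R v)
    nlinarith [sq_nonneg (‖R p‖ - ‖R v‖), sq_nonneg (‖R p‖ - ‖R p'‖),
      sq_nonneg (‖R p'‖ - ‖R v‖)]
  set N := ‖R p + R p' + R v‖ with hN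
  -- Weighted arithmetic-geometric mean; `hδ1` is what turns the `‖k‖²` part into `g / 12 * N ^ 2`.
  have h5 : 2 * (Y * ‖v‖ * ‖k‖) ≤ κ / 4 * ‖v‖ ^ 2 + g / 12 * N ^ 2 := by
    have e1 : 2 * (Y * ‖v‖ * ‖k‖) * κ ≤ (κ / 4 * ‖v‖ ^ 2) * κ + 4 * Y ^ 2 * ‖k‖ ^ 2 := by
      nlinarith [sq_nonneg (κ / 2 * ‖v‖ - 2 * Y * ‖k‖)]
    have e2 : 4 * Y ^ 2 * ‖k‖ ^ 2 ≤ 4 * Y ^ 2 * (δ * N ^ 2) := by gcongr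
    have e3 : 4 * Y ^ 2 * δ * N ^ 2 ≤ κ * (g / 12) * N ^ 2 := by gcongr
    refine le_of_mul_le_mul_right (a := κ) ?_ hκ
    nlinarith
  have h6 : s * RCLike.re (inner ℂ v y) ≤ κ / 4 * ‖v‖ ^ 2 := by
    calc _ ≤ s * (Y * ‖v‖ ^ 2) := by gcongr
      _ = s * Y * ‖v‖ ^ 2 := by ring
      _ ≤ _ := by gcongr
  have h7 : s * N ^ 2 ≤ g / 12 * N ^ 2 := by gcongr
  have h8 : g * ‖R v‖ ^ 2 ≤ κ / 16 * ‖v‖ ^ 2 := by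
    calc _ ≤ g * (δ * ‖v‖ ^ 2) := by gcongr
      _ = (16 * g * δ) / 16 * ‖v‖ ^ 2 := by ring
      _ ≤ _ := by gcongr
  have h9 : g * N ^ 2 ≤ g * (3 * (‖R p‖ ^ 2 + ‖R p'‖ ^ 2 + ‖R v‖ ^ 2)) := by gcongr
  have h10 : g * ‖R p + R v‖ ^ 2 ≤ g * (2 * ‖R p‖ ^ 2 + 2 * ‖R v‖ ^ 2) := by gcongr
  have h11 : 0 ≤ s * g * ‖v‖ ^ 2 := by positivity
  have h12 : 0 ≤ ‖k‖ ^ 2 := by positivity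
  have h13 : 0 ≤ κ * ‖v‖ ^ 2 := by positivity
  -- The losses `2 * (g / 12) * N ^ 2` cost at most `g / 2` on each of `‖R p‖²`, `‖R p'‖²`, `‖R
  -- v‖²`. This leaves `g / 2` on `‖R p'‖²` and gives `-5 / 2 * g` on `‖R p‖²`; the `v` terms cost
  -- `κ / 4 + κ / 4 + 5 * κ / 32`, less than `7 * κ / 8`.
  linarith

end Abstract
end MetricLandau

namespace MetricLandau

/-! ### Counting eigenvalues in a gap: upper bound -/

section Gap

variable {E : Type*} [NormedAddCommGroup E] [InnerProductSpace ℂ E]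

/-- The span of all eigenvectors of `X` with real eigenvalue in `[a, c)`. -/
def gapSpan (X : E →L[ℂ] E) (a c : ℝ) : Submodule ℂ E :=
  ⨆ t : Set.Ico a c, Module.End.eigenspace (X : Module.End ℂ E) ((t : ℝ) : ℂ)

theorem gapSpan_mono (X : E →L[ℂ] E) {a a' c : ℝ} (h : a ≤ a') :
    gapSpan X a' c ≤ gapSpan X a c :=
  iSup_le fun t => le_iSup_of_le (⟨t, h.trans t.2.1, t.2.2⟩ : Set.Ico a c) le_rfl

theorem eigenspace_le_gapSpan (X : E →L[ℂ] E) {a c t : ℝ} (h : t ∈ Set.Ico a c) :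
    Module.End.eigenspace (X : Module.End ℂ E) (t : ℂ) ≤ gapSpan X a c :=
  le_iSup (fun t : Set.Ico a c => Module.End.eigenspace (X : Module.End ℂ E) ((t : ℝ) : ℂ)) ⟨t, h⟩

theorem map_mem_gapSpan (X : E →L[ℂ] E) {a c : ℝ} {u : E} (hu : u ∈ gapSpan X a c) :
    X u ∈ gapSpan X a c := by
  refine Submodule.iSup_induction _ (motive := fun u => X u ∈ gapSpan X a c) hu ?_ (by simp) ?_
  · intro t x hx
    have : X x = ((t : ℝ) : ℂ) • x := Module.End.mem_eigenspace_iff.1 hx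
    rw [this]
    exact Submodule.smul_mem _ _ (eigenspace_le_gapSpan X t.2 hx)
  · intro x y hx hy
    rw [map_add]; exact Submodule.add_mem _ hx hy

/-- Eigenspaces are independent and the right end `c` is excluded from the span. This is what
finally contradicts a vector lying in the eigenspace at `lam'`. -/
theorem eq_zero_of_mem_gapSpan (X : E →L[ℂ] E) {a c : ℝ} {u : E} (hu : u ∈ gapSpan X a c)
    (h : X u = (c : ℂ) • u) : u = 0 := by
  have hind := Module.End.eigenspaces_iSupIndep (X : Module.End ℂ E)
  have hd := hind (c : ℂ)
  refine Submodule.disjoint_def.1 hd u (Module.End.mem_eigenspace_iff.2 h) ?_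
  have hle : gapSpan X a c ≤ ⨆ z, ⨆ (_ : z ≠ (c : ℂ)), Module.End.eigenspace (X : Module.End ℂ E) z :=
    iSup_le fun t => le_iSup₂_of_le ((t : ℝ) : ℂ) (by exact_mod_cast t.2.2.ne) le_rfl
  exact hle hu

variable [CompleteSpace E]

/-- Eigenspaces are orthogonal, and a component with eigenvalue `t` contributes `(t - a) (t - c)`
times its squared norm. -/
theorem re_inner_nonpos_of_mem_gapSpan (X : E →L[ℂ] E) (hX : IsSelfAdjoint X) {a c : ℝ} {u : E}
    (hu : u ∈ gapSpan X a c) :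
    RCLike.re (inner ℂ (X u - (a : ℂ) • u) (X u - (c : ℂ) • u)) ≤ 0 := by
  have hsym : (X : E →ₗ[ℂ] E).IsSymmetric := hX.isSymmetric
  have hof := hsym.orthogonalFamily_eigenspaces.comp
    (γ := Set.Ico a c) (f := fun t => ((t : ℝ) : ℂ))
    (fun x y h => Subtype.ext (Complex.ofReal_injective h))
  classical
  obtain ⟨f, rfl⟩ := (Submodule.mem_iSup_iff_exists_dfinsupp' _ _).1 hu
  have key : ∀ r : ℝ, X (f.sum fun _ x => (x : E)) - (r : ℂ) • (f.sum fun _ x => (x : E)) =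
      ∑ t ∈ f.support, ((((((t : ℝ) - r : ℝ)) : ℂ) • f t :
        Module.End.eigenspace (X : Module.End ℂ E) ((t : ℝ) : ℂ)) : E) := by
    intro r
    rw [DFinsupp.sum, map_sum, Finset.smul_sum, ← Finset.sum_sub_distrib]
    refine Finset.sum_congr rfl fun t _ => ?_
    have : X (f t : E) = ((t : ℝ) : ℂ) • (f t : E) := Module.End.mem_eigenspace_iff.1 (f t).2
    rw [this, ← sub_smul]
    push_cast
    rfl
  rw [key, key]
  have := hof.inner_sum (fun t => (((((t : ℝ) - a : ℝ)) : ℂ) • f t))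
    (fun t => (((((t : ℝ) - c : ℝ)) : ℂ) • f t)) f.support
  refine (congrArg RCLike.re this).trans_le ?_
  rw [map_sum]
  refine Finset.sum_nonpos fun t _ => ?_
  rw [inner_smul_left, inner_smul_right, inner_self_eq_norm_sq_to_K, Complex.conj_ofReal]
  have h1 : 0 ≤ (t : ℝ) - a := by linarith [t.2.1]
  have h2 : (t : ℝ) - c ≤ 0 := by linarith [t.2.2]
  have : RCLike.re ((((t : ℝ) - a : ℝ) : ℂ) * ((((t : ℝ) - c : ℝ) : ℂ) * (‖f t‖ : ℂ) ^ 2)) =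
      ((t : ℝ) - a) * (((t : ℝ) - c) * ‖f t‖ ^ 2) := by
    rw [← Complex.ofReal_pow, ← Complex.ofReal_mul, ← Complex.ofReal_mul]
    exact Complex.ofReal_re _
  refine this.trans_le ?_
  exact mul_nonpos_of_nonneg_of_nonpos h1 (mul_nonpos_of_nonpos_of_nonneg h2 (by positivity))

/-- A self-adjoint operator `X₀` with a gap `(lam, lam')` in its spectrum, both ends being
isolated from the rest, together with the square root `R` of a compact non-negative operator. -/
structure GapPerturbation (X₀ R : E →L[ℂ] E) (lam lam' κ : ℝ) : Prop where
  selfAdjoint : IsSelfAdjoint X₀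
  selfAdjoint_root : IsSelfAdjoint R
  compact : IsCompactOperator (R * R)
  lt : lam < lam'
  pos : 0 < κ
  coercive : ∀ v, v ∈ (Module.End.eigenspace (X₀ : Module.End ℂ E) (lam : ℂ))ᗮ →
    v ∈ (Module.End.eigenspace (X₀ : Module.End ℂ E) (lam' : ℂ))ᗮ →
    κ * ‖v‖ ^ 2 ≤ RCLike.re (inner ℂ (X₀ v - (lam : ℂ) • v) (X₀ v - (lam' : ℂ) • v))

/-- The term in `A` is absorbed by the one in `P` because `s` strictly exceeds `5 / 2 * σ`; all
remaining terms are then non-negative with sum at most zero. -/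
theorem eq_zero_of_gap_bound {κ g s σ P V A A' : ℝ} (hκ : 0 < κ) (hg : 0 < g)
    (hσ : 5 / 2 * σ < s) (hP : 0 ≤ P) (hV : 0 ≤ V) (hA' : 0 ≤ A') (hA : A ≤ σ * P)
    (h : κ / 8 * V + s * g * P + g / 2 * A' - 5 / 2 * g * A ≤ 0) : P = 0 ∧ V = 0 ∧ A' = 0 := by
  have h1 : 5 / 2 * g * A ≤ 5 / 2 * g * (σ * P) := by gcongr
  have h2 : 0 ≤ κ / 8 * V := by positivity
  have h3 : 0 ≤ g / 2 * A' := by positivity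
  have hs : 0 < g * (s - 5 / 2 * σ) := mul_pos hg (by linarith)
  have h4 : 0 ≤ g * (s - 5 / 2 * σ) * P := by positivity
  refine ⟨?_, ?_, ?_⟩
  · exact (mul_eq_zero.1 (by linarith : g * (s - 5 / 2 * σ) * P = 0)).resolve_left hs.ne'
  · exact (mul_eq_zero.1 (by linarith : κ / 8 * V = 0)).resolve_left (by positivity)
  · exact (mul_eq_zero.1 (by linarith : g / 2 * A' = 0)).resolve_left (by positivity)

namespace GapPerturbation

variable {X₀ R : E →L[ℂ] E} {lam lam' κ : ℝ}

theorem decomposition (h : GapPerturbation X₀ R lam lam' κ) (u : E) :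
    ∃ p p' v : E, u = p + p' + v ∧
      X₀ p = (lam : ℂ) • p ∧ X₀ p' = (lam' : ℂ) • p' ∧
      p = (Module.End.eigenspace (X₀ : Module.End ℂ E) (lam : ℂ)).starProjection u ∧
      p' = (Module.End.eigenspace (X₀ : Module.End ℂ E) (lam' : ℂ)).starProjection u ∧
      inner ℂ p p' = 0 ∧ inner ℂ p v = 0 ∧ inner ℂ p' v = 0 ∧
      inner ℂ p (X₀ v) = 0 ∧ inner ℂ p' (X₀ v) = 0 ∧
      κ * ‖v‖ ^ 2 ≤ RCLike.re (inner ℂ (X₀ v - (lam : ℂ) • v) (X₀ v - (lam' : ℂ) • v)) := by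
  set U := Module.End.eigenspace (X₀ : Module.End ℂ E) (lam : ℂ) with hU
  set U' := Module.End.eigenspace (X₀ : Module.End ℂ E) (lam' : ℂ) with hU'
  have hsym : (X₀ : E →ₗ[ℂ] E).IsSymmetric := h.selfAdjoint.isSymmetric
  have hne : (lam : ℂ) ≠ lam' := by exact_mod_cast h.lt.ne
  have horth : ∀ x ∈ U, ∀ y ∈ U', inner ℂ x y = 0 := fun x hx y hy =>
    hsym.orthogonalFamily_eigenspaces hne ⟨x, hx⟩ ⟨y, hy⟩
  have hp : U.starProjection u ∈ U := U.starProjection_apply_mem u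
  have hp' : U'.starProjection u ∈ U' := U'.starProjection_apply_mem u
  set p := U.starProjection u
  set p' := U'.starProjection u
  have e1 : ∀ x ∈ U, inner ℂ x (u - p) = 0 := fun x hx =>
    (U.sub_starProjection_mem_orthogonal u) x hx
  have e2 : ∀ x ∈ U', inner ℂ x (u - p') = 0 := fun x hx =>
    (U'.sub_starProjection_mem_orthogonal u) x hx
  have hvU : u - p - p' ∈ Uᗮ := fun x hx => by
    rw [inner_sub_right, e1 x hx, horth x hx p' hp', sub_zero]
  have hvU' : u - p - p' ∈ U'ᗮ := fun x hx => by
    rw [sub_right_comm, inner_sub_right, e2 x hx,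
      inner_eq_zero_symm.1 (horth p hp x hx), sub_zero]
  have hXp : X₀ p = (lam : ℂ) • p := Module.End.mem_eigenspace_iff.1 hp
  have hXp' : X₀ p' = (lam' : ℂ) • p' := Module.End.mem_eigenspace_iff.1 hp'
  refine ⟨p, p', u - p - p', by abel, hXp, hXp', rfl, rfl, horth p hp p' hp', hvU p hp,
    hvU' p' hp', ?_, ?_, h.coercive _ hvU hvU'⟩
  · rw [← ContinuousLinearMap.adjoint_inner_left, h.selfAdjoint.adjoint_eq, hXp, inner_smul_left,
      hvU p hp, mul_zero]
  · rw [← ContinuousLinearMap.adjoint_inner_left, h.selfAdjoint.adjoint_eq, hXp', inner_smul_left,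
      hvU' p' hp', mul_zero]

/-- One of the two factors kills `p` and the other kills `p'`, so the form only sees the coercive
part `v`. -/
theorem unperturbed_form_nonneg (h : GapPerturbation X₀ R lam lam' κ) (u : E) :
    0 ≤ RCLike.re (inner ℂ (X₀ u - (lam : ℂ) • u) (X₀ u - (lam' : ℂ) • u)) := by
  obtain ⟨p, p', v, hu, hXp, hXp', -, -, h1, h2, h3, h4, h5, h6⟩ := h.decomposition u
  have c1 := inner_eq_zero_symm.1 h1
  have c2 := inner_eq_zero_symm.1 h2
  have c3 := inner_eq_zero_symm.1 h3
  have c4 := inner_eq_zero_symm.1 h4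
  have c5 := inner_eq_zero_symm.1 h5
  have : inner ℂ (X₀ u - (lam : ℂ) • u) (X₀ u - (lam' : ℂ) • u) =
      inner ℂ (X₀ v - (lam : ℂ) • v) (X₀ v - (lam' : ℂ) • v) := by
    have e1 : X₀ u - (lam : ℂ) • u = ((lam' : ℂ) - lam) • p' + (X₀ v - (lam : ℂ) • v) := by
      rw [hu, map_add, map_add, hXp, hXp']; module
    have e2 : X₀ u - (lam' : ℂ) • u = ((lam : ℂ) - lam') • p + (X₀ v - (lam' : ℂ) • v) := by
      rw [hu, map_add, map_add, hXp, hXp']; module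
    rw [e1, e2]
    simp only [inner_add_left, inner_add_right, inner_sub_left, inner_sub_right, inner_smul_left,
      inner_smul_right, h3, h5, c1, c2, c4]
    ring
  rw [this]
  exact (by have := h.pos; positivity : 0 ≤ κ * ‖v‖ ^ 2).trans h6

/-- Upper bound for the number of eigenvalues of `X₀ + R²` in `[lam + s, lam')`. -/
theorem exists_finrank_le (h : GapPerturbation X₀ R lam lam' κ) :
    ∃ s₀ > 0, ∃ r : ℕ, ∀ s, 0 < s → s ≤ s₀ → ∀ σ : ℝ, 5 / 2 * σ < s →
      ∀ (Y : Submodule ℂ E) [FiniteDimensional ℂ Y],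
      (∀ p, X₀ p = (lam : ℂ) • p → p ∈ Yᗮ → ‖R p‖ ^ 2 ≤ σ * ‖p‖ ^ 2) →
      ∀ (W : Submodule ℂ E) [FiniteDimensional ℂ W], W ≤ gapSpan (X₀ + R * R) (lam + s) lam' →
        Module.finrank ℂ W ≤ r + Module.finrank ℂ Y := by
  set g := lam' - lam with hg
  have hg0 : 0 < g := sub_pos.2 h.lt
  have hκ := h.pos
  set T : E →L[ℂ] E := X₀ - (lam : ℂ) • ContinuousLinearMap.id ℂ E with hT
  set B := ‖T‖ with hB
  have hB0 : 0 ≤ B := norm_nonneg _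
  obtain ⟨δ, hδ, hδ1, hδ2⟩ : ∃ δ > 0, 4 * B ^ 2 * δ ≤ κ * (g / 12) ∧ 16 * g * δ ≤ κ := by
    refine ⟨min (κ * (g / 12) / (4 * B ^ 2 + 1)) (κ / (16 * g)), by positivity, ?_, ?_⟩
    · calc _ ≤ (4 * B ^ 2 + 1) * (κ * (g / 12) / (4 * B ^ 2 + 1)) := by
            gcongr
            · linarith
            · exact min_le_left _ _
        _ = _ := by field_simp
    · calc _ ≤ 16 * g * (κ / (16 * g)) := by gcongr; exact min_le_right _ _
        _ = _ := by field_simp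
  obtain ⟨Z, hZ, hZδ⟩ := exists_finiteDimensional_sq_norm_le R h.selfAdjoint_root h.compact hδ
  set U := Module.End.eigenspace (X₀ : Module.End ℂ E) (lam : ℂ) with hU
  set U' := Module.End.eigenspace (X₀ : Module.End ℂ E) (lam' : ℂ) with hU'
  set V : E →L[ℂ] E := 1 - U.starProjection - U'.starProjection with hV
  refine ⟨min (g / 12) (κ / (4 * (B + 1))), by positivity,
    Module.finrank ℂ Z + Module.finrank ℂ Z, ?_⟩
  intro s hs hs0 σ hσ Y hY hYσ W hW hWX
  by_contra hcon
  push Not at hcon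
  -- Orthogonality to `Q` gives `u ⊥ Z`, `v = V u ⊥ Z` and `p ⊥ Y` at once, since the projections
  -- are self-adjoint. The two copies of `Z` explain the error term `r`.
  set Q := Z ⊔ Z.map (V : E →ₗ[ℂ] E) ⊔ Y.map (U.starProjection : E →ₗ[ℂ] E) with hQ
  have hQr : Module.finrank ℂ Q < Module.finrank ℂ W := by
    refine lt_of_le_of_lt ?_ hcon
    refine (Submodule.finrank_add_le_finrank_add_finrank _ _).trans ?_
    refine add_le_add ((Submodule.finrank_add_le_finrank_add_finrank _ _).trans ?_)
      (Submodule.finrank_map_le _ _)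
    gcongr
    exact Submodule.finrank_map_le _ _
  obtain ⟨u, huW, huQ, hu0⟩ := exists_ne_zero_mem_orthogonal_of_finrank_lt W Q hQr
  rw [hQ, ← Submodule.inf_orthogonal, ← Submodule.inf_orthogonal] at huQ
  obtain ⟨⟨huZ, huV⟩, huY⟩ := huQ
  obtain ⟨p, p', v, hu, hXp, hXp', hpu, hpu', h1, h2, h3, h4, h5, h6⟩ := h.decomposition u
  have hvu : v = V u := by
    simp only [hV, sub_apply, one_apply_eq_self]
    rw [← hpu, ← hpu']
    nth_rewrite 1 [hu]
    abel
  have hsa : ∀ (U : Submodule ℂ E) [U.HasOrthogonalProjection] (x y : E),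
      inner ℂ (U.starProjection x) y = inner ℂ x (U.starProjection y) := fun U _ x y =>
    U.inner_starProjection_left_eq_right x y
  have hvZ : v ∈ Zᗮ := by
    intro z hz
    have := huV (V z) ⟨z, hz, rfl⟩
    rw [hvu]
    simp only [hV, sub_apply, one_apply_eq_self, inner_sub_left, inner_sub_right, hsa] at this ⊢
    exact this
  have hpY : p ∈ Yᗮ := by
    intro y hy
    have := huY _ ⟨y, hy, rfl⟩
    rw [hpu, ← hsa]
    exact this
  obtain ⟨-, hu2⟩ := hZδ u huZ
  obtain ⟨hv1, -⟩ := hZδ v hvZ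
  have hRp := hYσ p hXp hpY
  have hsa' : IsSelfAdjoint (X₀ + R * R) :=
    h.selfAdjoint.add (by simp [IsSelfAdjoint, h.selfAdjoint_root.star_eq])
  have hform := re_inner_nonpos_of_mem_gapSpan _ hsa' (hWX huW)
  have e1 : (X₀ + R * R) u - ((lam + s : ℝ) : ℂ) • u =
      (g : ℂ) • p' + T v + R (R (p + p' + v)) - (s : ℂ) • (p + p' + v) := by
    rw [add_apply, mul_apply_eq_comp, hu, map_add X₀, map_add X₀, hXp, hXp', hT, hg]
    simp only [sub_apply, smul_apply, ContinuousLinearMap.id_apply]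
    push_cast
    module
  have e2 : (X₀ + R * R) u - (lam' : ℂ) • u =
      T v + R (R (p + p' + v)) - (g : ℂ) • p - (g : ℂ) • v := by
    rw [add_apply, mul_apply_eq_comp, hu, map_add X₀, map_add X₀, hXp, hXp', hT, hg]
    simp only [sub_apply, smul_apply, ContinuousLinearMap.id_apply]
    push_cast
    module
  rw [e1, e2] at hform
  have hTv : T v = X₀ v - (lam : ℂ) • v := by simp [hT]
  have hyv : κ * ‖v‖ ^ 2 ≤ ‖T v‖ ^ 2 - g * RCLike.re (inner ℂ (T v) v) := by
    refine h6.trans_eq ?_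
    have : X₀ v - (lam' : ℂ) • v = T v - (g : ℂ) • v := by
      rw [hTv, hg]; push_cast; module
    rw [this, ← hTv, inner_sub_right, inner_smul_right, map_sub, inner_self_eq_norm_sq]
    simp
  have hlow := gap_form_lower_bound R h.selfAdjoint_root p p' v (T v) hg0 hκ hs.le
    (hs0.trans (min_le_left _ _))
    (by
      calc s * B ≤ κ / (4 * (B + 1)) * (B + 1) := by
            gcongr
            · exact hs0.trans (min_le_right _ _)
            · linarith
        _ = κ / 4 := by field_simp) hδ1 hδ2 h1 h2 h3
    (by rw [hTv, inner_sub_right, h4, inner_smul_right, h2]; simp)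
    (by rw [hTv, inner_sub_right, h5, inner_smul_right, h3]; simp)
    (T.le_opNorm v) hyv (by rw [← hu]; exact hu2) hv1
  -- The form is both non-positive on `W` and coercive, which leaves `u = p'` with `R p' = 0`: an
  -- eigenvector at `lam'`, excluded from the span.
  obtain ⟨hpz, hvz, hRp'⟩ := eq_zero_of_gap_bound hκ hg0 hσ (sq_nonneg _) (sq_nonneg _)
    (sq_nonneg _) hRp (hlow.trans hform)
  rw [sq_eq_zero_iff, norm_eq_zero] at hpz hvz hRp'
  have hup : u = p' := by rw [hu, hpz, hvz]; simp
  refine hu0 (eq_zero_of_mem_gapSpan _ (hWX huW) ?_)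
  rw [add_apply, mul_apply_eq_comp, hup, hRp', map_zero, add_zero, hXp']

end GapPerturbation
end Gap
end MetricLandau

namespace MetricLandau

/-! ### Decreasing enumeration of a locally finite family -/

section Enumeration

/-- A locally finite family of multiplicities in an interval `(a, c)`, accumulating only at `a`,
can be listed in decreasing order. -/
theorem exists_antitone_enumeration (a c : ℝ) (mult : ℝ → ℕ) (P : ℝ → Set (Σ t : ℝ, Fin (mult t)))
    (hP : ∀ s, P s = {p | s ≤ p.1 ∧ p.1 < c}) (hfin : ∀ s ∈ Set.Ioo a c, (P s).Finite)
    (hinf : ∀ n : ℕ, ∃ s ∈ Set.Ioo a c, n < (P s).ncard) :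
    ∃ ν : ℕ → ℝ, Antitone ν ∧ (∀ k, ν k ∈ Set.Ioo a c) ∧
      (∀ t ∈ Set.Ioo a c, Cardinal.mk {k : ℕ // ν k = t} = mult t) ∧
      ∀ k, ∀ s ∈ Set.Ioo a c, s ≤ ν k ↔ k < (P s).ncard := by
  classical
  have hmem : ∀ s p, p ∈ P s ↔ s ≤ p.1 ∧ p.1 < c := fun s p => by rw [hP]; rfl
  have hanti : ∀ s ∈ Set.Ioo a c, ∀ s', s ≤ s' → (P s').ncard ≤ (P s).ncard := fun s hs s' h =>
    Set.ncard_le_ncard (fun p hp => by rw [hmem] at *; exact ⟨h.trans hp.1, hp.2⟩) (hfin s hs)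
  have hmin : ∀ s ∈ Set.Ioo a c, ∀ Q ⊆ P s, Q.Nonempty → ∃ q ∈ Q, ∀ p ∈ Q, q.1 ≤ p.1 :=
    fun s hs Q hQ hne => Set.exists_min_image Q (fun p => p.1) ((hfin s hs).subset hQ) hne
  -- The `k`-th value is the largest `t` with more than `k` members at or above it. The maximum
  -- exists because the count jumps only at members of a locally finite family.
  have hge : ∀ k, ∃ t ∈ Set.Ioo a c, k < (P t).ncard ∧
      ∀ t' ∈ Set.Ioo a c, k < (P t').ncard → t' ≤ t := by
    intro k
    obtain ⟨s, hs, hk⟩ := hinf k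
    have hne : {p ∈ P s | k < (P p.1).ncard}.Nonempty := by
      obtain ⟨q, hq, hqm⟩ := hmin s hs (P s) subset_rfl
        (Set.nonempty_of_ncard_ne_zero (by omega))
      refine ⟨q, hq, ?_⟩
      have : P s ⊆ P q.1 := fun p hp => by
        have := hqm p hp
        rw [hmem] at *; exact ⟨this, hp.2⟩
      have hq' := (hmem _ _).1 hq
      exact hk.trans_le (Set.ncard_le_ncard this (hfin _ ⟨hs.1.trans_le hq'.1, hq'.2⟩))
    obtain ⟨q, ⟨hqs, hqk⟩, hqm⟩ := Set.exists_max_image _ (fun p => p.1)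
      ((hfin s hs).subset (Set.sep_subset _ _)) hne
    have hq' := (hmem _ _).1 hqs
    refine ⟨q.1, ⟨hs.1.trans_le hq'.1, hq'.2⟩, hqk, fun t' ht' hk' => ?_⟩
    by_contra hlt
    push Not at hlt
    obtain ⟨p, hp, hpm⟩ := hmin t' ht' (P t') subset_rfl
        (Set.nonempty_of_ncard_ne_zero (by omega))
    have hp' := (hmem _ _).1 hp
    have h1 : P t' ⊆ P p.1 := fun x hx => by
        have := hpm x hx
        rw [hmem] at *; exact ⟨this, hx.2⟩
    have h2 : p.1 ≤ q.1 := hqm p ⟨(hmem _ _).2 ⟨by linarith [hq'.1, hp'.1], hp'.2⟩,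
      hk'.trans_le (Set.ncard_le_ncard h1 (hfin _ ⟨ht'.1.trans_le hp'.1, hp'.2⟩))⟩
    linarith [hp'.1]
  choose ν hν hνk hνm using hge
  have hiff : ∀ k, ∀ s ∈ Set.Ioo a c, s ≤ ν k ↔ k < (P s).ncard := fun k s hs =>
    ⟨fun h => (hνk k).trans_le (hanti s hs _ h), fun h => hνm k s hs h⟩
  refine ⟨ν, antitone_nat_of_succ_le fun k => hνm k _ (hν _) (by have := hνk (k + 1); omega),
    hν, fun t ht => ?_, hiff⟩
  set Q : Set (Σ t : ℝ, Fin (mult t)) := {p | t < p.1 ∧ p.1 < c} with hQ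
  have hQP : Q ⊆ P t := fun p hp => (hmem _ _).2 ⟨hp.1.le, hp.2⟩
  have hlt : ∀ k, t < ν k ↔ k < Q.ncard := by
    intro k
    constructor
    · intro h
      refine (hνk k).trans_le (Set.ncard_le_ncard (fun p hp => ?_) ((hfin t ht).subset hQP))
      have hp' := (hmem _ _).1 hp
      exact ⟨h.trans_le hp'.1, hp'.2⟩
    · intro h
      obtain ⟨q, hq, hqm⟩ := hmin t ht Q hQP (Set.nonempty_of_ncard_ne_zero (by omega))
      have h1 : Q ⊆ P q.1 := fun p hp => (hmem _ _).2 ⟨hqm p hp, hp.2⟩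
      have hqI : q.1 ∈ Set.Ioo a c := ⟨ht.1.trans hq.1, hq.2⟩
      exact hq.1.trans_le (hνm k _ hqI (h.trans_le (Set.ncard_le_ncard h1 (hfin _ hqI))))
  have hcard : (P t).ncard = mult t + Q.ncard := by
    have hu : P t = Set.range (Sigma.mk t) ∪ Q := by
      ext ⟨p, i⟩
      simp only [hmem, Set.mem_union, Set.mem_range, hQ, Set.mem_ofPred_eq]
      constructor
      · rintro ⟨h1, h2⟩
        rcases h1.eq_or_lt with h | h
        · subst h; exact Or.inl ⟨i, rfl⟩
        · exact Or.inr ⟨h, h2⟩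
      · rintro (⟨j, hj⟩ | h)
        · have : t = p := congrArg Sigma.fst hj
          exact ⟨this.le, this ▸ ht.2⟩
        · exact ⟨h.1.le, h.2⟩
    rw [hu, Set.ncard_union_eq ?_ (Set.finite_range _) ((hfin t ht).subset hQP),
      Set.ncard_range_of_injective sigma_mk_injective, Nat.card_eq_fintype_card, Fintype.card_fin]
    rw [Set.disjoint_left]
    rintro _ ⟨i, rfl⟩ h
    exact lt_irrefl t h.1
  -- The indices with value `t` run from the number of members above `t` up to the number at or
  -- above `t`; the difference is the multiplicity.
  have hset : {k : ℕ | ν k = t} = ↑(Finset.Ico Q.ncard (P t).ncard) := by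
    ext k
    have h1 := hiff k t ht
    have h2 := hlt k
    simp only [Set.mem_ofPred_eq, Finset.coe_Ico, Set.mem_Ico]
    rw [← h1, ← not_lt, ← h2]
    constructor
    · intro h; exact ⟨by rw [h]; exact lt_irrefl t, h.ge⟩
    · rintro ⟨h3, h4⟩; exact le_antisymm (not_lt.1 h3) h4
  change Cardinal.mk ({k : ℕ | ν k = t} : Set ℕ) = _
  rw [hset]
  simp [hcard]

end Enumeration

/-! ### Counting eigenvalues in a gap: lower bound and enumeration -/

section Gap

variable {E : Type} [NormedAddCommGroup E] [InnerProductSpace ℂ E]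

theorem finiteDimensional_of_forall_finrank_le {V : Submodule ℂ E} (n : ℕ)
    (h : ∀ (W : Submodule ℂ E) [FiniteDimensional ℂ W], W ≤ V → Module.finrank ℂ W ≤ n) :
    FiniteDimensional ℂ V := by
  have hr : Module.rank ℂ V ≤ n := by
    by_contra hcon
    push Not at hcon
    have h1 : ((n + 1 : ℕ) : Cardinal) ≤ Module.rank ℂ V := by
      rw [Nat.cast_succ]
      exact Cardinal.add_one_le_of_lt hcon
    obtain ⟨s, hs, hli⟩ := le_rank_iff_exists_linearIndependent_finset.1 h1
    have hli' : LinearIndependent ℂ (fun x : s => ((x : V) : E)) :=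
      hli.map' V.subtype V.ker_subtype
    have hfr := finrank_span_eq_card hli'
    rw [Fintype.card_coe, hs] at hfr
    have hle : Submodule.span ℂ (Set.range fun x : s => ((x : V) : E)) ≤ V := by
      rw [Submodule.span_le]
      rintro _ ⟨x, rfl⟩
      exact (x : V).2
    have : FiniteDimensional ℂ (Submodule.span ℂ (Set.range fun x : s => ((x : V) : E))) :=
      FiniteDimensional.span_of_finite ℂ (Set.finite_range _)
    have := h _ hle
    omega
  exact Module.rank_lt_aleph0_iff.1 (hr.trans_lt Cardinal.natCast_lt_aleph0)

/-- Orthonormal bases of the separate eigenspaces combine to an orthonormal basis of the span,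
indexed by pairs of an eigenvalue and a position. -/
theorem ncard_eq_finrank_gapSpan (X : E →L[ℂ] E) (hX : (X : E →ₗ[ℂ] E).IsSymmetric) (a c : ℝ)
    [FiniteDimensional ℂ (gapSpan X a c)]
    (P : Set (Σ t : ℝ, Fin (Module.finrank ℂ (Module.End.eigenspace (X : Module.End ℂ E) (t : ℂ)))))
    (hP : P = {p | a ≤ p.1 ∧ p.1 < c}) :
    P.Finite ∧ P.ncard = Module.finrank ℂ (gapSpan X a c) := by
  classical
  set U : ℝ → Submodule ℂ E := fun t => Module.End.eigenspace (X : Module.End ℂ E) (t : ℂ)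
    with hU
  have hof : OrthogonalFamily ℂ (fun t : ℝ => U t) fun t => (U t).subtypeₗᵢ :=
    hX.orthogonalFamily_eigenspaces.comp (f := fun t : ℝ => (t : ℂ)) Complex.ofReal_injective
  have hb : ∀ t : ℝ, ∃ v : Fin (Module.finrank ℂ (U t)) → U t, Orthonormal ℂ v ∧
      (FiniteDimensional ℂ (U t) → Submodule.span ℂ (Set.range v) = ⊤) := by
    intro t
    by_cases hf : FiniteDimensional ℂ (U t)
    · refine ⟨stdOrthonormalBasis ℂ (U t), (stdOrthonormalBasis ℂ (U t)).orthonormal, fun _ => ?_⟩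
      have := (stdOrthonormalBasis ℂ (U t)).toBasis.span_eq
      rwa [OrthonormalBasis.coe_toBasis] at this
    -- An infinite-dimensional eigenspace has `finrank` zero by default and contributes no index;
    -- this cannot occur for `t ∈ [a, c)`.
    · have : IsEmpty (Fin (Module.finrank ℂ (U t))) := by
        rw [Module.finrank_of_not_finite hf]; infer_instance
      exact ⟨fun i => isEmptyElim i, ⟨fun i => isEmptyElim i, fun i => isEmptyElim i⟩,
        fun h => absurd h hf⟩
  choose v hv hspan using hb
  have hon := OrthogonalFamily.orthonormal_sigma_orthonormal hof hv
  set w : (Σ t : ℝ, Fin (Module.finrank ℂ (U t))) → E := fun p => (v p.1 p.2 : E) with hw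
  have hon' : Orthonormal ℂ w := hon
  have hfd : ∀ t ∈ Set.Ico a c, FiniteDimensional ℂ (U t) := fun t ht =>
    Submodule.finiteDimensional_of_le (eigenspace_le_gapSpan X ht)
  have hsp : Submodule.span ℂ (w '' P) = gapSpan X a c := by
    refine le_antisymm (Submodule.span_le.2 ?_) (iSup_le fun t => ?_)
    · rintro _ ⟨p, hp, rfl⟩
      rw [hP] at hp
      exact eigenspace_le_gapSpan X hp (v p.1 p.2).2
    · have h1 := hspan t (hfd t t.2)
      have h2 := congrArg (Submodule.map (U t).subtype) h1
      rw [Submodule.map_span, Submodule.map_subtype_top] at h2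
      change U t ≤ _
      rw [← h2, Submodule.span_le]
      rintro _ ⟨_, ⟨i, rfl⟩, rfl⟩
      refine Submodule.subset_span ⟨⟨t, i⟩, ?_, rfl⟩
      rw [hP]; exact t.2
  have hli : LinearIndependent ℂ (fun p : P => w p) :=
    hon'.linearIndependent.comp _ Subtype.val_injective
  have hinj : Function.Injective w := hon'.linearIndependent.injective
  have hfin : P.Finite := by
    have hli2 : LinearIndependent ℂ (fun p : P =>
        (⟨w p, hsp ▸ Submodule.subset_span ⟨p, p.2, rfl⟩⟩ : gapSpan X a c)) :=
      LinearIndependent.of_comp (gapSpan X a c).subtype hli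
    exact Set.finite_coe_iff.1 hli2.finite
  refine ⟨hfin, ?_⟩
  have : Fintype P := hfin.fintype
  have h3 := finrank_span_eq_card hli
  rw [← hsp, Set.image_eq_range, h3, Set.ncard_eq_toFinset_card', Set.toFinset_card]

variable [CompleteSpace E]
namespace GapPerturbation

variable {X₀ R : E →L[ℂ] E} {lam lam' κ : ℝ}

theorem isSelfAdjoint_add (h : GapPerturbation X₀ R lam lam' κ) : IsSelfAdjoint (X₀ + R * R) :=
  h.selfAdjoint.add (by simp [IsSelfAdjoint, h.selfAdjoint_root.star_eq])

/-- Away from a finite-dimensional space the form of `R²` is as small as desired, so the upper count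
applies with that space as `Y`. -/
theorem finiteDimensional_gapSpan (h : GapPerturbation X₀ R lam lam' κ) {a : ℝ} (ha : lam < a) :
    FiniteDimensional ℂ (gapSpan (X₀ + R * R) a lam') := by
  obtain ⟨s₀, hs₀, r, H⟩ := h.exists_finrank_le
  set s := min s₀ (a - lam) with hs
  have hs0 : 0 < s := lt_min hs₀ (by linarith)
  obtain ⟨Z, hZ, hZδ⟩ := exists_finiteDimensional_sq_norm_le R h.selfAdjoint_root h.compact
    (δ := s / 5) (by positivity)
  refine finiteDimensional_of_forall_finrank_le (r + Module.finrank ℂ Z) fun W _ hW => ?_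
  refine H s hs0 (min_le_left _ _) (s / 5) (by linarith) Z (fun p _ hp => (hZδ p hp).1) W
    (hW.trans (gapSpan_mono _ ?_))
  linarith [min_le_right s₀ (a - lam)]

/-- Fredholm alternative: `t - (X₀ + K) = (t - X₀) (1 - G)` with `G = (t - X₀)⁻¹ K` compact, and `t
- X₀` is invertible inside the gap. -/
theorem not_mem_spectrum_of_eigenvector_trivial (h : GapPerturbation X₀ R lam lam' κ)
    (K : E →L[ℂ] E) (hK : IsCompactOperator K) {t : ℝ} (ht : t ∈ Set.Ioo lam lam')
    (hker : ∀ u, (X₀ + K) u = (t : ℂ) • u → u = 0) : t ∉ spectrum ℝ (X₀ + K) := by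
  have h0 : t ∉ spectrum ℝ X₀ := fun hmem => by
    have := (nonneg_quadratic_iff_spectrum X₀ h.selfAdjoint lam lam').1
      h.unperturbed_form_nonneg t hmem
    nlinarith [mul_pos (sub_pos.2 ht.1) (sub_pos.2 ht.2)]
  obtain ⟨U, hU⟩ := spectrum.notMem_iff.1 h0
  have happ : ∀ u, (U : E →L[ℂ] E) u = (t : ℂ) • u - X₀ u := fun u => by
    rw [hU, Algebra.algebraMap_eq_smul_one]; simp
  set G : E →L[ℂ] E := (↑U⁻¹ : E →L[ℂ] E) * K with hG
  have hGc : IsCompactOperator G := hK.clm_comp (↑U⁻¹ : E →L[ℂ] E)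
  have hfac : algebraMap ℝ (E →L[ℂ] E) t - (X₀ + K) = U * (1 - G) := by
    rw [hG, mul_sub, ← mul_assoc, Units.mul_inv, one_mul, mul_one, hU]; abel
  rcases hGc.hasEigenvalue_or_mem_resolventSet (one_ne_zero (α := ℂ)) with hev | hres
  · obtain ⟨u, hu⟩ := hev.exists_hasEigenvector
    have h1 : G u = u := by simpa using hu.apply_eq_smul
    have h2 : (U : E →L[ℂ] E) (G u) = K u := by
      rw [hG, ← mul_apply_eq_comp, ← mul_assoc, Units.mul_inv, one_mul]
    rw [h1, happ] at h2
    refine absurd (hker u ?_) hu.2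
    rw [add_apply, ← h2]; abel
  · rw [spectrum.notMem_iff, hfac]
    refine U.isUnit.mul ?_
    simpa [spectrum.mem_resolventSet_iff] using hres

/-- The finite-rank operator `D` moves every eigenvalue on `W` up to `lam'`. Then `X + D` has no
spectrum in `(a, lam')`, so its form is non-negative; and `D` vanishes on `Wᗮ`, where the two forms
therefore agree. -/
theorem form_nonneg_of_mem_orthogonal (h : GapPerturbation X₀ R lam lam' κ) {a : ℝ}
    (ha : lam < a) (ha' : a < lam') {u : E} (hu : u ∈ (gapSpan (X₀ + R * R) a lam')ᗮ) :
    0 ≤ RCLike.re (inner ℂ ((X₀ + R * R) u - (a : ℂ) • u) ((X₀ + R * R) u - (lam' : ℂ) • u)) := by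
  have := h.finiteDimensional_gapSpan ha
  set X := X₀ + R * R with hX
  have hXsa : IsSelfAdjoint X := h.isSelfAdjoint_add
  set W := gapSpan X a lam' with hW
  set Q := W.starProjection with hQ
  set D : E →L[ℂ] E := Q * (algebraMap ℝ (E →L[ℂ] E) lam' - X) * Q with hD
  have hQsa : IsSelfAdjoint Q := isSelfAdjoint_starProjection W
  have hDsa : IsSelfAdjoint D := by
    have h1 : IsSelfAdjoint (algebraMap ℝ (E →L[ℂ] E) lam' - X) :=
      (IsSelfAdjoint.algebraMap _ (IsSelfAdjoint.all lam')).sub hXsa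
    have := h1.conjugate Q
    rwa [hQsa.star_eq] at this
  have hQc : IsCompactOperator Q := by
    have := FiniteDimensional.proper ℂ W
    have : IsCompactOperator (W.orthogonalProjectionOnto) :=
      isCompactOperator_of_locallyCompactSpace_dom _
    exact this.clm_comp W.subtypeL
  have hDc : IsCompactOperator D := hQc.clm_comp (Q * (algebraMap ℝ (E →L[ℂ] E) lam' - X))
  have hKc : IsCompactOperator (R * R + D) := h.compact.add hDc
  have hDapp : ∀ u, D u = Q ((lam' : ℂ) • Q u - X (Q u)) := fun u => by
    rw [hD, Algebra.algebraMap_eq_smul_one]; simp [mul_apply_eq_comp]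
  have hspec : ∀ t ∈ spectrum ℝ (X + D), 0 ≤ (t - a) * (t - lam') := by
    intro t ht
    by_contra hneg
    push Not at hneg
    have ht' : t ∈ Set.Ioo a lam' := by
      constructor <;> by_contra hc <;> push Not at hc <;> nlinarith
    rw [hX, add_assoc] at ht
    refine h.not_mem_spectrum_of_eigenvector_trivial (R * R + D) hKc ⟨ha.trans ht'.1, ht'.2⟩
      (fun u hu => ?_) ht
    rw [← add_assoc, ← hX, add_apply, hDapp] at hu
    set w := Q u with hw
    have hwW : w ∈ W := W.starProjection_apply_mem u
    have hXw : X w ∈ W := map_mem_gapSpan X hwW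
    have h1 : Q ((lam' : ℂ) • w - X w) = (lam' : ℂ) • w - X w :=
      W.starProjection_eq_self_iff.2 (W.sub_mem (W.smul_mem _ hwW) hXw)
    rw [h1] at hu
    have hperp : ∀ z ∈ W, inner ℂ z (u - w) = 0 := fun z hz =>
      (W.sub_starProjection_mem_orthogonal u) z hz
    have hin : inner ℂ w (X u) = inner ℂ w (X w) := by
      have : inner ℂ w (X (u - w)) = 0 := by
        rw [← ContinuousLinearMap.adjoint_inner_left, hXsa.adjoint_eq]
        exact hperp _ hXw
      rwa [map_sub, inner_sub_right, sub_eq_zero] at this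
    have hin2 : inner ℂ w u = inner ℂ w w := by
      have := hperp w hwW
      rwa [inner_sub_right, sub_eq_zero] at this
    -- Pairing with `w = Q u` reduces the eigenvalue equation to `(lam' - t) ‖w‖² = 0`; then `u` is
    -- an eigenvector of `X` itself and lies in `W`.
    have h2 := congrArg (fun z => inner ℂ w z) hu
    simp only [inner_add_right, inner_sub_right, inner_smul_right, hin, hin2] at h2
    have h3 : ((lam' : ℂ) - t) * inner ℂ w w = 0 := by linear_combination h2
    have hne : (lam' : ℂ) - t ≠ 0 := by
      rw [sub_ne_zero]; exact_mod_cast ht'.2.ne'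
    have hw0 : w = 0 := inner_self_eq_zero.1 ((mul_eq_zero.1 h3).resolve_left hne)
    rw [hw0] at hu
    have huW : u ∈ W := eigenspace_le_gapSpan X (t := t) ⟨ht'.1.le, ht'.2⟩
      (Module.End.mem_eigenspace_iff.2 (by simpa using hu))
    rw [← W.starProjection_eq_self_iff.2 huW]
    exact hw0
  have hform := (nonneg_quadratic_iff_spectrum (X + D) (hXsa.add hDsa) a lam').2 hspec u
  have hu0 : Q u = 0 := W.starProjection_apply_eq_zero_iff.2 hu
  have hDu : D u = 0 := by rw [hDapp, hu0]; simp
  rwa [add_apply, hDu, add_zero] at hform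

/-- Lower bound for the number of eigenvalues of `X₀ + R²` in `[lam + s, lam')`. -/
theorem exists_le_finrank (h : GapPerturbation X₀ R lam lam' κ) :
    ∃ r : ℕ, ∀ s, 0 < s → s < lam' - lam → ∀ σ : ℝ, 2 * s < σ →
      ∀ (F : Submodule ℂ E) [FiniteDimensional ℂ F],
      (∀ f ∈ F, X₀ f = (lam : ℂ) • f ∧ σ * ‖f‖ ^ 2 ≤ ‖R f‖ ^ 2) →
      Module.finrank ℂ F ≤ r + Module.finrank ℂ (gapSpan (X₀ + R * R) (lam + s) lam') := by
  set g := lam' - lam with hg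
  have hg0 : 0 < g := sub_pos.2 h.lt
  obtain ⟨Z, hZ, hZδ⟩ := exists_finiteDimensional_sq_norm_le R h.selfAdjoint_root h.compact
    (δ := g / 2) (by positivity)
  refine ⟨Module.finrank ℂ Z, fun s hs hsg σ hσ F hF hFσ => ?_⟩
  have := h.finiteDimensional_gapSpan (a := lam + s) (by linarith)
  by_contra hcon
  push Not at hcon
  obtain ⟨f, hfF, hfQ, hf0⟩ := exists_ne_zero_mem_orthogonal_of_finrank_lt F
    (Z ⊔ gapSpan (X₀ + R * R) (lam + s) lam')
    ((Submodule.finrank_add_le_finrank_add_finrank _ _).trans_lt hcon)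
  rw [← Submodule.inf_orthogonal] at hfQ
  have hform := h.form_nonneg_of_mem_orthogonal (by linarith) (by linarith) hfQ.2
  obtain ⟨hX0, hRf⟩ := hFσ f hfF
  have hδ := (hZδ f hfQ.1).2
  have e1 : (X₀ + R * R) f - ((lam + s : ℝ) : ℂ) • f = R (R f) - (s : ℂ) • f := by
    rw [add_apply, mul_apply_eq_comp, hX0]; push_cast; module
  have e2 : (X₀ + R * R) f - (lam' : ℂ) • f = R (R f) - (g : ℂ) • f := by
    rw [add_apply, mul_apply_eq_comp, hX0, hg]; push_cast; module
  have hR1 : inner ℂ (R (R f)) f = inner ℂ (R f) (R f) := by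
    rw [← ContinuousLinearMap.adjoint_inner_right, h.selfAdjoint_root.adjoint_eq]
  have hR2 : inner ℂ f (R (R f)) = inner ℂ (R f) (R f) := by
    rw [← ContinuousLinearMap.adjoint_inner_left, h.selfAdjoint_root.adjoint_eq]
  rw [e1, e2] at hform
  -- Here `‖R² f‖² ≤ g / 2 * ‖R f‖²` and `‖R f‖² ≥ σ ‖f‖²` with `σ > 2 s` make this expression
  -- negative, against the sign of the form off the span.
  have hval : RCLike.re (inner ℂ (R (R f) - (s : ℂ) • f) (R (R f) - (g : ℂ) • f)) =
      ‖R (R f)‖ ^ 2 - (g + s) * ‖R f‖ ^ 2 + s * g * ‖f‖ ^ 2 := by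
    simp only [inner_sub_left, inner_sub_right, inner_smul_left, inner_smul_right, hR1, hR2,
      inner_self_eq_norm_sq_to_K, Complex.conj_ofReal]
    have : ∀ z : E, RCLike.re ((‖z‖ : ℂ) ^ 2) = ‖z‖ ^ 2 := fun z => by
      rw [← Complex.ofReal_pow]; exact Complex.ofReal_re _
    simp only [Complex.coe_algebraMap, ← Complex.ofReal_pow, ← Complex.ofReal_mul,
      ← Complex.ofReal_sub, RCLike.re_to_complex, Complex.ofReal_re]
    ring
  rw [hval] at hform
  have hfn : 0 < ‖f‖ ^ 2 := by have := norm_pos_iff.2 hf0; positivity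
  have h1 : 0 ≤ s * ‖R f‖ ^ 2 := by positivity
  have h2 : g * (σ * ‖f‖ ^ 2) ≤ g * ‖R f‖ ^ 2 := by gcongr
  have h3 : g * (2 * s) * ‖f‖ ^ 2 < g * σ * ‖f‖ ^ 2 := by gcongr
  linarith

/-- The eigenvalues of `X₀ + R²` in the gap can be listed in decreasing order, and are controlled
by the quadratic form of `R²` on the eigenspace of `X₀`. -/
theorem exists_enumeration (h : GapPerturbation X₀ R lam lam' κ)
    (hinf : ∀ n : ℕ, ∃ F : Submodule ℂ E, FiniteDimensional ℂ F ∧ n < Module.finrank ℂ F ∧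
      ∃ σ > 0, ∀ f ∈ F, X₀ f = (lam : ℂ) • f ∧ σ * ‖f‖ ^ 2 ≤ ‖R f‖ ^ 2) :
    ∃ ν : ℕ → ℝ, Antitone ν ∧ (∀ k, ν k ∈ Set.Ioo lam lam') ∧
      (∀ t ∈ Set.Ioo lam lam', Cardinal.mk {k : ℕ // ν k = t} =
        Module.rank ℂ (Module.End.eigenspace ((X₀ + R * R : E →L[ℂ] E) : Module.End ℂ E) (t : ℂ))) ∧
      ∃ s₀ > 0, ∃ r : ℕ, ∀ n s, 0 < s → s ≤ s₀ →
        (∀ σ : ℝ, 5 / 2 * σ < s → ∀ (Y : Submodule ℂ E) [FiniteDimensional ℂ Y],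
          (∀ p, X₀ p = (lam : ℂ) • p → p ∈ Yᗮ → ‖R p‖ ^ 2 ≤ σ * ‖p‖ ^ 2) →
          r + Module.finrank ℂ Y ≤ n → ν n < lam + s) ∧
        (∀ σ : ℝ, 2 * s < σ → ∀ (F : Submodule ℂ E) [FiniteDimensional ℂ F],
          (∀ f ∈ F, X₀ f = (lam : ℂ) • f ∧ σ * ‖f‖ ^ 2 ≤ ‖R f‖ ^ 2) →
          r + n < Module.finrank ℂ F → lam + s ≤ ν n) := by
  set X := X₀ + R * R with hX
  have hg0 : 0 < lam' - lam := sub_pos.2 h.lt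
  obtain ⟨s₁, hs₁, r₁, H₁⟩ := h.exists_finrank_le
  obtain ⟨r₂, H₂⟩ := h.exists_le_finrank
  have hN : ∀ s ∈ Set.Ioo lam lam', _ := fun s hs =>
    haveI := h.finiteDimensional_gapSpan hs.1
    ncard_eq_finrank_gapSpan X h.isSelfAdjoint_add.isSymmetric s lam' _ rfl
  obtain ⟨ν, hν1, hν2, hν3, hν4⟩ := exists_antitone_enumeration lam lam'
    (fun t => Module.finrank ℂ (Module.End.eigenspace (X : Module.End ℂ E) (t : ℂ)))
    (fun s => {p | s ≤ p.1 ∧ p.1 < lam'}) (fun _ => rfl) (fun s hs => (hN s hs).1) (by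
      intro n
      obtain ⟨F, hF, hnF, σ, hσ, hFσ⟩ := hinf (r₂ + n)
      set s := min (σ / 4) ((lam' - lam) / 2) with hs
      have hs0 : 0 < s := lt_min (by positivity) (by positivity)
      have hs1 : s < lam' - lam := (min_le_right _ _).trans_lt (by linarith)
      have hs2 : 2 * s < σ := by linarith [min_le_left (σ / 4) ((lam' - lam) / 2)]
      have hmem : lam + s ∈ Set.Ioo lam lam' := ⟨by linarith, by linarith⟩
      refine ⟨lam + s, hmem, ?_⟩
      rw [(hN _ hmem).2]
      have : _ ≤ r₂ + Module.finrank ℂ (gapSpan X (lam + s) lam') := H₂ s hs0 hs1 σ hs2 F hFσ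
      omega)
  refine ⟨ν, hν1, hν2, fun t ht => ?_, min s₁ ((lam' - lam) / 2), lt_min hs₁ (by positivity),
    max r₁ r₂, fun n s hs hs0 => ?_⟩
  · rw [hν3 t ht]
    have := h.finiteDimensional_gapSpan ht.1
    have : FiniteDimensional ℂ (Module.End.eigenspace (X : Module.End ℂ E) (t : ℂ)) :=
      Submodule.finiteDimensional_of_le (eigenspace_le_gapSpan X ⟨le_rfl, ht.2⟩)
    exact Module.finrank_eq_rank ℂ _
  · have hs1 := hs0.trans (min_le_left _ _)
    have hs2 := hs0.trans (min_le_right _ _)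
    have hmem : lam + s ∈ Set.Ioo lam lam' := ⟨by linarith, by linarith⟩
    have := h.finiteDimensional_gapSpan hmem.1
    have hcount := hν4 n _ hmem
    rw [(hN _ hmem).2] at hcount
    constructor
    · intro σ hσ Y hY hYσ hr
      rw [← not_le, hcount, not_lt]
      refine (H₁ s hs hs1 σ hσ Y hYσ _ le_rfl).trans (le_trans ?_ hr)
      gcongr
      exact le_max_left _ _
    · intro σ hσ F hF hFσ hr
      rw [hcount]
      have : _ ≤ r₂ + Module.finrank ℂ (gapSpan X (lam + s) lam') :=
        H₂ s hs (by linarith) σ hσ F hFσ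
      have := le_max_right r₁ r₂
      omega

end GapPerturbation
end Gap
end MetricLandau

/-! ### Gaussian monomials in the complex coordinate -/

namespace MetricLandau

/-- The complex coordinate of a point of the plane. -/
noncomputable def zc : Plane →L[ℝ] ℂ :=
  Complex.ofRealCLM ∘L EuclideanSpace.proj (0 : Fin 2) +
    Complex.I • (Complex.ofRealCLM ∘L EuclideanSpace.proj (1 : Fin 2))

theorem zc_apply (x : Plane) : zc x = x 0 + Complex.I * x 1 := by
  simp [zc]

theorem normSq_zc (x : Plane) : Complex.normSq (zc x) = ‖x‖ ^ 2 := by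
  rw [EuclideanSpace.norm_sq_eq, zc_apply, Complex.normSq_apply, Fin.sum_univ_two]
  simp
  ring

theorem norm_zc (x : Plane) : ‖zc x‖ = ‖x‖ := by
  have := normSq_zc x
  rw [Complex.normSq_eq_norm_sq] at this
  exact (pow_left_inj₀ (norm_nonneg _) (norm_nonneg _) two_ne_zero).1 this

/-- The functions `z^i * conj z^j * exp (-b |z|^2 / 4)`. -/
noncomputable def gaussMono (b : ℝ) (i j : ℕ) (x : Plane) : ℂ :=
  zc x ^ i * (starRingEnd ℂ (zc x)) ^ j *
    Complex.exp (-(b / 4 : ℂ) * (zc x * starRingEnd ℂ (zc x)))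

theorem contDiff_gaussMono (b : ℝ) (i j : ℕ) : ContDiff ℝ ∞ (gaussMono b i j) := by
  have h1 : ContDiff ℝ ∞ (fun x : Plane => zc x) := zc.contDiff
  have h2 : ContDiff ℝ ∞ (fun x : Plane => starRingEnd ℂ (zc x)) :=
    Complex.conjCLE.contDiff.comp h1
  exact ((h1.pow i).mul (h2.pow j)).mul ((contDiff_const.mul (h1.mul h2)).cexp)

theorem norm_gaussMono (b : ℝ) (i j : ℕ) (x : Plane) :
    ‖gaussMono b i j x‖ = ‖x‖ ^ (i + j) * Real.exp (-(b / 4) * ‖x‖ ^ 2) := by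
  have : -(b / 4 : ℂ) * (zc x * starRingEnd ℂ (zc x)) = ((-(b / 4) * ‖x‖ ^ 2 : ℝ) : ℂ) := by
    rw [Complex.mul_conj, normSq_zc]; push_cast; ring
  rw [gaussMono, this, norm_mul, norm_mul, norm_pow, norm_pow, RCLike.norm_conj, norm_zc, pow_add,
    Complex.norm_exp, Complex.ofReal_re]

/-- The truncated indices `i - 1` and `j - 1` are harmless, as they carry the factors `i` and `j`.
-/
theorem fderiv_gaussMono (b : ℝ) (i j : ℕ) (x v : Plane) :
    fderiv ℝ (gaussMono b i j) x v =
      zc v * (i * gaussMono b (i - 1) j x - (b / 4 : ℂ) * gaussMono b i (j + 1) x) +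
      starRingEnd ℂ (zc v) * (j * gaussMono b i (j - 1) x - (b / 4 : ℂ) * gaussMono b (i + 1) j x) := by
  have hd : DifferentiableAt ℝ (gaussMono b i j) x :=
    ((contDiff_gaussMono b i j).differentiable (by simp)).differentiableAt
  rw [← hd.lineDeriv_eq_fderiv]
  set z := zc x with hz
  set w := starRingEnd ℂ (zc x) with hw
  set ζ := zc v with hζ
  set η := starRingEnd ℂ (zc v) with hη
  have h1 : HasDerivAt (fun t : ℝ => z + (t : ℂ) * ζ) ζ 0 := by
    simpa using ((Complex.ofRealCLM.hasDerivAt (x := (0 : ℝ))).mul_const ζ).const_add z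
  have h2 : HasDerivAt (fun t : ℝ => w + (t : ℂ) * η) η 0 := by
    simpa using ((Complex.ofRealCLM.hasDerivAt (x := (0 : ℝ))).mul_const η).const_add w
  have h3 := ((h1.pow i).mul (h2.pow j)).mul (((h1.mul h2).const_mul (-(b / 4 : ℂ))).cexp)
  have h4 := h3.congr_of_eventuallyEq (f₁ := fun t : ℝ => gaussMono b i j (x + t • v))
    (Eventually.of_forall fun t => by
      have e1 : zc (x + t • v) = z + (t : ℂ) * ζ := by simp [hz, hζ]
      simp only [gaussMono, e1, map_add, map_mul, Complex.conj_ofReal, Pi.mul_apply, Pi.pow_apply]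
      rfl)
  have h5 : HasLineDerivAt ℝ (gaussMono b i j) _ x v := h4
  rw [h5.lineDeriv]
  simp only [gaussMono, Pi.mul_apply, Pi.pow_apply, Complex.ofReal_zero, zero_mul, add_zero,
    ← hz]
  ring

theorem zc_single_zero : zc (EuclideanSpace.single 0 1) = 1 := by
  rw [zc_apply]; simp

theorem zc_single_one : zc (EuclideanSpace.single 1 1) = Complex.I := by
  rw [zc_apply]; simp

/-- The Gaussian and the potential contribute equally: their terms in `z` cancel and their terms in
`conj z` double. This is why ladder operators act so simply here. -/
theorem momentum_zero_gaussMono (b : ℝ) (i j : ℕ) :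
    momentum b 0 (gaussMono b i j) = -Complex.I • ((i : ℂ) • gaussMono b (i - 1) j +
      (j : ℂ) • gaussMono b i (j - 1) - (b / 2 : ℂ) • gaussMono b i (j + 1)) := by
  funext x
  have h1 : (potential b x 0 : ℂ) = (b / 4 : ℂ) * Complex.I * (zc x - starRingEnd ℂ (zc x)) := by
    rw [zc_apply]; simp [potential]; linear_combination (-(b / 2 : ℂ) * x 1) * Complex.I_sq
  rw [momentum, fderiv_gaussMono, zc_single_zero, h1]
  simp only [Pi.smul_apply, Pi.add_apply, Pi.sub_apply, smul_eq_mul, map_one]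
  have e1 : zc x * gaussMono b i j x = gaussMono b (i + 1) j x := by simp only [gaussMono]; ring
  have e2 : starRingEnd ℂ (zc x) * gaussMono b i j x = gaussMono b i (j + 1) x := by
    simp only [gaussMono]; ring
  linear_combination (-(b / 4 : ℂ) * Complex.I) * e1 + ((b / 4 : ℂ) * Complex.I) * e2

theorem momentum_one_gaussMono (b : ℝ) (i j : ℕ) :
    momentum b 1 (gaussMono b i j) = (i : ℂ) • gaussMono b (i - 1) j -
      (j : ℂ) • gaussMono b i (j - 1) - (b / 2 : ℂ) • gaussMono b i (j + 1) := by
  funext x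
  have h1 : (potential b x 1 : ℂ) = (b / 4 : ℂ) * (zc x + starRingEnd ℂ (zc x)) := by
    rw [zc_apply]; simp [potential]; ring
  rw [momentum, fderiv_gaussMono, zc_single_one, h1]
  simp only [Pi.smul_apply, Pi.sub_apply, smul_eq_mul, Complex.conj_I]
  have e1 : zc x * gaussMono b i j x = gaussMono b (i + 1) j x := by simp only [gaussMono]; ring
  have e2 : starRingEnd ℂ (zc x) * gaussMono b i j x = gaussMono b i (j + 1) x := by
    simp only [gaussMono]; ring
  linear_combination (-(b / 4 : ℂ)) * e1 - (b / 4 : ℂ) * e2 - ((i * gaussMono b (i - 1) j x -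
    (b / 4 : ℂ) * gaussMono b i (j + 1) x) - (j * gaussMono b i (j - 1) x -
    (b / 4 : ℂ) * gaussMono b (i + 1) j x)) * Complex.I_sq

/-- The span of the functions `gaussMono b i j`. -/
noncomputable def gaussSpan (b : ℝ) : Submodule ℂ (Plane → ℂ) :=
  Submodule.span ℂ (Set.range fun p : ℕ × ℕ => gaussMono b p.1 p.2)

theorem gaussMono_mem (b : ℝ) (i j : ℕ) : gaussMono b i j ∈ gaussSpan b :=
  Submodule.subset_span ⟨(i, j), rfl⟩

theorem contDiff_of_mem_gaussSpan {b : ℝ} {φ : Plane → ℂ} (h : φ ∈ gaussSpan b) :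
    ContDiff ℝ ∞ φ := by
  refine Submodule.span_induction (p := fun φ _ => ContDiff ℝ ∞ φ) ?_ contDiff_const ?_ ?_ h
  · rintro _ ⟨p, rfl⟩; exact contDiff_gaussMono b _ _
  · intro f g _ _ hf hg; exact hf.add hg
  · intro c f _ hf; exact contDiff_const.smul hf

theorem momentum_add {φ ψ : Plane → ℂ} (b : ℝ) (j : Fin 2) (hφ : Differentiable ℝ φ)
    (hψ : Differentiable ℝ ψ) : momentum b j (φ + ψ) = momentum b j φ + momentum b j ψ := by
  funext x
  simp only [momentum, Pi.add_apply, fderiv_add (hφ x) (hψ x), add_apply]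
  ring

theorem momentum_smul {φ : Plane → ℂ} (b : ℝ) (j : Fin 2) (c : ℂ) (hφ : Differentiable ℝ φ) :
    momentum b j (c • φ) = c • momentum b j φ := by
  funext x
  simp only [momentum, Pi.smul_apply, fderiv_const_smul (hφ x) c, smul_apply, smul_eq_mul]
  ring

theorem momentum_mem_gaussSpan {b : ℝ} (j : Fin 2) {φ : Plane → ℂ} (h : φ ∈ gaussSpan b) :
    momentum b j φ ∈ gaussSpan b := by
  have hd : ∀ {f}, f ∈ gaussSpan b → Differentiable ℝ f := fun hf =>
    (contDiff_of_mem_gaussSpan hf).differentiable (by simp)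
  refine Submodule.span_induction (p := fun φ _ => momentum b j φ ∈ gaussSpan b) ?_ ?_ ?_ ?_ h
  · rintro _ ⟨p, rfl⟩
    have hm := fun c i k => (gaussSpan b).smul_mem c (gaussMono_mem b i k)
    fin_cases j
    · change momentum b 0 _ ∈ _
      rw [momentum_zero_gaussMono]
      exact Submodule.smul_mem _ _ (sub_mem (add_mem (hm _ _ _) (hm _ _ _)) (hm _ _ _))
    · change momentum b 1 _ ∈ _
      rw [momentum_one_gaussMono]
      exact sub_mem (sub_mem (hm _ _ _) (hm _ _ _)) (hm _ _ _)
  · have : momentum b j 0 = 0 := by funext x; simp [momentum]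
    rw [this]; exact zero_mem _
  · intro f g hf hg h1 h2
    rw [momentum_add b j (hd hf) (hd hg)]; exact add_mem h1 h2
  · intro c f hf h1
    rw [momentum_smul b j c (hd hf)]; exact Submodule.smul_mem _ _ h1

theorem exists_bound_of_mem_gaussSpan {b : ℝ} (hb : 0 < b) {φ : Plane → ℂ} (h : φ ∈ gaussSpan b) :
    ∃ C : ℝ, ∀ x, ‖φ x‖ ≤ C * Real.exp (-(b / 8) * ‖x‖ ^ 2) := by
  refine Submodule.span_induction
    (p := fun φ _ => ∃ C : ℝ, ∀ x, ‖φ x‖ ≤ C * Real.exp (-(b / 8) * ‖x‖ ^ 2)) ?_ ?_ ?_ ?_ h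
  · rintro _ ⟨⟨i, j⟩, rfl⟩
    set n := i + j with hn
    refine ⟨n.factorial * Real.exp (2 / b), fun x => ?_⟩
    rw [norm_gaussMono]
    have h1 : ‖x‖ ^ n ≤ n.factorial * Real.exp ‖x‖ := by
      have := Real.pow_div_factorial_le_exp ‖x‖ (norm_nonneg x) n
      rw [div_le_iff₀ (by positivity)] at this
      linarith
    calc _ ≤ n.factorial * Real.exp ‖x‖ * Real.exp (-(b / 4) * ‖x‖ ^ 2) := by gcongr
      _ = n.factorial * Real.exp (‖x‖ + -(b / 4) * ‖x‖ ^ 2) := by rw [mul_assoc, ← Real.exp_add]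
      _ ≤ n.factorial * Real.exp (2 / b + -(b / 8) * ‖x‖ ^ 2) := by
        gcongr _ * Real.exp ?_
        -- Completing the square absorbs `exp ‖x‖` into half of the Gaussian, at the cost of the
        -- constant `exp (2 / b)`.
        have : 0 ≤ (b / 8) * (‖x‖ - 4 / b) ^ 2 := by positivity
        have e : (b / 8) * (‖x‖ - 4 / b) ^ 2 = b / 8 * ‖x‖ ^ 2 - ‖x‖ + 2 / b := by
          field_simp; ring
        linarith
      _ = _ := by rw [Real.exp_add, mul_assoc]
  · exact ⟨0, fun x => by simp⟩
  · rintro f g _ _ ⟨C, hC⟩ ⟨D, hD⟩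
    refine ⟨C + D, fun x => (norm_add_le _ _).trans ?_⟩
    rw [add_mul]; exact add_le_add (hC x) (hD x)
  · rintro c f _ ⟨C, hC⟩
    refine ⟨‖c‖ * C, fun x => ?_⟩
    rw [Pi.smul_apply, norm_smul, mul_assoc]
    exact mul_le_mul_of_nonneg_left (hC x) (norm_nonneg _)

theorem integrable_gaussian {a : ℝ} (ha : 0 < a) :
    Integrable (fun x : Plane => Real.exp (-a * ‖x‖ ^ 2)) volume := by
  have := (GaussianFourier.integrable_cexp_neg_mul_sq_norm_add (V := Plane) (b := (a : ℂ))
    (by simpa using ha) 0 0).norm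
  refine this.congr (Eventually.of_forall fun x => ?_)
  simp only [zero_mul, add_zero, Complex.norm_exp]
  congr 1
  rw [← Complex.ofReal_neg, ← Complex.ofReal_pow, ← Complex.ofReal_mul, Complex.ofReal_re]

theorem memLp_of_gaussian_bound {a C : ℝ} (ha : 0 < a) {φ : Plane → ℂ} (hc : Continuous φ)
    (h : ∀ x, ‖φ x‖ ≤ C * Real.exp (-a * ‖x‖ ^ 2)) : MemLp φ 2 volume := by
  rw [memLp_two_iff_integrable_sq_norm hc.aestronglyMeasurable]
  refine ((integrable_gaussian (a := 2 * a) (by positivity)).const_mul (C ^ 2)).mono'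
    (by fun_prop) (Eventually.of_forall fun x => ?_)
  rw [Real.norm_of_nonneg (by positivity)]
  calc ‖φ x‖ ^ 2 ≤ (C * Real.exp (-a * ‖x‖ ^ 2)) ^ 2 := by
        gcongr; exact h x
    _ = _ := by rw [mul_pow, ← Real.exp_nat_mul]; congr 2; push_cast; ring

theorem memLp_of_mem_gaussSpan {b : ℝ} (hb : 0 < b) {φ : Plane → ℂ} (h : φ ∈ gaussSpan b) :
    MemLp φ 2 (volume : Measure Plane) := by
  obtain ⟨C, hC⟩ := exists_bound_of_mem_gaussSpan hb h
  exact memLp_of_gaussian_bound (by positivity) (contDiff_of_mem_gaussSpan h).continuous hC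

theorem inner_toLp {φ : Plane → ℂ} (hφ : MemLp φ 2 (volume : Measure Plane)) (w : L2) :
    inner ℂ (hφ.toLp φ) w = ∫ x, starRingEnd ℂ (φ x) * w x := by
  rw [L2.inner_def]
  refine integral_congr_ae ?_
  filter_upwards [hφ.coeFn_toLp] with x hx
  rw [hx, RCLike.inner_apply, mul_comm]

theorem integrable_conj_mul {φ ψ : Plane → ℂ} (hφ : MemLp φ 2 (volume : Measure Plane))
    (hψ : MemLp ψ 2 (volume : Measure Plane)) :
    Integrable (fun x => starRingEnd ℂ (φ x) * ψ x) volume :=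
  MemLp.integrable_mul hφ.star hψ

theorem inner_toLp_toLp {φ ψ : Plane → ℂ} (hφ : MemLp φ 2 (volume : Measure Plane))
    (hψ : MemLp ψ 2 (volume : Measure Plane)) :
    inner ℂ (hφ.toLp φ) (hψ.toLp ψ) = ∫ x, starRingEnd ℂ (φ x) * ψ x := by
  rw [inner_toLp]
  refine integral_congr_ae ?_
  filter_upwards [hψ.coeFn_toLp] with x hx
  rw [hx]

/-- Integration by parts; compact support of the test function removes any growth condition on `ψ`
beyond square integrability. -/
theorem weakMomentum_of_smooth (b : ℝ) (j : Fin 2) {ψ : Plane → ℂ} (hψ : ContDiff ℝ ∞ ψ)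
    (h1 : MemLp ψ 2 (volume : Measure Plane)) (h2 : MemLp (momentum b j ψ) 2 volume) :
    WeakMomentum b j (h1.toLp ψ) (h2.toLp _) := by
  intro φ hφ
  have hs : ContDiff ℝ ∞ (fun x => starRingEnd ℂ (φ x)) := Complex.conjCLE.contDiff.comp hφ.1
  have hcs : HasCompactSupport (fun x => starRingEnd ℂ (φ x)) :=
    hφ.2.comp_left (map_zero _)
  set v : Plane := EuclideanSpace.single j 1
  have hdφ : ∀ x, fderiv ℝ (fun x => starRingEnd ℂ (φ x)) x v = starRingEnd ℂ (fderiv ℝ φ x v) := by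
    intro x
    have := (Complex.conjCLE.toContinuousLinearMap.hasFDerivAt.comp x
      ((hφ.1.differentiable (by simp)) x).hasFDerivAt).fderiv
    have h' : fderiv ℝ (fun x => starRingEnd ℂ (φ x)) x = _ := this
    rw [h']; rfl
  have hdc : Continuous fun x => fderiv ℝ ψ x v := (hψ.continuous_fderiv (by simp)).clm_apply
    continuous_const
  have hdc' : Continuous fun x => fderiv ℝ (fun x => starRingEnd ℂ (φ x)) x v :=
    (hs.continuous_fderiv (by simp)).clm_apply continuous_const
  have hcs' : HasCompactSupport fun x => fderiv ℝ (fun x => starRingEnd ℂ (φ x)) x v :=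
    hcs.fderiv_apply ℝ v
  have i1 : Integrable (fun x => fderiv ℝ (fun x => starRingEnd ℂ (φ x)) x v * ψ x) volume :=
    (hdc'.mul hψ.continuous).integrable_of_hasCompactSupport hcs'.mul_right
  have i2 : Integrable (fun x => starRingEnd ℂ (φ x) * fderiv ℝ ψ x v) volume :=
    (hs.continuous.mul hdc).integrable_of_hasCompactSupport hcs.mul_right
  have i3 : Integrable (fun x => starRingEnd ℂ (φ x) * ψ x) volume :=
    (hs.continuous.mul hψ.continuous).integrable_of_hasCompactSupport hcs.mul_right
  have hpc : Continuous fun x : Plane => (potential b x j : ℂ) := by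
    refine Complex.continuous_ofReal.comp ?_
    unfold potential
    split_ifs <;> fun_prop
  have i4 : Integrable (fun x => starRingEnd ℂ (φ x) * ((potential b x j : ℂ) * ψ x)) volume :=
    (hs.continuous.mul (hpc.mul hψ.continuous)).integrable_of_hasCompactSupport hcs.mul_right
  have ibp := integral_mul_fderiv_eq_neg_fderiv_mul_of_integrable (μ := (volume : Measure Plane))
    i1 i2 i3 (fun x _ => hs.differentiable (by simp) x) (fun x _ => hψ.differentiable (by simp) x)
  rw [IsTest.toL2, IsTest.toL2, inner_toLp_toLp, inner_toLp_toLp]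
  have e1 : ∀ x, starRingEnd ℂ (φ x) * momentum b j ψ x =
      -Complex.I * (starRingEnd ℂ (φ x) * fderiv ℝ ψ x v) -
        starRingEnd ℂ (φ x) * ((potential b x j : ℂ) * ψ x) := fun x => by
    simp only [momentum]; ring
  have e2 : ∀ x, starRingEnd ℂ (momentum b j φ x) * ψ x =
      Complex.I * (fderiv ℝ (fun x => starRingEnd ℂ (φ x)) x v * ψ x) -
        starRingEnd ℂ (φ x) * ((potential b x j : ℂ) * ψ x) := fun x => by
    rw [hdφ]
    simp only [momentum, map_sub, map_mul, map_neg, Complex.conj_I, Complex.conj_ofReal]; ring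
  simp only [e1, e2]
  rw [integral_sub (i2.const_mul _) i4, integral_sub (i1.const_mul _) i4, integral_const_mul,
    integral_const_mul, ibp]
  ring

end MetricLandau

/-! ### Completeness and approximation by test functions -/

namespace MetricLandau

/-- Any test function is the Fourier transform of a Schwartz function; moving the transform onto `h`
shows that `h` integrates to zero against it. -/
theorem ae_eq_zero_of_fourier_eq_zero {V : Type*} [NormedAddCommGroup V] [InnerProductSpace ℝ V]
    [FiniteDimensional ℝ V] [MeasurableSpace V] [BorelSpace V] {h : V → ℂ}
    (hi : Integrable h volume)
    (h0 : ∀ ξ : V, ∫ x, Complex.exp (((-2 * Real.pi * inner ℝ x ξ : ℝ) : ℂ) * Complex.I) * h x = 0) :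
    h =ᵐ[volume] 0 := by
  open FourierTransform in
  refine ae_eq_zero_of_integral_contDiff_smul_eq_zero hi.locallyIntegrable fun g hg hgc => ?_
  have hF : 𝓕 h = 0 := by
    funext ξ
    rw [Real.fourier_eq']
    exact h0 ξ
  have hgc' : HasCompactSupport (fun x => (g x : ℂ)) := hgc.comp_left Complex.ofReal_zero
  have hg' : ContDiff ℝ ∞ (fun x => (g x : ℂ)) := Complex.ofRealCLM.contDiff.comp hg
  set G : SchwartzMap V ℂ := hgc'.toSchwartzMap hg' with hG
  have hGx : ∀ x, G x = (g x : ℂ) := fun x => rfl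
  set ψ : SchwartzMap V ℂ := 𝓕⁻ G with hψ
  have hψG : 𝓕 (ψ : V → ℂ) = G := by
    rw [← SchwartzMap.fourier_coe, hψ, FourierTransform.fourier_fourierInv_eq]
  have key := VectorFourier.integral_fourierIntegral_smul_eq_flip (μ := volume) (ν := volume)
    (L := innerₗ V) Real.continuous_fourierChar continuous_inner hi ψ.integrable
  have e1 : VectorFourier.fourierIntegral Real.fourierChar volume (innerₗ V) h = 0 := hF
  have e2 : VectorFourier.fourierIntegral Real.fourierChar volume (innerₗ V).flip (ψ : V → ℂ) =
      G := by
    rw [flip_innerₗ]; exact hψG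
  rw [e1, e2] at key
  simp only [Pi.zero_apply, zero_smul, integral_zero] at key
  rw [key]
  refine integral_congr_ae (Eventually.of_forall fun x => ?_)
  simp [hGx, mul_comm]

/-- All polynomial moments of `h = e u` vanish, with `e` the Gaussian. Gaussian decay allows the
exponential series to be integrated term by term, so the Fourier transform of `h` vanishes, hence
`h` and `u`. -/
theorem eq_zero_of_inner_gaussMono {b : ℝ} (hb : 0 < b) (u : L2)
    (hu : ∀ i j, ∫ x, starRingEnd ℂ (gaussMono b i j x) * u x = 0) : u = 0 := by
  set e : Plane → ℂ := gaussMono b 0 0 with he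
  have hmem : ∀ i j, MemLp (gaussMono b i j) 2 (volume : Measure Plane) := fun i j =>
    memLp_of_mem_gaussSpan hb (gaussMono_mem b i j)
  have huL : MemLp (u : Plane → ℂ) 2 volume := Lp.memLp u
  have hee : ∀ x, e x = (Real.exp (-(b / 4) * ‖x‖ ^ 2) : ℂ) := fun x => by
    rw [he, gaussMono, Complex.mul_conj, normSq_zc]; push_cast; simp
  have hmono : ∀ i j x, starRingEnd ℂ (gaussMono b i j x) =
      starRingEnd ℂ (zc x) ^ i * zc x ^ j * e x := fun i j x => by
    rw [he, gaussMono, gaussMono]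
    simp only [map_mul, map_pow, Complex.conj_conj, pow_zero, one_mul, ← Complex.exp_conj,
      map_neg, map_div₀, Complex.conj_ofReal, map_ofNat]
    ring_nf
  set h : Plane → ℂ := fun x => e x * u x with hh
  have hint : ∀ i j, Integrable (fun x => starRingEnd ℂ (zc x) ^ i * zc x ^ j * h x) volume := by
    intro i j
    refine (integrable_conj_mul (hmem i j) huL).congr (Eventually.of_forall fun x => ?_)
    simp only [hmono, hh]; ring
  have hzero : ∀ i j, ∫ x, starRingEnd ℂ (zc x) ^ i * zc x ^ j * h x = 0 := by
    intro i j
    rw [← hu i j]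
    refine integral_congr_ae (Eventually.of_forall fun x => ?_)
    simp only [hmono, hh]; ring
  have hhi : Integrable h volume := by simpa using hint 0 0
  have hinner : ∀ x ξ : Plane, ((inner ℝ x ξ : ℝ) : ℂ) =
      (zc ξ / 2) * starRingEnd ℂ (zc x) + (starRingEnd ℂ (zc ξ) / 2) * zc x := by
    intro x ξ
    rw [PiLp.inner_apply, Fin.sum_univ_two, zc_apply, zc_apply]
    simp
    linear_combination ((x 1 : ℂ) * ξ 1) * Complex.I_sq
  have hpow : ∀ (ξ : Plane) (n : ℕ), ∫ x, ((inner ℝ x ξ : ℝ) : ℂ) ^ n * h x = 0 := by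
    intro ξ n
    have e1 : ∀ x, ((inner ℝ x ξ : ℝ) : ℂ) ^ n * h x = ∑ m ∈ Finset.range (n + 1),
        ((zc ξ / 2) ^ m * (starRingEnd ℂ (zc ξ) / 2) ^ (n - m) * (n.choose m : ℂ)) *
          (starRingEnd ℂ (zc x) ^ m * zc x ^ (n - m) * h x) := by
      intro x
      rw [hinner, add_pow, Finset.sum_mul]
      refine Finset.sum_congr rfl fun m _ => ?_
      rw [mul_pow, mul_pow]; ring
    simp only [e1]
    rw [integral_finsetSum _ fun m _ => (hint _ _).const_mul _]
    refine Finset.sum_eq_zero fun m _ => ?_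
    rw [integral_const_mul, hzero, mul_zero]
  have hfour : h =ᵐ[volume] 0 := by
    refine ae_eq_zero_of_fourier_eq_zero hhi fun ξ => ?_
    set c : ℝ := 2 * Real.pi * ‖ξ‖ with hc
    have hc0 : 0 ≤ c := by positivity
    -- The terms are dominated with total `‖h x‖ exp (c ‖x‖)`, integrable because `e x exp (c ‖x‖)`
    -- is still square integrable.
    have hsum := hasSum_integral_of_dominated_convergence (μ := (volume : Measure Plane))
      (F := fun (n : ℕ) x => ((n.factorial : ℂ)⁻¹ * ((-2 * Real.pi : ℂ) * Complex.I) ^ n) *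
        (((inner ℝ x ξ : ℝ) : ℂ) ^ n * h x))
      (f := fun x => Complex.exp (((-2 * Real.pi * inner ℝ x ξ : ℝ) : ℂ) * Complex.I) * h x)
      (fun n x => ‖h x‖ * ((c * ‖x‖) ^ n / n.factorial))
      (fun n => by
        refine (AEStronglyMeasurable.mul ?_ hhi.aestronglyMeasurable).const_mul _
        fun_prop)
      (fun n => Eventually.of_forall fun x => ?_)
      (Eventually.of_forall fun x => (Real.summable_pow_div_factorial _).mul_left _)
      ?_ (Eventually.of_forall fun x => ?_)
    · have hz : ∀ n : ℕ, ∫ x, ((n.factorial : ℂ)⁻¹ * ((-2 * Real.pi : ℂ) * Complex.I) ^ n) *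
          (((inner ℝ x ξ : ℝ) : ℂ) ^ n * h x) = 0 := fun n => by
        rw [integral_const_mul, hpow, mul_zero]
      simp only [hz] at hsum
      exact hsum.unique hasSum_zero
    · have h1 : |inner ℝ x ξ| ≤ ‖x‖ * ‖ξ‖ := abs_real_inner_le_norm x ξ
      rw [norm_mul, norm_mul, norm_mul, norm_inv, norm_pow, norm_pow, norm_mul, norm_mul,
        Complex.norm_I, Complex.norm_natCast, Complex.norm_real, Complex.norm_real]
      simp only [norm_neg, Complex.norm_ofNat, mul_one, Real.norm_eq_abs, abs_of_pos Real.pi_pos]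
      calc _ ≤ (n.factorial : ℝ)⁻¹ * (2 * Real.pi) ^ n * ((‖x‖ * ‖ξ‖) ^ n * ‖h x‖) := by gcongr
        _ = _ := by rw [hc]; ring
    · have e1 : ∀ x, ∑' n : ℕ, ‖h x‖ * ((c * ‖x‖) ^ n / n.factorial) =
          ‖h x‖ * Real.exp (c * ‖x‖) := fun x => by
        rw [tsum_mul_left, Real.exp_eq_exp_ℝ, NormedSpace.exp_eq_tsum_div]
      simp only [e1]
      have hE : MemLp (fun x : Plane => ((Real.exp (-(b / 4) * ‖x‖ ^ 2 + c * ‖x‖) : ℝ) : ℂ)) 2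
          volume := by
        refine memLp_of_gaussian_bound (a := b / 8) (C := Real.exp (2 * c ^ 2 / b)) (by positivity)
          (by fun_prop) fun x => ?_
        rw [Complex.norm_real, Real.norm_of_nonneg (Real.exp_pos _).le, ← Real.exp_add]
        refine Real.exp_le_exp.2 ?_
        have h1 : 0 ≤ (b / 8) * (‖x‖ - 4 * c / b) ^ 2 := by positivity
        have h2 : (b / 8) * (‖x‖ - 4 * c / b) ^ 2 =
            b / 8 * ‖x‖ ^ 2 - c * ‖x‖ + 2 * c ^ 2 / b := by
          field_simp; ring
        linarith
      refine (MemLp.integrable_mul hE huL).norm.congr (Eventually.of_forall fun x => ?_)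
      simp only [Pi.mul_apply, hh, norm_mul, hee]
      rw [Complex.norm_real, Complex.norm_real, Real.norm_of_nonneg (Real.exp_pos _).le,
        Real.norm_of_nonneg (Real.exp_pos _).le, Real.exp_add]
      ring
    · have h1 := NormedSpace.expSeries_div_hasSum_exp
        (((-2 * Real.pi * inner ℝ x ξ : ℝ) : ℂ) * Complex.I)
      rw [← Complex.exp_eq_exp_ℂ] at h1
      refine (h1.mul_right (h x)).congr_fun ?_
      intro n
      have h2 : ((-2 * Real.pi * inner ℝ x ξ : ℝ) : ℂ) * Complex.I =
          ((-2 * Real.pi : ℂ) * Complex.I) * ((inner ℝ x ξ : ℝ) : ℂ) := by push_cast; ring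
      rw [h2, mul_pow]
      ring
  refine Lp.ext ?_
  filter_upwards [hfour, Lp.coeFn_zero ℂ 2 (volume : Measure Plane)] with x hx h0
  rw [h0]
  have hne : e x ≠ 0 := by rw [hee]; exact_mod_cast (Real.exp_pos _).ne'
  exact (mul_eq_zero.1 hx).resolve_left hne

/-- Functions in `gaussSpan b` are limits of test functions, together with their momenta. -/
theorem exists_test_approx {b : ℝ} (hb : 0 < b) {φ : Plane → ℂ} (hφ : φ ∈ gaussSpan b) :
    ∃ (χ : ℕ → Plane → ℂ) (hχ : ∀ n, IsTest (χ n)), ∀ w : L2,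
      Tendsto (fun n => inner ℂ (hχ n).toL2 w) atTop
        (𝓝 (inner ℂ ((memLp_of_mem_gaussSpan hb hφ).toLp φ) w)) ∧
      ∀ j, Tendsto (fun n => inner ℂ ((hχ n).momentum b j).toL2 w) atTop
        (𝓝 (inner ℂ ((memLp_of_mem_gaussSpan hb (momentum_mem_gaussSpan j hφ)).toLp _) w)) := by
  let B : ContDiffBump (0 : Plane) := ⟨1, 2, one_pos, one_lt_two⟩
  let c : Plane → ℂ := fun x => ((B x : ℝ) : ℂ)
  have hBs : ContDiff ℝ ∞ (fun x => B x) := B.contDiff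
  have hBc : HasCompactSupport (fun x => B x) := B.hasCompactSupport
  have hc : ContDiff ℝ ∞ c := Complex.ofRealCLM.contDiff.comp hBs
  have hcc : HasCompactSupport c := hBc.comp_left Complex.ofReal_zero
  have hc1 : ∀ x, ‖c x‖ ≤ 1 := fun x => by
    change ‖((B x : ℝ) : ℂ)‖ ≤ 1
    rw [Complex.norm_real, Real.norm_of_nonneg B.nonneg]; exact B.le_one
  have hc0 : c 0 = 1 := by
    change ((B 0 : ℝ) : ℂ) = 1
    rw [B.one_of_mem_closedBall (Metric.mem_closedBall_self B.rIn_pos.le)]; simp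
  obtain ⟨D, hD⟩ : ∃ D, ∀ x, ‖fderiv ℝ c x‖ ≤ D :=
    (hc.continuous_fderiv (by simp)).bounded_above_of_compact_support (hcc.fderiv (𝕜 := ℝ))
  have hD0 : 0 ≤ D := (norm_nonneg _).trans (hD 0)
  -- The cutoffs are dilates `c (r n • x)`: the error they cause in the momentum carries a factor `r
  -- n` and disappears in the limit.
  let r : ℕ → ℝ := fun n => ((n : ℝ) + 1)⁻¹
  have hr0 : ∀ n, 0 < r n := fun n => by positivity
  have hr1 : ∀ n, r n ≤ 1 := fun n => inv_le_one_of_one_le₀ (by simp)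
  have hrt : Tendsto r atTop (𝓝 0) := tendsto_inv_atTop_zero.comp
    (tendsto_atTop_add_const_right _ _ tendsto_natCast_atTop_atTop)
  let cn : ℕ → Plane → ℂ := fun n x => c (r n • x)
  have hcn : ∀ n, ContDiff ℝ ∞ (cn n) := fun n => hc.comp (contDiff_const_smul _)
  have hcnc : ∀ n, HasCompactSupport (cn n) := fun n => hcc.comp_smul (hr0 n).ne'
  have hφs := contDiff_of_mem_gaussSpan hφ
  have hdcn : ∀ n x v, fderiv ℝ (cn n) x v = (r n : ℂ) * fderiv ℝ c (r n • x) v := by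
    intro n x v
    have := fderiv_comp_smul (𝕜 := ℝ) (f := c) (c := r n) (x := x)
    change fderiv ℝ (fun x => c (r n • x)) x v = _
    rw [this]; simp
  have hmom : ∀ n j x, momentum b j (fun x => cn n x * φ x) x = cn n x * momentum b j φ x -
      Complex.I * (r n * fderiv ℝ c (r n • x) (EuclideanSpace.single j 1)) * φ x := by
    intro n j x
    have hd := fderiv_fun_mul ((hcn n).differentiable (by simp) x) (hφs.differentiable (by simp) x)
    simp only [momentum, hd, add_apply, smul_apply, smul_eq_mul, hdcn]
    ring
  have hs1 : ∀ j, ‖(EuclideanSpace.single j 1 : Plane)‖ = 1 := fun j => by simp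
  have hφL := memLp_of_mem_gaussSpan hb hφ
  have hpt : ∀ x, Tendsto (fun n => cn n x) atTop (𝓝 1) := fun x => by
    have : Tendsto (fun n => r n • x) atTop (𝓝 0) := by simpa using hrt.smul_const x
    have h2 := (hc.continuous.tendsto 0).comp this
    rwa [hc0] at h2
  refine ⟨fun n x => cn n x * φ x, fun n => ⟨(hcn n).mul hφs, (hcnc n).mul_right⟩, fun w => ?_⟩
  have hwL : MemLp (w : Plane → ℂ) 2 volume := Lp.memLp w
  constructor
  · rw [inner_toLp]
    simp only [IsTest.toL2, inner_toLp]
    refine tendsto_integral_of_dominated_convergence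
      (fun x => ‖starRingEnd ℂ (φ x) * w x‖) (fun n => ?_)
      (integrable_conj_mul hφL hwL).norm (fun n => Eventually.of_forall fun x => ?_)
      (Eventually.of_forall fun x => ?_)
    · exact (Continuous.aestronglyMeasurable (by
        have := (hcn n).continuous
        have := hφs.continuous
        fun_prop)).mul hwL.aestronglyMeasurable
    · rw [norm_mul, norm_mul, RCLike.norm_conj, RCLike.norm_conj, norm_mul]
      gcongr
      exact mul_le_of_le_one_left (norm_nonneg _) (hc1 _)
    · have := ((Complex.continuous_conj.tendsto _).comp ((hpt x).mul_const (φ x))).mul_const (w x)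
      simpa using this
  · intro j
    have hφm := memLp_of_mem_gaussSpan hb (momentum_mem_gaussSpan j hφ)
    rw [inner_toLp]
    simp only [IsTest.toL2, inner_toLp, hmom]
    refine tendsto_integral_of_dominated_convergence
      (fun x => ‖starRingEnd ℂ (momentum b j φ x) * w x‖ + D * ‖starRingEnd ℂ (φ x) * w x‖)
      (fun n => ?_)
      ((integrable_conj_mul hφm hwL).norm.add ((integrable_conj_mul hφL hwL).norm.const_mul D))
      (fun n => Eventually.of_forall fun x => ?_)
      (Eventually.of_forall fun x => ?_)
    · refine (Continuous.aestronglyMeasurable ?_).mul hwL.aestronglyMeasurable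
      have h1 := (hcn n).continuous
      have h2 := hφs.continuous
      have h3 := (contDiff_of_mem_gaussSpan (momentum_mem_gaussSpan j hφ)).continuous
      have h4 : Continuous fun x => fderiv ℝ c (r n • x) (EuclideanSpace.single j 1) :=
        ((hc.continuous_fderiv (by simp)).comp (continuous_const_smul _)).clm_apply continuous_const
      fun_prop
    · rw [norm_mul, norm_mul, norm_mul, RCLike.norm_conj, RCLike.norm_conj, RCLike.norm_conj,
        ← mul_assoc D, ← add_mul]
      gcongr
      refine (norm_sub_le _ _).trans (add_le_add ?_ ?_)
      · rw [norm_mul]; exact mul_le_of_le_one_left (norm_nonneg _) (hc1 _)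
      · rw [norm_mul, norm_mul, norm_mul, Complex.norm_I, one_mul, Complex.norm_real,
          Real.norm_of_nonneg (hr0 n).le]
        gcongr
        have h1 : ‖fderiv ℝ c (r n • x) (EuclideanSpace.single j 1)‖ ≤ D := by
          refine (ContinuousLinearMap.le_opNorm _ _).trans ?_
          rw [hs1, mul_one]
          exact hD _
        calc _ ≤ 1 * D := by gcongr; exact hr1 n
          _ = D := one_mul D
    · have h1 : Tendsto (fun n => (r n : ℂ) * fderiv ℝ c (r n • x) (EuclideanSpace.single j 1))
          atTop (𝓝 0) := by
        rw [tendsto_zero_iff_norm_tendsto_zero]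
        refine squeeze_zero (fun _ => norm_nonneg _) (fun n => ?_)
          (by simpa using hrt.mul_const D : Tendsto (fun n => r n * D) atTop (𝓝 0))
        rw [norm_mul, Complex.norm_real, Real.norm_of_nonneg (hr0 n).le]
        gcongr
        refine (ContinuousLinearMap.le_opNorm _ _).trans ?_
        rw [hs1, mul_one]
        exact hD _
      have h2 := ((hpt x).mul_const (momentum b j φ x)).sub
        ((h1.const_mul Complex.I).mul_const (φ x))
      have := ((Complex.continuous_conj.tendsto _).comp h2).mul_const (w x)
      simpa using this

end MetricLandau

namespace MetricLandau

/-! ### Ladder operators and angular momentum -/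

section Ladder

/-- The momentum operators, acting on `gaussSpan b`. -/
noncomputable def gMom (b : ℝ) (j : Fin 2) : gaussSpan b →ₗ[ℂ] gaussSpan b where
  toFun φ := ⟨momentum b j φ, momentum_mem_gaussSpan j φ.2⟩
  map_add' φ ψ := Subtype.ext (momentum_add b j
    ((contDiff_of_mem_gaussSpan φ.2).differentiable (by simp))
    ((contDiff_of_mem_gaussSpan ψ.2).differentiable (by simp)))
  map_smul' c φ := Subtype.ext (momentum_smul b j c
    ((contDiff_of_mem_gaussSpan φ.2).differentiable (by simp)))

/-- The inclusion of `gaussSpan b` in the Hilbert space. -/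
noncomputable def gaussToL2 {b : ℝ} (hb : 0 < b) : gaussSpan b →ₗ[ℂ] L2 where
  toFun φ := (memLp_of_mem_gaussSpan hb φ.2).toLp φ
  map_add' _ _ := rfl
  map_smul' _ _ := rfl

variable {b : ℝ} (hb : 0 < b)

theorem coeFn_gaussToL2 (φ : gaussSpan b) :
    (gaussToL2 hb φ : Plane → ℂ) =ᵐ[volume] (φ : Plane → ℂ) :=
  MemLp.coeFn_toLp (memLp_of_mem_gaussSpan hb φ.2)

theorem inner_gaussToL2 (φ : gaussSpan b) (w : L2) :
    inner ℂ (gaussToL2 hb φ) w = ∫ x, starRingEnd ℂ ((φ : Plane → ℂ) x) * w x :=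
  inner_toLp (memLp_of_mem_gaussSpan hb φ.2) w

theorem inner_gaussToL2_gaussToL2 (φ ψ : gaussSpan b) :
    inner ℂ (gaussToL2 hb φ) (gaussToL2 hb ψ) =
      ∫ x, starRingEnd ℂ ((φ : Plane → ℂ) x) * (ψ : Plane → ℂ) x :=
  inner_toLp_toLp (memLp_of_mem_gaussSpan hb φ.2) (memLp_of_mem_gaussSpan hb ψ.2)

theorem weakMomentum_gaussToL2 (j : Fin 2) (φ : gaussSpan b) :
    WeakMomentum b j (gaussToL2 hb φ) (gaussToL2 hb (gMom b j φ)) :=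
  weakMomentum_of_smooth b j (contDiff_of_mem_gaussSpan φ.2) (memLp_of_mem_gaussSpan hb φ.2)
    (memLp_of_mem_gaussSpan hb (gMom b j φ).2)

/-- Identities in the sense of distributions extend to Gaussian functions, which are not compactly
supported; the eigenfunctions can then be used as test functions. -/
theorem inner_gaussToL2_of_forall_test (v : L2) (y : Fin 2 → L2)
    (h : ∀ (φ : Plane → ℂ) (h : IsTest φ),
      inner ℂ h.toL2 v = ∑ j, inner ℂ (h.momentum b j).toL2 (y j)) (φ : gaussSpan b) :
    inner ℂ (gaussToL2 hb φ) v = ∑ j, inner ℂ (gaussToL2 hb (gMom b j φ)) (y j) := by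
  obtain ⟨χ, hχ, hlim⟩ := exists_test_approx hb φ.2
  refine tendsto_nhds_unique (hlim v).1 ?_
  simp only [h _ (hχ _)]
  exact tendsto_finsetSum _ fun j _ => (hlim (y j)).2 j

theorem _root_.MetricLandau.WeakMomentum.inner_gaussToL2 {j : Fin 2} {u w : L2}
    (h : WeakMomentum b j u w) (φ : gaussSpan b) :
    inner ℂ (gaussToL2 hb φ) w = inner ℂ (gaussToL2 hb (gMom b j φ)) u := by
  obtain ⟨χ, hχ, hlim⟩ := exists_test_approx hb φ.2
  refine tendsto_nhds_unique (hlim w).1 ?_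
  simp only [h _ (hχ _)]
  exact (hlim u).2 j

theorem inner_gMom_left (j : Fin 2) (φ ψ : gaussSpan b) :
    inner ℂ (gaussToL2 hb (gMom b j φ)) (gaussToL2 hb ψ) =
      inner ℂ (gaussToL2 hb φ) (gaussToL2 hb (gMom b j ψ)) :=
  ((weakMomentum_gaussToL2 hb j ψ).inner_gaussToL2 hb φ).symm

/-- The creation operator. -/
noncomputable def raise (b : ℝ) : gaussSpan b →ₗ[ℂ] gaussSpan b :=
  gMom b 0 - Complex.I • gMom b 1

/-- The annihilation operator. -/
noncomputable def lower (b : ℝ) : gaussSpan b →ₗ[ℂ] gaussSpan b :=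
  gMom b 0 + Complex.I • gMom b 1

/-- `gaussMono b i j` as an element of `gaussSpan b`. -/
noncomputable def gm (b : ℝ) (i j : ℕ) : gaussSpan b := ⟨gaussMono b i j, gaussMono_mem b i j⟩

theorem gMom_zero_gm (i j : ℕ) : gMom b 0 (gm b i j) = -Complex.I • ((i : ℂ) • gm b (i - 1) j +
    (j : ℂ) • gm b i (j - 1) - (b / 2 : ℂ) • gm b i (j + 1)) :=
  Subtype.ext (momentum_zero_gaussMono b i j)

theorem gMom_one_gm (i j : ℕ) : gMom b 1 (gm b i j) = (i : ℂ) • gm b (i - 1) j -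
    (j : ℂ) • gm b i (j - 1) - (b / 2 : ℂ) • gm b i (j + 1) :=
  Subtype.ext (momentum_one_gaussMono b i j)

theorem raise_gm (i j : ℕ) : raise b (gm b i j) =
    (-2 * Complex.I) • ((i : ℂ) • gm b (i - 1) j + (-(b / 2) : ℂ) • gm b i (j + 1)) := by
  rw [raise, LinearMap.sub_apply, LinearMap.smul_apply, gMom_zero_gm, gMom_one_gm]
  module

theorem lower_gm (i j : ℕ) : lower b (gm b i j) = (-2 * Complex.I * j) • gm b i (j - 1) := by
  rw [lower, LinearMap.add_apply, LinearMap.smul_apply, gMom_zero_gm, gMom_one_gm]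
  module

theorem gaussSpan_ext {M : Type*} [AddCommMonoid M] [Module ℂ M] {f g : gaussSpan b →ₗ[ℂ] M}
    (h : ∀ i j, f (gm b i j) = g (gm b i j)) : f = g := by
  refine LinearMap.ext fun φ => ?_
  obtain ⟨φ, hφ⟩ := φ
  refine Submodule.span_induction (p := fun φ hφ => f ⟨φ, hφ⟩ = g ⟨φ, hφ⟩) ?_ ?_ ?_ ?_ hφ
  · rintro _ ⟨p, rfl⟩; exact h _ _
  · exact (map_zero f).trans (map_zero g).symm
  · intro x y hx hy h1 h2
    exact (map_add f ⟨x, hx⟩ ⟨y, hy⟩).trans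
      ((congrArg₂ (· + ·) h1 h2).trans (map_add g ⟨x, hx⟩ ⟨y, hy⟩).symm)
  · intro c x hx h1
    exact (map_smul f c ⟨x, hx⟩).trans
      ((congrArg (c • ·) h1).trans (map_smul g c ⟨x, hx⟩).symm)

/-- The canonical commutation relation, from which the whole spectrum of the Landau Hamiltonian
follows algebraically. -/
theorem lower_raise (φ : gaussSpan b) :
    lower b (raise b φ) = raise b (lower b φ) + (2 * b : ℂ) • φ := by
  have : lower b ∘ₗ raise b = raise b ∘ₗ lower b + (2 * b : ℂ) • LinearMap.id := by
    refine gaussSpan_ext fun i j => ?_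
    simp only [LinearMap.comp_apply, LinearMap.add_apply, LinearMap.smul_apply, LinearMap.id_apply,
      raise_gm, lower_gm, map_smul, map_add]
    have hI := Complex.I_sq
    -- The case `j = 0` is separate because `j - 1 + 1` is not `j` for the truncated subtraction.
    rcases j with _ | j
    · simp only [Nat.cast_zero, mul_zero, zero_smul, smul_zero, zero_add, Nat.cast_one, mul_one,
        Nat.sub_self]
      rw [smul_smul, smul_smul]
      congr 1
      linear_combination (-2 * b : ℂ) * hI
    · simp only [Nat.add_sub_cancel, Nat.cast_add, Nat.cast_one, smul_add, smul_smul]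
      match_scalars
      · ring
      · linear_combination (-2 * b : ℂ) * hI
  exact LinearMap.congr_fun this φ

theorem inner_raise_left (φ ψ : gaussSpan b) :
    inner ℂ (gaussToL2 hb (raise b φ)) (gaussToL2 hb ψ) =
      inner ℂ (gaussToL2 hb φ) (gaussToL2 hb (lower b ψ)) := by
  rw [raise, lower, LinearMap.sub_apply, LinearMap.smul_apply, LinearMap.add_apply,
    LinearMap.smul_apply, map_sub, map_smul, map_add, map_smul, inner_sub_left, inner_smul_left,
    inner_add_right, inner_smul_right, inner_gMom_left, inner_gMom_left, Complex.conj_I]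
  ring

/-- Unnormalized eigenfunctions of the Landau Hamiltonian. -/
noncomputable def psi (b : ℝ) (n k : ℕ) : gaussSpan b := (raise b ^ n) (gm b k 0)

theorem psi_succ (n k : ℕ) : psi b (n + 1) k = raise b (psi b n k) := by
  rw [psi, psi, pow_succ', Module.End.mul_apply]

theorem lower_psi_zero (k : ℕ) : lower b (psi b 0 k) = 0 := by
  rw [psi, pow_zero, Module.End.one_apply, lower_gm]; simp

theorem lower_psi_succ (n k : ℕ) :
    lower b (psi b (n + 1) k) = (2 * b * (n + 1) : ℂ) • psi b n k := by
  induction n with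
  | zero =>
    rw [psi_succ, lower_raise, lower_psi_zero, map_zero, zero_add]; simp
  | succ n ih =>
    rw [psi_succ, lower_raise, ih, map_smul, ← psi_succ]
    push_cast
    module

/-- Up to the factor `-2 i`, raising is the sum of the commuting operations `∂_z` on `z ^ i` and
multiplication of `conj z ^ j` by `-(b / 2) conj z`; the sum is the binomial expansion of its `n`-th
power. -/
theorem psi_eq_sum (n k : ℕ) : psi b n k = (-2 * Complex.I) ^ n •
    ∑ p ∈ Finset.HasAntidiagonal.antidiagonal n, n.choose p.1 •
      (((k.descFactorial p.1 : ℂ) * (-(b / 2) : ℂ) ^ p.2) • gm b (k - p.1) p.2) := by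
  induction n with
  | zero => simp [psi]
  | succ n ih =>
    rw [psi_succ, ih, map_smul, map_sum, pow_succ, mul_smul]
    congr 1
    rw [Finset.sum_antidiagonal_choose_succ_nsmul
      (fun i j => ((k.descFactorial i : ℂ) * (-(b / 2) : ℂ) ^ j) • gm b (k - i) j), ← Finset.sum_add_distrib, Finset.smul_sum]
    refine Finset.sum_congr rfl fun p hp => ?_
    rw [map_nsmul, map_smul, raise_gm,
      ← Nat.choose_symm_of_eq_add (Finset.HasAntidiagonal.mem_antidiagonal.1 hp).symm, Nat.descFactorial_succ,
      Nat.sub_sub]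
    push_cast
    rw [pow_succ]
    simp only [← Nat.cast_smul_eq_nsmul ℂ]
    module

/-- For `n ≤ k` every term contains `z ^ (k - n)`. What remains is a Gaussian times a real
polynomial in `‖x‖²`. -/
theorem psi_apply {n k : ℕ} (h : n ≤ k) (x : Plane) : (psi b n k : Plane → ℂ) x =
    (-2 * Complex.I) ^ n * zc x ^ (k - n) * Complex.exp (-(b / 4 : ℂ) * (‖x‖ ^ 2 : ℝ)) *
      ((∑ p ∈ Finset.HasAntidiagonal.antidiagonal n, (n.choose p.1 : ℝ) *
        ((k.descFactorial p.1 : ℝ) * (-(b / 2 * ‖x‖ ^ 2)) ^ p.2) : ℝ) : ℂ) := by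
  have hev : ∀ φ : gaussSpan b, (φ : Plane → ℂ) x =
      (LinearMap.proj x ∘ₗ (gaussSpan b).subtype) φ := fun φ => rfl
  rw [hev, psi_eq_sum, map_smul, map_sum, smul_eq_mul, mul_assoc, mul_assoc]
  congr 1
  rw [Complex.ofReal_sum, Finset.mul_sum, Finset.mul_sum]
  refine Finset.sum_congr rfl fun p hp => ?_
  have hp' := Finset.HasAntidiagonal.mem_antidiagonal.1 hp
  rw [map_nsmul, map_smul, ← hev]
  simp only [gm, gaussMono, smul_eq_mul, nsmul_eq_mul]
  push_cast
  have h1 : k - p.1 = (k - n) + p.2 := by omega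
  have h2 : zc x * starRingEnd ℂ (zc x) = (‖x‖ : ℂ) ^ 2 := by
    rw [Complex.mul_conj, normSq_zc]; push_cast; rfl
  rw [h1, pow_add, h2]
  have h3 : zc x ^ p.2 * starRingEnd ℂ (zc x) ^ p.2 = ((‖x‖ : ℂ) ^ 2) ^ p.2 := by
    rw [← mul_pow, h2]
  rw [neg_pow, neg_pow (b / 2 * (‖x‖ : ℂ) ^ 2), mul_pow]
  linear_combination (n.choose p.1 * (k.descFactorial p.1 * ((-1) ^ p.2 * (b / 2 : ℂ) ^ p.2)) *
    zc x ^ (k - n) * Complex.exp (-(b / 4 : ℂ) * (‖x‖ : ℂ) ^ 2)) * h3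

/-- The plane with its complex coordinate, as a linear isometry. -/
noncomputable def zcE : Plane ≃ₗᵢ[ℝ] ℂ := Complex.orthonormalBasisOneI.repr.symm

theorem zcE_apply (x : Plane) : zcE x = zc x := by
  rw [zc_apply]
  conv_lhs => rw [show x = Complex.orthonormalBasisOneI.repr (x 0 + Complex.I * x 1) from by
    ext i; fin_cases i <;> simp]
  exact Complex.orthonormalBasisOneI.repr.symm_apply_apply _

/-- Rotations of the plane. -/
noncomputable def planeRotation (a : Circle) : Plane ≃ₗᵢ[ℝ] Plane :=
  (zcE.trans (rotation a)).trans zcE.symm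

theorem zc_planeRotation (a : Circle) (x : Plane) : zc (planeRotation a x) = a * zc x := by
  rw [← zcE_apply, ← zcE_apply]
  simp [planeRotation]

/-- The angular momentum is `k - n`. Powers of the conjugate phase on both sides express this
without negative exponents when `k < n`. -/
theorem psi_planeRotation (a : Circle) (n k : ℕ) (x : Plane) :
    starRingEnd ℂ (a : ℂ) ^ k * (psi b n k : Plane → ℂ) (planeRotation a x) =
      starRingEnd ℂ (a : ℂ) ^ n * (psi b n k : Plane → ℂ) x := by
  have hev : ∀ (y : Plane) (φ : gaussSpan b), (φ : Plane → ℂ) y =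
      (LinearMap.proj y ∘ₗ (gaussSpan b).subtype) φ := fun y φ => rfl
  have haa : (a : ℂ) * starRingEnd ℂ (a : ℂ) = 1 := by
    rw [Complex.mul_conj, Circle.normSq_coe]; simp
  rw [hev, hev x, psi_eq_sum, map_smul, map_smul, map_sum, map_sum, smul_eq_mul, smul_eq_mul,
    Finset.mul_sum, Finset.mul_sum, Finset.mul_sum, Finset.mul_sum]
  refine Finset.sum_congr rfl fun p hp => ?_
  have hp' := Finset.HasAntidiagonal.mem_antidiagonal.1 hp
  rw [map_nsmul, map_nsmul, map_smul, map_smul, ← hev, ← hev]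
  by_cases hk : p.1 ≤ k
  · have h1 : starRingEnd ℂ (a : ℂ) ^ k * gaussMono b (k - p.1) p.2 (planeRotation a x) =
        starRingEnd ℂ (a : ℂ) ^ n * gaussMono b (k - p.1) p.2 x := by
      simp only [gaussMono, zc_planeRotation, map_mul, mul_pow]
      have e1 : starRingEnd ℂ (a : ℂ) ^ k = starRingEnd ℂ (a : ℂ) ^ p.1 *
        starRingEnd ℂ (a : ℂ) ^ (k - p.1) := by rw [← pow_add]; congr 1; omega
      have e2 : starRingEnd ℂ (a : ℂ) ^ n = starRingEnd ℂ (a : ℂ) ^ p.1 *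
        starRingEnd ℂ (a : ℂ) ^ p.2 := by rw [← pow_add, hp']
      have e3 : (a : ℂ) ^ (k - p.1) * starRingEnd ℂ (a : ℂ) ^ (k - p.1) = 1 := by
        rw [← mul_pow, haa, one_pow]
      have e4 : (a : ℂ) * zc x * (starRingEnd ℂ (a : ℂ) * starRingEnd ℂ (zc x)) =
          zc x * starRingEnd ℂ (zc x) := by
        linear_combination (zc x * starRingEnd ℂ (zc x)) * haa
      rw [e1, e2, e4]
      linear_combination (starRingEnd ℂ (a : ℂ) ^ p.1 * zc x ^ (k - p.1) *
        starRingEnd ℂ (a : ℂ) ^ p.2 * starRingEnd ℂ (zc x) ^ p.2 *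
        Complex.exp (-(b / 4 : ℂ) * (zc x * starRingEnd ℂ (zc x)))) * e3
    simp only [gm, smul_eq_mul, nsmul_eq_mul]
    linear_combination ((-2 * Complex.I) ^ n * n.choose p.1 *
      (k.descFactorial p.1 * (-(b / 2) : ℂ) ^ p.2)) * h1
  · rw [Nat.descFactorial_of_lt (not_le.1 hk)]; simp

/-- Distinct angular momenta are orthogonal for every radial weight. -/
theorem integral_radial_psi_eq_zero (ρ : ℝ → ℂ) (n : ℕ) {k l : ℕ} (hkl : k ≠ l) :
    ∫ x : Plane, ρ ‖x‖ * (starRingEnd ℂ ((psi b n k : Plane → ℂ) x) *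
      (psi b n l : Plane → ℂ) x) = 0 := by
  -- The rotation angle is chosen so that the integrand acquires the phase `-1`. The integral then
  -- equals its own negative, with no integrability condition on the weight.
  set a : Circle := Circle.exp (Real.pi / ((l : ℝ) - k)) with ha
  have hne : (l : ℝ) - k ≠ 0 := by
    rw [sub_ne_zero]; exact_mod_cast hkl.symm
  set F : Plane → ℂ := fun x => ρ ‖x‖ * (starRingEnd ℂ ((psi b n k : Plane → ℂ) x) *
      (psi b n l : Plane → ℂ) x) with hF
  have haa : (a : ℂ) * starRingEnd ℂ (a : ℂ) = 1 := by
    rw [Complex.mul_conj, Circle.normSq_coe]; simp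
  have hrot : ∀ x, (a : ℂ) ^ k * starRingEnd ℂ (a : ℂ) ^ l * F (planeRotation a x) = F x := by
    intro x
    have h1 := congrArg (starRingEnd ℂ) (psi_planeRotation (b := b) a n k x)
    have h2 := psi_planeRotation (b := b) a n l x
    simp only [map_mul, map_pow, Complex.conj_conj] at h1
    have e3 : (a : ℂ) ^ n * starRingEnd ℂ (a : ℂ) ^ n = 1 := by
      rw [← mul_pow, haa, one_pow]
    simp only [hF, LinearIsometryEquiv.norm_map]
    calc _ = ρ ‖x‖ * (((a : ℂ) ^ k *
            starRingEnd ℂ ((psi b n k : Plane → ℂ) (planeRotation a x))) *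
            (starRingEnd ℂ (a : ℂ) ^ l * (psi b n l : Plane → ℂ) (planeRotation a x))) := by ring
      _ = _ := by
        rw [h1, h2]
        linear_combination (ρ ‖x‖ * starRingEnd ℂ ((psi b n k : Plane → ℂ) x) *
          (psi b n l : Plane → ℂ) x) * e3
  have hval : (a : ℂ) ^ k * starRingEnd ℂ (a : ℂ) ^ l = -1 := by
    rw [ha, Circle.coe_exp, ← Complex.exp_conj, ← Complex.exp_nat_mul, ← Complex.exp_nat_mul,
      ← Complex.exp_add, map_mul, Complex.conj_I, Complex.conj_ofReal]
    have : (k : ℂ) * (((Real.pi / ((l : ℝ) - k) : ℝ) : ℂ) * Complex.I) +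
        (l : ℂ) * (((Real.pi / ((l : ℝ) - k) : ℝ) : ℂ) * -Complex.I) = -(Real.pi * Complex.I) := by
      have hne' : (l : ℂ) - k ≠ 0 := by exact_mod_cast hne
      push_cast
      field_simp
      ring
    rw [this, Complex.exp_neg, Complex.exp_pi_mul_I]; norm_num
  have hint : ∫ x, F (planeRotation a x) = ∫ x, F x :=
    (planeRotation a).measurePreserving.integral_comp
      (planeRotation a).toHomeomorph.measurableEmbedding F
  have h3 : ∫ x, F x = -∫ x, F x := by
    conv_lhs => rw [← integral_congr_ae (Eventually.of_forall hrot)]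
    rw [integral_const_mul, hint, hval]; ring
  have h4 : (2 : ℂ) * ∫ x, F x = 0 := by linear_combination h3
  simpa using h4

end Ladder
end MetricLandau

namespace MetricLandau

/-! ### The Hilbert basis of Landau eigenfunctions -/

section Basis

variable {b : ℝ} (hb : 0 < b)

/-- The kinetic energy is the average of `raise ∘ lower` and `lower ∘ raise`, which differ by `2 b`.
-/
theorem sum_gMom_gMom (φ : gaussSpan b) :
    ∑ j, gMom b j (gMom b j φ) = raise b (lower b φ) + (b : ℂ) • φ := by
  have h := lower_raise φ
  have h1 : raise b (lower b φ) + (b : ℂ) • φ = (1 / 2 : ℂ) • (raise b (lower b φ) +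
      (raise b (lower b φ) + (2 * b : ℂ) • φ)) := by module
  rw [h1, ← h, Fin.sum_univ_two]
  simp only [raise, lower, LinearMap.sub_apply, LinearMap.smul_apply, LinearMap.add_apply, map_add,
    map_sub, map_smul]
  simp only [smul_add, smul_sub, smul_smul, Complex.I_mul_I]
  match_scalars <;> simp <;> ring_nf

theorem sum_gMom_gMom_psi (n k : ℕ) :
    ∑ j, gMom b j (gMom b j (psi b n k)) = (landauLevel b n : ℂ) • psi b n k := by
  rw [sum_gMom_gMom]
  rcases n with _ | n
  · rw [lower_psi_zero, map_zero, zero_add, landauLevel]; simp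
  · rw [lower_psi_succ, map_smul, ← psi_succ, ← add_smul, landauLevel]
    congr 1
    push_cast
    ring

theorem inner_psi_succ_succ (n m k l : ℕ) :
    inner ℂ (gaussToL2 hb (psi b (n + 1) k)) (gaussToL2 hb (psi b (m + 1) l)) =
      (2 * b * (m + 1) : ℂ) * inner ℂ (gaussToL2 hb (psi b n k)) (gaussToL2 hb (psi b m l)) := by
  rw [psi_succ, inner_raise_left, lower_psi_succ, map_smul, inner_smul_right]

/-- Raising operators are cancelled in pairs until the lower vector sits in the bottom level, which
`lower` annihilates. -/
theorem inner_psi_of_lt {n m : ℕ} (h : n < m) (k l : ℕ) :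
    inner ℂ (gaussToL2 hb (psi b m k)) (gaussToL2 hb (psi b n l)) = 0 := by
  induction n generalizing m with
  | zero =>
    obtain ⟨m, rfl⟩ := Nat.exists_eq_succ_of_ne_zero h.ne'
    rw [Nat.succ_eq_add_one, psi_succ, inner_raise_left, lower_psi_zero, map_zero, inner_zero_right]
  | succ n ih =>
    obtain ⟨m, rfl⟩ := Nat.exists_eq_succ_of_ne_zero (Nat.ne_zero_of_lt h)
    rw [Nat.succ_eq_add_one, inner_psi_succ_succ, ih (by omega), mul_zero]

theorem inner_psi_of_ne_right (n : ℕ) {k l : ℕ} (h : k ≠ l) :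
    inner ℂ (gaussToL2 hb (psi b n k)) (gaussToL2 hb (psi b n l)) = 0 := by
  rw [inner_gaussToL2_gaussToL2]
  simpa using integral_radial_psi_eq_zero (b := b) (fun _ => 1) n h

theorem inner_psi_of_ne {p q : ℕ × ℕ} (h : p ≠ q) :
    inner ℂ (gaussToL2 hb (psi b p.1 p.2)) (gaussToL2 hb (psi b q.1 q.2)) = 0 := by
  rcases lt_trichotomy p.1 q.1 with h1 | h1 | h1
  · rw [← inner_conj_symm, inner_psi_of_lt hb h1, map_zero]
  · rw [h1]
    exact inner_psi_of_ne_right hb _ fun h2 => h (Prod.ext h1 h2)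
  · exact inner_psi_of_lt hb h1 _ _

theorem normSq_psi_succ (n k : ℕ) : ‖gaussToL2 hb (psi b (n + 1) k)‖ ^ 2 =
    2 * b * (n + 1) * ‖gaussToL2 hb (psi b n k)‖ ^ 2 := by
  have := inner_psi_succ_succ hb n n k k
  rw [inner_self_eq_norm_sq_to_K, inner_self_eq_norm_sq_to_K] at this
  exact Complex.ofReal_injective (by push_cast; exact this)

theorem normSq_gm (k : ℕ) : ‖gaussToL2 hb (gm b k 0)‖ ^ 2 =
    ∫ x : Plane, ‖x‖ ^ (2 * k) * Real.exp (-(b / 2 * ‖x‖ ^ 2)) := by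
  have := inner_gaussToL2_gaussToL2 hb (gm b k 0) (gm b k 0)
  rw [inner_self_eq_norm_sq_to_K] at this
  have h2 : ∀ x : Plane, starRingEnd ℂ ((gm b k 0 : Plane → ℂ) x) * (gm b k 0 : Plane → ℂ) x =
      ((‖x‖ ^ (2 * k) * Real.exp (-(b / 2 * ‖x‖ ^ 2)) : ℝ) : ℂ) := fun x => by
    rw [mul_comm, Complex.mul_conj, Complex.normSq_eq_norm_sq]
    congr 1
    simp only [gm]
    rw [norm_gaussMono, mul_pow, ← pow_mul, ← Real.exp_nat_mul]
    congr 2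
    · ring
    · push_cast; ring
  simp only [h2] at this
  rw [integral_complex_ofReal] at this
  refine Complex.ofReal_injective ?_
  rw [Complex.ofReal_pow]
  exact this

theorem normSq_psi (n k : ℕ) : ‖gaussToL2 hb (psi b n k)‖ ^ 2 =
    (2 * b) ^ n * n.factorial * ‖gaussToL2 hb (gm b k 0)‖ ^ 2 := by
  induction n with
  | zero => simp [psi]
  | succ n ih => rw [normSq_psi_succ, ih, Nat.factorial_succ]; push_cast; ring

theorem gaussToL2_gm_ne_zero (k : ℕ) : gaussToL2 hb (gm b k 0) ≠ 0 := by
  intro h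
  have h1 := coeFn_gaussToL2 hb (gm b k 0)
  rw [h] at h1
  have h2 : gaussMono b k 0 =ᵐ[volume] fun _ => (0 : ℂ) :=
    h1.symm.trans (Lp.coeFn_zero ℂ 2 (volume : Measure Plane))
  have h3 := (Continuous.ae_eq_iff_eq volume (contDiff_gaussMono b k 0).continuous
    continuous_const).1 h2
  have h4 := congrArg norm (congrFun h3 (EuclideanSpace.single 0 1))
  rw [norm_gaussMono] at h4
  simp at h4

theorem norm_psi_pos (n k : ℕ) : 0 < ‖gaussToL2 hb (psi b n k)‖ := by
  have h1 := norm_pos_iff.2 (gaussToL2_gm_ne_zero hb k)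
  have h2 : 0 < ‖gaussToL2 hb (psi b n k)‖ ^ 2 := by rw [normSq_psi]; positivity
  exact (norm_nonneg _).lt_of_ne' (sq_pos_iff.1 h2)

/-- Normalized eigenfunctions of the Landau Hamiltonian. -/
noncomputable def phi (p : ℕ × ℕ) : gaussSpan b :=
  ((‖gaussToL2 hb (psi b p.1 p.2)‖⁻¹ : ℝ) : ℂ) • psi b p.1 p.2

theorem orthonormal_phi : Orthonormal ℂ fun p => gaussToL2 hb (phi hb p) := by
  refine ⟨fun p => ?_, fun p q hpq => ?_⟩
  · have := norm_psi_pos hb p.1 p.2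
    simp only [phi, map_smul, norm_smul, Complex.norm_real, norm_inv, norm_norm]
    exact inv_mul_cancel₀ this.ne'
  · simp only [phi, map_smul, inner_smul_left, inner_smul_right, inner_psi_of_ne hb hpq, mul_zero]

/-- The span is stable under `raise`, and `raise` of `gm b i j` contains exactly one term with an
additional power of `conj z`; solving for it gives the induction on `j`. -/
theorem gm_mem_span (i j : ℕ) : gm b i j ∈ Submodule.span ℂ (Set.range fun p => phi hb p) := by
  have hpsi : ∀ n k, psi b n k ∈ Submodule.span ℂ (Set.range fun p => phi hb p) := fun n k => by
    have h : psi b n k = ((‖gaussToL2 hb (psi b n k)‖ : ℝ) : ℂ) • phi hb (n, k) := by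
      have h0 : ((‖gaussToL2 hb (psi b n k)‖ : ℝ) : ℂ) ≠ 0 := by
        exact_mod_cast (norm_psi_pos hb n k).ne'
      simp only [phi, smul_smul]
      rw [← Complex.ofReal_mul, mul_inv_cancel₀ (norm_psi_pos hb n k).ne', Complex.ofReal_one,
        one_smul]
    rw [h]
    exact Submodule.smul_mem _ _ (Submodule.subset_span ⟨_, rfl⟩)
  have hraise : ∀ φ ∈ Submodule.span ℂ (Set.range fun p => phi hb p),
      raise b φ ∈ Submodule.span ℂ (Set.range fun p => phi hb p) := fun φ hφ => by
    induction hφ using Submodule.span_induction with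
    | mem x hx =>
      obtain ⟨p, rfl⟩ := hx
      simp only [phi, map_smul, ← psi_succ]
      exact Submodule.smul_mem _ _ (hpsi _ _)
    | zero => simp
    | add x y _ _ h1 h2 => rw [map_add]; exact add_mem h1 h2
    | smul c x _ h1 => rw [map_smul]; exact Submodule.smul_mem _ _ h1
  induction j generalizing i with
  | zero => exact hpsi 0 i
  | succ j ih =>
    have h : gm b i (j + 1) = (2 / b : ℂ) • ((i : ℂ) • gm b (i - 1) j -
        (Complex.I / 2 : ℂ) • raise b (gm b i j)) := by
      have hb' : (b : ℂ) ≠ 0 := by exact_mod_cast hb.ne'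
      rw [raise_gm]
      match_scalars
      · field_simp
        ring_nf
        rw [Complex.I_sq]; ring
      · field_simp
        ring_nf
        rw [Complex.I_sq]; ring
    rw [h]
    exact Submodule.smul_mem _ _ (sub_mem (Submodule.smul_mem _ _ (ih _))
      (Submodule.smul_mem _ _ (hraise _ (ih _))))

theorem orthogonal_span_phi :
    (Submodule.span ℂ (Set.range fun p => gaussToL2 hb (phi hb p)))ᗮ = ⊥ := by
  rw [Submodule.eq_bot_iff]
  intro u hu
  refine eq_zero_of_inner_gaussMono hb u fun i j => ?_
  have h1 : gaussToL2 hb (gm b i j) ∈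
      Submodule.span ℂ (Set.range fun p => gaussToL2 hb (phi hb p)) := by
    have := Submodule.mem_map_of_mem (f := gaussToL2 hb) (gm_mem_span hb i j)
    rwa [Submodule.map_span, ← Set.range_comp] at this
  have h2 := Submodule.inner_right_of_mem_orthogonal h1 hu
  rwa [inner_gaussToL2] at h2

/-- The Hilbert basis of eigenfunctions of the Landau Hamiltonian. -/
noncomputable def landauBasis : HilbertBasis (ℕ × ℕ) ℂ L2 :=
  HilbertBasis.mkOfOrthogonalEqBot (orthonormal_phi hb) (orthogonal_span_phi hb)

theorem landauBasis_apply (p : ℕ × ℕ) : landauBasis hb p = gaussToL2 hb (phi hb p) := by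
  rw [landauBasis, HilbertBasis.coe_mkOfOrthogonalEqBot]

theorem sum_gMom_gMom_phi (p : ℕ × ℕ) :
    ∑ j, gMom b j (gMom b j (phi hb p)) = (landauLevel b p.1 : ℂ) • phi hb p := by
  simp only [phi, map_smul, ← Finset.smul_sum, sum_gMom_gMom_psi]
  rw [smul_comm]

/-- The magnetic gradient maps the basis to an orthogonal family with squared norms `Λ_n`; this is
the source of its polar decomposition. -/
theorem sum_inner_gMom_phi (p q : ℕ × ℕ) :
    ∑ j, inner ℂ (gaussToL2 hb (gMom b j (phi hb p))) (gaussToL2 hb (gMom b j (phi hb q))) =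
      if p = q then (landauLevel b p.1 : ℂ) else 0 := by
  simp only [inner_gMom_left]
  rw [← inner_sum, ← map_sum, sum_gMom_gMom_phi, map_smul, inner_smul_right,
    orthonormal_iff_ite.1 (orthonormal_phi hb) p q]
  split_ifs with h
  · rw [h, mul_one]
  · rw [mul_zero]

end Basis
end MetricLandau

namespace MetricLandau

/-! ### Diagonal operators and a compactness criterion -/

section HilbertBasis

variable {ι E : Type*} [NormedAddCommGroup E] [InnerProductSpace ℂ E] (e : HilbertBasis ι ℂ E)

theorem hilbertBasis_ext {u v : E} (h : ∀ i, inner ℂ (e i) u = inner ℂ (e i) v) : u = v := by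
  refine e.repr.injective (lp.ext (funext fun i => ?_))
  rw [e.repr_apply_apply, e.repr_apply_apply, h]

theorem hilbertBasis_ext_clm {F : Type*} [NormedAddCommGroup F] [NormedSpace ℂ F]
    {S T : E →L[ℂ] F} (h : ∀ i, S (e i) = T (e i)) : S = T := by
  refine ContinuousLinearMap.ext_on (s := Set.range e) ?_ (by rintro _ ⟨i, rfl⟩; exact h i)
  rw [Submodule.dense_iff_topologicalClosure_eq_top]
  exact e.dense_span

theorem hasSum_normSq_inner (u : E) : HasSum (fun i => ‖inner ℂ (e i) u‖ ^ 2) (‖u‖ ^ 2) := by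
  have h := e.hasSum_inner_mul_inner u u
  have h2 := Complex.hasSum_re h
  rw [inner_self_eq_norm_sq_to_K] at h2
  convert! h2 using 1
  · funext i
    rw [← inner_conj_symm u, mul_comm, Complex.mul_conj, Complex.normSq_eq_norm_sq,
      Complex.ofReal_re]
  · rw [← RCLike.ofReal_pow]; rfl

/-- The bounded operator which is diagonal in the given Hilbert basis. -/
noncomputable def diagOp (a : ι → ℝ) {C : ℝ} (h : ∀ i, |a i| ≤ C) : E →L[ℂ] E :=
  have key : ∀ u : E, ∀ i, ‖(a i : ℂ) * e.repr u i‖ ^ (2 : ℝ≥0∞).toReal ≤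
      C ^ 2 * ‖e.repr u i‖ ^ (2 : ℝ≥0∞).toReal := fun u i => by
    rw [ENNReal.toReal_ofNat, Real.rpow_two, Real.rpow_two, norm_mul, mul_pow, Complex.norm_real]
    gcongr
    exact h i
  have hs : ∀ u : E, Summable fun i => ‖e.repr u i‖ ^ (2 : ℝ≥0∞).toReal := fun u =>
    (lp.hasSum_norm (by simp) (e.repr u)).summable
  have hs' : ∀ u : E, Summable fun i => ‖(a i : ℂ) * e.repr u i‖ ^ (2 : ℝ≥0∞).toReal := fun u =>
    Summable.of_nonneg_of_le (fun i => by positivity) (key u) ((hs u).mul_left _)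
  LinearMap.mkContinuous
    { toFun := fun u => e.repr.symm ⟨fun i => (a i : ℂ) * e.repr u i, memℓp_gen (hs' u)⟩
      map_add' := fun u v => by
        rw [← map_add]
        congr 1
        refine lp.ext (funext fun i => ?_)
        simp [mul_add]
        rfl
      map_smul' := fun c u => by
        rw [RingHom.id_apply, ← map_smul]
        congr 1
        refine lp.ext (funext fun i => ?_)
        simp [mul_left_comm] } |C| (fun u => by
      change ‖e.repr.symm _‖ ≤ _
      rw [LinearIsometryEquiv.norm_map]
      refine lp.norm_le_of_tsum_le (by simp) (by positivity) ?_
      calc ∑' i, ‖(a i : ℂ) * e.repr u i‖ ^ (2 : ℝ≥0∞).toReal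
          ≤ ∑' i, C ^ 2 * ‖e.repr u i‖ ^ (2 : ℝ≥0∞).toReal :=
            (hs' u).tsum_le_tsum (key u) ((hs u).mul_left _)
        _ = C ^ 2 * ‖e.repr u‖ ^ (2 : ℝ≥0∞).toReal := by
            rw [tsum_mul_left, ← lp.norm_rpow_eq_tsum (by simp)]
        _ = _ := by
            rw [LinearIsometryEquiv.norm_map, ENNReal.toReal_ofNat, Real.rpow_two, Real.rpow_two,
              mul_pow, sq_abs])

section diagOp

variable (a : ι → ℝ) {C : ℝ} (h : ∀ i, |a i| ≤ C)

theorem inner_diagOp_right (i : ι) (u : E) :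
    inner ℂ (e i) (diagOp e a h u) = (a i : ℂ) * inner ℂ (e i) u := by
  rw [← e.repr_apply_apply, ← e.repr_apply_apply]
  change e.repr (e.repr.symm _) i = _
  rw [LinearIsometryEquiv.apply_symm_apply]

theorem diagOp_apply_self (i : ι) : diagOp e a h (e i) = (a i : ℂ) • e i := by
  classical
  refine hilbertBasis_ext e fun j => ?_
  rw [inner_diagOp_right, inner_smul_right, orthonormal_iff_ite.1 e.orthonormal j i]
  split_ifs with hij
  · rw [hij]
  · simp

theorem inner_diagOp_left (u v : E) :
    inner ℂ (diagOp e a h u) v = inner ℂ u (diagOp e a h v) := by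
  have h1 := e.hasSum_inner_mul_inner (diagOp e a h u) v
  have h2 := e.hasSum_inner_mul_inner u (diagOp e a h v)
  refine h1.unique (h2.congr_fun ?_)
  intro i
  rw [inner_diagOp_right, ← inner_conj_symm, inner_diagOp_right, map_mul, inner_conj_symm,
    Complex.conj_ofReal]
  ring

theorem norm_diagOp_le (u : E) {c : ℝ} (hc : 0 ≤ c) (h' : ∀ i, inner ℂ (e i) u ≠ 0 → |a i| ≤ c) :
    ‖diagOp e a h u‖ ≤ c * ‖u‖ := by
  refine le_of_sq_le_sq ?_ (by positivity)
  rw [mul_pow]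
  refine hasSum_le (fun i => ?_) (hasSum_normSq_inner e (diagOp e a h u))
    ((hasSum_normSq_inner e u).mul_left (c ^ 2))
  rw [inner_diagOp_right, norm_mul, mul_pow, Complex.norm_real]
  by_cases hi : inner ℂ (e i) u = 0
  · simp [hi]
  · gcongr
    exact h' i hi

theorem inner_eq_zero_of_diagOp_eq {lam : ℝ} {u : E} (hu : diagOp e a h u = (lam : ℂ) • u) {i : ι}
    (hi : a i ≠ lam) : inner ℂ (e i) u = 0 := by
  have h1 := inner_diagOp_right e a h i u
  rw [hu, inner_smul_right, ← sub_eq_zero, ← sub_mul] at h1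
  rcases mul_eq_zero.1 h1 with h2 | h2
  · exact absurd (by exact_mod_cast (sub_eq_zero.1 h2).symm) hi
  · exact h2

/-- Lower bound for the product of two shifts of a diagonal operator. -/
theorem diagOp_coercive {lam lam' κ : ℝ} (v : E)
    (hκ : ∀ i, inner ℂ (e i) v ≠ 0 → κ ≤ (a i - lam) * (a i - lam')) :
    κ * ‖v‖ ^ 2 ≤ (inner ℂ (diagOp e a h v - (lam : ℂ) • v)
      (diagOp e a h v - (lam' : ℂ) • v)).re := by
  refine hasSum_le (fun i => ?_) ((hasSum_normSq_inner e v).mul_left κ)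
    (Complex.hasSum_re (e.hasSum_inner_mul_inner _ _))
  have h1 : ∀ r : ℝ, inner ℂ (e i) (diagOp e a h v - (r : ℂ) • v) =
      ((a i - r : ℝ) : ℂ) * inner ℂ (e i) v := fun r => by
    rw [inner_sub_right, inner_diagOp_right, inner_smul_right]; push_cast; ring
  have h2 : inner ℂ (diagOp e a h v - (lam : ℂ) • v) (e i) *
      inner ℂ (e i) (diagOp e a h v - (lam' : ℂ) • v) =
      (((a i - lam) * (a i - lam') * ‖inner ℂ (e i) v‖ ^ 2 : ℝ) : ℂ) := by
    rw [← inner_conj_symm, h1, h1, map_mul, Complex.conj_ofReal]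
    push_cast
    have := Complex.mul_conj (inner ℂ (e i) v)
    rw [Complex.normSq_eq_norm_sq] at this
    push_cast at this
    rw [← this]; ring
  rw [h2, Complex.ofReal_re]
  by_cases hi : inner ℂ (e i) v = 0
  · simp [hi]
  · gcongr
    exact hκ i hi

end diagOp

/-- `R` is a norm limit of the finite-rank operators obtained by composing it with the projections
to `Z`. -/
theorem isCompactOperator_of_norm_le_on_orthogonal [CompleteSpace E] (R : E →L[ℂ] E)
    (h : ∀ δ > 0, ∃ Z : Submodule ℂ E, FiniteDimensional ℂ Z ∧ ∀ u ∈ Zᗮ, ‖R u‖ ≤ δ * ‖u‖) :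
    IsCompactOperator R := by
  have hc := isClosed_setOfPred_isCompactOperator (M₁ := E) (M₂ := E) (σ₁₂ := RingHom.id ℂ)
  refine hc.closure_subset (Metric.mem_closure_iff.2 fun δ hδ => ?_)
  obtain ⟨Z, hZ, hR⟩ := h (δ / 2) (by positivity)
  refine ⟨R ∘L Z.starProjection, ?_, ?_⟩
  · have : LocallyCompactSpace Z := by
      have := FiniteDimensional.proper ℂ Z
      infer_instance
    have h2 : IsCompactOperator (R ∘L Z.subtypeL) :=
      isCompactOperator_of_locallyCompactSpace_rng _
    exact h2.comp_clm Z.orthogonalProjectionOnto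
  · rw [dist_eq_norm]
    refine lt_of_le_of_lt (ContinuousLinearMap.opNorm_le_bound _ (by positivity) fun u => ?_)
      (half_lt_self hδ)
    have h1 : (R - R ∘L Z.starProjection) u = R (u - Z.starProjection u) := by simp
    rw [h1]
    refine (hR _ (Submodule.sub_starProjection_mem_orthogonal u)).trans ?_
    gcongr
    have := Zᗮ.norm_starProjection_apply_le u
    rwa [Submodule.starProjection_orthogonal_val] at this

/-- Smallness on high levels leaves finitely many levels, and smallness at high index within each
level then leaves finitely many basis vectors. -/
theorem isCompactOperator_of_hilbertBasis [CompleteSpace E] (e : HilbertBasis (ℕ × ℕ) ℂ E)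
    (R : E →L[ℂ] E)
    (h1 : ∀ n, ∀ δ > 0, ∃ K : ℕ, ∀ u : E, (∀ p : ℕ × ℕ, p.1 ≠ n ∨ p.2 < K → inner ℂ (e p) u = 0) →
      ‖R u‖ ≤ δ * ‖u‖)
    (h2 : ∀ δ > 0, ∃ Q : ℕ, ∀ u : E, (∀ p : ℕ × ℕ, p.1 < Q → inner ℂ (e p) u = 0) →
      ‖R u‖ ≤ δ * ‖u‖) : IsCompactOperator R := by
  refine isCompactOperator_of_norm_le_on_orthogonal R fun δ hδ => ?_
  obtain ⟨Q, hQ⟩ := h2 (δ / 2) (by positivity)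
  -- Half of `δ` is spent on the high levels, and the other half is shared among the `Q` low ones.
  have hδ' : 0 < δ / (2 * (Q + 1)) := by positivity
  choose K hK using fun n => h1 n (δ / (2 * (Q + 1))) hδ'
  set t : Finset (ℕ × ℕ) := Finset.range Q ×ˢ Finset.range ((Finset.range Q).sup K)
  have ht : ∀ p : ℕ × ℕ, p.1 < Q → p.2 < K p.1 → p ∈ t := fun p hp hp' =>
    Finset.mem_product.2 ⟨Finset.mem_range.2 hp, Finset.mem_range.2
      (hp'.trans_le (Finset.le_sup (f := K) (Finset.mem_range.2 hp)))⟩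
  refine ⟨Submodule.span ℂ (e '' t), FiniteDimensional.span_of_finite ℂ (t.finite_toSet.image _),
    fun u hu => ?_⟩
  have hu' : ∀ p : ℕ × ℕ, p.1 < Q → p.2 < K p.1 → inner ℂ (e p) u = 0 := fun p hp hp' =>
    Submodule.inner_right_of_mem_orthogonal
      (Submodule.subset_span (Set.mem_image_of_mem e (Finset.mem_coe.2 (ht p hp hp')))) hu
  have ha : ∀ n, ∀ p : ℕ × ℕ, |if p.1 = n then (1 : ℝ) else 0| ≤ 1 := fun n p => by
    split_ifs <;> simp
  have ha' : ∀ p : ℕ × ℕ, |if p.1 < Q then (0 : ℝ) else 1| ≤ 1 := fun p => by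
    split_ifs <;> simp
  set D : ℕ → E →L[ℂ] E := fun n => diagOp e _ (ha n) with hD
  set D' : E →L[ℂ] E := diagOp e _ ha' with hD'
  have hsum : u = ∑ n ∈ Finset.range Q, D n u + D' u := by
    refine hilbertBasis_ext e fun p => ?_
    simp only [inner_add_right, inner_sum, hD, hD', inner_diagOp_right, ← Finset.sum_mul]
    rw [← Complex.ofReal_sum, Finset.sum_ite_eq (Finset.range Q) p.1 (fun _ => (1 : ℝ)),
      ← add_mul, ← Complex.ofReal_add]
    by_cases hp : p.1 < Q <;> simp [hp]
  have hDn : ∀ n, ‖D n u‖ ≤ ‖u‖ := fun n => by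
    simpa using norm_diagOp_le e _ (ha n) u zero_le_one fun p _ => ha n p
  have hDn' : ‖D' u‖ ≤ ‖u‖ := by
    simpa using norm_diagOp_le e _ ha' u zero_le_one fun p _ => ha' p
  have hR1 : ∀ n ∈ Finset.range Q, ‖R (D n u)‖ ≤ δ / (2 * (Q + 1)) * ‖u‖ := fun n hn => by
    refine (hK n (D n u) fun p hp => ?_).trans (by gcongr; exact hDn n)
    rw [inner_diagOp_right]
    split_ifs with hpn
    · subst hpn
      rw [hu' p (Finset.mem_range.1 hn) (hp.resolve_left (by simp)), mul_zero]
    · simp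
  have hR2 : ‖R (D' u)‖ ≤ δ / 2 * ‖u‖ := by
    refine (hQ (D' u) fun p hp => ?_).trans (by gcongr)
    rw [inner_diagOp_right, if_pos hp]; simp
  calc ‖R u‖ = ‖∑ n ∈ Finset.range Q, R (D n u) + R (D' u)‖ := by
        conv_lhs => rw [hsum]
        rw [map_add, map_sum]
    _ ≤ ∑ n ∈ Finset.range Q, ‖R (D n u)‖ + ‖R (D' u)‖ :=
        (norm_add_le _ _).trans (by gcongr; exact norm_sum_le _ _)
    _ ≤ ∑ n ∈ Finset.range Q, δ / (2 * (Q + 1)) * ‖u‖ + δ / 2 * ‖u‖ := by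
        gcongr with n hn
        exact hR1 n hn
    _ ≤ δ * ‖u‖ := by
        rw [Finset.sum_const, Finset.card_range, nsmul_eq_mul]
        have h3 : (Q : ℝ) * (δ / (2 * (Q + 1)) * ‖u‖) ≤ δ / 2 * ‖u‖ := by
          rw [← mul_assoc]
          gcongr
          rw [mul_div_assoc', div_le_div_iff₀ (by positivity) (by positivity)]
          nlinarith
        linarith

end HilbertBasis
end MetricLandau

namespace MetricLandau

/-! ### Polar decomposition of the magnetic gradient -/

section Operators

/-- Multiplication by a bounded function. -/
noncomputable def mulOp (g : Plane → ℂ) (hg : MemLp g ∞ (volume : Measure Plane)) : L2 →L[ℂ] L2 :=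
  (ContinuousLinearMap.mul ℂ ℂ).holderL volume ∞ 2 2 (hg.toLp g)

theorem coeFn_mulOp (g : Plane → ℂ) (hg : MemLp g ∞ (volume : Measure Plane)) (u : L2) :
    (mulOp g hg u : Plane → ℂ) =ᵐ[volume] fun x => g x * (u : Plane → ℂ) x := by
  filter_upwards [(ContinuousLinearMap.mul ℂ ℂ).coeFn_holder (r := 2) (hg.toLp g) u,
    hg.coeFn_toLp] with x h1 h2
  rw [mulOp, ContinuousLinearMap.holderL_apply_apply, h1, h2]
  rfl

theorem landauLevel_pos {b : ℝ} (hb : 0 < b) (n : ℕ) : 0 < landauLevel b n := by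
  unfold landauLevel; positivity

theorem landauLevel_strictMono {b : ℝ} (hb : 0 < b) : StrictMono (landauLevel b) := by
  intro n m h
  have : (n : ℝ) < m := by exact_mod_cast h
  unfold landauLevel
  gcongr

variable {b : ℝ} (hb : 0 < b)

/-- The momenta of the normalized eigenfunctions, normalized. -/
noncomputable def momVec (p : ℕ × ℕ) : PiLp 2 fun _ : Fin 2 => L2 :=
  WithLp.toLp 2 fun j => ((√(landauLevel b p.1))⁻¹ : ℂ) • gaussToL2 hb (gMom b j (phi hb p))

theorem orthonormal_momVec : Orthonormal ℂ (momVec hb) := by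
  classical
  rw [orthonormal_iff_ite]
  intro p q
  rw [PiLp.inner_apply]
  have h1 := sum_inner_gMom_phi hb p q
  have h2 : ∀ j, inner ℂ ((momVec hb p) j) ((momVec hb q) j) =
      ((√(landauLevel b p.1))⁻¹ * (√(landauLevel b q.1))⁻¹ : ℂ) *
        inner ℂ (gaussToL2 hb (gMom b j (phi hb p))) (gaussToL2 hb (gMom b j (phi hb q))) := by
    intro j
    simp only [momVec, inner_smul_left, inner_smul_right, map_inv₀, Complex.conj_ofReal,
      Complex.ofReal_inv]
    ring
  simp only [h2, ← Finset.mul_sum, h1]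
  split_ifs with h
  · subst h
    have h3 := landauLevel_pos hb p.1
    have h4 : ((√(landauLevel b p.1))⁻¹ * (√(landauLevel b p.1))⁻¹ : ℝ) * landauLevel b p.1 = 1 := by
      rw [← mul_inv, Real.mul_self_sqrt h3.le, inv_mul_cancel₀ h3.ne']
    exact_mod_cast h4
  · rw [mul_zero]

/-- The polar part of the magnetic gradient. -/
noncomputable def momIso : L2 →ₗᵢ[ℂ] PiLp 2 fun _ : Fin 2 => L2 :=
  (orthonormal_momVec hb).orthogonalFamily.linearIsometry.comp
    (landauBasis hb).repr.toLinearIsometry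

theorem momIso_landauBasis (p : ℕ × ℕ) : momIso hb (landauBasis hb p) = momVec hb p := by
  classical
  change (orthonormal_momVec hb).orthogonalFamily.linearIsometry
    ((landauBasis hb).repr (landauBasis hb p)) = _
  rw [(landauBasis hb).repr_self, OrthogonalFamily.linearIsometry_apply_single]
  simp

/-- The components of the polar part of the magnetic gradient. -/
noncomputable def momComp (j : Fin 2) : L2 →L[ℂ] L2 :=
  PiLp.proj 2 (fun _ : Fin 2 => L2) j ∘L (momIso hb).toContinuousLinearMap

theorem momComp_landauBasis (j : Fin 2) (p : ℕ × ℕ) : momComp hb j (landauBasis hb p) =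
    ((√(landauLevel b p.1))⁻¹ : ℂ) • gaussToL2 hb (gMom b j (phi hb p)) := by
  change (momIso hb (landauBasis hb p)) j = _
  rw [momIso_landauBasis]; rfl

theorem sum_inner_momComp (f g : L2) :
    ∑ j, inner ℂ (momComp hb j f) (momComp hb j g) = inner ℂ f g := by
  rw [← (momIso hb).inner_map_map f g, PiLp.inner_apply]; rfl

theorem abs_sqrt_landauLevel_inv_le {b : ℝ} (hb : 0 < b) (p : ℕ × ℕ) : |(√(landauLevel b p.1))⁻¹| ≤ (√b)⁻¹ := by
  rw [abs_of_nonneg (by positivity)]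
  have h : b ≤ landauLevel b p.1 := by
    have := (landauLevel_strictMono hb).monotone (Nat.zero_le p.1)
    simpa [landauLevel] using this
  have := Real.sqrt_pos.2 hb
  gcongr

/-- The inverse square root of the Landau Hamiltonian. -/
noncomputable def invSqrt : L2 →L[ℂ] L2 :=
  diagOp (landauBasis hb) (fun p => (√(landauLevel b p.1))⁻¹) (abs_sqrt_landauLevel_inv_le hb)

theorem invSqrt_landauBasis (p : ℕ × ℕ) : invSqrt hb (landauBasis hb p) =
    ((√(landauLevel b p.1))⁻¹ : ℂ) • landauBasis hb p := by
  rw [invSqrt, diagOp_apply_self, Complex.ofReal_inv]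

theorem sqrt_landauLevel_ne_zero {b : ℝ} (hb : 0 < b) (n : ℕ) : (√(landauLevel b n) : ℂ) ≠ 0 := by
  exact_mod_cast (Real.sqrt_pos.2 (landauLevel_pos hb n)).ne'

/-- Both sides are continuous in `f`, so it suffices to verify the identity on the basis, where the
factor `Λ_n^{-1/2}` is common. -/
theorem weakMomentum_invSqrt (j : Fin 2) (f : L2) :
    WeakMomentum b j (invSqrt hb f) (momComp hb j f) := by
  intro φ h
  have key : innerSL ℂ h.toL2 ∘L momComp hb j =
      innerSL ℂ (h.momentum b j).toL2 ∘L invSqrt hb := by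
    refine hilbertBasis_ext_clm (landauBasis hb) fun p => ?_
    simp only [ContinuousLinearMap.comp_apply, innerSL_apply_apply, momComp_landauBasis,
      invSqrt_landauBasis, inner_smul_right]
    congr 1
    rw [landauBasis_apply]
    exact weakMomentum_gaussToL2 hb j (phi hb p) φ h
  exact DFunLike.congr_fun key f

theorem gaussToL2_gMom_phi (j : Fin 2) (p : ℕ × ℕ) : gaussToL2 hb (gMom b j (phi hb p)) =
    (√(landauLevel b p.1) : ℂ) • momComp hb j (landauBasis hb p) := by
  rw [momComp_landauBasis, smul_smul, mul_inv_cancel₀ (sqrt_landauLevel_ne_zero hb _), one_smul]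

/-- Pairing with a basis vector moves both momenta onto the eigenfunction, where they produce `Λ_n`;
the two square roots cancel it. -/
theorem inner_gMom_of_weakMomentum {u : L2} {w : Fin 2 → L2} (h : ∀ j, WeakMomentum b j u (w j))
    (p : ℕ × ℕ) : inner ℂ (landauBasis hb p) (invSqrt hb (∑ j, (momComp hb j).adjoint (w j))) =
      inner ℂ (landauBasis hb p) u := by
  have hs := sqrt_landauLevel_ne_zero hb p.1
  rw [invSqrt, inner_diagOp_right, inner_sum]
  simp only [ContinuousLinearMap.adjoint_inner_right, momComp_landauBasis, inner_smul_left,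
    (h _).inner_gaussToL2 hb, map_inv₀, Complex.conj_ofReal, ← Finset.mul_sum]
  rw [← sum_inner, ← map_sum, sum_gMom_gMom_phi, map_smul, inner_smul_left, Complex.conj_ofReal,
    ← landauBasis_apply]
  have h2 : (√(landauLevel b p.1) : ℂ) * √(landauLevel b p.1) = landauLevel b p.1 := by
    exact_mod_cast Real.mul_self_sqrt (landauLevel_pos hb p.1).le
  rw [← h2, Complex.ofReal_inv]
  field_simp

/-- The form domain is exactly the range of `L^{-1/2}`, with the isometric part of the gradient as
weak momenta. The distributional definition thereby becomes an identity between bounded operators.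
-/
theorem weakMomentum_iff {u : L2} {w : Fin 2 → L2} : (∀ j, WeakMomentum b j u (w j)) ↔
    ∃ f, u = invSqrt hb f ∧ ∀ j, w j = momComp hb j f := by
  refine ⟨fun h => ⟨∑ j, (momComp hb j).adjoint (w j), ?_, fun j => ?_⟩, ?_⟩
  · exact hilbertBasis_ext (landauBasis hb) fun p => (inner_gMom_of_weakMomentum hb h p).symm
  · rw [← sub_eq_zero]
    refine eq_zero_of_inner_test fun φ hφ => ?_
    rw [inner_sub_right, h j φ hφ, weakMomentum_invSqrt hb j _ φ hφ,
      hilbertBasis_ext (landauBasis hb) (inner_gMom_of_weakMomentum hb h), sub_self]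
  · rintro ⟨f, rfl, hw⟩ j
    rw [hw j]
    exact weakMomentum_invSqrt hb j f

section Metric

variable (m : Plane → Matrix (Fin 2) (Fin 2) ℂ)
  (hm : ∀ j k, MemLp (fun x => m x j k) ∞ (volume : Measure Plane))

/-- The bounded operator which represents the quadratic form of the metric `m`, relative to the
Landau Hamiltonian. -/
noncomputable def metricForm : L2 →L[ℂ] L2 :=
  ∑ j, (momComp hb j).adjoint ∘L ∑ k, mulOp _ (hm j k) ∘L momComp hb k

theorem metricForm_apply (f : L2) : metricForm hb m hm f =
    ∑ j, (momComp hb j).adjoint (∑ k, mulOp _ (hm j k) (momComp hb k f)) := by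
  simp [metricForm]

theorem inner_metricForm (f g : L2) : inner ℂ f (metricForm hb m hm g) =
    ∑ j, inner ℂ (momComp hb j f) (∑ k, mulOp _ (hm j k) (momComp hb k g)) := by
  simp only [metricForm_apply, inner_sum, ContinuousLinearMap.adjoint_inner_right]

/-- With `u = S f` and weak momenta `momComp hb k f`, the distributional equation says `S v = (1 + σ
M) f`, and `1 - σ N` inverts `1 + σ M`. Thus the inverse of the differential operator is `S (1 - σ
N) S`. -/
theorem mem_metricGraph_iff {σ : ℝ} {N : L2 →L[ℂ] L2}
    (h1 : (1 - (σ : ℂ) • N) * (1 + (σ : ℂ) • metricForm hb m hm) = 1)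
    (h2 : (1 + (σ : ℂ) • metricForm hb m hm) * (1 - (σ : ℂ) • N) = 1) (u v : L2) :
    (u, v) ∈ metricGraph b (fun x => 1 + (σ : ℂ) • m x) ↔
      u = invSqrt hb ((1 - (σ : ℂ) • N) (invSqrt hb v)) := by
  have hy : ∀ (f : L2) (j : Fin 2),
      ((momComp hb j f + (σ : ℂ) • ∑ k, mulOp _ (hm j k) (momComp hb k f) : L2) : Plane → ℂ)
        =ᵐ[volume] fun x => ∑ k, (1 + (σ : ℂ) • m x) j k * (momComp hb k f : Plane → ℂ) x := by
    intro f j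
    rw [Fin.sum_univ_two]
    filter_upwards [Lp.coeFn_add (momComp hb j f) ((σ : ℂ) • (mulOp _ (hm j 0) (momComp hb 0 f) +
      mulOp _ (hm j 1) (momComp hb 1 f))), Lp.coeFn_smul (σ : ℂ) (mulOp _ (hm j 0) (momComp hb 0 f) +
      mulOp _ (hm j 1) (momComp hb 1 f)), Lp.coeFn_add (mulOp _ (hm j 0) (momComp hb 0 f))
      (mulOp _ (hm j 1) (momComp hb 1 f)), coeFn_mulOp _ (hm j 0) (momComp hb 0 f),
      coeFn_mulOp _ (hm j 1) (momComp hb 1 f)] with x e1 e2 e3 e4 e5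
    rw [e1, Pi.add_apply, e2, Pi.smul_apply, e3, Pi.add_apply, e4, e5, Fin.sum_univ_two]
    fin_cases j <;> simp [Matrix.add_apply] <;> ring
  have hform : ∀ f g : L2, ∑ j, inner ℂ (momComp hb j f)
      (momComp hb j g + (σ : ℂ) • ∑ k, mulOp _ (hm j k) (momComp hb k g)) =
      inner ℂ f ((1 + (σ : ℂ) • metricForm hb m hm) g) := by
    intro f g
    simp only [inner_add_right, inner_smul_right, Finset.sum_add_distrib, ← Finset.mul_sum,
      sum_inner_momComp, add_apply, smul_apply, one_apply_eq_self, inner_metricForm]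
  constructor
  · rintro ⟨w, y, hw, hyw, hv⟩
    obtain ⟨f, hu, hwf⟩ := (weakMomentum_iff hb).1 hw
    have hyf : ∀ j, y j = momComp hb j f + (σ : ℂ) • ∑ k, mulOp _ (hm j k) (momComp hb k f) := by
      intro j
      refine Lp.ext (EventuallyEq.trans ?_ (hy f j).symm)
      simpa only [hwf] using hyw j
    -- The equation extends from test functions to basis vectors, whose momenta are `√Λ_n` times
    -- those of the isometric part.
    have hSv : invSqrt hb v = (1 + (σ : ℂ) • metricForm hb m hm) f := by
      refine hilbertBasis_ext (landauBasis hb) fun p => ?_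
      rw [invSqrt, inner_diagOp_right, landauBasis_apply, inner_gaussToL2_of_forall_test hb v y hv,
        ← landauBasis_apply, ← hform]
      simp only [hyf, gaussToL2_gMom_phi, inner_smul_left, Complex.conj_ofReal, ← Finset.mul_sum]
      rw [← mul_assoc, Complex.ofReal_inv, inv_mul_cancel₀ (sqrt_landauLevel_ne_zero hb p.1),
        one_mul]
    change u = _ at hu
    rw [hSv, ← mul_apply_eq_comp (1 - (σ : ℂ) • N), h1, one_apply_eq_self, hu]
  · intro hu
    set f := (1 - (σ : ℂ) • N) (invSqrt hb v) with hf
    refine ⟨fun k => momComp hb k f, _, fun k => ?_, hy f, fun φ h => ?_⟩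
    · change WeakMomentum b k u _
      rw [hu]; exact weakMomentum_invSqrt hb k f
    -- A test function is itself of the form `S f'`, so both sides reduce to the pairing of `f'`
    -- with `S v`.
    · obtain ⟨f', hu', hw'⟩ := (weakMomentum_iff hb).1 fun j =>
        weakMomentum_of_smooth b j h.1 h.memLp (h.momentum b j).memLp
      have e1 : ∀ j, (h.momentum b j).toL2 = momComp hb j f' := hw'
      have e2 : h.toL2 = invSqrt hb f' := hu'
      simp only [e1, e2]
      rw [hform, hf, ← mul_apply_eq_comp, h2, one_apply_eq_self, invSqrt, inner_diagOp_left]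

end Metric

end Operators
end MetricLandau

namespace MetricLandau

/-! ### Inverting the pencil by functional calculus -/

section Pencil

variable {E : Type*} [NormedAddCommGroup E] [InnerProductSpace ℂ E]

theorem re_inner_le_of_le {S T : E →L[ℂ] E} (h : S ≤ T) (f : E) :
    (inner ℂ f (S f)).re ≤ (inner ℂ f (T f)).re := by
  have h1 := (ContinuousLinearMap.le_def _ _).1 h |>.re_inner_nonneg_right f
  rw [sub_apply, inner_sub_right, map_sub] at h1
  exact sub_nonneg.1 h1

variable [CompleteSpace E]

/-- `N` is the function `y / (1 + σ y)` of `M`, and `1 - σ y / (1 + σ y) = 1 / (1 + σ y)`. On `[0,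
c]` the denominator lies between `δ` and `1 + |σ| |c|`, so the forms of `M` and `N` are comparable
and only `M` need be studied. -/
theorem exists_resolvent_pencil {M : E →L[ℂ] E} {σ c δ : ℝ} (h0 : 0 ≤ M)
    (hc : M ≤ algebraMap ℝ _ c) (hδ : 0 < δ) (hσ : ∀ y, 0 ≤ y → y ≤ c → δ ≤ 1 + σ * y) :
    ∃ N : E →L[ℂ] E, IsSelfAdjoint N ∧ (1 - (σ : ℂ) • N) * (1 + (σ : ℂ) • M) = 1 ∧
      (1 + (σ : ℂ) • M) * (1 - (σ : ℂ) • N) = 1 ∧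
      ∃ a > 0, ∃ A > 0, ∀ f, a * (inner ℂ f (M f)).re ≤ (inner ℂ f (N f)).re ∧
        (inner ℂ f (N f)).re ≤ A * (inner ℂ f (M f)).re := by
  have hsa : IsSelfAdjoint M := h0.isSelfAdjoint
  have hs0 : ∀ y ∈ spectrum ℝ M, 0 ≤ y := fun y hy => spectrum_nonneg_of_nonneg h0 hy
  have hsc : ∀ y ∈ spectrum ℝ M, y ≤ c := (le_algebraMap_iff_spectrum_le hsa).1 hc
  have hpos : ∀ y ∈ spectrum ℝ M, 0 < 1 + σ * y := fun y hy =>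
    hδ.trans_le (hσ y (hs0 y hy) (hsc y hy))
  have hcont : ContinuousOn (fun y : ℝ => y / (1 + σ * y)) (spectrum ℝ M) :=
    ContinuousOn.div (by fun_prop) (by fun_prop) fun y hy => (hpos y hy).ne'
  have hsm : ∀ (r : ℝ) (T : E →L[ℂ] E), (r : ℂ) • T = r • T := fun r T => by
    ext x; simp
  have e1 : cfc (fun y : ℝ => 1 + σ * y) M = 1 + (σ : ℂ) • M := by
    rw [cfc_const_add (1 : ℝ) (fun y => σ * y) M, cfc_const_mul_id σ M, map_one, hsm]
  have e2 : cfc (fun y : ℝ => 1 - σ * (y / (1 + σ * y))) M =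
      1 - (σ : ℂ) • cfc (fun y : ℝ => y / (1 + σ * y)) M := by
    rw [cfc_sub (fun _ : ℝ => (1 : ℝ)) (fun y => σ * (y / (1 + σ * y))) M (by fun_prop)
      (hcont.const_smul σ), cfc_const_mul σ _ M hcont, cfc_const (1 : ℝ) M, map_one, hsm]
  have hcont2 : ContinuousOn (fun y : ℝ => 1 - σ * (y / (1 + σ * y))) (spectrum ℝ M) :=
    continuousOn_const.sub (hcont.const_smul σ)
  have e3 : cfc (fun y : ℝ => (1 - σ * (y / (1 + σ * y))) * (1 + σ * y)) M = 1 := by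
    rw [cfc_congr (g := fun _ => (1 : ℝ)) fun y hy => by
      have := (hpos y hy).ne'
      simp only; field_simp; ring, cfc_const (1 : ℝ) M, map_one]
  refine ⟨cfc (fun y : ℝ => y / (1 + σ * y)) M, IsSelfAdjoint.cfc, ?_, ?_,
    (1 + |σ| * |c|)⁻¹, by positivity, δ⁻¹, by positivity, fun f => ⟨?_, ?_⟩⟩
  · rw [← e1, ← e2, ← cfc_mul _ _ M hcont2 (by fun_prop), e3]
  · rw [← e1, ← e2, ← cfc_mul _ _ M (by fun_prop) hcont2]
    simp_rw [mul_comm (1 + σ * _)]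
    exact e3
  · have h1 : cfc (fun y : ℝ => (1 + |σ| * |c|)⁻¹ * y) M ≤ cfc (fun y : ℝ => y / (1 + σ * y)) M := by
      refine cfc_mono (fun y hy => ?_) (by fun_prop) hcont
      rw [inv_mul_eq_div]
      have h2 := hpos y hy
      have h3 := hs0 y hy
      gcongr
      exacts [le_abs_self σ, (hsc y hy).trans (le_abs_self c)]
    rw [cfc_const_mul_id _ M, ← hsm] at h1
    have h2 := re_inner_le_of_le h1 f
    rwa [smul_apply, inner_smul_right, Complex.re_ofReal_mul] at h2
  · have h1 : cfc (fun y : ℝ => y / (1 + σ * y)) M ≤ cfc (fun y : ℝ => δ⁻¹ * y) M := by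
      refine cfc_mono (fun y hy => ?_) hcont (by fun_prop)
      rw [inv_mul_eq_div]
      have h3 := hs0 y hy
      gcongr
      exact hσ y h3 (hsc y hy)
    rw [cfc_const_mul_id _ M, ← hsm] at h1
    have h2 := re_inner_le_of_le h1 f
    rwa [smul_apply, inner_smul_right, Complex.re_ofReal_mul] at h2

theorem le_algebraMap_of_re_inner_le {M : E →L[ℂ] E} {c : ℝ} (hM : IsSelfAdjoint M)
    (h : ∀ f, (inner ℂ f (M f)).re ≤ c * ‖f‖ ^ 2) : M ≤ algebraMap ℝ _ c := by
  rw [ContinuousLinearMap.le_def, ContinuousLinearMap.isPositive_def']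
  refine ⟨(IsSelfAdjoint.algebraMap _ (IsSelfAdjoint.all c)).sub hM, fun f => ?_⟩
  rw [ContinuousLinearMap.reApplyInnerSelf_apply, inner_re_symm, sub_apply, inner_sub_right, map_sub,
    Algebra.algebraMap_eq_smul_one, smul_apply, one_apply_eq_self, sub_nonneg]
  have h1 : RCLike.re (inner ℂ f (c • f)) = c * ‖f‖ ^ 2 := by
    rw [← Complex.coe_smul, inner_smul_right, inner_self_eq_norm_sq_to_K, ← RCLike.ofReal_pow]
    exact (Complex.re_ofReal_mul _ _).trans (by congr 1)
  rw [h1]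
  exact h f

theorem re_inner_le_of_le_algebraMap {M : E →L[ℂ] E} {c : ℝ} (h : M ≤ algebraMap ℝ _ c) (f : E) :
    (inner ℂ f (M f)).re ≤ c * ‖f‖ ^ 2 := by
  refine (re_inner_le_of_le h f).trans_eq ?_
  rw [Algebra.algebraMap_eq_smul_one, smul_apply, one_apply_eq_self, ← Complex.coe_smul,
    inner_smul_right, inner_self_eq_norm_sq_to_K, ← RCLike.ofReal_pow]
  exact (Complex.re_ofReal_mul _ _).trans (by congr 1)

/-- The square root of a bounded operator. -/
noncomputable def opSqrt (K : E →L[ℂ] E) : E →L[ℂ] E := CFC.sqrt K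

theorem isSelfAdjoint_opSqrt (K : E →L[ℂ] E) : IsSelfAdjoint (opSqrt K) :=
  (CFC.sqrt_nonneg K).isSelfAdjoint

theorem opSqrt_mul_self {K : E →L[ℂ] E} (hK : 0 ≤ K) : opSqrt K * opSqrt K = K :=
  CFC.sqrt_mul_sqrt_self K hK

theorem norm_opSqrt_apply_sq {K : E →L[ℂ] E} (hK : 0 ≤ K) (f : E) :
    ‖opSqrt K f‖ ^ 2 = (inner ℂ f (K f)).re := by
  conv_rhs => rw [← opSqrt_mul_self hK, mul_apply_eq_comp,
    ← ContinuousLinearMap.adjoint_inner_left, (isSelfAdjoint_opSqrt K).adjoint_eq]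
  rw [inner_self_eq_norm_sq_to_K, ← RCLike.ofReal_pow]
  rfl

end Pencil

/-! ### The form of the metric as an integral -/

section Form

variable {b : ℝ} (hb : 0 < b) (m : Plane → Matrix (Fin 2) (Fin 2) ℂ)
  (hm : ∀ j k, MemLp (fun x => m x j k) ∞ (volume : Measure Plane))

/-- The value of the Hermitian form of a matrix. -/
noncomputable def matForm (A : Matrix (Fin 2) (Fin 2) ℂ) (w : Fin 2 → ℂ) : ℂ :=
  star w ⬝ᵥ A.mulVec w

/-- The polar part of the magnetic gradient, as a vector field. -/
noncomputable def momField (f : L2) (x : Plane) : Fin 2 → ℂ :=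
  fun j => (momComp hb j f : Plane → ℂ) x

theorem inner_metricForm_eq_integral (f : L2) :
    Integrable (fun x => matForm (m x) (momField hb f x)) volume ∧
    inner ℂ f (metricForm hb m hm f) = ∫ x, matForm (m x) (momField hb f x) := by
  have h1 : ∀ j, (fun x => inner ℂ ((momComp hb j f : Plane → ℂ) x)
      ((∑ k, mulOp _ (hm j k) (momComp hb k f) : L2) x)) =ᵐ[volume]
      fun x => starRingEnd ℂ (momField hb f x j) * ∑ k, m x j k * momField hb f x k := by
    intro j
    rw [Fin.sum_univ_two]
    filter_upwards [Lp.coeFn_add (mulOp _ (hm j 0) (momComp hb 0 f))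
      (mulOp _ (hm j 1) (momComp hb 1 f)), coeFn_mulOp _ (hm j 0) (momComp hb 0 f),
      coeFn_mulOp _ (hm j 1) (momComp hb 1 f)] with x e3 e4 e5
    rw [e3, Pi.add_apply, e4, e5, Fin.sum_univ_two, RCLike.inner_apply, mul_comm]
    rfl
  have h2 : ∀ x, matForm (m x) (momField hb f x) =
      ∑ j, starRingEnd ℂ (momField hb f x j) * ∑ k, m x j k * momField hb f x k := fun x => by
    simp [matForm, dotProduct, Matrix.mulVec]
  have h3 : ∀ j, Integrable (fun x => starRingEnd ℂ (momField hb f x j) *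
      ∑ k, m x j k * momField hb f x k) volume := fun j =>
    (L2.integrable_inner (𝕜 := ℂ) _ _).congr (h1 j)
  simp only [h2]
  refine ⟨integrable_finsetSum _ fun j _ => h3 j, ?_⟩
  rw [inner_metricForm, integral_finsetSum _ fun j _ => h3 j]
  refine Finset.sum_congr rfl fun j _ => ?_
  rw [L2.inner_def]
  exact integral_congr_ae (h1 j)

theorem integrable_momField (f : L2) (j : Fin 2) :
    Integrable (fun x => ‖momField hb f x j‖ ^ 2) volume :=
  (Lp.memLp (momComp hb j f)).integrable_norm_pow (by simp)

/-- The isometry property in integral form; it converts pointwise bounds on the matrix into operator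
bounds. -/
theorem sum_integral_momField (f : L2) :
    ∫ x, ∑ j, ‖momField hb f x j‖ ^ 2 = ‖f‖ ^ 2 := by
  have h := sum_inner_momComp hb f f
  rw [integral_finsetSum _ fun j _ => integrable_momField hb f j]
  simp only [inner_self_eq_norm_sq_to_K] at h
  have h2 : ∑ j, ‖momComp hb j f‖ ^ 2 = ‖f‖ ^ 2 := Complex.ofReal_injective (by
    push_cast; exact h)
  rw [← h2]
  refine Finset.sum_congr rfl fun j _ => ?_
  have h3 := L2.inner_def (𝕜 := ℂ) (momComp hb j f) (momComp hb j f)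
  rw [inner_self_eq_norm_sq_to_K] at h3
  simp only [inner_self_eq_norm_sq_to_K] at h3
  refine Complex.ofReal_injective ?_
  rw [← integral_complex_ofReal, Complex.ofReal_pow]
  refine Eq.trans ?_ h3.symm
  exact integral_congr_ae (Eventually.of_forall fun x => by simp [momField])

theorem metricForm_nonneg (hpos : ∀ x, (m x).PosSemidef) : 0 ≤ metricForm hb m hm := by
  rw [ContinuousLinearMap.nonneg_iff_isPositive, ContinuousLinearMap.isPositive_iff_complex]
  intro f
  have h1 : 0 ≤ inner ℂ f (metricForm hb m hm f) := by
    rw [(inner_metricForm_eq_integral hb m hm f).2]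
    exact integral_nonneg fun x => (hpos x).dotProduct_mulVec_nonneg _
  have h2 : 0 ≤ inner ℂ (metricForm hb m hm f) f := by
    rw [← inner_conj_symm]; exact star_nonneg_iff.2 h1
  obtain ⟨h3, h4⟩ := Complex.nonneg_iff.1 h2
  exact ⟨Complex.ext rfl h4, h3⟩

theorem re_inner_metricForm (f : L2) : Integrable (fun x => (matForm (m x) (momField hb f x)).re) volume ∧
    (inner ℂ f (metricForm hb m hm f)).re = ∫ x, (matForm (m x) (momField hb f x)).re := by
  obtain ⟨h1, h2⟩ := inner_metricForm_eq_integral hb m hm f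
  refine ⟨h1.re, ?_⟩
  rw [h2]
  exact (integral_re h1).symm

theorem metricForm_le (hpos : ∀ x, (m x).PosSemidef) {c : ℝ}
    (hc : ∀ x w, (matForm (m x) w).re ≤ c * ∑ j, ‖w j‖ ^ 2) :
    metricForm hb m hm ≤ algebraMap ℝ _ c := by
  refine le_algebraMap_of_re_inner_le (metricForm_nonneg hb m hm hpos).isSelfAdjoint fun f => ?_
  refine (re_inner_metricForm hb m hm f).2.le.trans ?_
  rw [← sum_integral_momField hb f, ← integral_const_mul]
  refine integral_mono (re_inner_metricForm hb m hm f).1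
    ((integrable_finsetSum _ fun j _ => integrable_momField hb f j).const_mul c) fun x => hc x _

end Form
end MetricLandau

namespace MetricLandau

/-! ### Index shifts on the logarithmic scale -/

section Shift

theorem isBigO_log_add (r : ℕ) :
    (fun k : ℕ => Real.log ((k + r : ℕ) : ℝ)) =O[atTop] fun k : ℕ => Real.log (k : ℝ) := by
  refine IsBigO.of_bound (1 + Real.log (r + 1)) ?_
  filter_upwards [eventually_ge_atTop 3] with k hk
  have hk' : (3 : ℝ) ≤ k := by exact_mod_cast hk
  have h1 : 1 ≤ Real.log k := by
    rw [Real.le_log_iff_exp_le (by linarith)]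
    linarith [Real.exp_one_lt_d9]
  have h2 : Real.log ((k + r : ℕ) : ℝ) ≤ Real.log k + Real.log (r + 1) := by
    rw [← Real.log_mul (by positivity) (by positivity)]
    refine Real.log_le_log (by push_cast; positivity) ?_
    push_cast
    have : (0 : ℝ) ≤ r := by positivity
    nlinarith
  have h3 : 0 ≤ Real.log ((k + r : ℕ) : ℝ) := Real.log_natCast_nonneg _
  have h4 : 0 ≤ Real.log ((r : ℝ) + 1) := Real.log_nonneg (by linarith [(Nat.cast_nonneg r : (0 : ℝ) ≤ r)])
  rw [Real.norm_of_nonneg h3, Real.norm_of_nonneg (by linarith)]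
  nlinarith

/-- Increments of size `O(ln k)` make a fixed index shift invisible at the precision of the theorem.
-/
theorem isBigO_shift {W : ℕ → ℝ}
    (hW : (fun k => W (k + 1) - W k) =O[atTop] fun k : ℕ => Real.log (k : ℝ)) (r : ℕ) :
    (fun k => W (k + r) - W k) =O[atTop] fun k : ℕ => Real.log (k : ℝ) := by
  induction r with
  | zero => simpa using isBigO_zero _ _
  | succ r ih =>
    have h1 : (fun k => W (k + r + 1) - W (k + r)) =O[atTop] fun k : ℕ => Real.log (k : ℝ) :=
      (hW.comp_tendsto (tendsto_add_atTop_nat r)).trans (isBigO_log_add r)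
    refine (h1.add ih).congr_left fun k => ?_
    rw [← add_assoc]; ring

theorem isBigO_shift_sub {W : ℕ → ℝ}
    (hW : (fun k => W (k + 1) - W k) =O[atTop] fun k : ℕ => Real.log (k : ℝ)) (r : ℕ) :
    (fun k => W k - W (k - r)) =O[atTop] fun k : ℕ => Real.log (k : ℝ) := by
  have h1 := (isBigO_shift hW r).comp_tendsto (tendsto_sub_atTop_nat r)
  have h2 : (fun k : ℕ => Real.log ((k - r : ℕ) : ℝ)) =O[atTop] fun k : ℕ => Real.log (k : ℝ) := by
    refine IsBigO.of_bound 1 ?_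
    filter_upwards [eventually_gt_atTop r] with k hk
    rw [Real.norm_of_nonneg (Real.log_natCast_nonneg _),
      Real.norm_of_nonneg (Real.log_natCast_nonneg _), one_mul]
    exact Real.log_le_log (by exact_mod_cast Nat.sub_pos_of_lt hk) (by exact_mod_cast Nat.sub_le k r)
  refine (h1.trans h2).congr' ?_ EventuallyEq.rfl
  filter_upwards [eventually_ge_atTop r] with k hk
  simp [Nat.sub_add_cancel hk]

/-- Finite-rank errors in the counting bounds appear as index shifts `r` and `r'`, which are
absorbed here. -/
theorem isBigO_of_shifted_bounds {W D : ℕ → ℝ}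
    (hW : (fun k => W (k + 1) - W k) =O[atTop] fun k : ℕ => Real.log (k : ℝ)) {r r' : ℕ} {C : ℝ}
    (h1 : ∀ᶠ n in atTop, D n ≤ W (n - r) + C * Real.log n)
    (h2 : ∀ᶠ n in atTop, W (n + r') - C * Real.log n ≤ D n) :
    (fun n => D n - W n) =O[atTop] fun n : ℕ => Real.log (n : ℝ) := by
  obtain ⟨A, hA⟩ := (isBigO_shift hW r').bound
  obtain ⟨B, hB⟩ := (isBigO_shift_sub hW r).bound
  refine IsBigO.of_bound (|A| + |B| + |C|) ?_
  filter_upwards [h1, h2, hA, hB] with n h1 h2 h3 h4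
  have hl : 0 ≤ Real.log n := Real.log_natCast_nonneg n
  rw [Real.norm_of_nonneg hl, Real.norm_eq_abs] at *
  have h5 := mul_le_mul_of_nonneg_right (le_abs_self A) hl
  have h6 := mul_le_mul_of_nonneg_right (le_abs_self B) hl
  have h7 := mul_le_mul_of_nonneg_right (le_abs_self C) hl
  have h8 := mul_nonneg (abs_nonneg A) hl
  have h9 := mul_nonneg (abs_nonneg B) hl
  have h10 := abs_le.1 h3
  have h11 := abs_le.1 h4
  rw [abs_le]
  constructor <;> nlinarith [h10.1, h11.1, h10.2, h11.2]

end Shift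

/-! ### The inverse Landau Hamiltonian and its gaps -/

section Model

variable {b : ℝ} (hb : 0 < b)

/-- The vectors supported on a set of indices of the Landau basis. -/
def SupportedOn (s : Set (ℕ × ℕ)) (f : L2) : Prop :=
  ∀ p, p ∉ s → inner ℂ (landauBasis hb p) f = 0

theorem SupportedOn.invSqrt {s : Set (ℕ × ℕ)} {f : L2} (hf : SupportedOn hb s f) :
    SupportedOn hb s (invSqrt hb f) := fun p hp => by
  rw [MetricLandau.invSqrt, inner_diagOp_right, hf p hp, mul_zero]

theorem SupportedOn.mono {s t : Set (ℕ × ℕ)} (hst : s ⊆ t) {f : L2} (hf : SupportedOn hb s f) :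
    SupportedOn hb t f := fun p hp => hf p (mt (fun h => hst h) hp)

theorem supportedOn_of_mem_span {s : Set (ℕ × ℕ)} {f : L2}
    (hf : f ∈ Submodule.span ℂ (landauBasis hb '' s)) : SupportedOn hb s f := by
  classical
  intro p hp
  induction hf using Submodule.span_induction with
  | mem x hx =>
    obtain ⟨i, hi, rfl⟩ := hx
    rw [orthonormal_iff_ite.1 (landauBasis hb).orthonormal p i, if_neg (by rintro rfl; exact hp hi)]
  | zero => exact inner_zero_right _
  | add x y _ _ h1 h2 => rw [inner_add_right, h1, h2, add_zero]
  | smul c x _ h1 => rw [inner_smul_right, h1, mul_zero]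

/-- The inverse of the Landau Hamiltonian, multiplied by `-σ`. -/
noncomputable def landauInv (σ : ℝ) : L2 →L[ℂ] L2 :=
  diagOp (landauBasis hb) (fun p => -σ / landauLevel b p.1) (C := |σ| / b) fun p => by
    have h : b ≤ landauLevel b p.1 := by
      have := (landauLevel_strictMono hb).monotone (Nat.zero_le p.1)
      simpa [landauLevel] using this
    rw [abs_div, abs_neg, abs_of_pos (landauLevel_pos hb _)]
    gcongr

theorem invSqrt_invSqrt (σ : ℝ) (f : L2) :
    landauInv hb σ f = (-σ : ℂ) • invSqrt hb (invSqrt hb f) := by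
  refine hilbertBasis_ext (landauBasis hb) fun p => ?_
  rw [landauInv, inner_smul_right, invSqrt, inner_diagOp_right, inner_diagOp_right,
    inner_diagOp_right]
  have h2 : ((√(landauLevel b p.1))⁻¹ : ℝ) * (√(landauLevel b p.1))⁻¹ = (landauLevel b p.1)⁻¹ := by
    rw [← mul_inv, Real.mul_self_sqrt (landauLevel_pos hb p.1).le]
  rw [← mul_assoc (Complex.ofReal _) (Complex.ofReal _), ← Complex.ofReal_mul, h2]
  push_cast
  ring

theorem supportedOn_of_landauInv_eq {σ : ℝ} (hσ : σ ≠ 0) {q : ℕ} {f : L2}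
    (h : landauInv hb σ f = ((-σ / landauLevel b q : ℝ) : ℂ) • f) :
    SupportedOn hb {p | p.1 = q} f := fun p hp => by
  refine inner_eq_zero_of_diagOp_eq (landauBasis hb) _ _ h fun h1 => hp ?_
  have h2 := landauLevel_pos hb p.1
  have h3 := landauLevel_pos hb q
  have h4 : -σ ≠ 0 := neg_ne_zero.2 hσ
  rw [div_eq_div_iff h2.ne' h3.ne'] at h1
  exact (landauLevel_strictMono hb).injective (mul_left_cancel₀ h4 h1).symm

theorem landauInv_eq_of_supportedOn {σ : ℝ} {q : ℕ} {f : L2}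
    (h : SupportedOn hb {p | p.1 = q} f) :
    landauInv hb σ f = ((-σ / landauLevel b q : ℝ) : ℂ) • f := by
  refine hilbertBasis_ext (landauBasis hb) fun p => ?_
  rw [landauInv, inner_diagOp_right, inner_smul_right]
  by_cases hp : p.1 = q
  · rw [hp]
  · rw [h p hp, mul_zero, mul_zero]

theorem norm_invSqrt_sq_of_supportedOn {q : ℕ} {f : L2} (h : SupportedOn hb {p | p.1 = q} f) :
    ‖invSqrt hb f‖ ^ 2 = (landauLevel b q)⁻¹ * ‖f‖ ^ 2 := by
  have h1 : invSqrt hb f = ((√(landauLevel b q))⁻¹ : ℂ) • f := by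
    refine hilbertBasis_ext (landauBasis hb) fun p => ?_
    rw [invSqrt, inner_diagOp_right, inner_smul_right, Complex.ofReal_inv]
    by_cases hp : p.1 = q
    · rw [hp]
    · rw [h p hp, mul_zero, mul_zero]
  rw [h1, norm_smul, mul_pow, norm_inv, Complex.norm_real, inv_pow,
    Real.norm_of_nonneg (Real.sqrt_nonneg _), Real.sq_sqrt (landauLevel_pos hb _).le]

/-- The products tend to `lam * lam' > 0`, hence are eventually bounded below; the finitely many
others are positive once the end points are excluded. The sign condition keeps the accumulation
point `0` away from the closed gap. -/
theorem exists_landau_gap_bound {x : ℕ → ℝ} {lam lam' : ℝ} (hx : Tendsto x atTop (𝓝 0))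
    (hpos : 0 < lam * lam') (hgap : ∀ n, 0 ≤ (x n - lam) * (x n - lam')) :
    ∃ κ > 0, ∀ n, x n ≠ lam → x n ≠ lam' → κ ≤ (x n - lam) * (x n - lam') := by
  have h1 : Tendsto (fun n => (x n - lam) * (x n - lam')) atTop (𝓝 (lam * lam')) := by
    have := (hx.sub_const lam).mul (hx.sub_const lam')
    simpa using this
  obtain ⟨n0, hn0⟩ := eventually_atTop.1 (h1.eventually_const_lt (half_lt_self hpos))
  have hfin : ∀ N : ℕ, ∃ κ > 0, ∀ n < N, x n ≠ lam → x n ≠ lam' →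
      κ ≤ (x n - lam) * (x n - lam') := by
    intro N
    induction N with
    | zero => exact ⟨1, one_pos, by simp⟩
    | succ N ih =>
      obtain ⟨κ, hκ, h⟩ := ih
      by_cases hN : x N ≠ lam ∧ x N ≠ lam'
      · have h2 : 0 < (x N - lam) * (x N - lam') := (hgap N).lt_of_ne'
          (mul_ne_zero (sub_ne_zero.2 hN.1) (sub_ne_zero.2 hN.2))
        refine ⟨min κ _, lt_min hκ h2, fun n hn h3 h4 => ?_⟩
        rcases Nat.lt_succ_iff_lt_or_eq.1 hn with h5 | rfl
        · exact (min_le_left _ _).trans (h n h5 h3 h4)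
        · exact min_le_right _ _
      · refine ⟨κ, hκ, fun n hn h3 h4 => ?_⟩
        rcases Nat.lt_succ_iff_lt_or_eq.1 hn with h5 | rfl
        · exact h n h5 h3 h4
        · exact absurd ⟨h3, h4⟩ hN
  obtain ⟨κ, hκ, h⟩ := hfin n0
  refine ⟨min κ (lam * lam' / 2), lt_min hκ (by positivity), fun n h3 h4 => ?_⟩
  rcases lt_or_ge n n0 with h5 | h5
  · exact (min_le_left _ _).trans (h n h5 h3 h4)
  · exact (min_le_right _ _).trans (hn0 n h5).le

theorem tendsto_inv_landauLevel {b : ℝ} (hb : 0 < b) (σ : ℝ) :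
    Tendsto (fun n => -σ / landauLevel b n) atTop (𝓝 0) := by
  have h1 : Tendsto (landauLevel b) atTop atTop := by
    refine tendsto_atTop_mono (fun n => ?_) (tendsto_natCast_atTop_atTop.const_mul_atTop hb)
    unfold landauLevel
    have : (0 : ℝ) ≤ n := by positivity
    gcongr
    linarith
  exact h1.const_div_atTop _

end Model
end MetricLandau

namespace MetricLandau

/-! ### Eigenvalue asymptotics for the perturbed inverse -/

section Model

variable {b : ℝ} (hb : 0 < b)

/-- Bounds for the form of `M` on the eigenspaces of the Landau Hamiltonian, on a logarithmic
scale. -/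
structure LevelBounds (M : L2 →L[ℂ] L2) (W : ℕ → ℝ) : Prop where
  upper : ∀ q, ∃ C : ℝ, ∃ K₀ : ℕ, ∀ K ≥ K₀, ∀ f, SupportedOn hb {p | p.1 = q ∧ K ≤ p.2} f →
    (inner ℂ f (M f)).re ≤ Real.exp (W K + C * Real.log K) * ‖f‖ ^ 2
  lower : ∀ q, ∃ C : ℝ, ∃ K₀ : ℕ, ∀ K ≥ K₀, ∀ f,
    SupportedOn hb {p | p.1 = q ∧ K₀ ≤ p.2 ∧ p.2 ≤ K} f →
    Real.exp (W K - C * Real.log K) * ‖f‖ ^ 2 ≤ (inner ℂ f (M f)).re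
  tendsto : ∀ C : ℝ, Tendsto (fun k : ℕ => W k + C * Real.log k) atTop atBot
  step : (fun k => W (k + 1) - W k) =O[atTop] fun k : ℕ => Real.log (k : ℝ)

theorem isSelfAdjoint_diagOp {ι E : Type*} [NormedAddCommGroup E] [InnerProductSpace ℂ E]
    [CompleteSpace E] (e : HilbertBasis ι ℂ E) (a : ι → ℝ) {C : ℝ} (h : ∀ i, |a i| ≤ C) :
    IsSelfAdjoint (diagOp e a h) :=
  ContinuousLinearMap.isSelfAdjoint_iff_isSymmetric.2 fun u v => inner_diagOp_left e a h u v

/-- The effective perturbation of the inverse of the Landau Hamiltonian. -/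
noncomputable def effPert (N : L2 →L[ℂ] L2) : L2 →L[ℂ] L2 := invSqrt hb * N * invSqrt hb

theorem inner_effPert (N : L2 →L[ℂ] L2) (f : L2) :
    inner ℂ f (effPert hb N f) = inner ℂ (invSqrt hb f) (N (invSqrt hb f)) := by
  rw [effPert, mul_apply_eq_comp, mul_apply_eq_comp]
  exact (inner_diagOp_left _ _ _ _ _).symm

theorem effPert_nonneg {M N : L2 →L[ℂ] L2} (hM : 0 ≤ M) (hN : IsSelfAdjoint N) {a : ℝ} (ha : 0 < a)
    (h : ∀ f, a * (inner ℂ f (M f)).re ≤ (inner ℂ f (N f)).re) : 0 ≤ effPert hb N := by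
  rw [ContinuousLinearMap.nonneg_iff_isPositive, ContinuousLinearMap.isPositive_def']
  refine ⟨?_, fun f => ?_⟩
  · have h1 : IsSelfAdjoint (invSqrt hb) := isSelfAdjoint_diagOp _ _ _
    rw [IsSelfAdjoint, effPert, star_mul, star_mul, h1.star_eq, hN.star_eq, mul_assoc]
  · rw [ContinuousLinearMap.reApplyInnerSelf_apply, inner_re_symm, inner_effPert]
    refine le_trans ?_ (h _)
    have := re_inner_le_of_le hM (invSqrt hb f)
    rw [zero_apply, inner_zero_right] at this
    exact mul_nonneg ha.le this

theorem norm_root_sq {M N : L2 →L[ℂ] L2} (hM : 0 ≤ M) (hN : IsSelfAdjoint N) {a : ℝ} (ha : 0 < a)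
    (h : ∀ f, a * (inner ℂ f (M f)).re ≤ (inner ℂ f (N f)).re) (f : L2) :
    ‖opSqrt (effPert hb N) f‖ ^ 2 = (inner ℂ (invSqrt hb f) (N (invSqrt hb f))).re := by
  rw [norm_opSqrt_apply_sq (effPert_nonneg hb hM hN ha h), inner_effPert]

variable {M N : L2 →L[ℂ] L2} {W : ℕ → ℝ} {a A c : ℝ}

/-- Here `‖R u‖²` is at most `A` times the form of `M` at `S u`. It is small at high angular index
by the bounds on each level, and on high levels because `S` itself is small there. -/
theorem isCompactOperator_root (hW : LevelBounds hb M W) (hM : 0 ≤ M)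
    (hMc : M ≤ algebraMap ℝ _ c)
    (hN : IsSelfAdjoint N) (ha : 0 < a) (hA : 0 < A)
    (h : ∀ f, a * (inner ℂ f (M f)).re ≤ (inner ℂ f (N f)).re)
    (h' : ∀ f, (inner ℂ f (N f)).re ≤ A * (inner ℂ f (M f)).re) :
    IsCompactOperator (opSqrt (effPert hb N)) := by
  have hroot := norm_root_sq hb hM hN ha h
  refine isCompactOperator_of_hilbertBasis (landauBasis hb) _ (fun q δ hδ => ?_) fun δ hδ => ?_
  · obtain ⟨C, K₀, hC⟩ := hW.upper q
    have h1 : Tendsto (fun k : ℕ => A * (landauLevel b q)⁻¹ * Real.exp (W k + C * Real.log k)) atTop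
        (𝓝 0) := by
      simpa using (Real.tendsto_exp_atBot.comp (hW.tendsto C)).const_mul (A * (landauLevel b q)⁻¹)
    obtain ⟨K, hK, hK'⟩ := ((eventually_ge_atTop K₀).and
      (h1.eventually_lt_const (by positivity : 0 < δ ^ 2))).exists
    refine ⟨K, fun u hu => ?_⟩
    have hu1 : SupportedOn hb {p | p.1 = q ∧ K ≤ p.2} u := fun p hp => hu p (by
      simp only [Set.mem_ofPred_eq, not_and_or, not_le] at hp; exact hp)
    refine le_of_sq_le_sq ?_ (by positivity)
    rw [hroot, mul_pow]
    calc _ ≤ A * (inner ℂ (invSqrt hb u) (M (invSqrt hb u))).re := h' _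
      _ ≤ A * (Real.exp (W K + C * Real.log K) * ‖invSqrt hb u‖ ^ 2) := by
          gcongr
          exact hC K hK _ hu1.invSqrt
      _ = A * (landauLevel b q)⁻¹ * Real.exp (W K + C * Real.log K) * ‖u‖ ^ 2 := by
          rw [norm_invSqrt_sq_of_supportedOn hb (hu1.mono hb fun p hp => hp.1)]; ring
      _ ≤ _ := by gcongr
  · have h1 : Tendsto (fun n => A * |c| * (landauLevel b n)⁻¹) atTop (𝓝 0) := by
      simpa [neg_div] using (tendsto_inv_landauLevel hb 1).const_mul (-(A * |c|))
    obtain ⟨Q, hQ⟩ := (h1.eventually_lt_const (by positivity : 0 < δ ^ 2)).exists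
    refine ⟨Q, fun u hu => ?_⟩
    refine le_of_sq_le_sq ?_ (by positivity)
    have hLQ := landauLevel_pos hb Q
    have h2 : ‖invSqrt hb u‖ ≤ (√(landauLevel b Q))⁻¹ * ‖u‖ := by
      refine norm_diagOp_le _ _ _ u (by positivity) fun p hp => ?_
      have hp' : Q ≤ p.1 := by
        by_contra hlt
        exact hp (hu p (not_le.1 hlt))
      rw [abs_of_nonneg (by positivity)]
      have h3 := (landauLevel_strictMono hb).monotone hp'
      have h4 := Real.sqrt_pos.2 hLQ
      gcongr
    have h3 : ‖invSqrt hb u‖ ^ 2 ≤ (landauLevel b Q)⁻¹ * ‖u‖ ^ 2 := by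
      calc _ ≤ ((√(landauLevel b Q))⁻¹ * ‖u‖) ^ 2 := by gcongr
        _ = _ := by rw [mul_pow, inv_pow, Real.sq_sqrt hLQ.le]
    have h4 : (inner ℂ (invSqrt hb u) (M (invSqrt hb u))).re ≤ |c| * ‖invSqrt hb u‖ ^ 2 := by
      refine (re_inner_le_of_le_algebraMap hMc _).trans ?_
      gcongr
      exact le_abs_self c
    rw [hroot, mul_pow]
    calc _ ≤ A * (inner ℂ (invSqrt hb u) (M (invSqrt hb u))).re := h' _
      _ ≤ A * (|c| * ((landauLevel b Q)⁻¹ * ‖u‖ ^ 2)) := by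
          gcongr
          exact h4.trans (by gcongr)
      _ = A * |c| * (landauLevel b Q)⁻¹ * ‖u‖ ^ 2 := by ring
      _ ≤ _ := by gcongr

theorem gapPerturbation_landau {σ lam' : ℝ} {q : ℕ}
    (hlt : -σ / landauLevel b q < lam') (hpos : 0 < -σ / landauLevel b q * lam')
    (hgap : ∀ n, 0 ≤ (-σ / landauLevel b n - -σ / landauLevel b q) * (-σ / landauLevel b n - lam'))
    (hW : LevelBounds hb M W) (hM : 0 ≤ M)
    (hMc : M ≤ algebraMap ℝ _ c)
    (hN : IsSelfAdjoint N) (ha : 0 < a) (hA : 0 < A)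
    (h : ∀ f, a * (inner ℂ f (M f)).re ≤ (inner ℂ f (N f)).re)
    (h' : ∀ f, (inner ℂ f (N f)).re ≤ A * (inner ℂ f (M f)).re) :
    ∃ κ, GapPerturbation (landauInv hb σ) (opSqrt (effPert hb N)) (-σ / landauLevel b q) lam' κ := by
  obtain ⟨κ, hκ, hκ'⟩ := exists_landau_gap_bound (tendsto_inv_landauLevel hb σ) hpos hgap
  refine ⟨κ, isSelfAdjoint_diagOp _ _ _, isSelfAdjoint_opSqrt _,
    (isCompactOperator_root hb hW hM hMc hN ha hA h h').clm_comp _, hlt, hκ, fun v hv hv' => ?_⟩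
  refine diagOp_coercive (landauBasis hb) _ _ v fun p hp => hκ' p.1 (fun h1 => hp ?_) fun h1 => hp ?_
  · refine Submodule.inner_right_of_mem_orthogonal ?_ hv
    rw [Module.End.mem_eigenspace_iff, ← h1]
    exact diagOp_apply_self _ _ _ p
  · refine Submodule.inner_right_of_mem_orthogonal ?_ hv'
    rw [Module.End.mem_eigenspace_iff, ← h1]
    exact diagOp_apply_self _ _ _ p

theorem finrank_span_landauBasis (s : Finset (ℕ × ℕ)) :
    Module.finrank ℂ (Submodule.span ℂ (landauBasis hb '' s)) = s.card := by
  have h1 := (landauBasis hb).orthonormal.linearIndependent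
  have : Fintype (landauBasis hb '' (s : Set (ℕ × ℕ))) := (s.finite_toSet.image _).fintype
  rw [finrank_span_set_eq_card (LinearIndepOn.id_image (h1.linearIndepOn _)), Set.toFinset_card,
    Fintype.card_eq_nat_card, Nat.card_coe_set_eq, Set.ncard_image_of_injective _ h1.injective,
    Set.ncard_coe_finset]

/-- The abstract counting bounds are tested on coordinate subspaces of level `q`: the first `K`
basis vectors as `Y`, and those with index in `[K₂, K]` as `F`. -/
theorem exists_gap_enumeration {σ lam' : ℝ} (hσ : σ ≠ 0) {q : ℕ}
    (hlt : -σ / landauLevel b q < lam') (hpos : 0 < -σ / landauLevel b q * lam')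
    (hgap : ∀ n, 0 ≤ (-σ / landauLevel b n - -σ / landauLevel b q) * (-σ / landauLevel b n - lam'))
    (hW : LevelBounds hb M W) (hM : 0 ≤ M)
    (hMc : M ≤ algebraMap ℝ _ c)
    (hN : IsSelfAdjoint N) (ha : 0 < a) (hA : 0 < A)
    (h : ∀ f, a * (inner ℂ f (M f)).re ≤ (inner ℂ f (N f)).re)
    (h' : ∀ f, (inner ℂ f (N f)).re ≤ A * (inner ℂ f (M f)).re) :
    ∃ ν : ℕ → ℝ, Antitone ν ∧ (∀ k, ν k ∈ Set.Ioo (-σ / landauLevel b q) lam') ∧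
      (∀ t ∈ Set.Ioo (-σ / landauLevel b q) lam', Cardinal.mk {k : ℕ // ν k = t} =
        Module.rank ℂ (Module.End.eigenspace
          ((landauInv hb σ + effPert hb N : L2 →L[ℂ] L2) : Module.End ℂ L2) (t : ℂ))) ∧
      (fun k => Real.log (ν k - -σ / landauLevel b q) - W k) =O[atTop]
        fun k : ℕ => Real.log (k : ℝ) := by
  obtain ⟨κ, hgp⟩ := gapPerturbation_landau hb hlt hpos hgap hW hM hMc hN ha hA h h'
  have hroot := norm_root_sq hb hM hN ha h
  have hL := landauLevel_pos hb q
  obtain ⟨C₁, K₁, hC₁⟩ := hW.upper q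
  obtain ⟨C₂, K₂, hC₂⟩ := hW.lower q
  have hup : ∀ K ≥ K₁, ∀ u, SupportedOn hb {p | p.1 = q ∧ K ≤ p.2} u →
      ‖opSqrt (effPert hb N) u‖ ^ 2 ≤
        A * (landauLevel b q)⁻¹ * Real.exp (W K + C₁ * Real.log K) * ‖u‖ ^ 2 := by
    intro K hK u hu1
    rw [hroot]
    calc _ ≤ A * (inner ℂ (invSqrt hb u) (M (invSqrt hb u))).re := h' _
      _ ≤ A * (Real.exp (W K + C₁ * Real.log K) * ‖invSqrt hb u‖ ^ 2) := by
          gcongr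
          exact hC₁ K hK _ hu1.invSqrt
      _ = _ := by
          rw [norm_invSqrt_sq_of_supportedOn hb (hu1.mono hb fun p hp => hp.1)]; ring
  have hlow : ∀ K ≥ K₂, ∀ u, SupportedOn hb {p | p.1 = q ∧ K₂ ≤ p.2 ∧ p.2 ≤ K} u →
      a * (landauLevel b q)⁻¹ * Real.exp (W K - C₂ * Real.log K) * ‖u‖ ^ 2 ≤
      ‖opSqrt (effPert hb N) u‖ ^ 2 := by
    intro K hK u hu1
    rw [hroot]
    calc _ = a * (Real.exp (W K - C₂ * Real.log K) * ‖invSqrt hb u‖ ^ 2) := by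
          rw [norm_invSqrt_sq_of_supportedOn hb (hu1.mono hb fun p hp => hp.1)]; ring
      _ ≤ a * (inner ℂ (invSqrt hb u) (M (invSqrt hb u))).re := by
          gcongr
          exact hC₂ K hK _ hu1.invSqrt
      _ ≤ _ := h _
  let t : ℕ → Finset (ℕ × ℕ) := fun K => (Finset.Icc K₂ K).map ⟨fun k => (q, k), fun x y hxy =>
    (Prod.mk.inj hxy).2⟩
  have htF : ∀ K, ∀ f ∈ Submodule.span ℂ (landauBasis hb '' t K),
      SupportedOn hb {p | p.1 = q ∧ K₂ ≤ p.2 ∧ p.2 ≤ K} f := fun K f hf =>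
    (supportedOn_of_mem_span hb hf).mono hb fun p hp => by
      simp only [t, Finset.coe_map, Set.mem_image, Finset.mem_coe, Finset.mem_Icc] at hp
      obtain ⟨k, hk, rfl⟩ := hp
      exact ⟨rfl, hk⟩
  have htfin : ∀ K, FiniteDimensional ℂ (Submodule.span ℂ (landauBasis hb '' t K)) := fun K =>
    FiniteDimensional.span_of_finite ℂ ((t K).finite_toSet.image _)
  have htrank : ∀ K, Module.finrank ℂ (Submodule.span ℂ (landauBasis hb '' t K)) = K + 1 - K₂ :=
    fun K => by rw [finrank_span_landauBasis, Finset.card_map, Nat.card_Icc]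
  have hlev : ∀ K, ∀ f ∈ Submodule.span ℂ (landauBasis hb '' t K),
      landauInv hb σ f = ((-σ / landauLevel b q : ℝ) : ℂ) • f := fun K f hf =>
    landauInv_eq_of_supportedOn hb ((htF K f hf).mono hb fun p hp => hp.1)
  -- There are infinitely many eigenvalues, since the form is positive definite on subspaces of
  -- arbitrarily large dimension.
  obtain ⟨ν, hν1, hν2, hν3, s₀, hs₀, r, hν4⟩ := hgp.exists_enumeration fun n =>
    ⟨_, htfin (n + K₂), by rw [htrank]; omega, _, by positivity, fun f hf => ⟨hlev _ f hf,
      hlow (n + K₂) (by omega) f (htF _ f hf)⟩⟩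
  rw [opSqrt_mul_self (effPert_nonneg hb hM hN ha h)] at hν3
  refine ⟨ν, hν1, hν2, hν3, ?_⟩
  have hdpos : ∀ n, 0 < ν n - -σ / landauLevel b q := fun n => sub_pos.2 (hν2 n).1
  have hlog : Tendsto (fun n : ℕ => Real.log (n : ℝ)) atTop atTop :=
    Real.tendsto_log_atTop.comp tendsto_natCast_atTop_atTop
  refine isBigO_of_shifted_bounds hW.step (r := r) (r' := r + K₂) (C := |C₁| + |C₂| + 2) ?_ ?_
  -- Any factor above `5 / 2` would do; it costs only a constant in the logarithm.
  · set A' := 3 * (A * (landauLevel b q)⁻¹) with hA'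
    have hA'0 : 0 < A' := by positivity
    have h1 : Tendsto (fun k : ℕ => A' * Real.exp (W k + C₁ * Real.log k)) atTop (𝓝 0) := by
      simpa using (Real.tendsto_exp_atBot.comp (hW.tendsto C₁)).const_mul A'
    filter_upwards [eventually_gt_atTop (r + K₁), (tendsto_sub_atTop_nat r).eventually
      (h1.eventually_le_const hs₀), hlog.eventually_ge_atTop (Real.log A')] with n hn hsn hln
    -- Then `Y` has dimension `K` and `r + K = n`, exactly what the upper count tolerates.
    set K := n - r with hK
    let Y : Submodule ℂ L2 := Submodule.span ℂ (landauBasis hb '' ((Finset.range K).map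
      ⟨fun k => (q, k), fun x y hxy => (Prod.mk.inj hxy).2⟩ : Finset (ℕ × ℕ)))
    have hYfin : FiniteDimensional ℂ Y :=
      FiniteDimensional.span_of_finite ℂ ((Finset.finite_toSet _).image _)
    have hYrank : Module.finrank ℂ Y = K := by
      rw [finrank_span_landauBasis, Finset.card_map, Finset.card_range]
    have h2 := (hν4 n (A' * Real.exp (W K + C₁ * Real.log K)) (by positivity) hsn).1
      (A * (landauLevel b q)⁻¹ * Real.exp (W K + C₁ * Real.log K)) (by
        have : 0 < A * (landauLevel b q)⁻¹ * Real.exp (W K + C₁ * Real.log K) := by positivity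
        rw [hA']; linarith) Y (fun p hp hpY => hup K (by omega) p fun i hi => by
          by_cases hiq : i.1 = q
          · have hik : i.2 < K := by
              by_contra hlt
              exact hi ⟨hiq, not_lt.1 hlt⟩
            refine Submodule.inner_right_of_mem_orthogonal (Submodule.subset_span ?_) hpY
            refine Set.mem_image_of_mem _ (Finset.mem_coe.2 (Finset.mem_map.2 ⟨i.2,
              Finset.mem_range.2 hik, ?_⟩))
            exact Prod.ext hiq.symm rfl
          · exact supportedOn_of_landauInv_eq hb hσ hp i hiq) (by omega)
    have h3 : ν n - -σ / landauLevel b q ≤ A' * Real.exp (W K + C₁ * Real.log K) := by linarith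
    have h4 := Real.log_le_log (hdpos n) h3
    rw [Real.log_mul hA'0.ne' (Real.exp_pos _).ne', Real.log_exp] at h4
    have h5 : Real.log (K : ℝ) ≤ Real.log n := Real.log_le_log
      (by exact_mod_cast (by omega : 0 < K)) (by exact_mod_cast Nat.sub_le n r)
    have h6 : C₁ * Real.log K ≤ |C₁| * Real.log n := (mul_le_mul_of_nonneg_right (le_abs_self C₁)
      (Real.log_natCast_nonneg _)).trans (mul_le_mul_of_nonneg_left h5 (abs_nonneg _))
    have h7 : 0 ≤ |C₂| * Real.log n := mul_nonneg (abs_nonneg _) (Real.log_natCast_nonneg _)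
    have h8 : 0 ≤ Real.log n := Real.log_natCast_nonneg _
    linarith
  -- Dividing by three ensures `2 s < σ` in the lower count.
  · set a' := a * (landauLevel b q)⁻¹ / 3 with ha'
    have ha'0 : 0 < a' := by positivity
    have h1 : Tendsto (fun k : ℕ => a' * Real.exp (W k - C₂ * Real.log k)) atTop (𝓝 0) := by
      have := (Real.tendsto_exp_atBot.comp (hW.tendsto (-C₂))).const_mul a'
      simpa [← sub_eq_add_neg] using this
    obtain ⟨B, hB⟩ := (isBigO_log_add (r + K₂)).bound
    have hlog2 : ∀ᶠ n : ℕ in atTop, |C₂| * Real.log ((n + (r + K₂) : ℕ) : ℝ) ≤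
        (|C₂| + 1) * Real.log n := by
      have hratio : ∀ᶠ n : ℕ in atTop, |C₂| * Real.log ((r + K₂ : ℕ) + 1 : ℝ) ≤ Real.log n :=
        hlog.eventually_ge_atTop _
      filter_upwards [hratio, eventually_gt_atTop 0] with n hn hn0
      have hn1 : (1 : ℝ) ≤ n := by exact_mod_cast hn0
      have hle : Real.log ((n + (r + K₂) : ℕ) : ℝ) ≤ Real.log n + Real.log ((r + K₂ : ℕ) + 1 : ℝ) := by
        rw [← Real.log_mul (by positivity) (by positivity)]
        refine Real.log_le_log (by positivity) ?_
        push_cast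
        have : (0 : ℝ) ≤ (r : ℝ) + K₂ := by positivity
        nlinarith
      have := mul_le_mul_of_nonneg_left hle (abs_nonneg C₂)
      linarith
    filter_upwards [eventually_gt_atTop 0, (tendsto_add_atTop_nat (r + K₂)).eventually
      (h1.eventually_le_const hs₀), hlog.eventually_ge_atTop (-Real.log a'), hlog2]
      with n hn hsn hln hl2
    -- The test space has dimension `K + 1 - K₂ = n + r + 1`, one more than `r + n`.
    set K := n + (r + K₂) with hK
    have h2 := (hν4 n (a' * Real.exp (W K - C₂ * Real.log K)) (by positivity) hsn).2
      (a * (landauLevel b q)⁻¹ * Real.exp (W K - C₂ * Real.log K)) (by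
        have : 0 < a * (landauLevel b q)⁻¹ * Real.exp (W K - C₂ * Real.log K) := by positivity
        rw [ha']; linarith) (Submodule.span ℂ (landauBasis hb '' t K)) (fun f hf => ⟨hlev _ f hf,
          hlow K (by omega) f (htF _ f hf)⟩) (by rw [htrank]; omega)
    have h3 : a' * Real.exp (W K - C₂ * Real.log K) ≤ ν n - -σ / landauLevel b q := by linarith
    have h4 := Real.log_le_log (by positivity) h3
    rw [Real.log_mul ha'0.ne' (Real.exp_pos _).ne', Real.log_exp] at h4
    have h6 : C₂ * Real.log K ≤ |C₂| * Real.log K := mul_le_mul_of_nonneg_right (le_abs_self C₂)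
      (Real.log_natCast_nonneg _)
    have h7 : 0 ≤ |C₁| * Real.log n := mul_nonneg (abs_nonneg _) (Real.log_natCast_nonneg _)
    linarith

end Model
end MetricLandau

namespace MetricLandau

/-! ### From the differential operators to the bounded model -/

section Reduction

variable {b : ℝ} (hb : 0 < b) (m : Plane → Matrix (Fin 2) (Fin 2) ℂ)
  (hm : ∀ j k, MemLp (fun x => m x j k) ∞ (volume : Measure Plane))

theorem mem_eigenspace_metricOperator (g : Plane → Matrix (Fin 2) (Fin 2) ℂ) (E : ℝ) (u : L2) :
    u ∈ eigenspace (metricOperator b g) E ↔ (u, (E : ℂ) • u) ∈ metricGraph b g := by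
  rw [eigenspace, metricOperator_graph, Submodule.mem_comap]
  rfl

variable {N : L2 →L[ℂ] L2} {σ : ℝ}

/-- Multiplying the inverse `S (1 - σ N) S` by `-σ` and using `σ² = 1` makes the perturbation `S N
S` non-negative for both signs, so one gap theorem serves `H₊` and `H₋`. -/
theorem landauInv_add_effPert_apply (hσ : σ * σ = 1) (v : L2) :
    (landauInv hb σ + effPert hb N) v =
      (-σ : ℂ) • invSqrt hb ((1 - (σ : ℂ) • N) (invSqrt hb v)) := by
  have hσ' : (σ : ℂ) * σ = 1 := by exact_mod_cast hσ
  rw [add_apply, invSqrt_invSqrt, effPert, mul_apply_eq_comp, mul_apply_eq_comp, sub_apply,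
    one_apply_eq_self, smul_apply, map_sub, map_smul, smul_sub, smul_smul]
  rw [neg_mul, hσ']
  module

theorem eigenspace_metricOperator_eq (hσ : σ * σ = 1)
    (h1 : (1 - (σ : ℂ) • N) * (1 + (σ : ℂ) • metricForm hb m hm) = 1)
    (h2 : (1 + (σ : ℂ) • metricForm hb m hm) * (1 - (σ : ℂ) • N) = 1) {E : ℝ} (hE : E ≠ 0) :
    eigenspace (metricOperator b (fun x => 1 + (σ : ℂ) • m x)) E = Module.End.eigenspace
      ((landauInv hb σ + effPert hb N : L2 →L[ℂ] L2) : Module.End ℂ L2) ((-σ / E : ℝ) : ℂ) := by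
  ext u
  rw [mem_eigenspace_metricOperator, mem_metricGraph_iff hb m hm h1 h2,
    Module.End.mem_eigenspace_iff]
  change _ ↔ (landauInv hb σ + effPert hb N) u = _
  rw [landauInv_add_effPert_apply hb hσ, map_smul, map_smul, map_smul]
  set y := invSqrt hb ((1 - (σ : ℂ) • N) (invSqrt hb u))
  have hE' : (E : ℂ) ≠ 0 := by exact_mod_cast hE
  have hσ' : (-σ : ℂ) ≠ 0 := by
    intro h0
    have : σ = 0 := by exact_mod_cast neg_eq_zero.1 h0
    simp [this] at hσ
  have h3 : ((-σ / E : ℝ) : ℂ) • u = (-σ : ℂ) • ((E : ℂ)⁻¹ • u) := by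
    rw [smul_smul]; push_cast; rw [div_eq_mul_inv]
  rw [h3, (smul_right_injective L2 hσ').eq_iff]
  constructor
  · intro h
    rw [h, smul_smul, inv_mul_cancel₀ hE', one_smul]
  · intro h
    rw [h, smul_smul, mul_inv_cancel₀ hE', one_smul]

/-- Pairing the inverted eigenvalue equation with `u` gives `‖u‖²` as `E` times a non-negative
number. -/
theorem eigenspace_metricOperator_eq_bot
    (h1 : (1 - (σ : ℂ) • N) * (1 + (σ : ℂ) • metricForm hb m hm) = 1)
    (h2 : (1 + (σ : ℂ) • metricForm hb m hm) * (1 - (σ : ℂ) • N) = 1)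
    (hN : ∀ f, 0 ≤ (inner ℂ f ((1 - (σ : ℂ) • N) f)).re) {E : ℝ} (hE : E ≤ 0) :
    eigenspace (metricOperator b (fun x => 1 + (σ : ℂ) • m x)) E = ⊥ := by
  rw [Submodule.eq_bot_iff]
  intro u hu
  rw [mem_eigenspace_metricOperator, mem_metricGraph_iff hb m hm h1 h2, map_smul, map_smul,
    map_smul] at hu
  have h3 := congrArg (fun v => (inner ℂ u v : ℂ).re) hu
  have h4 : inner ℂ u (invSqrt hb ((1 - (σ : ℂ) • N) (invSqrt hb u))) =
      inner ℂ (invSqrt hb u) ((1 - (σ : ℂ) • N) (invSqrt hb u)) :=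
    (inner_diagOp_left _ _ _ _ _).symm
  simp only [inner_smul_right, h4, Complex.re_ofReal_mul] at h3
  have h5 : (inner ℂ u u : ℂ).re = ‖u‖ ^ 2 := by
    rw [inner_self_eq_norm_sq_to_K, ← RCLike.ofReal_pow]; exact Complex.ofReal_re _
  rw [h5] at h3
  have h6 := mul_nonpos_of_nonpos_of_nonneg hE (hN (invSqrt hb u))
  rw [← h3] at h6
  exact norm_eq_zero.1 (pow_eq_zero_iff two_ne_zero |>.1 (le_antisymm h6 (sq_nonneg _)))

/-- Inversion of the eigenvalue changes distances to the level by bounded factors, which contribute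
`O(1)` to the logarithm. -/
theorem isBigO_log_mul {d D W : ℕ → ℝ} {A B : ℝ} (hd : ∀ k, 0 < d k) (hA : 0 < A)
    (hD : ∀ k, A * d k ≤ D k ∧ D k ≤ B * d k)
    (h : (fun k => Real.log (d k) - W k) =O[atTop] fun k : ℕ => Real.log (k : ℝ)) :
    (fun k => Real.log (D k) - W k) =O[atTop] fun k : ℕ => Real.log (k : ℝ) := by
  have hB : 0 < B := by
    by_contra hB
    have h1 := (hD 0).1.trans (hD 0).2
    have h2 := mul_pos hA (hd 0)
    have h3 := mul_nonpos_of_nonpos_of_nonneg (not_lt.1 hB) (hd 0).le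
    linarith
  have h1 : (fun k => Real.log (D k) - Real.log (d k)) =O[atTop] fun k : ℕ => Real.log (k : ℝ) := by
    refine IsBigO.of_bound (|Real.log A| + |Real.log B|) ?_
    have hlog : Tendsto (fun n : ℕ => Real.log (n : ℝ)) atTop atTop :=
      Real.tendsto_log_atTop.comp tendsto_natCast_atTop_atTop
    filter_upwards [hlog.eventually_ge_atTop 1] with k hk
    have h2 := Real.log_le_log (mul_pos hA (hd k)) (hD k).1
    have h3 := Real.log_le_log ((mul_pos hA (hd k)).trans_le (hD k).1) (hD k).2
    rw [Real.log_mul hA.ne' (hd k).ne'] at h2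
    rw [Real.log_mul hB.ne' (hd k).ne'] at h3
    rw [Real.norm_eq_abs, Real.norm_of_nonneg (by linarith)]
    have h4 := neg_abs_le (Real.log A)
    have h5 := le_abs_self (Real.log B)
    have h6 := abs_nonneg (Real.log A)
    have h7 := abs_nonneg (Real.log B)
    have h8 : |Real.log A| + |Real.log B| ≤ (|Real.log A| + |Real.log B|) * Real.log k :=
      le_mul_of_one_le_right (by positivity) hk
    rw [abs_le]
    constructor <;> linarith
  exact (h.add h1).congr_left fun k => by ring

variable {W : ℕ → ℝ}

/-- For `σ = 1` the map `E ↦ -1 / E` is increasing on the positive half-line and carries the gap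
above `Λ_q` to the gap above `-1 / Λ_q`, preserving order and multiplicities. -/
theorem exists_listing_HPlus (hW : LevelBounds hb (metricForm hb m hm) W)
    (hpos : ∀ x, (m x).PosSemidef) {c : ℝ}
    (hc : ∀ x w, (matForm (m x) w).re ≤ c * ∑ j, ‖w j‖ ^ 2) (q : ℕ) :
    ∃ lam : ℕ → ℝ, Antitone lam ∧ ListsEigenvalues (HPlus b m) (gapAbove b q) lam ∧
      (fun k => Real.log (lam k - landauLevel b q) - W k) =O[atTop]
        fun k : ℕ => Real.log (k : ℝ) := by
  obtain ⟨N, hN, h1, h2, a, ha, A, hA, hNM⟩ := exists_resolvent_pencil (σ := 1) (δ := 1)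
    (metricForm_nonneg hb m hm hpos) (metricForm_le hb m hm hpos hc) one_pos
    fun y hy _ => by linarith
  have hL := landauLevel_pos hb
  have hq := hL q
  have hq1 := hL (q + 1)
  have hlt := landauLevel_strictMono hb (Nat.lt_succ_self q)
  rw [Nat.succ_eq_add_one] at hlt
  have hinv : ∀ {x y : ℝ}, 0 < x → x ≤ y → -1 / x ≤ -1 / y := fun hx hxy => by
    rw [neg_div, neg_div, neg_le_neg_iff]; exact one_div_le_one_div_of_le hx hxy
  have hinv' : ∀ {x y : ℝ}, 0 < x → x < y → -1 / x < -1 / y := fun hx hxy => by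
    rw [neg_div, neg_div, neg_lt_neg_iff]; exact one_div_lt_one_div_of_lt hx hxy
  obtain ⟨ν, hν1, hν2, hν3, hν4⟩ := exists_gap_enumeration hb (σ := 1)
    (lam' := -1 / landauLevel b (q + 1)) one_ne_zero (q := q) (hinv' hq hlt)
    (by rw [neg_div, neg_div, neg_mul_neg]; positivity) (fun n => by
      rcases Nat.lt_or_ge q n with h | h
      · have h3 := (landauLevel_strictMono hb).monotone h
        exact mul_nonneg (sub_nonneg.2 (hinv hq (hlt.le.trans h3))) (sub_nonneg.2 (hinv hq1 h3))
      · have h3 := (landauLevel_strictMono hb).monotone h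
        exact mul_nonneg_of_nonpos_of_nonpos (sub_nonpos.2 (hinv (hL n) h3))
          (sub_nonpos.2 (hinv (hL n) (h3.trans hlt.le)))) hW (metricForm_nonneg hb m hm hpos)
    (metricForm_le hb m hm hpos hc) hN ha hA (fun f => (hNM f).1) fun f => (hNM f).2
  have hneg : ∀ k, ν k < 0 := fun k => (hν2 k).2.trans (by rw [neg_div]; linarith [one_div_pos.2 hq1])
  have hmem : ∀ k, -1 / ν k ∈ gapAbove b q := fun k => by
    have h3 := hν2 k
    have h4 : 0 < -ν k := by linarith [hneg k]
    rw [Set.mem_Ioo, neg_div, neg_div, neg_lt, lt_neg] at h3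
    rw [gapAbove, Set.mem_Ioo, ← neg_div_neg_eq, neg_neg]
    exact ⟨(lt_one_div hq h4).2 h3.1, (one_div_lt h4 hq1).2 h3.2⟩
  refine ⟨fun k => -1 / ν k, fun i j hij => ?_, ⟨hmem, fun E hE => ?_⟩, ?_⟩
  · have h3 := hν1 hij
    change -1 / ν j ≤ -1 / ν i
    rw [neg_div, neg_div, neg_le_neg_iff]
    exact one_div_le_one_div_of_neg_of_le (hneg i) h3
  · have hE0 : 0 < E := hq.trans hE.1
    have h3 : ∀ k, -1 / ν k = E ↔ ν k = -1 / E := fun k => by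
      rw [div_eq_iff (hneg k).ne, eq_div_iff hE0.ne', eq_comm, mul_comm]
    have h4 := hν3 (-1 / E) ⟨hinv' hq hE.1, hinv' hE0 hE.2⟩
    rw [← eigenspace_metricOperator_eq hb m hm (by norm_num) h1 h2 hE0.ne'] at h4
    have h5 : (fun x => 1 + ((1 : ℝ) : ℂ) • m x) = fun x => 1 + m x := by
      funext x; rw [Complex.ofReal_one, one_smul]
    rw [Cardinal.mk_congr (Equiv.subtypeEquivRight h3), h4, HPlus, h5]
  -- The identity `E - Λ_q = Λ_q E (ν + 1 / Λ_q)` with `E = -1 / ν` between `Λ_q` and `Λ_{q+1}`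
  -- gives both constants.
  · refine isBigO_log_mul (A := landauLevel b q * landauLevel b q)
      (B := landauLevel b q * landauLevel b (q + 1))
      (fun k => sub_pos.2 (hν2 k).1) (by positivity) (fun k => ?_) hν4
    have h3 := hmem k
    have h4 : -1 / ν k - landauLevel b q =
        landauLevel b q * (-1 / ν k) * (ν k - -1 / landauLevel b q) := by
      have := (hneg k).ne
      field_simp
      ring
    have h5 := sub_pos.2 (hν2 k).1
    rw [h4]
    constructor
    · gcongr
      exact h3.1.le
    · gcongr
      exact h3.2.le

theorem eigenspace_eq_bot_of_norm_lt (X : L2 →L[ℂ] L2) {t : ℝ} (ht : ‖X‖ < t) :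
    Module.End.eigenspace (X : Module.End ℂ L2) (t : ℂ) = ⊥ := by
  rw [Submodule.eq_bot_iff]
  intro u hu
  rw [Module.End.mem_eigenspace_iff] at hu
  have h1 : ‖X u‖ = t * ‖u‖ := by
    have : X u = (t : ℂ) • u := hu
    rw [this, norm_smul, Complex.norm_real, Real.norm_of_nonneg ((norm_nonneg X).trans ht.le)]
  have h2 := X.le_opNorm u
  by_contra hne
  have h3 := mul_lt_mul_of_pos_right ht (norm_pos_iff.2 hne)
  linarith

/-- For `σ = -1` the map `E ↦ 1 / E` reverses order. The half-line below the first level corresponds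
to an unbounded gap; so `lam'` is allowed to depend on a bound `t₀`, taken to be the operator norm,
beyond which there are no eigenvalues. -/
theorem exists_listing_HMinus_aux (hW : LevelBounds hb (metricForm hb m hm) W)
    (hpos : ∀ x, (m x).PosSemidef) {c : ℝ} (hc1 : c < 1)
    (hc : ∀ x w, (matForm (m x) w).re ≤ c * ∑ j, ‖w j‖ ^ 2) (q : ℕ)
    (I : Set ℝ) (hI : ∀ E ∈ I, E < landauLevel b q)
    (hIlam : ∀ t₀ : ℝ, ∃ lam' : ℝ, 1 / landauLevel b q < lam' ∧
      (∀ n, 0 ≤ (1 / landauLevel b n - 1 / landauLevel b q) * (1 / landauLevel b n - lam')) ∧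
      (∀ E > 0, E < landauLevel b q → 1 / E < lam' → E ∈ I) ∧
      ∀ E ∈ I, 0 < E → 1 / E < lam' ∨ t₀ < 1 / E) :
    ∃ lam : ℕ → ℝ, Monotone lam ∧ ListsEigenvalues (HMinus b m) I lam ∧
      (fun k => Real.log (-(lam k - landauLevel b q)) - W k) =O[atTop]
        fun k : ℕ => Real.log (k : ℝ) := by
  have hM0 := metricForm_nonneg hb m hm hpos
  have hMc := metricForm_le hb m hm hpos hc
  obtain ⟨N, hN, h1, h2, a, ha, A, hA, hNM⟩ := exists_resolvent_pencil (σ := -1) (δ := 1 - c)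
    hM0 hMc (by linarith) fun y _ hy => by linarith
  have hL := landauLevel_pos hb
  have hq := hL q
  have hneg1 : ∀ x : ℝ, -(-1 : ℝ) / x = 1 / x := fun x => by rw [neg_neg]
  obtain ⟨lam', hlam, hgap, hI2, hI3⟩ := hIlam ‖landauInv hb (-1) + effPert hb N‖
  obtain ⟨ν, hν1, hν2, hν3, hν4⟩ := exists_gap_enumeration hb (σ := -1) (lam' := lam')
    (by norm_num) (q := q) (by rwa [hneg1]) (by
      rw [hneg1]
      have := one_div_pos.2 hq
      exact mul_pos this (this.trans hlam)) (fun n => by rw [hneg1, hneg1]; exact hgap n) hW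
    hM0 hMc hN ha hA (fun f => (hNM f).1) fun f => (hNM f).2
  simp only [hneg1] at hν2 hν3 hν4
  have hposν : ∀ k, 0 < ν k := fun k => (one_div_pos.2 hq).trans (hν2 k).1
  have hltq : ∀ k, 1 / ν k < landauLevel b q := fun k => (one_div_lt hq (hposν k)).1 (hν2 k).1
  have hmetric : HMinus b m = metricOperator b (fun x => 1 + (((-1 : ℝ) : ℝ) : ℂ) • m x) := by
    rw [HMinus]
    congr 1
    funext x
    rw [Complex.ofReal_neg, Complex.ofReal_one, neg_one_smul, sub_eq_add_neg]
  have hmem : ∀ k, 1 / ν k ∈ I := fun k =>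
    hI2 _ (one_div_pos.2 (hposν k)) (hltq k) (by rw [one_div_one_div]; exact (hν2 k).2)
  refine ⟨fun k => 1 / ν k, fun i j hij => one_div_le_one_div_of_le (hposν j) (hν1 hij),
    ⟨hmem, fun E hE => ?_⟩, ?_⟩
  · rw [hmetric]
    have hempty : (∀ k, ν k ≠ 1 / E) → eigenspace (metricOperator b
        (fun x => 1 + (((-1 : ℝ) : ℝ) : ℂ) • m x)) E = ⊥ →
        Cardinal.mk {k : ℕ // 1 / ν k = E} = Module.rank ℂ (eigenspace (metricOperator b
        (fun x => 1 + (((-1 : ℝ) : ℝ) : ℂ) • m x)) E) := fun h3 h4 => by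
      rw [h4, rank_bot, Cardinal.mk_eq_zero_iff]
      exact ⟨fun ⟨k, hk⟩ => h3 k (by rw [← hk, one_div_one_div])⟩
    -- Three cases: no eigenvalue at `E ≤ 0` by positivity, the enumerated ones for `1 / E < lam'`,
    -- and none for `1 / E` beyond the norm.
    rcases le_or_gt E 0 with hE0 | hE0
    · refine hempty (fun k hk => ?_) (eigenspace_metricOperator_eq_bot hb m hm h1 h2
        (fun f => ?_) hE0)
      · have := hposν k
        rw [hk] at this
        exact absurd (one_div_pos.1 this) (not_lt.2 hE0)
      · rw [sub_apply, one_apply_eq_self, smul_apply, inner_sub_right, inner_smul_right,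
          Complex.sub_re, Complex.re_ofReal_mul, inner_self_eq_norm_sq_to_K, ← RCLike.ofReal_pow]
        have h3 := (hNM f).1
        have h4 := re_inner_le_of_le hM0 f
        rw [zero_apply, inner_zero_right, Complex.zero_re] at h4
        have h5 := mul_nonneg ha.le h4
        have h6 : (RCLike.ofReal (‖f‖ ^ 2) : ℂ).re = ‖f‖ ^ 2 := Complex.ofReal_re _
        rw [h6]
        nlinarith [sq_nonneg ‖f‖]
    · have hEq := eigenspace_metricOperator_eq hb m hm (by norm_num) h1 h2 hE0.ne'
      rw [hneg1] at hEq
      by_cases hE1 : 1 / E < lam'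
      · have h3 : ∀ k, 1 / ν k = E ↔ ν k = 1 / E := fun k => by
          rw [div_eq_iff (hposν k).ne', eq_div_iff hE0.ne', eq_comm, mul_comm]
        rw [hEq, Cardinal.mk_congr (Equiv.subtypeEquivRight h3)]
        exact hν3 (1 / E) ⟨one_div_lt_one_div_of_lt hE0 (hI E hE), hE1⟩
      · refine hempty (fun k hk => hE1 (hk ▸ (hν2 k).2)) ?_
        rw [hEq]
        exact eigenspace_eq_bot_of_norm_lt _ ((hI3 E hE hE0).resolve_left hE1)
  · have hlam0 : 0 < lam' := (one_div_pos.2 hq).trans hlam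
    refine isBigO_log_mul (A := landauLevel b q * (1 / lam'))
      (B := landauLevel b q * landauLevel b q)
      (fun k => sub_pos.2 (hν2 k).1) (by positivity) (fun k => ?_) hν4
    have h4 : -(1 / ν k - landauLevel b q) =
        landauLevel b q * (1 / ν k) * (ν k - 1 / landauLevel b q) := by
      have := (hposν k).ne'
      field_simp
      ring
    have h5 := sub_pos.2 (hν2 k).1
    rw [h4]
    constructor
    · gcongr
      · exact hposν k
      · exact (hν2 k).2.le
    · gcongr
      exact (hltq k).le

theorem exists_listing_HMinus (hW : LevelBounds hb (metricForm hb m hm) W)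
    (hpos : ∀ x, (m x).PosSemidef) {c : ℝ} (hc1 : c < 1)
    (hc : ∀ x w, (matForm (m x) w).re ≤ c * ∑ j, ‖w j‖ ^ 2) (q : ℕ) :
    ∃ lam : ℕ → ℝ, Monotone lam ∧ ListsEigenvalues (HMinus b m) (gapBelow b q) lam ∧
      (fun k => Real.log (-(lam k - landauLevel b q)) - W k) =O[atTop]
        fun k : ℕ => Real.log (k : ℝ) := by
  have hL := landauLevel_pos hb
  have hmono := (landauLevel_strictMono hb).monotone
  have hinv : ∀ {n k : ℕ}, n ≤ k → 1 / landauLevel b k ≤ 1 / landauLevel b n := fun h =>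
    one_div_le_one_div_of_le (hL _) (hmono h)
  rcases q with _ | q
  · refine exists_listing_HMinus_aux hb m hm hW hpos hc1 hc 0 _ (fun E hE => hE) fun t₀ => ?_
    -- Any value above the top `1 / Λ_0` of the unperturbed spectrum and above `t₀` is an admissible
    -- artificial end of the gap.
    refine ⟨max t₀ (1 / landauLevel b 0) + 1, ?_, fun n => ?_, fun E _ hE _ => hE,
      fun E _ _ => ?_⟩
    · linarith [le_max_right t₀ (1 / landauLevel b 0)]
    · have h1 := hinv (Nat.zero_le n)
      refine mul_nonneg_of_nonpos_of_nonpos (sub_nonpos.2 h1) ?_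
      linarith [le_max_right t₀ (1 / landauLevel b 0)]
    · by_cases h : 1 / E < max t₀ (1 / landauLevel b 0) + 1
      · exact Or.inl h
      · exact Or.inr (by linarith [le_max_left t₀ (1 / landauLevel b 0), not_lt.1 h])
  · refine exists_listing_HMinus_aux hb m hm hW hpos hc1 hc (q + 1) _ (fun E hE => hE.2)
      fun t₀ => ⟨1 / landauLevel b q, ?_, fun n => ?_, fun E hE0 hE hE' => ⟨?_, hE⟩,
      fun E hE hE0 => Or.inl (one_div_lt_one_div_of_lt (hL q) hE.1)⟩
    · exact one_div_lt_one_div_of_lt (hL q) (landauLevel_strictMono hb (Nat.lt_succ_self q))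
    · rcases Nat.lt_or_ge q n with h | h
      · exact mul_nonneg_of_nonpos_of_nonpos (sub_nonpos.2 (hinv h)) (sub_nonpos.2 (hinv h.le))
      · exact mul_nonneg (sub_nonneg.2 (hinv (h.trans (Nat.le_succ q)))) (sub_nonneg.2 (hinv h))
    · exact (one_div_lt_one_div hE0 (hL q)).1 hE'

end Reduction
end MetricLandau

namespace MetricLandau

/-! ### The saddle point and its value -/

section Saddle

variable {β μ : ℝ}

/-- The exponent `k ln t - t - μ t^β`. -/
noncomputable def saddlePhase (β μ k t : ℝ) : ℝ := k * Real.log t - t - μ * t ^ β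

theorem exists_saddle (hβ : 0 < β) (hμ : 0 < μ) {k : ℝ} (hk : 0 < k) :
    ∃ t, 0 < t ∧ t + β * μ * t ^ β = k := by
  have hc : ContinuousOn (fun t : ℝ => t + β * μ * t ^ β) (Set.Icc 0 k) :=
    (continuous_id.add (continuous_const.mul (Real.continuous_rpow_const hβ.le))).continuousOn
  have h1 : k ∈ Set.Icc ((0 : ℝ) + β * μ * 0 ^ β) (k + β * μ * k ^ β) := by
    rw [Real.zero_rpow hβ.ne']
    have h2 := mul_nonneg (mul_pos hβ hμ).le (Real.rpow_nonneg hk.le β)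
    exact ⟨by linarith, by linarith⟩
  obtain ⟨t, ht, h2⟩ := intermediate_value_Icc hk.le hc h1
  refine ⟨t, ht.1.lt_of_ne ?_, h2⟩
  rintro rfl
  simp only [Real.zero_rpow hβ.ne'] at h2
  linarith

open Classical in
/-- The critical point of `saddlePhase β μ k`. -/
noncomputable def saddle (β μ k : ℝ) : ℝ :=
  if h : ∃ t, 0 < t ∧ t + β * μ * t ^ β = k then h.choose else 0

theorem saddle_pos (hβ : 0 < β) (hμ : 0 < μ) {k : ℝ} (hk : 0 < k) : 0 < saddle β μ k := by
  rw [saddle, dif_pos (exists_saddle hβ hμ hk)]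
  exact (exists_saddle hβ hμ hk).choose_spec.1

theorem saddle_eq (hβ : 0 < β) (hμ : 0 < μ) {k : ℝ} (hk : 0 < k) :
    saddle β μ k + β * μ * saddle β μ k ^ β = k := by
  rw [saddle, dif_pos (exists_saddle hβ hμ hk)]
  exact (exists_saddle hβ hμ hk).choose_spec.2

theorem saddle_unique (hβ : 0 < β) (hμ : 0 < μ) {k t : ℝ} (ht : 0 < t)
    (h : t + β * μ * t ^ β = k) : saddle β μ k = t := by
  have hk : 0 < k := by rw [← h]; positivity
  have h1 := saddle_pos hβ hμ hk
  have h2 := saddle_eq hβ hμ hk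
  have hm : StrictMonoOn (fun t : ℝ => t + β * μ * t ^ β) (Set.Ici 0) := by
    intro x hx y hy hxy
    have := Real.rpow_lt_rpow hx hxy hβ
    have h3 : 0 < β * μ := by positivity
    have := mul_lt_mul_of_pos_left this h3
    simp only
    linarith
  exact hm.injOn h1.le ht.le (h2.trans h.symm)

theorem saddle_le (hβ : 0 < β) (hμ : 0 < μ) {k : ℝ} (hk : 0 < k) : saddle β μ k ≤ k := by
  have h1 := saddle_pos hβ hμ hk
  have h2 := saddle_eq hβ hμ hk
  have : 0 < β * μ * saddle β μ k ^ β := by positivity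
  linarith

theorem tendsto_saddle (hβ : 0 < β) (hμ : 0 < μ) : Tendsto (saddle β μ) atTop atTop := by
  refine tendsto_atTop.2 fun A => ?_
  filter_upwards [eventually_gt_atTop (0 : ℝ), eventually_gt_atTop (|A| + β * μ * |A| ^ β)]
    with k hk hk2
  by_contra hlt
  have h1 := saddle_pos hβ hμ hk
  have h2 := saddle_eq hβ hμ hk
  have h3 : saddle β μ k ≤ |A| := (not_le.1 hlt).le.trans (le_abs_self A)
  have h4 : β * μ * saddle β μ k ^ β ≤ β * μ * |A| ^ β := by gcongr
  linarith

/-- The maximal value of `saddlePhase β μ k`. -/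
noncomputable def saddleMax (β μ k : ℝ) : ℝ := saddlePhase β μ k (saddle β μ k)

/-- The inequality `ln y ≤ y - 1` is applied to `s / t` and to `(s / t) ^ β`, with weights `t` and
`μ t ^ β`. The critical equation makes the logarithms add up to exactly `k ln (s / t)`. -/
theorem saddlePhase_le (hβ : 0 < β) (hμ : 0 < μ) {k s : ℝ} (hk : 0 < k) (hs : 0 < s) :
    saddlePhase β μ k s ≤ saddleMax β μ k := by
  have ht := saddle_pos hβ hμ hk
  have h2 := saddle_eq hβ hμ hk
  set t := saddle β μ k with htdef
  have h3 : Real.log (s / t) = Real.log s - Real.log t := Real.log_div hs.ne' ht.ne'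
  have h4 : Real.log (s / t) + 1 ≤ s / t := by
    have := Real.log_le_sub_one_of_pos (div_pos hs ht)
    linarith
  have h5 : β * Real.log (s / t) + 1 ≤ s ^ β / t ^ β := by
    rw [← Real.div_rpow hs.le ht.le]
    have := Real.log_le_sub_one_of_pos (Real.rpow_pos_of_pos (div_pos hs ht) β)
    rw [Real.log_rpow (div_pos hs ht)] at this
    linarith
  have h6 := mul_le_mul_of_nonneg_left h4 ht.le
  have htb : 0 < t ^ β := Real.rpow_pos_of_pos ht β
  have h7 := mul_le_mul_of_nonneg_left h5 (mul_pos hμ htb).le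
  rw [mul_div_cancel₀ _ ht.ne'] at h6
  have h8 : μ * t ^ β * (s ^ β / t ^ β) = μ * s ^ β := by field_simp
  rw [h8] at h7
  have h9 : k * Real.log (s / t) = t * Real.log (s / t) + β * μ * t ^ β * Real.log (s / t) := by
    rw [← h2]; ring
  rw [saddleMax, ← htdef, saddlePhase, saddlePhase]
  rw [h3] at h9 h6 h7
  nlinarith

/-- A discrete envelope argument: the saddle for `k` is a trial point for `k + 1`. The reverse
choice gives the companion upper bound. -/
theorem log_saddle_le (hβ : 0 < β) (hμ : 0 < μ) {k : ℝ} (hk : 0 < k) :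
    Real.log (saddle β μ k) ≤ saddleMax β μ (k + 1) - saddleMax β μ k := by
  have := saddlePhase_le hβ hμ (by linarith : 0 < k + 1) (saddle_pos hβ hμ hk)
  simp only [saddleMax, saddlePhase] at *
  linarith

theorem saddleMax_sub_le (hβ : 0 < β) (hμ : 0 < μ) {k : ℝ} (hk : 0 < k) :
    saddleMax β μ (k + 1) - saddleMax β μ k ≤ Real.log (saddle β μ (k + 1)) := by
  have := saddlePhase_le hβ hμ hk (saddle_pos hβ hμ (by linarith : 0 < k + 1))
  simp only [saddleMax, saddlePhase] at *
  linarith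

/-- The logarithm of the leading behaviour of the moments of `e^{-μ t^β}`. -/
noncomputable def logMoment (β μ : ℝ) (k : ℕ) : ℝ :=
  saddleMax β μ k - Real.log (k.factorial : ℝ)

theorem tendsto_saddle_natCast (hβ : 0 < β) (hμ : 0 < μ) :
    Tendsto (fun k : ℕ => saddle β μ k) atTop atTop :=
  (tendsto_saddle hβ hμ).comp tendsto_natCast_atTop_atTop

theorem saddleMax_step (hβ : 0 < β) (hμ : 0 < μ) :
    (fun k : ℕ => saddleMax β μ (k + 1 : ℕ) - saddleMax β μ k) =O[atTop]
      fun k : ℕ => Real.log (k : ℝ) := by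
  refine IsBigO.trans (IsBigO.of_bound 1 ?_) (isBigO_log_add 1)
  filter_upwards [(tendsto_saddle_natCast hβ hμ).eventually_ge_atTop 1, eventually_gt_atTop 0]
    with k h1 hk
  have hk' : (0 : ℝ) < k := by exact_mod_cast hk
  have h2 := log_saddle_le hβ hμ hk'
  have h3 := saddleMax_sub_le hβ hμ hk'
  have h4 := Real.log_le_log (saddle_pos hβ hμ (by linarith)) (saddle_le hβ hμ (by linarith : 0 < (k : ℝ) + 1))
  have h5 := Real.log_nonneg h1
  push_cast
  rw [Real.norm_of_nonneg (h5.trans h2), Real.norm_of_nonneg (Real.log_nonneg (by linarith)), one_mul]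
  exact h3.trans h4

theorem logMoment_succ_sub (k : ℕ) : logMoment β μ (k + 1) - logMoment β μ k =
    saddleMax β μ (k + 1) - saddleMax β μ k - Real.log (k + 1) := by
  rw [logMoment, logMoment, Nat.factorial_succ, Nat.cast_mul, Real.log_mul (by positivity)
    (by positivity)]
  push_cast
  ring

theorem logMoment_step (hβ : 0 < β) (hμ : 0 < μ) :
    (fun k : ℕ => logMoment β μ (k + 1) - logMoment β μ k) =O[atTop]
      fun k : ℕ => Real.log (k : ℝ) := by
  refine ((saddleMax_step hβ hμ).sub (isBigO_log_add 1)).congr_left fun k => ?_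
  rw [logMoment_succ_sub]
  push_cast
  ring

/-- The decrement is at least `β μ t ^ β / (k + 1)` with `t` the saddle for `k + 1`. As `t → ∞`,
this beats the increment of `C ln k`, at most `2 |C| / (k + 1)` in absolute value. -/
theorem eventually_logMoment_succ_le (hβ : 0 < β) (hμ : 0 < μ) (C : ℝ) :
    ∀ᶠ k : ℕ in atTop, logMoment β μ (k + 1) + C * Real.log ((k + 1 : ℕ) : ℝ) ≤
      logMoment β μ k + C * Real.log k := by
  have hlim : Tendsto (fun k : ℕ => β * μ * saddle β μ ((k + 1 : ℕ) : ℝ) ^ β) atTop atTop :=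
    ((tendsto_rpow_atTop hβ).comp ((tendsto_saddle_natCast hβ hμ).comp
      (tendsto_add_atTop_nat 1))).const_mul_atTop (mul_pos hβ hμ)
  filter_upwards [hlim.eventually_ge_atTop (2 * |C|), eventually_gt_atTop 0] with k hC hk
  have hk' : (1 : ℝ) ≤ k := by exact_mod_cast hk
  have hk1 : (0 : ℝ) < k + 1 := by linarith
  push_cast at hC ⊢
  have h1 := saddleMax_sub_le hβ hμ (by linarith : (0 : ℝ) < k)
  have h2 := logMoment_succ_sub (β := β) (μ := μ) k
  have ht := saddle_pos hβ hμ hk1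
  have h3 := saddle_eq hβ hμ hk1
  have h4 : Real.log (saddle β μ (k + 1)) - Real.log (k + 1) ≤
      -(β * μ * saddle β μ (k + 1) ^ β) / (k + 1) := by
    rw [← Real.log_div ht.ne' hk1.ne']
    refine (Real.log_le_sub_one_of_pos (by positivity)).trans_eq ?_
    rw [eq_div_iff hk1.ne', sub_mul, div_mul_cancel₀ _ hk1.ne']
    linarith
  have h5 : Real.log (k + 1) - Real.log k ≤ 2 / (k + 1) := by
    rw [← Real.log_div hk1.ne' (by linarith)]
    refine (Real.log_le_sub_one_of_pos (by positivity)).trans ?_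
    rw [div_sub_one (by linarith), div_le_div_iff₀ (by linarith) hk1]
    linarith
  have h6 : 0 ≤ Real.log (k + 1) - Real.log k :=
    sub_nonneg.2 (Real.log_le_log (by linarith) (by linarith))
  have h7 : C * (Real.log (k + 1) - Real.log k) ≤ |C| * (2 / (k + 1)) :=
    (mul_le_mul_of_nonneg_right (le_abs_self C) h6).trans
      (mul_le_mul_of_nonneg_left h5 (abs_nonneg C))
  have h8 : |C| * (2 / (k + 1)) - (β * μ * saddle β μ (k + 1) ^ β) / (k + 1) ≤ 0 := by
    rw [mul_div_assoc', ← sub_div]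
    exact div_nonpos_of_nonpos_of_nonneg (by linarith) hk1.le
  rw [neg_div] at h4
  linarith

theorem exists_forall_logMoment_le (hβ : 0 < β) (hμ : 0 < μ) (C : ℝ) :
    ∃ K₀ : ℕ, ∀ K ≥ K₀, ∀ k ≥ K, logMoment β μ k + C * Real.log k ≤
      logMoment β μ K + C * Real.log K := by
  obtain ⟨K₀, h⟩ := eventually_atTop.1 (eventually_logMoment_succ_le hβ hμ C)
  refine ⟨K₀, fun K hK k hk => ?_⟩
  induction k, hk using Nat.le_induction with
  | base => exact le_rfl
  | succ k hk ih => exact (h k (hK.trans hk)).trans ih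

/-- Eventual monotonicity with the larger constant `C + 1` leaves a spare `-ln k`, which tends to
`-∞`. -/
theorem tendsto_logMoment (hβ : 0 < β) (hμ : 0 < μ) (C : ℝ) :
    Tendsto (fun k : ℕ => logMoment β μ k + C * Real.log k) atTop atBot := by
  obtain ⟨K₀, h⟩ := exists_forall_logMoment_le hβ hμ (C + 1)
  have hlog : Tendsto (fun n : ℕ => Real.log (n : ℝ)) atTop atTop :=
    Real.tendsto_log_atTop.comp tendsto_natCast_atTop_atTop
  refine tendsto_atBot_mono' _ ?_ (tendsto_atBot_add_const_left _
    (logMoment β μ K₀ + (C + 1) * Real.log K₀) (tendsto_neg_atTop_atBot.comp hlog))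
  filter_upwards [eventually_ge_atTop K₀] with k hk
  have := h K₀ le_rfl k hk
  simp only [Function.comp_apply]
  linarith

end Saddle
end MetricLandau

namespace MetricLandau

/-! ### Polynomial lower bounds and radial integrals -/

section Moments

open Polynomial in
/-- The polynomial factor of the eigenfunctions of the Landau Hamiltonian. -/
noncomputable def lagPoly (n k : ℕ) : ℝ[X] :=
  ∑ p ∈ Finset.HasAntidiagonal.antidiagonal n,
    C ((n.choose p.1 : ℝ) * (k.descFactorial p.1 : ℝ) * (-1) ^ p.2) * X ^ p.2

theorem eval_lagPoly (n k : ℕ) (t : ℝ) : (lagPoly n k).eval t =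
    ∑ p ∈ Finset.HasAntidiagonal.antidiagonal n, (n.choose p.1 : ℝ) *
      ((k.descFactorial p.1 : ℝ) * (-t) ^ p.2) := by
  simp only [lagPoly, Polynomial.eval_finsetSum, Polynomial.eval_mul, Polynomial.eval_C,
    Polynomial.eval_pow, Polynomial.eval_X]
  refine Finset.sum_congr rfl fun p _ => ?_
  rw [neg_pow t]; ring

theorem natDegree_lagPoly_le (n k : ℕ) : (lagPoly n k).natDegree ≤ n :=
  Polynomial.natDegree_sum_le_of_forall_le _ _ fun p hp =>
    (Polynomial.natDegree_C_mul_X_pow_le _ _).trans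
      (by have := Finset.HasAntidiagonal.mem_antidiagonal.1 hp; omega)

/-- The leading coefficient has modulus one whatever `k` is. The lower moment bound needs nothing
else about the position of the zeros. -/
theorem coeff_lagPoly (n k : ℕ) : (lagPoly n k).coeff n = (-1) ^ n := by
  simp only [lagPoly, Polynomial.finsetSum_coeff, Polynomial.coeff_C_mul_X_pow]
  rw [Finset.sum_eq_single (0, n)]
  · simp
  · intro p hp hne
    have h := Finset.HasAntidiagonal.mem_antidiagonal.1 hp
    rw [if_neg]
    intro h2
    exact hne (Prod.ext (by simp only; omega) h2.symm)
  · intro h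
    exact absurd (Finset.HasAntidiagonal.mem_antidiagonal.2 (zero_add n)) h

theorem abs_eval_lagPoly_le (n k : ℕ) {t : ℝ} (ht : 0 ≤ t) :
    |(lagPoly n k).eval t| ≤ (k + t) ^ n := by
  rw [eval_lagPoly, (Commute.all (k : ℝ) t).add_pow']
  refine (Finset.abs_sum_le_sum_abs _ _).trans (Finset.sum_le_sum fun p _ => ?_)
  rw [abs_mul, abs_mul, abs_pow, abs_neg, abs_of_nonneg ht, Nat.abs_cast, Nat.abs_cast,
    nsmul_eq_mul]
  gcongr
  exact_mod_cast Nat.descFactorial_le_pow k p.1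

/-- The `n`-th difference of a polynomial of degree `n` is `n!` times the leading coefficient times
`h ^ n`, so the sampled values cannot all be small. -/
theorem factorial_mul_le_sum_abs_eval {P : Polynomial ℝ} {n : ℕ} (hn : P.natDegree ≤ n)
    (hc : |P.coeff n| = 1) {h : ℝ} (hh : 0 < h) (t : ℝ) :
    (n.factorial : ℝ) * h ^ n ≤
      ∑ j ∈ Finset.range (n + 1), (n.choose j : ℝ) * |P.eval (t + j * h)| := by
  have hc0 : P.coeff n ≠ 0 := fun h0 => by simp [h0] at hc
  have hdeg : P.natDegree = n := Polynomial.natDegree_eq_of_le_of_coeff_ne_zero hn hc0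
  set L : Polynomial ℝ := Polynomial.C h * Polynomial.X + Polynomial.C t with hL
  have hLd : L.natDegree = 1 := Polynomial.natDegree_linear hh.ne'
  have hLl : L.leadingCoeff = h := Polynomial.leadingCoeff_linear hh.ne'
  have hQd : (P.comp L).natDegree = n := by rw [Polynomial.natDegree_comp, hdeg, hLd, mul_one]
  have hQl : (P.comp L).leadingCoeff = P.coeff n * h ^ n := by
    rw [Polynomial.leadingCoeff_comp (by rw [hLd]; exact one_ne_zero), hLl, hdeg,
      Polynomial.leadingCoeff, hdeg]
  have h1 := congrFun (P.comp L).fwdDiff_iter_degree_eq_factorial 0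
  rw [hQd, hQl, fwdDiff_iter_eq_sum_shift] at h1
  have h2 := congrArg abs h1
  rw [Pi.smul_apply, smul_eq_mul, abs_mul, abs_mul, hc, one_mul, abs_of_pos (pow_pos hh n)] at h2
  have h3 : |((n.factorial : ℝ → ℝ) 0)| = n.factorial := by
    rw [Pi.natCast_apply, Nat.abs_cast]
  rw [h3] at h2
  rw [mul_comm, ← h2]
  refine (Finset.abs_sum_le_sum_abs _ _).trans (Finset.sum_le_sum fun j _ => ?_)
  rw [zsmul_eq_mul, abs_mul]
  push_cast
  rw [abs_mul, abs_pow, abs_neg, abs_one, one_pow, one_mul, Nat.abs_cast, Polynomial.eval_comp, hL]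
  simp only [Polynomial.eval_add, Polynomial.eval_mul, Polynomial.eval_C, Polynomial.eval_X, zero_add,
    nsmul_eq_mul, mul_one]
  rw [add_comm, mul_comm h]

/-- The finite-difference bound is squared by Cauchy-Schwarz with binomial weights and averaged over
base points in `[t, t + h]`; all shifted intervals lie in `[t, t + (n + 1) h]`. Each of the two
steps costs `2 ^ n`. -/
theorem le_integral_sq_eval {P : Polynomial ℝ} {n : ℕ} (hn : P.natDegree ≤ n)
    (hc : |P.coeff n| = 1) {h : ℝ} (hh : 0 < h) (t : ℝ) :
    h ^ (2 * n + 1) ≤ 4 ^ n * ∫ s in t..(t + (n + 1) * h), P.eval s ^ 2 := by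
  have hcont : Continuous fun s => P.eval s := P.continuous
  have hint : ∀ a b, IntervalIntegrable (fun s => P.eval s ^ 2) volume a b := fun a b =>
    (hcont.pow 2).intervalIntegrable a b
  have key : ∀ s, h ^ (2 * n) ≤ 2 ^ n * ∑ j ∈ Finset.range (n + 1),
      (n.choose j : ℝ) * P.eval (s + j * h) ^ 2 := by
    intro s
    have h1 := factorial_mul_le_sum_abs_eval hn hc hh s
    have h2 : h ^ n ≤ ∑ j ∈ Finset.range (n + 1), (n.choose j : ℝ) * |P.eval (s + j * h)| := by
      refine le_trans ?_ h1
      have : (1 : ℝ) ≤ n.factorial := by exact_mod_cast n.factorial_pos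
      nlinarith [pow_pos hh n]
    have h3 := Finset.sum_mul_sq_le_sq_mul_sq (Finset.range (n + 1))
      (fun j => √(n.choose j : ℝ)) (fun j => √(n.choose j : ℝ) * |P.eval (s + j * h)|)
    have h4 : ∀ j, √(n.choose j : ℝ) * (√(n.choose j : ℝ) * |P.eval (s + j * h)|) =
        (n.choose j : ℝ) * |P.eval (s + j * h)| := fun j => by
      rw [← mul_assoc, Real.mul_self_sqrt (by positivity)]
    have h5 : ∀ j, √(n.choose j : ℝ) ^ 2 = (n.choose j : ℝ) := fun j =>
      Real.sq_sqrt (by positivity)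
    simp only [h4, mul_pow, h5, sq_abs] at h3
    have h6 : ∑ j ∈ Finset.range (n + 1), (n.choose j : ℝ) = 2 ^ n := by
      exact_mod_cast Nat.sum_range_choose n
    rw [h6] at h3
    calc h ^ (2 * n) = (h ^ n) ^ 2 := by rw [mul_comm, pow_mul]
      _ ≤ _ := by gcongr
      _ ≤ _ := h3
  have h1 : ∫ s in t..(t + h), h ^ (2 * n) ≤ ∫ s in t..(t + h), 2 ^ n *
      ∑ j ∈ Finset.range (n + 1), (n.choose j : ℝ) * P.eval (s + j * h) ^ 2 := by
    refine intervalIntegral.integral_mono_on (by linarith) intervalIntegrable_const ?_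
      fun s _ => key s
    exact Continuous.intervalIntegrable (by fun_prop) _ _
  rw [intervalIntegral.integral_const, intervalIntegral.integral_const_mul,
    intervalIntegral.integral_finsetSum fun j _ =>
      Continuous.intervalIntegrable (by fun_prop) _ _] at h1
  have h2 : ∀ j ∈ Finset.range (n + 1),
      ∫ s in t..(t + h), (n.choose j : ℝ) * P.eval (s + j * h) ^ 2 ≤
      (n.choose j : ℝ) * ∫ s in t..(t + (n + 1) * h), P.eval s ^ 2 := by
    intro j hj
    have hj' : (j : ℝ) ≤ n := by exact_mod_cast Nat.lt_succ_iff.1 (Finset.mem_range.1 hj)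
    rw [intervalIntegral.integral_const_mul]
    gcongr
    rw [intervalIntegral.integral_comp_add_right (fun s => P.eval s ^ 2)]
    refine intervalIntegral.integral_mono_interval ?_ ?_ ?_ (Eventually.of_forall fun s => sq_nonneg _)
      (hint _ _)
    · have : 0 ≤ (j : ℝ) * h := by positivity
      linarith
    · linarith
    · nlinarith
  have h3 := Finset.sum_le_sum h2
  rw [← Finset.sum_mul] at h3
  have h6 : ∑ j ∈ Finset.range (n + 1), (n.choose j : ℝ) = 2 ^ n := by
    exact_mod_cast Nat.sum_range_choose n
  rw [h6] at h3
  calc h ^ (2 * n + 1) = (t + h - t) • h ^ (2 * n) := by rw [smul_eq_mul]; ring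
    _ ≤ _ := h1
    _ ≤ 2 ^ n * (2 ^ n * ∫ s in t..(t + (n + 1) * h), P.eval s ^ 2) := by gcongr
    _ = _ := by rw [← mul_assoc, ← mul_pow]; norm_num

variable {b : ℝ} (hb : 0 < b)

theorem integral_radial {b : ℝ} (hb : 0 < b) (F : ℝ → ℝ) :
    ∫ x : Plane, F (b / 2 * ‖x‖ ^ 2) = 2 * Real.pi / b * ∫ t in Set.Ioi (0 : ℝ), F t := by
  have h1 := integral_fun_norm_addHaar (volume : Measure Plane) (fun r => F (b / 2 * r ^ 2))
  have h2 : (volume : Measure Plane).real (Metric.ball 0 1) = Real.pi := by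
    rw [Measure.real, EuclideanSpace.volume_ball_fin_two]
    simp [Real.pi_pos.le]
  rw [h1, h2, finrank_euclideanSpace_fin]
  have h3 := integral_comp_rpow_Ioi_of_pos (g := fun y => F (b / 2 * y)) (p := 2) two_pos
  have h4 : ∫ y in Set.Ioi (0 : ℝ), y ^ (2 - 1) • F (b / 2 * y ^ 2) =
      (1 / 2) * ∫ x in Set.Ioi (0 : ℝ), (2 * x ^ ((2 : ℝ) - 1)) • F (b / 2 * x ^ (2 : ℝ)) := by
    rw [← integral_const_mul]
    refine setIntegral_congr_fun measurableSet_Ioi fun x hx => ?_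
    have e1 : (2 : ℝ) - 1 = 1 := by norm_num
    simp only [smul_eq_mul, e1, Real.rpow_one, Real.rpow_two]
    norm_num
    ring
  rw [h4, h3, integral_comp_mul_left_Ioi (fun y => F y) 0 (by positivity : 0 < b / 2), mul_zero]
  simp only [nsmul_eq_mul, smul_eq_mul, Nat.cast_ofNat]
  field_simp

theorem normSq_psi_apply {n k : ℕ} (h : n ≤ k) (x : Plane) :
    ‖(psi b n k : Plane → ℂ) x‖ ^ 2 = 4 ^ n * ‖x‖ ^ (2 * (k - n)) *
      Real.exp (-(b / 2 * ‖x‖ ^ 2)) * (lagPoly n k).eval (b / 2 * ‖x‖ ^ 2) ^ 2 := by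
  rw [psi_apply h, ← eval_lagPoly, norm_mul, norm_mul, norm_mul, norm_pow, norm_pow, norm_zc,
    Complex.norm_exp, Complex.norm_real, Real.norm_eq_abs, mul_pow, sq_abs, mul_pow, mul_pow,
    ← Real.exp_nat_mul]
  have h1 : ‖(-2 * Complex.I : ℂ)‖ = 2 := by simp
  have h2 : (-(b / 4 : ℂ) * ((‖x‖ ^ 2 : ℝ) : ℂ)).re = -(b / 4) * ‖x‖ ^ 2 := by
    have : (-(b / 4 : ℂ) * ((‖x‖ ^ 2 : ℝ) : ℂ)) = ((-(b / 4) * ‖x‖ ^ 2 : ℝ) : ℂ) := by push_cast; ring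
    rw [this, Complex.ofReal_re]
  rw [h1, h2, ← pow_mul, ← pow_mul, mul_comm n 2, pow_mul, mul_comm (k - n) 2]
  congr 3
  · norm_num
  · push_cast; ring

theorem normSq_psi_eq (n k : ℕ) : ‖gaussToL2 hb (psi b n k)‖ ^ 2 =
    (2 * b) ^ n * n.factorial * (2 * Real.pi / b * ((2 / b) ^ k * k.factorial)) := by
  rw [normSq_psi, normSq_gm]
  congr 1
  have h1 : ∀ x : Plane, ‖x‖ ^ (2 * k) * Real.exp (-(b / 2 * ‖x‖ ^ 2)) =
      (fun t => (2 / b) ^ k * (t ^ k * Real.exp (-t))) (b / 2 * ‖x‖ ^ 2) := fun x => by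
    simp only
    rw [← mul_assoc, ← mul_pow, pow_mul]
    congr 2
    field_simp
  simp only [h1]
  rw [integral_radial hb (fun t => (2 / b) ^ k * (t ^ k * Real.exp (-t))), integral_const_mul]
  congr 2
  rw [← Real.Gamma_nat_eq_factorial, Real.Gamma_eq_integral (by positivity)]
  refine setIntegral_congr_fun measurableSet_Ioi fun x hx => ?_
  simp only [add_sub_cancel_right, Real.rpow_natCast]
  ring

/-- Polar coordinates and `t = b ‖x‖² / 2` reduce the moment to one variable; dividing by the
squared norm of the eigenfunction leaves the factor `1 / (n! k!)`. -/
theorem integral_weight_psi (ρ : ℝ → ℝ) {n k : ℕ} (h : n ≤ k) :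
    ∫ x : Plane, ρ (b / 2 * ‖x‖ ^ 2) * ‖(psi b n k : Plane → ℂ) x‖ ^ 2 =
      ‖gaussToL2 hb (psi b n k)‖ ^ 2 * (((n.factorial : ℝ) * k.factorial)⁻¹ *
        ∫ t in Set.Ioi (0 : ℝ), ρ t * (t ^ (k - n) * Real.exp (-t) * (lagPoly n k).eval t ^ 2)) := by
  have h1 : ∀ x : Plane, ρ (b / 2 * ‖x‖ ^ 2) * ‖(psi b n k : Plane → ℂ) x‖ ^ 2 =
      (fun t => (4 ^ n * (2 / b) ^ (k - n)) *
        (ρ t * (t ^ (k - n) * Real.exp (-t) * (lagPoly n k).eval t ^ 2))) (b / 2 * ‖x‖ ^ 2) := by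
    intro x
    have h2 : ‖x‖ ^ (2 * (k - n)) = (2 / b) ^ (k - n) * (b / 2 * ‖x‖ ^ 2) ^ (k - n) := by
      rw [← mul_pow, pow_mul]
      congr 1
      field_simp
    simp only
    rw [normSq_psi_apply h, h2]
    ring
  simp only [h1]
  rw [integral_radial hb (fun t => (4 ^ n * (2 / b) ^ (k - n)) *
    (ρ t * (t ^ (k - n) * Real.exp (-t) * (lagPoly n k).eval t ^ 2))), integral_const_mul,
    normSq_psi_eq]
  obtain ⟨j, rfl⟩ := Nat.exists_eq_add_of_le h
  rw [Nat.add_sub_cancel_left]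
  have h3 : (n.factorial : ℝ) ≠ 0 := by positivity
  have h4 : ((n + j).factorial : ℝ) ≠ 0 := by positivity
  have h5 : (2 * b) ^ n * (2 / b) ^ (n + j) = 4 ^ n * (2 / b) ^ j := by
    rw [pow_add, ← mul_assoc, ← mul_pow]
    congr 2
    field_simp
    norm_num
  rw [← h5]
  field_simp

end Moments
end MetricLandau

namespace MetricLandau

/-! ### Two-sided bounds for the moments -/

section MomentBounds

variable {β μ : ℝ}

theorem pow_mul_exp_le (hβ : 0 < β) (hμ : 0 < μ) {j : ℕ} (hj : 0 < j) {t : ℝ} (ht : 0 < t) :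
    t ^ j * (Real.exp (-t) * Real.exp (-μ * t ^ β)) ≤ Real.exp (saddleMax β μ j) := by
  have h := saddlePhase_le hβ hμ (by exact_mod_cast hj : (0 : ℝ) < j) ht
  have h2 : t ^ j = Real.exp (j * Real.log t) := by
    rw [mul_comm, Real.exp_mul, Real.exp_log ht, Real.rpow_natCast]
  rw [h2, ← Real.exp_add, ← Real.exp_add]
  refine Real.exp_le_exp.2 (le_trans (le_of_eq ?_) h)
  rw [saddlePhase]; ring

/-- Polynomial factors are bounded by powers of `k` and `1 + t`, and the latter split into `1` and a
single power of `t`. Each piece is then below a saddle value with shifted index. -/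
theorem weight_density_le (hβ : 0 < β) (hμ : 0 < μ) {A : ℝ} (hA : 0 ≤ A) (N : ℕ) {n k : ℕ}
    (hk : n < k) {t : ℝ} (ht : 0 < t) :
    A * (1 + t) ^ N * Real.exp (-μ * t ^ β) *
      (t ^ (k - n) * Real.exp (-t) * (lagPoly n k).eval t ^ 2) ≤
    A * k ^ (2 * n) * 2 ^ (N + 2 * n + 2) * (Real.exp (saddleMax β μ (k - n : ℕ)) +
      Real.exp (saddleMax β μ (k - n + (N + 2 * n + 2) : ℕ))) * (1 + t ^ 2)⁻¹ := by
  have hk1 : (1 : ℝ) ≤ k := by exact_mod_cast (by omega : 1 ≤ k)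
  have h1 : (lagPoly n k).eval t ^ 2 ≤ k ^ (2 * n) * (1 + t) ^ (2 * n) := by
    rw [← sq_abs, ← mul_pow, mul_comm 2 n, pow_mul]
    gcongr
    refine (abs_eval_lagPoly_le n k ht.le).trans ?_
    gcongr
    nlinarith
  -- The two additional powers pay for the integrable factor `(1 + t ^ 2)⁻¹`.
  set P := N + 2 * n + 2 with hP
  have h2 : (1 + t) ^ P ≤ 2 ^ P * (1 + t ^ P) := by
    refine (add_pow_le zero_le_one ht.le P).trans ?_
    rw [one_pow]
    gcongr
    · norm_num
    · omega
  have h3 := pow_mul_exp_le hβ hμ (by omega : 0 < k - n) ht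
  have h4 := pow_mul_exp_le hβ hμ (by omega : 0 < k - n + P) ht
  have h5 : (1 + t) ^ N * (1 + t) ^ (2 * n) ≤ (1 + t) ^ P * (1 + t ^ 2)⁻¹ := by
    rw [hP, pow_add, pow_add, mul_assoc ((1 + t) ^ N * _)]
    refine le_mul_of_one_le_right (by positivity) ?_
    rw [← div_eq_mul_inv, one_le_div (by positivity)]
    nlinarith
  calc _ ≤ A * (1 + t) ^ N * Real.exp (-μ * t ^ β) *
        (t ^ (k - n) * Real.exp (-t) * (k ^ (2 * n) * (1 + t) ^ (2 * n))) := by gcongr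
    _ = A * k ^ (2 * n) * ((1 + t) ^ N * (1 + t) ^ (2 * n)) *
        (t ^ (k - n) * (Real.exp (-t) * Real.exp (-μ * t ^ β))) := by ring
    _ ≤ A * k ^ (2 * n) * (2 ^ P * (1 + t ^ P) * (1 + t ^ 2)⁻¹) *
        (t ^ (k - n) * (Real.exp (-t) * Real.exp (-μ * t ^ β))) := by
          refine mul_le_mul_of_nonneg_right (mul_le_mul_of_nonneg_left ?_ ?_) ?_
          · exact h5.trans (mul_le_mul_of_nonneg_right h2 (by positivity))
          · positivity
          · positivity
    _ = A * k ^ (2 * n) * 2 ^ P * (t ^ (k - n) * (Real.exp (-t) * Real.exp (-μ * t ^ β)) +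
        t ^ (k - n + P) * (Real.exp (-t) * Real.exp (-μ * t ^ β))) * (1 + t ^ 2)⁻¹ := by
          rw [pow_add]; ring
    _ ≤ _ := by gcongr

/-- Weights that decay like `e^{-μ t^β}`, up to powers. -/
structure IsUpperWeight (β μ A : ℝ) (N : ℕ) (ρ : ℝ → ℝ) : Prop where
  measurable : Measurable ρ
  nonneg : ∀ t, 0 ≤ ρ t
  le : ∀ t, 0 ≤ t → ρ t ≤ A * (1 + t) ^ N * Real.exp (-μ * t ^ β)

variable {A : ℝ} {N : ℕ} {ρ : ℝ → ℝ}

theorem IsUpperWeight.coeff_nonneg (hρ : IsUpperWeight β μ A N ρ) : 0 ≤ A := by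
  have h1 := (hρ.nonneg 0).trans (hρ.le 0 le_rfl)
  rw [add_zero, one_pow, mul_one] at h1
  exact nonneg_of_mul_nonneg_left h1 (Real.exp_pos _)

theorem IsUpperWeight.density_le (hρ : IsUpperWeight β μ A N ρ) (hβ : 0 < β) (hμ : 0 < μ) {n k : ℕ}
    (hk : n < k) {t : ℝ} (ht : 0 < t) :
    ρ t * (t ^ (k - n) * Real.exp (-t) * (lagPoly n k).eval t ^ 2) ≤
    A * k ^ (2 * n) * 2 ^ (N + 2 * n + 2) * (Real.exp (saddleMax β μ (k - n : ℕ)) +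
      Real.exp (saddleMax β μ (k - n + (N + 2 * n + 2) : ℕ))) * (1 + t ^ 2)⁻¹ := by
  refine le_trans ?_ (weight_density_le hβ hμ hρ.coeff_nonneg N hk ht)
  gcongr
  exact hρ.le t ht.le

theorem IsUpperWeight.integrableOn (hρ : IsUpperWeight β μ A N ρ) (hβ : 0 < β) (hμ : 0 < μ)
    {n k : ℕ} (hk : n < k) : IntegrableOn
      (fun t => ρ t * (t ^ (k - n) * Real.exp (-t) * (lagPoly n k).eval t ^ 2))
      (Set.Ioi (0 : ℝ)) volume := by
  refine Integrable.mono' (integrable_inv_one_add_sq.integrableOn.const_mul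
    (A * k ^ (2 * n) * 2 ^ (N + 2 * n + 2) * (Real.exp (saddleMax β μ (k - n : ℕ)) +
      Real.exp (saddleMax β μ (k - n + (N + 2 * n + 2) : ℕ)))))
    (hρ.measurable.aestronglyMeasurable.mul
      (Continuous.aestronglyMeasurable (by fun_prop))) ?_
  filter_upwards [ae_restrict_mem measurableSet_Ioi] with t ht
  have ht' : 0 < t := ht
  rw [Real.norm_of_nonneg (mul_nonneg (hρ.nonneg t) (by positivity))]
  exact hρ.density_le hβ hμ hk ht

/-- Index shifts and powers of `k` both turn into a multiple of `ln k` in the exponent; the constant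
`B` is absorbed by one more power of `k`. -/
theorem exists_exp_log_bound {V : ℕ → ℝ}
    (hV : (fun k => V (k + 1) - V k) =O[atTop] fun k : ℕ => Real.log (k : ℝ)) (r n : ℕ) (B : ℝ) (d : ℕ) :
    ∃ C : ℝ, ∃ K₀ : ℕ, ∀ k ≥ K₀, B * k ^ d * (Real.exp (V (k - n)) + Real.exp (V (k + r))) ≤
      Real.exp (V k + C * Real.log k) := by
  obtain ⟨C₁, h1⟩ := (isBigO_shift hV r).bound
  obtain ⟨C₂, h2⟩ := (isBigO_shift_sub hV n).bound
  have hlog : Tendsto (fun n : ℕ => Real.log (n : ℝ)) atTop atTop :=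
    Real.tendsto_log_atTop.comp tendsto_natCast_atTop_atTop
  obtain ⟨K₀, hK⟩ := eventually_atTop.1 (h1.and (h2.and ((hlog.eventually_ge_atTop
    (Real.log (2 * (|B| + 1)))).and (eventually_ge_atTop 1))))
  refine ⟨|C₁| + |C₂| + d + 1, K₀, fun k hk => ?_⟩
  obtain ⟨e1, e2, e3, e4⟩ := hK k hk
  have hk0 : (0 : ℝ) < k := by exact_mod_cast e4
  have hl : 0 ≤ Real.log k := Real.log_natCast_nonneg k
  rw [Real.norm_eq_abs, Real.norm_of_nonneg hl, abs_le] at e1 e2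
  have h5 := mul_le_mul_of_nonneg_right (le_abs_self C₁) hl
  have h6 := mul_le_mul_of_nonneg_right (le_abs_self C₂) hl
  have h7 := mul_nonneg (abs_nonneg C₁) hl
  have h8 := mul_nonneg (abs_nonneg C₂) hl
  set X := Real.exp (V k + (|C₁| + |C₂|) * Real.log k) with hX
  have h9 : Real.exp (V (k - n)) ≤ X := Real.exp_le_exp.2 (by linarith [e2.1])
  have h10 : Real.exp (V (k + r)) ≤ X := Real.exp_le_exp.2 (by linarith [e1.2])
  calc _ ≤ (|B| + 1) * (k : ℝ) ^ d * (X + X) := by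
        gcongr
        linarith [le_abs_self B]
    _ = 2 * (|B| + 1) * ((k : ℝ) ^ d * X) := by ring
    _ ≤ (k : ℝ) * ((k : ℝ) ^ d * X) := by
        gcongr
        exact (Real.log_le_log_iff (by positivity) hk0).1 e3
    _ = _ := by
        have h11 : (k : ℝ) ^ d = Real.exp (d * Real.log k) := by
          rw [mul_comm, Real.exp_mul, Real.exp_log hk0, Real.rpow_natCast]
        rw [h11, hX]
        conv_lhs => rw [← Real.exp_log hk0]
        rw [← Real.exp_add, ← Real.exp_add, Real.exp_log hk0]
        congr 1
        ring

theorem IsUpperWeight.exists_moment_le (hρ : IsUpperWeight β μ A N ρ) (hβ : 0 < β) (hμ : 0 < μ)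
    {b : ℝ} (hb : 0 < b) (n : ℕ) : ∃ C : ℝ, ∃ K₀ : ℕ, ∀ k ≥ K₀,
      ∫ x : Plane, ρ (b / 2 * ‖x‖ ^ 2) * ‖(psi b n k : Plane → ℂ) x‖ ^ 2 ≤
        Real.exp (logMoment β μ k + C * Real.log k) * ‖gaussToL2 hb (psi b n k)‖ ^ 2 := by
  set I₀ := ∫ t in Set.Ioi (0 : ℝ), (1 + t ^ 2)⁻¹ with hI₀
  obtain ⟨C, K₀, hC⟩ := exists_exp_log_bound (V := fun k => saddleMax β μ k) (saddleMax_step hβ hμ) (N + n + 2) n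
    ((n.factorial : ℝ)⁻¹ * A * 2 ^ (N + 2 * n + 2) * I₀) (2 * n)
  refine ⟨C, max K₀ (n + 1), fun k hk => ?_⟩
  have hk1 : n < k := (le_max_right _ _).trans hk
  have hk2 := hC k ((le_max_left _ _).trans hk)
  rw [integral_weight_psi hb ρ hk1.le, mul_comm]
  gcongr
  have h1 : ∫ t in Set.Ioi (0 : ℝ), ρ t * (t ^ (k - n) * Real.exp (-t) * (lagPoly n k).eval t ^ 2) ≤
      A * k ^ (2 * n) * 2 ^ (N + 2 * n + 2) * (Real.exp (saddleMax β μ (k - n : ℕ)) +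
      Real.exp (saddleMax β μ (k - n + (N + 2 * n + 2) : ℕ))) * I₀ := by
    rw [hI₀, ← integral_const_mul]
    refine integral_mono_of_nonneg ?_ (integrable_inv_one_add_sq.integrableOn.const_mul _) ?_
    · filter_upwards [ae_restrict_mem measurableSet_Ioi] with t ht
      have ht' : 0 < t := ht
      exact mul_nonneg (hρ.nonneg t) (by positivity)
    · filter_upwards [ae_restrict_mem measurableSet_Ioi] with t ht
      exact hρ.density_le hβ hμ hk1 ht
  have h2 : k - n + (N + 2 * n + 2) = k + (N + n + 2) := by omega
  rw [h2] at h1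
  have h3 : Real.exp (logMoment β μ k + C * Real.log k) =
      (k.factorial : ℝ)⁻¹ * Real.exp (saddleMax β μ k + C * Real.log k) := by
    rw [logMoment, sub_add_eq_add_sub, Real.exp_sub, Real.exp_log (by positivity)]
    field_simp
  rw [h3, mul_inv, mul_comm (n.factorial : ℝ)⁻¹, mul_assoc]
  gcongr
  refine le_trans ?_ hk2
  refine (mul_le_mul_of_nonneg_left h1 (by positivity)).trans_eq ?_
  ring

/-- Near the saddle point, the density is comparable to its maximum. -/
theorem exists_le_density (hβ : 0 < β) (hμ : 0 < μ) (n : ℕ) : ∃ B : ℝ, ∃ K₀ : ℕ, ∀ k : ℕ, k ≥ K₀ →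
    ∀ t, saddle β μ k ≤ t → t ≤ saddle β μ k + (n + 1) * (k : ℝ)⁻¹ →
      Real.exp (saddleMax β μ k - B) ≤ t ^ k * (Real.exp (-t) * Real.exp (-μ * t ^ β)) := by
  obtain ⟨K₀, hK⟩ := eventually_atTop.1 (((tendsto_saddle_natCast hβ hμ).eventually_ge_atTop 1).and
    (eventually_ge_atTop (n + 1)))
  -- Over a window of width `(n + 1) / k ≤ 1` the term `t` grows by at most `n + 1`. The term `μ t ^
  -- β` grows by at most `(n + 1) e^β`, because `β μ s ^ β ≤ k` at the saddle `s ≥ 1`.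
  refine ⟨(n + 1) + (n + 1) * Real.exp β, K₀, fun k hk t ht1 ht2 => ?_⟩
  obtain ⟨hs1, hkn⟩ := hK k hk
  have hkn' : (n : ℝ) + 1 ≤ k := by exact_mod_cast hkn
  have hk0 : (0 : ℝ) < k := by linarith [(Nat.cast_nonneg n : (0 : ℝ) ≤ n)]
  set s := saddle β μ k with hs
  have hs0 : 0 < s := saddle_pos hβ hμ hk0
  have hse : s + β * μ * s ^ β = k := saddle_eq hβ hμ hk0
  have ht0 : 0 < t := hs0.trans_le ht1
  have h2 : t ^ k = Real.exp (k * Real.log t) := by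
    rw [mul_comm, Real.exp_mul, Real.exp_log ht0, Real.rpow_natCast]
  rw [h2, ← Real.exp_add, ← Real.exp_add]
  refine Real.exp_le_exp.2 ?_
  have h3 : Real.log s ≤ Real.log t := Real.log_le_log hs0 ht1
  have h4 : k * Real.log s ≤ k * Real.log t := by gcongr
  have hinv : (n + 1) * (k : ℝ)⁻¹ ≤ 1 := by
    rw [← div_eq_mul_inv, div_le_one hk0]; exact hkn'
  have hn0 : (0 : ℝ) ≤ n := Nat.cast_nonneg n
  set x := (t - s) / s with hx
  have hx0 : 0 ≤ x := div_nonneg (by linarith) hs0.le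
  have hx1 : x ≤ (n + 1) * (k : ℝ)⁻¹ := (div_le_self (by linarith) hs1).trans (by linarith)
  have htx : t = s * (1 + x) := by rw [hx]; field_simp; ring
  have h5 : t ^ β ≤ s ^ β * Real.exp (β * x) := by
    rw [htx, Real.mul_rpow hs0.le (by linarith)]
    gcongr
    rw [mul_comm β x, Real.exp_mul]
    exact Real.rpow_le_rpow (by linarith) (by linarith [Real.add_one_le_exp x]) hβ.le
  have h6 : Real.exp (β * x) - 1 ≤ β * x * Real.exp β := by
    have h7 := Real.add_one_le_exp (-(β * x))
    have h8 : Real.exp (β * x) ≤ Real.exp β := Real.exp_le_exp.2 (by nlinarith)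
    have h9 : Real.exp (β * x) * Real.exp (-(β * x)) = 1 := by rw [← Real.exp_add]; simp
    have h10 := mul_le_mul_of_nonneg_left h7 (Real.exp_pos (β * x)).le
    rw [h9] at h10
    have h11 : β * x * Real.exp (β * x) ≤ β * x * Real.exp β := by gcongr
    linarith
  have h7 : μ * t ^ β - μ * s ^ β ≤ (n + 1) * Real.exp β := by
    have hsb : 0 ≤ s ^ β := by positivity
    calc μ * t ^ β - μ * s ^ β ≤ μ * (s ^ β * Real.exp (β * x)) - μ * s ^ β := by gcongr
      _ = μ * s ^ β * (Real.exp (β * x) - 1) := by ring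
      _ ≤ μ * s ^ β * (β * x * Real.exp β) := by gcongr
      _ = (β * μ * s ^ β) * x * Real.exp β := by ring
      _ ≤ k * ((n + 1) * (k : ℝ)⁻¹) * Real.exp β := by
          gcongr
          linarith
      _ = (n + 1) * Real.exp β := by field_simp
  rw [saddleMax, saddlePhase, ← hs]
  have h8 : t ≤ s + (n + 1) := by linarith
  linarith

/-- Only the window of length `(n + 1) / k` to the right of the saddle is kept. There the
exponential is comparable to its maximum, and the polynomial is bounded below in mean square with
step `1 / k`; every loss is a power of `k`. -/
theorem IsUpperWeight.exists_le_moment (hρ : IsUpperWeight β μ A N ρ) (hβ : 0 < β) (hμ : 0 < μ)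
    {c t₀ : ℝ} (hc : 0 < c)
    (hlow : ∀ t, t₀ ≤ t → c * ((1 + t) ^ N)⁻¹ * Real.exp (-μ * t ^ β) ≤ ρ t)
    {b : ℝ} (hb : 0 < b) (n : ℕ) : ∃ C : ℝ, ∃ K₀ : ℕ, ∀ k ≥ K₀,
      Real.exp (logMoment β μ k - C * Real.log k) * ‖gaussToL2 hb (psi b n k)‖ ^ 2 ≤
        ∫ x : Plane, ρ (b / 2 * ‖x‖ ^ 2) * ‖(psi b n k : Plane → ℂ) x‖ ^ 2 := by
  obtain ⟨B, K₁, hB⟩ := exists_le_density hβ hμ n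
  set D := (n.factorial : ℝ)⁻¹ * c * Real.exp (-B) * ((3 : ℝ) ^ (N + n))⁻¹ * ((4 : ℝ) ^ n)⁻¹ with hD
  have hD0 : 0 < D := by positivity
  have hlog : Tendsto (fun n : ℕ => Real.log (n : ℝ)) atTop atTop :=
    Real.tendsto_log_atTop.comp tendsto_natCast_atTop_atTop
  obtain ⟨K₂, hK⟩ := eventually_atTop.1 (((tendsto_saddle_natCast hβ hμ).eventually_ge_atTop
    (max 1 t₀)).and ((eventually_ge_atTop (n + 1)).and
      (hlog.eventually_ge_atTop (-Real.log D))))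
  -- The three summands come from the powers of `t`, from the polynomial, and from absorbing the
  -- constant `D`.
  refine ⟨(N + n) + (2 * n + 1) + 1, max K₁ K₂, fun k hk => ?_⟩
  obtain ⟨hs1, hkn, hlk⟩ := hK k ((le_max_right _ _).trans hk)
  have hkn' : (n : ℝ) + 1 ≤ k := by exact_mod_cast hkn
  have hn0 : (0 : ℝ) ≤ n := Nat.cast_nonneg n
  have hk1 : (1 : ℝ) ≤ k := by linarith
  have hk0 : (0 : ℝ) < k := by linarith
  set s := saddle β μ k with hs
  have hs2 : 1 ≤ s := (le_max_left _ _).trans hs1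
  have hsk : s ≤ k := saddle_le hβ hμ hk0
  have hinv : (n + 1) * (k : ℝ)⁻¹ ≤ 1 := by
    rw [← div_eq_mul_inv, div_le_one hk0]; exact hkn'
  set s' := s + (n + 1) * (k : ℝ)⁻¹ with hs'
  have hss' : s ≤ s' := by rw [hs']; linarith [(by positivity : 0 ≤ (n + 1) * (k : ℝ)⁻¹)]
  set G := c * Real.exp (saddleMax β μ k - B) * ((3 * (k : ℝ)) ^ (N + n))⁻¹ with hG
  have hGpos : 0 < G := by positivity
  have key : ∀ t ∈ Set.Ioc s s', G * (lagPoly n k).eval t ^ 2 ≤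
      ρ t * (t ^ (k - n) * Real.exp (-t) * (lagPoly n k).eval t ^ 2) := by
    intro t ht
    have ht0 : 0 < t := by linarith [ht.1]
    have htk : t ≤ 2 * k := by linarith [ht.2]
    have h1 := hB k ((le_max_left _ _).trans hk) t ht.1.le ht.2
    have h2 := hlow t (((le_max_right _ _).trans hs1).trans ht.1.le)
    have h3 : ((3 * (k : ℝ)) ^ (N + n))⁻¹ ≤ ((1 + t) ^ N)⁻¹ * (t ^ n)⁻¹ := by
      rw [← mul_inv, pow_add]
      gcongr <;> linarith
    have h4 : t ^ (k - n) = t ^ k * (t ^ n)⁻¹ := by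
      rw [eq_mul_inv_iff_mul_eq₀ (by positivity), ← pow_add, Nat.sub_add_cancel (by omega)]
    rw [← mul_assoc]
    refine mul_le_mul_of_nonneg_right ?_ (sq_nonneg _)
    calc G = c * ((3 * (k : ℝ)) ^ (N + n))⁻¹ * Real.exp (saddleMax β μ k - B) := by rw [hG]; ring
      _ ≤ c * (((1 + t) ^ N)⁻¹ * (t ^ n)⁻¹) * (t ^ k * (Real.exp (-t) * Real.exp (-μ * t ^ β))) := by
          gcongr
      _ = c * ((1 + t) ^ N)⁻¹ * Real.exp (-μ * t ^ β) * (t ^ (k - n) * Real.exp (-t)) := by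
          rw [h4]; ring
      _ ≤ _ := by gcongr
  have hint := hρ.integrableOn hβ hμ (by omega : n < k)
  have hsub : Set.Ioc s s' ⊆ Set.Ioi 0 := fun t ht => (by linarith [ht.1] : (0 : ℝ) < t)
  have h1 : G * ∫ t in s..s', (lagPoly n k).eval t ^ 2 ≤
      ∫ t in Set.Ioi (0 : ℝ), ρ t * (t ^ (k - n) * Real.exp (-t) * (lagPoly n k).eval t ^ 2) := by
    rw [intervalIntegral.integral_of_le hss', ← integral_const_mul]
    calc _ ≤ ∫ t in Set.Ioc s s', ρ t * (t ^ (k - n) * Real.exp (-t) * (lagPoly n k).eval t ^ 2) := by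
          refine setIntegral_mono_on ?_ (hint.mono_set hsub) measurableSet_Ioc key
          have hcont : Continuous fun t => G * (lagPoly n k).eval t ^ 2 := by fun_prop
          exact hcont.integrableOn_Icc.mono_set Set.Ioc_subset_Icc_self
      _ ≤ _ := by
          refine setIntegral_mono_set hint ?_ (LE.le.eventuallyLE hsub)
          filter_upwards [ae_restrict_mem measurableSet_Ioi] with t ht
          have ht' : 0 < t := ht
          exact mul_nonneg (hρ.nonneg t) (by positivity)
  have h2 := le_integral_sq_eval (natDegree_lagPoly_le n k) (by rw [coeff_lagPoly]; simp)
    (inv_pos.2 hk0) s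
  rw [integral_weight_psi hb ρ (by omega), mul_comm]
  gcongr
  have h3 : Real.exp (logMoment β μ k - ((N + n) + (2 * n + 1) + 1) * Real.log k) =
      (k.factorial : ℝ)⁻¹ * Real.exp (saddleMax β μ k - ((N + n) + (2 * n + 1) + 1) * Real.log k) := by
    rw [logMoment, sub_right_comm, Real.exp_sub _ (Real.log _), Real.exp_log (by positivity)]
    field_simp
  rw [h3, mul_inv, mul_comm (n.factorial : ℝ)⁻¹, mul_assoc]
  gcongr
  have hpow : ∀ d : ℕ, Real.exp (-(d * Real.log k)) = ((k : ℝ) ^ d)⁻¹ := fun d => by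
    rw [Real.exp_neg, mul_comm, Real.exp_mul, Real.exp_log hk0, Real.rpow_natCast]
  have hDk : (k : ℝ)⁻¹ ≤ D := by
    rw [← Real.log_le_log_iff (by positivity) hD0, Real.log_inv]
    linarith
  calc Real.exp (saddleMax β μ k - ((N + n) + (2 * n + 1) + 1) * Real.log k)
      = Real.exp (saddleMax β μ k) * ((k : ℝ) ^ (N + n))⁻¹ * ((k : ℝ) ^ (2 * n + 1))⁻¹ * (k : ℝ)⁻¹ := by
        have e1 := hpow (N + n)
        have e2 := hpow (2 * n + 1)
        have e3 := hpow 1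
        rw [pow_one] at e3
        rw [← e1, ← e2, ← e3, ← Real.exp_add, ← Real.exp_add, ← Real.exp_add]
        congr 1
        push_cast
        ring
    _ ≤ Real.exp (saddleMax β μ k) * ((k : ℝ) ^ (N + n))⁻¹ * ((k : ℝ) ^ (2 * n + 1))⁻¹ * D := by gcongr
    _ = (n.factorial : ℝ)⁻¹ * (G * (((4 : ℝ) ^ n)⁻¹ * (k : ℝ)⁻¹ ^ (2 * n + 1))) := by
        rw [hD, hG, mul_pow, sub_eq_add_neg, Real.exp_add, inv_pow, mul_inv]
        ring
    _ ≤ (n.factorial : ℝ)⁻¹ * (G * ∫ t in s..s', (lagPoly n k).eval t ^ 2) := by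
        gcongr
        rw [inv_mul_le_iff₀ (by positivity)]
        exact h2
    _ ≤ _ := by gcongr

end MomentBounds
end MetricLandau

namespace MetricLandau

/-! ### Forms that are diagonal on a coordinate subspace -/

section DiagonalForm

variable {ι E : Type*} [NormedAddCommGroup E] [InnerProductSpace ℂ E]
  (e : HilbertBasis ι ℂ E) {M : E →L[ℂ] E} {d : ι → ℝ} {s : Set ι} {f : E} {D : ℝ}

/-- Coefficients of `f` outside `s` vanish, so matrix elements of `M` leading out of `s` never enter
and need not be controlled. -/
theorem hasSum_re_inner_of_diagonal [DecidableEq ι]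
    (hM : ∀ i ∈ s, ∀ j ∈ s, inner ℂ (e i) (M (e j)) = if i = j then (d j : ℂ) else 0)
    (hf : ∀ i, i ∉ s → inner ℂ (e i) f = 0) :
    HasSum (fun i => d i * ‖inner ℂ (e i) f‖ ^ 2) (inner ℂ f (M f)).re := by
  have h1 : HasSum (fun j => inner ℂ (e j) f * inner ℂ f (M (e j))) (inner ℂ f (M f)) := by
    have h2 := ((e.hasSum_repr f).mapL M).mapL (innerSL ℂ f)
    refine h2.congr_fun fun j => ?_
    rw [innerSL_apply_apply, map_smul, inner_smul_right, e.repr_apply_apply]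
  refine (Complex.hasSum_re h1).congr_fun fun j => ?_
  by_cases hj : j ∈ s
  · have h3 : inner ℂ f (M (e j)) = (d j : ℂ) * starRingEnd ℂ (inner ℂ (e j) f) := by
      have h4 := e.hasSum_inner_mul_inner f (M (e j))
      refine h4.unique ?_
      have h5 : ∀ i, i ≠ j → inner ℂ f (e i) * inner ℂ (e i) (M (e j)) = 0 := fun i hi => by
        by_cases his : i ∈ s
        · rw [hM i his j hj, if_neg hi, mul_zero]
        · rw [← inner_conj_symm, hf i his, map_zero, zero_mul]
      have h6 := hasSum_single j h5
      rwa [hM j hj j hj, if_pos rfl, ← inner_conj_symm, mul_comm] at h6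
    rw [h3, mul_left_comm, Complex.mul_conj, ← Complex.ofReal_mul, Complex.ofReal_re,
      Complex.normSq_eq_norm_sq]
  · rw [hf j hj]; simp

theorem re_inner_le_of_diagonal [DecidableEq ι]
    (hM : ∀ i ∈ s, ∀ j ∈ s, inner ℂ (e i) (M (e j)) = if i = j then (d j : ℂ) else 0)
    (hf : ∀ i, i ∉ s → inner ℂ (e i) f = 0) (hd : ∀ i ∈ s, d i ≤ D) :
    (inner ℂ f (M f)).re ≤ D * ‖f‖ ^ 2 := by
  refine hasSum_le (fun i => ?_) (hasSum_re_inner_of_diagonal e hM hf)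
    ((hasSum_normSq_inner e f).mul_left D)
  by_cases hi : i ∈ s
  · exact mul_le_mul_of_nonneg_right (hd i hi) (by positivity)
  · rw [hf i hi]; simp

theorem le_re_inner_of_diagonal [DecidableEq ι]
    (hM : ∀ i ∈ s, ∀ j ∈ s, inner ℂ (e i) (M (e j)) = if i = j then (d j : ℂ) else 0)
    (hf : ∀ i, i ∉ s → inner ℂ (e i) f = 0) (hd : ∀ i ∈ s, D ≤ d i) :
    D * ‖f‖ ^ 2 ≤ (inner ℂ f (M f)).re := by
  refine hasSum_le (fun i => ?_) ((hasSum_normSq_inner e f).mul_left D)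
    (hasSum_re_inner_of_diagonal e hM hf)
  by_cases hi : i ∈ s
  · exact mul_le_mul_of_nonneg_right (hd i hi) (by positivity)
  · rw [hf i hi]; simp

end DiagonalForm

/-! ### Radial weights on a Landau level -/

section WeightForm

variable {b : ℝ} (hb : 0 < b) {ρ : ℝ → ℝ}

theorem memLp_radial (hρ : Measurable ρ) {B : ℝ} (hB : ∀ t, |ρ t| ≤ B) :
    MemLp (fun x : Plane => ((ρ (b / 2 * ‖x‖ ^ 2) : ℝ) : ℂ)) ∞ volume := by
  refine memLp_top_of_bound (Measurable.aestronglyMeasurable ?_) B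
    (Eventually.of_forall fun x => ?_)
  · exact Complex.measurable_ofReal.comp (hρ.comp (by fun_prop))
  · rw [Complex.norm_real]; exact hB _

variable (hσ : MemLp (fun x : Plane => ((ρ (b / 2 * ‖x‖ ^ 2) : ℝ) : ℂ)) ∞ volume)

/-- The operator `metricForm` of a scalar radial metric. -/
noncomputable def weightForm : L2 →L[ℂ] L2 :=
  ∑ j, (momComp hb j).adjoint ∘L mulOp _ hσ ∘L momComp hb j

theorem inner_weightForm (f g : L2) : inner ℂ f (weightForm hb hσ g) =
    ∑ j, inner ℂ (momComp hb j f) (mulOp _ hσ (momComp hb j g)) := by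
  simp only [weightForm, sum_apply, ContinuousLinearMap.comp_apply, inner_sum,
    ContinuousLinearMap.adjoint_inner_right]

theorem inner_mulOp_eq_integral {g : Plane → ℂ} (hg : MemLp g ∞ volume) (u v : L2) :
    inner ℂ u (mulOp g hg v) =
      ∫ x, g x * (starRingEnd ℂ ((u : Plane → ℂ) x) * (v : Plane → ℂ) x) := by
  rw [L2.inner_def]
  refine integral_congr_ae ?_
  filter_upwards [coeFn_mulOp g hg v] with x h
  rw [h, RCLike.inner_apply]
  ring

theorem re_inner_weightForm (f : L2) :
    Integrable (fun x : Plane => ρ (b / 2 * ‖x‖ ^ 2) * ∑ j, ‖momField hb f x j‖ ^ 2) ∧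
    (inner ℂ f (weightForm hb hσ f)).re =
      ∫ x : Plane, ρ (b / 2 * ‖x‖ ^ 2) * ∑ j, ‖momField hb f x j‖ ^ 2 := by
  have h1 : ∀ j, Integrable (fun x : Plane => ρ (b / 2 * ‖x‖ ^ 2) * ‖momField hb f x j‖ ^ 2) ∧
      inner ℂ (momComp hb j f) (mulOp _ hσ (momComp hb j f)) =
        ((∫ x : Plane, ρ (b / 2 * ‖x‖ ^ 2) * ‖momField hb f x j‖ ^ 2 : ℝ) : ℂ) := by
    intro j
    have h2 : ∀ x : Plane, ((ρ (b / 2 * ‖x‖ ^ 2) : ℝ) : ℂ) *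
        (starRingEnd ℂ ((momComp hb j f : Plane → ℂ) x) * (momComp hb j f : Plane → ℂ) x) =
        ((ρ (b / 2 * ‖x‖ ^ 2) * ‖momField hb f x j‖ ^ 2 : ℝ) : ℂ) := fun x => by
      rw [mul_comm (starRingEnd ℂ _), Complex.mul_conj, Complex.normSq_eq_norm_sq, momField]
      push_cast
      ring
    constructor
    · have h3 := L2.integrable_inner (𝕜 := ℂ) (momComp hb j f) (mulOp _ hσ (momComp hb j f))
      refine h3.re.congr ?_
      filter_upwards [coeFn_mulOp _ hσ (momComp hb j f)] with x h
      have h4 := congrArg Complex.re (h2 x)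
      rw [Complex.ofReal_re] at h4
      rw [← h4, h, RCLike.inner_apply]
      change Complex.re _ = _
      congr 1
      ring
    · rw [inner_mulOp_eq_integral, ← integral_complex_ofReal]
      simp only [h2]
  simp only [Finset.mul_sum]
  refine ⟨integrable_finsetSum _ fun j _ => (h1 j).1, ?_⟩
  rw [inner_weightForm, integral_finsetSum _ fun j _ => (h1 j).1, Complex.re_sum]
  refine Finset.sum_congr rfl fun j _ => ?_
  rw [(h1 j).2, Complex.ofReal_re]

/-- Passing from the two momenta to the ladder operators shows that the form on level `n` only sees
moments on the levels `n + 1` and `n - 1`. -/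
theorem sum_inner_gMom (S : L2 →L[ℂ] L2) (φ ψ : gaussSpan b) :
    ∑ j, inner ℂ (gaussToL2 hb (gMom b j φ)) (S (gaussToL2 hb (gMom b j ψ))) =
      (1 / 2 : ℂ) * (inner ℂ (gaussToL2 hb (raise b φ)) (S (gaussToL2 hb (raise b ψ))) +
        inner ℂ (gaussToL2 hb (lower b φ)) (S (gaussToL2 hb (lower b ψ)))) := by
  simp only [raise, lower, LinearMap.sub_apply, LinearMap.add_apply, LinearMap.smul_apply, map_sub,
    map_add, map_smul, inner_sub_left, inner_sub_right, inner_add_left, inner_add_right,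
    inner_smul_left, inner_smul_right, Complex.conj_I, Fin.sum_univ_two]
  linear_combination (inner ℂ (gaussToL2 hb (gMom b 1 φ)) (S (gaussToL2 hb (gMom b 1 ψ)))) *
    Complex.I_sq

/-- The moments of a radial weight. -/
noncomputable def radialMoment (b : ℝ) (ρ : ℝ → ℝ) (n k : ℕ) : ℝ :=
  ∫ x : Plane, ρ (b / 2 * ‖x‖ ^ 2) * ‖(psi b n k : Plane → ℂ) x‖ ^ 2

theorem inner_mulOp_psi (n k l : ℕ) :
    inner ℂ (gaussToL2 hb (psi b n k)) (mulOp _ hσ (gaussToL2 hb (psi b n l))) =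
      if k = l then (radialMoment b ρ n l : ℂ) else 0 := by
  have h1 : inner ℂ (gaussToL2 hb (psi b n k)) (mulOp _ hσ (gaussToL2 hb (psi b n l))) =
      ∫ x : Plane, ((ρ (b / 2 * ‖x‖ ^ 2) : ℝ) : ℂ) *
        (starRingEnd ℂ ((psi b n k : Plane → ℂ) x) * (psi b n l : Plane → ℂ) x) := by
    rw [inner_mulOp_eq_integral]
    refine integral_congr_ae ?_
    filter_upwards [coeFn_gaussToL2 hb (psi b n k), coeFn_gaussToL2 hb (psi b n l)] with x e1 e2
    rw [e1, e2]
  rw [h1]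
  split_ifs with hkl
  · subst hkl
    rw [radialMoment, ← integral_complex_ofReal]
    refine integral_congr_ae (Eventually.of_forall fun x => ?_)
    dsimp only
    rw [mul_comm (starRingEnd ℂ _), Complex.mul_conj, Complex.normSq_eq_norm_sq]
    push_cast
    rfl
  · exact integral_radial_psi_eq_zero (fun r => ((ρ (b / 2 * r ^ 2) : ℝ) : ℂ)) n hkl

/-- The coefficient of the part of the weight form which comes from the level below. -/
noncomputable def lowerMoment (b : ℝ) (ρ : ℝ → ℝ) : ℕ → ℕ → ℝ
  | 0, _ => 0
  | n + 1, k => (2 * b * (n + 1)) ^ 2 * radialMoment b ρ n k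

theorem inner_mulOp_lower_psi (n k l : ℕ) :
    inner ℂ (gaussToL2 hb (lower b (psi b n k))) (mulOp _ hσ (gaussToL2 hb (lower b (psi b n l)))) =
      if k = l then (lowerMoment b ρ n l : ℂ) else 0 := by
  cases n with
  | zero => simp [lower_psi_zero, lowerMoment]
  | succ n =>
    simp only [lower_psi_succ, map_smul, inner_smul_left, inner_smul_right, inner_mulOp_psi,
      lowerMoment]
    split_ifs
    · have h : starRingEnd ℂ (2 * b * (n + 1) : ℂ) = 2 * b * (n + 1) := by
        rw [show (2 * b * (n + 1) : ℂ) = ((2 * b * (n + 1) : ℝ) : ℂ) from by push_cast; rfl,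
          Complex.conj_ofReal]
      rw [h]
      push_cast
      ring
    · simp

/-- The diagonal matrix elements of the weight form. -/
noncomputable def weightElement (ρ : ℝ → ℝ) (p : ℕ × ℕ) : ℝ :=
  (landauLevel b p.1)⁻¹ * ((‖gaussToL2 hb (psi b p.1 p.2)‖ ^ 2)⁻¹ *
    (1 / 2 * (radialMoment b ρ (p.1 + 1) p.2 + lowerMoment b ρ p.1 p.2)))

/-- Within one level, distinct indices are distinct angular momenta, which a radial weight does not
couple. -/
theorem inner_weightForm_landauBasis {p p' : ℕ × ℕ} (h : p.1 = p'.1) :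
    inner ℂ (landauBasis hb p) (weightForm hb hσ (landauBasis hb p')) =
      if p = p' then (weightElement hb ρ p' : ℂ) else 0 := by
  obtain ⟨n, k⟩ := p
  obtain ⟨n', l⟩ := p'
  obtain rfl : n = n' := h
  have hs : (starRingEnd ℂ ((√(landauLevel b n))⁻¹ : ℂ)) = ((√(landauLevel b n))⁻¹ : ℂ) := by
    rw [← Complex.ofReal_inv, Complex.conj_ofReal]
  have hs2 : ((√(landauLevel b n))⁻¹ : ℂ) * ((√(landauLevel b n))⁻¹ : ℂ) =
      (((landauLevel b n)⁻¹ : ℝ) : ℂ) := by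
    rw [← mul_inv, ← Complex.ofReal_mul, Real.mul_self_sqrt (landauLevel_pos hb n).le,
      Complex.ofReal_inv]
  simp only [inner_weightForm, momComp_landauBasis, map_smul, inner_smul_left, inner_smul_right, hs]
  simp only [← mul_assoc, hs2, ← Finset.mul_sum, sum_inner_gMom]
  simp only [phi, map_smul, inner_smul_left, inner_smul_right, ← psi_succ, inner_mulOp_psi,
    inner_mulOp_lower_psi, Complex.conj_ofReal, Prod.mk.injEq, true_and, weightElement]
  split_ifs with hkl
  · subst hkl
    push_cast
    ring
  · simp

/-- The neighbouring levels enter with total weight `(2 b (n + 1) + 2 b n) / 2 = Λ_n`, so the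
element is at most a common bound for the normalized moments. -/
theorem weightElement_le {ρ : ℝ → ℝ} {n k : ℕ} {X : ℝ}
    (h1 : ∀ n' ≤ n + 1, radialMoment b ρ n' k ≤ X * ‖gaussToL2 hb (psi b n' k)‖ ^ 2) :
    weightElement hb ρ (n, k) ≤ X := by
  have hΛ := landauLevel_pos hb n
  have hψ := norm_psi_pos hb n k
  have h2 := h1 (n + 1) le_rfl
  rw [normSq_psi_succ] at h2
  have h3 : lowerMoment b ρ n k ≤ X * (2 * b * n * ‖gaussToL2 hb (psi b n k)‖ ^ 2) := by
    cases n with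
    | zero => simp [lowerMoment]
    | succ n =>
      have h4 := h1 n (by omega)
      rw [lowerMoment, normSq_psi_succ]
      have h5 := mul_le_mul_of_nonneg_left h4 (sq_nonneg (2 * b * ((n : ℝ) + 1)))
      push_cast
      linarith
  rw [weightElement, inv_mul_le_iff₀ hΛ, inv_mul_le_iff₀ (by positivity)]
  rw [landauLevel]
  linarith

/-- The level below is dropped; the level above alone carries weight `b (n + 1) ≥ Λ_n / 2`. -/
theorem le_weightElement {ρ : ℝ → ℝ} (hρ : ∀ t, 0 ≤ ρ t) {n k : ℕ} {X : ℝ} (hX : 0 ≤ X)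
    (h1 : X * ‖gaussToL2 hb (psi b (n + 1) k)‖ ^ 2 ≤ radialMoment b ρ (n + 1) k) :
    1 / 2 * X ≤ weightElement hb ρ (n, k) := by
  have hΛ := landauLevel_pos hb n
  have hψ := norm_psi_pos hb n k
  rw [normSq_psi_succ] at h1
  have h3 : 0 ≤ lowerMoment b ρ n k := by
    cases n with
    | zero => simp [lowerMoment]
    | succ n =>
      exact mul_nonneg (sq_nonneg _) (integral_nonneg fun x => mul_nonneg (hρ _) (sq_nonneg _))
  rw [weightElement, le_inv_mul_iff₀ hΛ, le_inv_mul_iff₀ (by positivity)]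
  rw [landauLevel]
  have h4 : 0 ≤ X * (b * ‖gaussToL2 hb (psi b n k)‖ ^ 2) := by positivity
  linarith

end WeightForm
end MetricLandau

namespace MetricLandau

/-! ### Sandwiching the metric between radial weights -/

section Sandwich

variable {b : ℝ} (hb : 0 < b) (m : Plane → Matrix (Fin 2) (Fin 2) ℂ)
  (hm : ∀ j k, MemLp (fun x => m x j k) ∞ (volume : Measure Plane))
  {β μ : ℝ} {ρ : ℝ → ℝ}

theorem re_inner_metricForm_le (hσ : MemLp (fun x : Plane => ((ρ (b / 2 * ‖x‖ ^ 2) : ℝ) : ℂ)) ∞ volume)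
    (h : ∀ x w, (matForm (m x) w).re ≤ ρ (b / 2 * ‖x‖ ^ 2) * ∑ j, ‖w j‖ ^ 2) (f : L2) :
    (inner ℂ f (metricForm hb m hm f)).re ≤ (inner ℂ f (weightForm hb hσ f)).re := by
  rw [(re_inner_metricForm hb m hm f).2, (re_inner_weightForm hb hσ f).2]
  exact integral_mono (re_inner_metricForm hb m hm f).1 (re_inner_weightForm hb hσ f).1
    fun x => h x _

theorem le_re_inner_metricForm (hσ : MemLp (fun x : Plane => ((ρ (b / 2 * ‖x‖ ^ 2) : ℝ) : ℂ)) ∞ volume)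
    (h : ∀ x w, ρ (b / 2 * ‖x‖ ^ 2) * ∑ j, ‖w j‖ ^ 2 ≤ (matForm (m x) w).re) (f : L2) :
    (inner ℂ f (weightForm hb hσ f)).re ≤ (inner ℂ f (metricForm hb m hm f)).re := by
  rw [(re_inner_metricForm hb m hm f).2, (re_inner_weightForm hb hσ f).2]
  exact integral_mono (re_inner_weightForm hb hσ f).1 (re_inner_metricForm hb m hm f).1
    fun x => h x _

theorem exists_uniform_moment_le {A : ℝ} {N : ℕ} (hρ : IsUpperWeight β μ A N ρ) (hβ : 0 < β)
    (hμ : 0 < μ) (q : ℕ) : ∃ C : ℝ, ∃ K₀ : ℕ, ∀ n ≤ q, ∀ k ≥ K₀, radialMoment b ρ n k ≤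
      Real.exp (logMoment β μ k + C * Real.log k) * ‖gaussToL2 hb (psi b n k)‖ ^ 2 := by
  induction q with
  | zero =>
    obtain ⟨C, K₀, h⟩ := hρ.exists_moment_le hβ hμ hb 0
    refine ⟨C, K₀, fun n hn k hk => ?_⟩
    obtain rfl : n = 0 := by omega
    exact h k hk
  | succ q ih =>
    obtain ⟨C₁, K₁, h₁⟩ := ih
    obtain ⟨C₂, K₂, h₂⟩ := hρ.exists_moment_le hβ hμ hb (q + 1)
    refine ⟨max C₁ C₂, max K₁ K₂, fun n hn k hk => ?_⟩
    have hl : 0 ≤ Real.log k := Real.log_natCast_nonneg k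
    rcases Nat.lt_or_eq_of_le hn with hn | rfl
    · refine (h₁ n (by omega) k ((le_max_left _ _).trans hk)).trans ?_
      gcongr
      exact le_max_left _ _
    · refine (h₂ k ((le_max_right _ _).trans hk)).trans ?_
      gcongr
      exact le_max_right _ _

/-- The metric need not be radial, only bounded above and below by radial weights with the same
exponential rate. Eventual monotonicity of the moments then turns bounds on entries into bounds on
all vectors of indices `≥ K` or `≤ K`. -/
theorem levelBounds_metricForm (hβ : 0 < β) (hμ : 0 < μ) {ρ₁ ρ₂ : ℝ → ℝ} {A₁ A₂ B₁ B₂ c t₀ : ℝ}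
    {N₁ N₂ : ℕ} (h₁ : IsUpperWeight β μ A₁ N₁ ρ₁) (h₂ : IsUpperWeight β μ A₂ N₂ ρ₂)
    (hB₁ : ∀ t, |ρ₁ t| ≤ B₁) (hB₂ : ∀ t, |ρ₂ t| ≤ B₂) (hc : 0 < c)
    (hlow : ∀ t, t₀ ≤ t → c * ((1 + t) ^ N₂)⁻¹ * Real.exp (-μ * t ^ β) ≤ ρ₂ t)
    (hle : ∀ x w, (matForm (m x) w).re ≤ ρ₁ (b / 2 * ‖x‖ ^ 2) * ∑ j, ‖w j‖ ^ 2)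
    (hge : ∀ x w, ρ₂ (b / 2 * ‖x‖ ^ 2) * ∑ j, ‖w j‖ ^ 2 ≤ (matForm (m x) w).re) :
    LevelBounds hb (metricForm hb m hm) (logMoment β μ) where
  upper q := by
    obtain ⟨C, K₁, hC⟩ := exists_uniform_moment_le hb h₁ hβ hμ (q + 1)
    obtain ⟨K₂, hK⟩ := exists_forall_logMoment_le hβ hμ C
    refine ⟨C, max K₁ K₂, fun K hKK f hf => ?_⟩
    have hσ := memLp_radial (b := b) h₁.measurable hB₁
    refine (re_inner_metricForm_le hb m hm hσ hle f).trans ?_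
    refine re_inner_le_of_diagonal (landauBasis hb)
      (fun p hp p' hp' => inner_weightForm_landauBasis hb hσ (hp.1.trans hp'.1.symm)) hf ?_
    rintro ⟨n, k⟩ ⟨rfl, hk⟩
    dsimp only at hk
    refine weightElement_le hb fun n' hn' => (hC n' hn' k ?_).trans ?_
    · exact (le_max_left _ _).trans (hKK.trans hk)
    · exact mul_le_mul_of_nonneg_right
        (Real.exp_le_exp.2 (hK K ((le_max_right _ _).trans hKK) k hk)) (sq_nonneg _)
  lower q := by
    obtain ⟨C, K₁, hC⟩ := h₂.exists_le_moment hβ hμ hc hlow hb (q + 1)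
    -- The additional `ln k ≥ ln 2` compensates the factor `1 / 2` in the bound for the diagonal
    -- elements.
    obtain ⟨K₂, hK⟩ := exists_forall_logMoment_le hβ hμ (-(C + 1))
    refine ⟨C + 1, max 2 (max K₁ K₂), fun K hKK f hf => ?_⟩
    have hσ := memLp_radial (b := b) h₂.measurable hB₂
    refine le_trans ?_ (le_re_inner_metricForm hb m hm hσ hge f)
    refine le_re_inner_of_diagonal (landauBasis hb)
      (fun p hp p' hp' => inner_weightForm_landauBasis hb hσ (hp.1.trans hp'.1.symm)) hf ?_
    rintro ⟨n, k⟩ ⟨rfl, hk, hkK⟩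
    dsimp only at hk hkK
    have hk2 : 2 ≤ k := (le_max_left _ _).trans hk
    refine le_trans ?_ (le_weightElement hb h₂.nonneg (Real.exp_pos _).le
      (hC k (((le_max_left _ _).trans (le_max_right _ _)).trans hk)))
    have e1 := hK k (((le_max_right _ _).trans (le_max_right _ _)).trans hk) K hkK
    have e2 : Real.log 2 ≤ Real.log k :=
      Real.log_le_log two_pos (by exact_mod_cast hk2)
    have e3 : (1 / 2 : ℝ) = Real.exp (-Real.log 2) := by
      rw [Real.exp_neg, Real.exp_log two_pos, one_div]
    rw [e3, ← Real.exp_add]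
    exact Real.exp_le_exp.2 (by linarith)
  tendsto := tendsto_logMoment hβ hμ
  step := logMoment_step hβ hμ

end Sandwich

/-! ### Matrix forms and extreme eigenvalues -/

section Eigenvalues

variable {M : Matrix (Fin 2) (Fin 2) ℂ}

theorem re_matForm_sub_algebraMap (r : ℝ) (w : Fin 2 → ℂ) :
    (matForm (M - algebraMap ℝ _ r) w).re = (matForm M w).re - r * ∑ j, ‖w j‖ ^ 2 := by
  have h1 : matForm (algebraMap ℝ (Matrix (Fin 2) (Fin 2) ℂ) r) w =
      ((r * ∑ j, ‖w j‖ ^ 2 : ℝ) : ℂ) := by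
    rw [matForm, Algebra.algebraMap_eq_smul_one, Matrix.smul_mulVec, Matrix.one_mulVec]
    simp only [dotProduct, Fin.sum_univ_two, Pi.smul_apply, Pi.star_apply, Complex.real_smul]
    have h2 : ∀ z : ℂ, star z * (r * z) = ((r * ‖z‖ ^ 2 : ℝ) : ℂ) := fun z => by
      have := Complex.mul_conj z
      rw [Complex.normSq_eq_norm_sq] at this
      push_cast at this ⊢
      rw [← this]
      change starRingEnd ℂ z * _ = _
      ring
    rw [h2, h2]
    push_cast
    ring
  have h3 : matForm (M - algebraMap ℝ _ r) w = matForm M w - matForm (algebraMap ℝ _ r) w := by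
    simp only [matForm, Matrix.sub_mulVec, dotProduct_sub]
  rw [h3, h1, Complex.sub_re, Complex.ofReal_re]

theorem isHermitian_algebraMap (r : ℝ) :
    (algebraMap ℝ (Matrix (Fin 2) (Fin 2) ℂ) r).IsHermitian := by
  rw [Algebra.algebraMap_eq_smul_one, Matrix.IsHermitian, Matrix.conjTranspose_smul]
  simp

theorem minEigenvalue_mul_le (hM : M.IsHermitian) (w : Fin 2 → ℂ) :
    minEigenvalue M * ∑ j, ‖w j‖ ^ 2 ≤ (matForm M w).re := by
  have h1 : (M - algebraMap ℝ _ (minEigenvalue M)).PosSemidef := by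
    have h2 := hM.sub (isHermitian_algebraMap (minEigenvalue M))
    rw [h2.posSemidef_iff_eigenvalues_nonneg]
    intro i
    have h3 := h2.eigenvalues_mem_spectrum_real i
    rw [← spectrum.sub_singleton_eq] at h3
    obtain ⟨s, hs, t, ht, hst⟩ := h3
    have h4 : minEigenvalue M ≤ s := csInf_le M.finite_real_spectrum.bddBelow hs
    rw [Set.mem_singleton_iff] at ht
    subst ht
    rw [← hst]
    exact sub_nonneg.2 h4
  have h5 := (Complex.nonneg_iff.1 (h1.dotProduct_mulVec_nonneg w)).1
  have h6 := re_matForm_sub_algebraMap (M := M) (minEigenvalue M) w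
  rw [matForm] at h6
  linarith

theorem le_maxEigenvalue_mul (hM : M.IsHermitian) (w : Fin 2 → ℂ) :
    (matForm M w).re ≤ maxEigenvalue M * ∑ j, ‖w j‖ ^ 2 := by
  have h1 : (algebraMap ℝ _ (maxEigenvalue M) - M).PosSemidef := by
    have h2 := (isHermitian_algebraMap (maxEigenvalue M)).sub hM
    rw [h2.posSemidef_iff_eigenvalues_nonneg]
    intro i
    have h3 := h2.eigenvalues_mem_spectrum_real i
    rw [← spectrum.singleton_sub_eq] at h3
    obtain ⟨t, ht, s, hs, hst⟩ := h3
    have h4 : s ≤ maxEigenvalue M := le_csSup M.finite_real_spectrum.bddAbove hs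
    rw [Set.mem_singleton_iff] at ht
    subst ht
    rw [← hst]
    exact sub_nonneg.2 h4
  have h5 := (Complex.nonneg_iff.1 (h1.dotProduct_mulVec_nonneg w)).1
  have h6 := re_matForm_sub_algebraMap (M := M) (maxEigenvalue M) w
  rw [matForm, ← neg_sub, Matrix.neg_mulVec, dotProduct_neg, Complex.neg_re] at h6
  linarith

theorem nonneg_of_mem_spectrum (hM : M.PosSemidef) {r : ℝ} (hr : r ∈ spectrum ℝ M) : 0 ≤ r := by
  rw [hM.isHermitian.spectrum_real_eq_range_eigenvalues] at hr
  obtain ⟨i, rfl⟩ := hr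
  exact hM.eigenvalues_nonneg i

theorem minEigenvalue_nonneg (hM : M.PosSemidef) : 0 ≤ minEigenvalue M :=
  Real.sInf_nonneg fun _ hr => nonneg_of_mem_spectrum hM hr

theorem re_matForm_le {C : ℝ} (hC : ∀ j k, ‖M j k‖ ≤ C) (w : Fin 2 → ℂ) :
    (matForm M w).re ≤ 2 * C * ∑ j, ‖w j‖ ^ 2 := by
  have h0 : 0 ≤ C := (norm_nonneg _).trans (hC 0 0)
  have h1 : ∀ j k, ‖star (w j) * (M j k * w k)‖ ≤ C * (‖w j‖ * ‖w k‖) := fun j k => by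
    rw [norm_mul, norm_mul, norm_star]
    have := mul_le_mul_of_nonneg_right (hC j k) (mul_nonneg (norm_nonneg (w j)) (norm_nonneg (w k)))
    linarith
  have h2 : ‖matForm M w‖ ≤ ∑ j, ∑ k, C * (‖w j‖ * ‖w k‖) := by
    simp only [matForm, dotProduct, Matrix.mulVec, Finset.mul_sum]
    exact (norm_sum_le _ _).trans (Finset.sum_le_sum fun j _ =>
      (norm_sum_le _ _).trans (Finset.sum_le_sum fun k _ => h1 j k))
  refine ((Complex.re_le_norm _).trans h2).trans ?_
  simp only [Fin.sum_univ_two]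
  have h3 := mul_nonneg h0 (sq_nonneg (‖w 0‖ - ‖w 1‖))
  nlinarith

end Eigenvalues
end MetricLandau

/-! ### Radial weights from the eigenvalue asymptotics -/

namespace MetricLandau

theorem SmoothBounded.memLp {f : Plane → ℂ} (h : SmoothBounded f) :
    MemLp f ∞ (volume : Measure Plane) := by
  obtain ⟨C, hC⟩ := h.2 0
  refine memLp_top_of_bound h.1.continuous.aestronglyMeasurable C (Eventually.of_forall fun x => ?_)
  simpa using hC x

theorem exists_norm_entry_le {m : Plane → Matrix (Fin 2) (Fin 2) ℂ}
    (hm : ∀ j k, SmoothBounded fun x => m x j k) : ∃ C : ℝ, ∀ x j k, ‖m x j k‖ ≤ C := by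
  have h1 : ∀ j k, ∃ C : ℝ, ∀ x, ‖m x j k‖ ≤ C := fun j k => by
    obtain ⟨C, hC⟩ := (hm j k).2 0
    exact ⟨C, fun x => by simpa using hC x⟩
  choose C hC using h1
  refine ⟨∑ j, ∑ k, |C j k|, fun x j k => (hC j k x).trans ((le_abs_self _).trans ?_)⟩
  refine le_trans ?_ (Finset.single_le_sum (f := fun j => ∑ k, |C j k|)
    (fun j _ => Finset.sum_nonneg fun k _ => abs_nonneg _) (Finset.mem_univ j))
  exact Finset.single_le_sum (f := fun k => |C j k|) (fun k _ => abs_nonneg _) (Finset.mem_univ k)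

theorem mul_norm_rpow_eq {b γ β : ℝ} (hb : 0 < b) (x : Plane) :
    γ * (2 / b) ^ β * (b / 2 * ‖x‖ ^ 2) ^ β = γ * ‖x‖ ^ (2 * β) := by
  rw [mul_assoc, ← Real.mul_rpow (by positivity) (by positivity), Real.rpow_mul (norm_nonneg x)]
  congr 2
  rw [Real.rpow_two]
  field_simp

theorem exists_log_bound {β γ : ℝ} {u : Plane → ℝ}
    (h : (fun x => Real.log (u x) - (-γ * ‖x‖ ^ (2 * β)))
      =O[Bornology.cobounded Plane] fun x => Real.log ‖x‖) :
    ∃ R : ℝ, 1 ≤ R ∧ ∃ N : ℕ, ∀ x, R ≤ ‖x‖ →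
      |Real.log (u x) + γ * ‖x‖ ^ (2 * β)| ≤ N * Real.log ‖x‖ := by
  obtain ⟨C, hC⟩ := h.bound
  obtain ⟨R, -, hR⟩ := (hasBasis_cobounded_norm.eventually_iff).1 hC
  refine ⟨max 1 R, le_max_left _ _, ⌈|C|⌉₊, fun x hx => ?_⟩
  have h1 := hR (show R ≤ ‖x‖ from (le_max_right _ _).trans hx)
  have hl : 0 ≤ Real.log ‖x‖ := Real.log_nonneg ((le_max_left _ _).trans hx)
  rw [Real.norm_eq_abs, Real.norm_of_nonneg hl, sub_eq_add_neg, neg_mul, neg_neg] at h1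
  refine h1.trans (mul_le_mul_of_nonneg_right ((le_abs_self C).trans (Nat.le_ceil _)) hl)

theorem pow_norm_le {b : ℝ} (hb : 0 < b) {x : Plane} (hx : 1 ≤ ‖x‖) (N : ℕ) :
    ‖x‖ ^ N ≤ (2 / b) ^ N * (1 + b / 2 * ‖x‖ ^ 2) ^ N := by
  rw [← mul_pow]
  gcongr
  have h1 : 2 / b * (1 + b / 2 * ‖x‖ ^ 2) = 2 / b + ‖x‖ ^ 2 := by field_simp
  have h2 : 0 < 2 / b := by positivity
  nlinarith

variable {b β γ μ : ℝ} {m : Plane → Matrix (Fin 2) (Fin 2) ℂ}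

/-- The weight is the smaller of a global bound and the decaying profile. The first keeps it
bounded; the second is valid at large distance by hypothesis and near the origin because `A` is
large. -/
theorem exists_upper_weight (hb : 0 < b) (hm : ∀ j k, SmoothBounded fun x => m x j k)
    (hpos : ∀ x, (m x).PosSemidef) (hβ : 0 < β) (hμ0 : 0 < μ) (hμ : μ = γ * (2 / b) ^ β)
    (hmax : (fun x => Real.log (maxEigenvalue (m x)) - (-γ * ‖x‖ ^ (2 * β)))
      =O[Bornology.cobounded Plane] fun x => Real.log ‖x‖) :
    ∃ A B : ℝ, ∃ N : ℕ, ∃ ρ, IsUpperWeight β μ A N ρ ∧ (∀ t, |ρ t| ≤ B) ∧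
      ∀ x w, (matForm (m x) w).re ≤ ρ (b / 2 * ‖x‖ ^ 2) * ∑ j, ‖w j‖ ^ 2 := by
  obtain ⟨C, hC⟩ := exists_norm_entry_le hm
  obtain ⟨R, hR1, N, hR⟩ := exists_log_bound hmax
  have hC0 : 0 ≤ C := (norm_nonneg _).trans (hC 0 0 0)
  set A := (2 / b) ^ N + 2 * C * Real.exp (μ * (b / 2 * R ^ 2) ^ β) with hA
  set ρ : ℝ → ℝ := fun t => min (2 * C) (A * (1 + |t|) ^ N * Real.exp (-μ * |t| ^ β)) with hρ
  have hρ0 : ∀ t, 0 ≤ ρ t := fun t => le_min (by positivity) (by positivity)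
  refine ⟨A, 2 * C, N, ρ, ⟨?_, hρ0, fun t ht => ?_⟩, fun t => ?_, fun x w => ?_⟩
  · refine Measurable.min measurable_const (Continuous.measurable ?_)
    have h1 : Continuous fun t : ℝ => |t| ^ β :=
      (Real.continuous_rpow_const hβ.le).comp continuous_abs
    fun_prop
  · refine (min_le_right _ _).trans_eq ?_
    rw [abs_of_nonneg ht]
  · rw [abs_of_nonneg (hρ0 t)]
    exact min_le_left _ _
  · have hS : 0 ≤ ∑ j, ‖w j‖ ^ 2 := Finset.sum_nonneg fun j _ => sq_nonneg _
    rw [hρ, min_mul_of_nonneg _ _ hS]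
    have h1 := re_matForm_le (hC x) w
    have ht0 : 0 ≤ b / 2 * ‖x‖ ^ 2 := by positivity
    refine le_min h1 ?_
    rw [abs_of_nonneg ht0]
    rcases le_or_gt R ‖x‖ with hx | hx
    · refine (le_maxEigenvalue_mul (hpos x).isHermitian w).trans ?_
      gcongr
      have h2 := (abs_le.1 (hR x hx)).2
      have hx0 : 0 < ‖x‖ := by linarith
      have h3 := mul_norm_rpow_eq (γ := γ) (β := β) hb x
      rw [← hμ] at h3
      -- The inequality `y ≤ exp (log y)` holds for every real `y`, so positivity of the eigenvalue
      -- is not needed.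
      calc maxEigenvalue (m x) ≤ Real.exp (Real.log (maxEigenvalue (m x))) := Real.le_exp_log _
        _ ≤ Real.exp (N * Real.log ‖x‖ + -μ * (b / 2 * ‖x‖ ^ 2) ^ β) :=
          Real.exp_le_exp.2 (by linarith)
        _ = ‖x‖ ^ N * Real.exp (-μ * (b / 2 * ‖x‖ ^ 2) ^ β) := by
          rw [Real.exp_add, mul_comm (N : ℝ), Real.exp_mul (Real.log _), Real.exp_log hx0, Real.rpow_natCast]
        _ ≤ _ := by
          gcongr
          refine (pow_norm_le hb (hR1.trans hx) N).trans ?_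
          gcongr
          rw [hA]
          linarith [(by positivity : 0 ≤ 2 * C * Real.exp (μ * (b / 2 * R ^ 2) ^ β))]
    · refine h1.trans (mul_le_mul_of_nonneg_right ?_ hS)
      have h2 : (b / 2 * ‖x‖ ^ 2) ^ β ≤ (b / 2 * R ^ 2) ^ β := by gcongr
      have h3 : 1 ≤ (1 + b / 2 * ‖x‖ ^ 2) ^ N := one_le_pow₀ (by linarith)
      have h4 : 1 ≤ Real.exp (μ * (b / 2 * R ^ 2) ^ β) * Real.exp (-μ * (b / 2 * ‖x‖ ^ 2) ^ β) := by
        rw [← Real.exp_add]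
        refine Real.one_le_exp ?_
        have := mul_le_mul_of_nonneg_left h2 hμ0.le
        linarith
      calc 2 * C ≤ 2 * C * (Real.exp (μ * (b / 2 * R ^ 2) ^ β) *
            Real.exp (-μ * (b / 2 * ‖x‖ ^ 2) ^ β)) := le_mul_of_one_le_right (by positivity) h4
        _ = 2 * C * Real.exp (μ * (b / 2 * R ^ 2) ^ β) * 1 *
            Real.exp (-μ * (b / 2 * ‖x‖ ^ 2) ^ β) := by ring
        _ ≤ _ := by
          gcongr
          rw [hA]
          linarith [(by positivity : 0 ≤ (2 / b) ^ N)]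

/-- With the default `log 0 = 0`, a zero eigenvalue would force `γ r ^ (2 β) ≤ N ln r` at `r = ‖x‖`,
impossible for large `r`. -/
theorem eventually_minEigenvalue_pos (hpos : ∀ x, (m x).PosSemidef) (hβ : 0 < β) (hγ : 0 < γ)
    {N : ℕ} {R : ℝ} (hR : ∀ x, R ≤ ‖x‖ →
      |Real.log (minEigenvalue (m x)) + γ * ‖x‖ ^ (2 * β)| ≤ N * Real.log ‖x‖) :
    ∃ R', R ≤ R' ∧ ∀ x, R' ≤ ‖x‖ → 0 < minEigenvalue (m x) := by
  have h1 : ∀ᶠ r : ℝ in atTop, N * Real.log r < γ * r ^ (2 * β) := by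
    have h2 : (fun r : ℝ => N * Real.log r) =o[atTop] fun r : ℝ => γ * r ^ (2 * β) :=
      ((isLittleO_log_rpow_atTop (by linarith : 0 < 2 * β)).const_mul_left _).const_mul_right hγ.ne'
    filter_upwards [h2.bound (by norm_num : (0 : ℝ) < 1 / 2), eventually_gt_atTop 1] with r hr hr1
    have h3 : 0 < γ * r ^ (2 * β) := by positivity
    rw [Real.norm_of_nonneg h3.le] at hr
    linarith [Real.le_norm_self ((N : ℝ) * Real.log r)]
  obtain ⟨R₀, hR₀⟩ := eventually_atTop.1 h1
  refine ⟨max R R₀, le_max_left _ _, fun x hx => ?_⟩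
  refine (minEigenvalue_nonneg (hpos x)).lt_of_ne' fun h0 => ?_
  have h2 := (abs_le.1 (hR x ((le_max_left _ _).trans hx))).2
  rw [h0, Real.log_zero, zero_add] at h2
  exact absurd h2 (not_le.2 (hR₀ _ ((le_max_right _ _).trans hx)))

/-- The weight is cut off to zero below `t₀`, where the smaller eigenvalue may vanish; only the tail
matters for large angular index. -/
theorem exists_lower_weight (hb : 0 < b) (hpos : ∀ x, (m x).PosSemidef) (hβ : 0 < β) (hγ : 0 < γ)
    (hμ0 : 0 < μ) (hμ : μ = γ * (2 / b) ^ β)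
    (hmin : (fun x => Real.log (minEigenvalue (m x)) - (-γ * ‖x‖ ^ (2 * β)))
      =O[Bornology.cobounded Plane] fun x => Real.log ‖x‖) :
    ∃ A B c t₀ : ℝ, ∃ N : ℕ, ∃ ρ, IsUpperWeight β μ A N ρ ∧ (∀ t, |ρ t| ≤ B) ∧ 0 < c ∧
      (∀ t, t₀ ≤ t → c * ((1 + t) ^ N)⁻¹ * Real.exp (-μ * t ^ β) ≤ ρ t) ∧
      ∀ x w, ρ (b / 2 * ‖x‖ ^ 2) * ∑ j, ‖w j‖ ^ 2 ≤ (matForm (m x) w).re := by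
  obtain ⟨R₁, hR1, N, hR₁⟩ := exists_log_bound hmin
  obtain ⟨R, hRR, hR⟩ := eventually_minEigenvalue_pos hpos hβ hγ hR₁
  have hR0 : 1 ≤ R := hR1.trans hRR
  set c := ((2 / b) ^ N)⁻¹ with hc
  have hc0 : 0 < c := by positivity
  set t₀ := b / 2 * R ^ 2 with ht₀
  have ht00 : 0 ≤ t₀ := by positivity
  set ρ : ℝ → ℝ := (Set.Ici t₀).indicator
    fun t => c * ((1 + |t|) ^ N)⁻¹ * Real.exp (-μ * |t| ^ β) with hρ
  have hpt : ∀ t : ℝ, 0 ≤ c * ((1 + |t|) ^ N)⁻¹ * Real.exp (-μ * |t| ^ β) := fun t => by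
    positivity
  have hρ0 : ∀ t, 0 ≤ ρ t := fun t => Set.indicator_nonneg (fun t _ => hpt t) t
  have hρle : ∀ t, ρ t ≤ c * ((1 + |t|) ^ N)⁻¹ * Real.exp (-μ * |t| ^ β) := fun t =>
    Set.indicator_le_self' (fun t _ => hpt t) t
  have hinv : ∀ t : ℝ, ((1 + |t|) ^ N)⁻¹ ≤ 1 := fun t =>
    inv_le_one_of_one_le₀ (one_le_pow₀ (by linarith [abs_nonneg t]))
  refine ⟨c, c, c, t₀, N, ρ, ⟨?_, hρ0, fun t ht => (hρle t).trans ?_⟩, fun t => ?_, hc0,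
    fun t ht => ?_, fun x w => ?_⟩
  · refine Measurable.indicator (Continuous.measurable ?_) measurableSet_Ici
    have h1 : Continuous fun t : ℝ => |t| ^ β :=
      (Real.continuous_rpow_const hβ.le).comp continuous_abs
    have h2 : Continuous fun t : ℝ => ((1 + |t|) ^ N)⁻¹ :=
      Continuous.inv₀ (by fun_prop) fun t => by positivity
    fun_prop
  · rw [abs_of_nonneg ht]
    gcongr
    have h1 := hinv t
    rw [abs_of_nonneg ht] at h1
    exact h1.trans (one_le_pow₀ (by linarith))
  · rw [abs_of_nonneg (hρ0 t)]
    refine (hρle t).trans ?_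
    have h1 : Real.exp (-μ * |t| ^ β) ≤ 1 := by
      rw [Real.exp_le_one_iff]
      have : 0 ≤ μ * |t| ^ β := by positivity
      linarith
    calc _ ≤ c * 1 * 1 := by
          gcongr
          exact hinv t
      _ = c := by ring
  · rw [hρ, Set.indicator_of_mem (show t ∈ Set.Ici t₀ from ht), abs_of_nonneg (ht00.trans ht)]
  · have hS : 0 ≤ ∑ j, ‖w j‖ ^ 2 := Finset.sum_nonneg fun j _ => sq_nonneg _
    refine le_trans ?_ (minEigenvalue_mul_le (hpos x).isHermitian w)
    gcongr
    have hx00 : 0 ≤ b / 2 * ‖x‖ ^ 2 := by positivity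
    by_cases hx : t₀ ≤ b / 2 * ‖x‖ ^ 2
    · have hxR : R ≤ ‖x‖ := by
        rw [ht₀] at hx
        have h1 : R ^ 2 ≤ ‖x‖ ^ 2 := le_of_mul_le_mul_left hx (by positivity)
        exact le_of_sq_le_sq h1 (norm_nonneg x)
      rw [hρ, Set.indicator_of_mem (show _ ∈ Set.Ici t₀ from hx), abs_of_nonneg hx00]
      have h2 := (abs_le.1 (hR₁ x (hRR.trans hxR))).1
      have hx0 : 0 < ‖x‖ := by linarith
      have h3 := mul_norm_rpow_eq (γ := γ) (β := β) hb x
      rw [← hμ] at h3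
      calc c * ((1 + b / 2 * ‖x‖ ^ 2) ^ N)⁻¹ * Real.exp (-μ * (b / 2 * ‖x‖ ^ 2) ^ β)
          ≤ (‖x‖ ^ N)⁻¹ * Real.exp (-μ * (b / 2 * ‖x‖ ^ 2) ^ β) := by
            rw [hc, ← mul_inv]
            gcongr
            exact pow_norm_le hb (hR0.trans hxR) N
        _ = Real.exp (-(N * Real.log ‖x‖) + -μ * (b / 2 * ‖x‖ ^ 2) ^ β) := by
            rw [Real.exp_add, Real.exp_neg, mul_comm (N : ℝ), Real.exp_mul (Real.log _), Real.exp_log hx0,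
              Real.rpow_natCast]
        _ ≤ Real.exp (Real.log (minEigenvalue (m x))) := Real.exp_le_exp.2 (by linarith)
        _ = minEigenvalue (m x) := Real.exp_log (hR x hxR)
    · rw [hρ, Set.indicator_of_notMem (show _ ∉ Set.Ici t₀ from hx)]
      exact minEigenvalue_nonneg (hpos x)

end MetricLandau

namespace MetricLandau

/-! ### Analytic inversion, Taylor remainder, Stirling -/

section Expansion

theorem exists_analytic_inverse {e : ℝ → ℝ} {a : ℝ} (he : AnalyticAt ℝ e a) (hd : deriv e a ≠ 0) :
    ∃ σ : ℝ → ℝ, AnalyticAt ℝ σ (e a) ∧ σ (e a) = a ∧ ∀ᶠ y in 𝓝 (e a), e (σ y) = y := by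
  have hcd : ContDiffAt ℝ ω e a := he.contDiffAt
  have hf : HasFDerivAt e
      (ContinuousLinearEquiv.unitsEquivAut ℝ (Units.mk0 _ hd) : ℝ →L[ℝ] ℝ) a := by
    have h1 := he.differentiableAt.hasDerivAt.hasFDerivAt
    convert! h1 using 1
  have hn : (ω : WithTop ℕ∞) ≠ 0 := by simp
  exact ⟨hcd.localInverse hf hn, (hcd.to_localInverse hf hn).analyticAt,
    hcd.localInverse_apply_image hf hn, (hcd.hasStrictFDerivAt' hf hn).eventually_right_inverse⟩

/-- The remainder at `k ^ a` is `O(k ^ (a J))`, and `a J + 1 ≤ 0` makes it bounded after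
multiplication by `k`. -/
theorem isBigO_taylor {f : ℝ → ℝ} (hf : AnalyticAt ℝ f 0) {a : ℝ} (ha : a < 0) {J : ℕ}
    (hJ : a * J + 1 ≤ 0) :
    (fun k : ℕ => (k : ℝ) * f ((k : ℝ) ^ a) -
      ∑ j ∈ Finset.range J, iteratedDeriv j f 0 / (j.factorial : ℝ) * (k : ℝ) ^ (a * j + 1))
      =O[atTop] fun _ : ℕ => (1 : ℝ) := by
  have hlim : Tendsto (fun k : ℕ => (k : ℝ) ^ a) atTop (𝓝 0) := by
    have := (tendsto_rpow_neg_atTop (neg_pos.2 ha)).comp tendsto_natCast_atTop_atTop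
    simpa [Function.comp_def] using this
  have h1 := (hf.hasFPowerSeriesAt.isBigO_sub_partialSum_pow J).comp_tendsto hlim
  have h2 := (isBigO_refl (fun k : ℕ => (k : ℝ)) atTop).mul h1
  refine (h2.congr' ?_ EventuallyEq.rfl).trans (IsBigO.of_bound 1 ?_)
  · filter_upwards [eventually_gt_atTop 0] with k hk
    have hk0 : (0 : ℝ) < k := by exact_mod_cast hk
    simp only [Function.comp_apply, zero_add, mul_sub, FormalMultilinearSeries.partialSum,
      Finset.mul_sum]
    congr 1
    refine Finset.sum_congr rfl fun j _ => ?_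
    rw [FormalMultilinearSeries.ofScalars_apply_eq, smul_eq_mul, ← Real.rpow_natCast,
      ← Real.rpow_mul hk0.le, Real.rpow_add hk0, Real.rpow_one]
    ring
  · filter_upwards [eventually_ge_atTop 1] with k hk
    have hk1 : (1 : ℝ) ≤ k := by exact_mod_cast hk
    have hk0 : (0 : ℝ) < k := by linarith
    have h3 : (k : ℝ) * ((k : ℝ) ^ a) ^ J = (k : ℝ) ^ (a * J + 1) := by
      rw [← Real.rpow_natCast, ← Real.rpow_mul hk0.le, Real.rpow_add hk0, Real.rpow_one, mul_comm]
    simp only [Function.comp_apply, Real.norm_eq_abs, abs_of_pos (Real.rpow_pos_of_pos hk0 a), h3,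
      abs_of_pos (Real.rpow_pos_of_pos hk0 _), abs_one, mul_one]
    exact Real.rpow_le_one_of_one_le_of_nonpos hk1 hJ

theorem isBigO_one_log {u : ℕ → ℝ} (hu : u =O[atTop] fun _ : ℕ => (1 : ℝ)) :
    u =O[atTop] fun k : ℕ => Real.log (k : ℝ) := by
  refine hu.trans (IsLittleO.isBigO ?_)
  rw [isLittleO_one_left_iff]
  exact tendsto_norm_atTop_atTop.comp
    (Real.tendsto_log_atTop.comp tendsto_natCast_atTop_atTop)

theorem log_factorial_isBigO :
    (fun k : ℕ => Real.log (k.factorial : ℝ) - (k * Real.log k - k)) =O[atTop]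
      fun k : ℕ => Real.log (k : ℝ) := by
  have hlim : Tendsto (fun k => Real.log (Stirling.stirlingSeq k)) atTop (𝓝 (Real.log √Real.pi)) :=
    ((Real.continuousAt_log (by positivity)).tendsto).comp Stirling.tendsto_stirlingSeq_sqrt_pi
  have h1 := isBigO_one_log (hlim.isBigO_one ℝ)
  have h2 := isBigO_one_log (isBigO_refl (fun _ : ℕ => (1 : ℝ)) atTop)
  have h3 := (isBigO_refl (fun k : ℕ => Real.log (k : ℝ)) atTop).const_mul_left (1 / 2)
  refine ((h1.add (h2.const_mul_left (1 / 2 * Real.log 2))).add h3).congr' ?_ EventuallyEq.rfl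
  filter_upwards [eventually_gt_atTop 0] with k hk
  have hk0 : (0 : ℝ) < k := by exact_mod_cast hk
  rw [Stirling.log_stirlingSeq_formula, Real.log_mul two_ne_zero hk0.ne',
    Real.log_div hk0.ne' (Real.exp_ne_zero _), Real.log_exp]
  ring

end Expansion

/-! ### Rescaled critical points and the expansions -/

section CriticalPoints

variable {β μ : ℝ}

theorem analyticAt_rpow {s : ℝ} (hs : 0 < s) (p : ℝ) : AnalyticAt ℝ (fun s : ℝ => s ^ p) s := by
  have h : AnalyticAt ℝ (fun s : ℝ => Real.exp (Real.log s * p)) s :=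
    ((analyticAt_log hs).mul analyticAt_const).rexp
  refine h.congr ?_
  filter_upwards [lt_mem_nhds hs] with t ht
  exact (Real.rpow_def_of_pos ht p).symm

/-- Dividing by `s ^ β` solves the equation for `ε β μ = s ^ (-β) - s ^ (1 - β)`, strictly
decreasing when `0 < β < 1`. Uniqueness thus holds for all real `ε`. -/
theorem IsCriticalF.eq (hβ : 0 < β) (hβ1 : β < 1) {ε s t : ℝ}
    (hs : IsCriticalF β μ ε s) (ht : IsCriticalF β μ ε t) : s = t := by
  have key : ∀ {s t : ℝ}, IsCriticalF β μ ε s → IsCriticalF β μ ε t → ¬ s < t := by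
    rintro s t ⟨hs0, hs⟩ ⟨ht0, ht⟩ hst
    have h1 : ∀ {s : ℝ}, 0 < s → s = 1 - ε * β * μ * s ^ β →
        s ^ (-β) - s ^ (1 - β) = ε * β * μ := fun {s} hs0 hs => by
      have h2 : s ^ (1 - β) = s ^ (-β) * s := by
        rw [sub_eq_neg_add, Real.rpow_add hs0, Real.rpow_one]
      have h3 : s ^ (-β) * s ^ β = 1 := by rw [← Real.rpow_add hs0]; simp
      rw [h2]
      calc s ^ (-β) - s ^ (-β) * s = s ^ (-β) * (1 - s) := by ring
        _ = s ^ (-β) * (ε * β * μ * s ^ β) := by congr 1; linarith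
        _ = (s ^ (-β) * s ^ β) * (ε * β * μ) := by ring
        _ = _ := by rw [h3, one_mul]
    have h4 := (h1 hs0 hs).trans (h1 ht0 ht).symm
    have h5 : t ^ (-β) < s ^ (-β) := Real.rpow_lt_rpow_of_neg hs0 hst (by linarith)
    have h6 : s ^ (1 - β) < t ^ (1 - β) := Real.rpow_lt_rpow hs0.le hst (by linarith)
    linarith
  exact le_antisymm (not_lt.1 (key ht hs)) (not_lt.1 (key hs ht))

/-- Here `ε = s⁻¹ - β μ s ^ (β - 1)` is strictly decreasing in `s` when `β > 1`. -/
theorem IsCriticalG.eq (hβ1 : 1 < β) (hμ : 0 < μ) {ε s t : ℝ}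
    (hs : IsCriticalG β μ ε s) (ht : IsCriticalG β μ ε t) : s = t := by
  have key : ∀ {s t : ℝ}, IsCriticalG β μ ε s → IsCriticalG β μ ε t → ¬ s < t := by
    rintro s t ⟨hs0, hs⟩ ⟨ht0, ht⟩ hst
    have h1 : ∀ {s : ℝ}, 0 < s → β * μ * s ^ β = 1 - ε * s →
        s⁻¹ - β * μ * s ^ (β - 1) = ε := fun {s} hs0 hs => by
      rw [Real.rpow_sub_one hs0.ne', mul_div_assoc', hs]
      field_simp
      ring
    have h4 := (h1 hs0 hs).trans (h1 ht0 ht).symm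
    have h5 : t⁻¹ < s⁻¹ := inv_strictAnti₀ hs0 hst
    have h6 : s ^ (β - 1) < t ^ (β - 1) := Real.rpow_lt_rpow hs0.le hst (by linarith)
    have h7 : β * μ * s ^ (β - 1) < β * μ * t ^ (β - 1) := by gcongr
    linarith
  exact le_antisymm (not_lt.1 (key ht hs)) (not_lt.1 (key hs ht))

theorem IsCriticalF.critF_eq (hβ : 0 < β) (hβ1 : β < 1) {ε s : ℝ}
    (hs : IsCriticalF β μ ε s) : critF β μ ε = phaseF β μ s ε := by
  rw [critF, (Classical.epsilon_spec (⟨s, hs⟩ : ∃ s, IsCriticalF β μ ε s)).eq hβ hβ1 hs]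

theorem IsCriticalG.critG_eq (hβ1 : 1 < β) (hμ : 0 < μ) {ε s : ℝ}
    (hs : IsCriticalG β μ ε s) : critG β μ ε = phaseG β μ s ε := by
  rw [critG, (Classical.epsilon_spec (⟨s, hs⟩ : ∃ s, IsCriticalG β μ ε s)).eq hβ1 hμ hs]

/-- Since `ε` is an explicit analytic function of `s`, the one-variable inverse function theorem at
`s = 1` suffices. -/
theorem exists_critical_branch_F (hβ : 0 < β) (hμ : 0 < μ) : ∃ σ : ℝ → ℝ,
    AnalyticAt ℝ σ 0 ∧ σ 0 = 1 ∧ ∀ᶠ ε in 𝓝 (0 : ℝ), IsCriticalF β μ ε (σ ε) := by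
  set e : ℝ → ℝ := fun s => (1 - s) * s ^ (-β) / (β * μ) with he
  have hβμ : β * μ ≠ 0 := (mul_pos hβ hμ).ne'
  have h1 : AnalyticAt ℝ e 1 :=
    ((analyticAt_const.sub analyticAt_id).mul (analyticAt_rpow one_pos _)).div_const
  have h2 : HasDerivAt e (-1 / (β * μ)) 1 := by
    have h3 := (((hasDerivAt_id (1 : ℝ)).const_sub 1).mul
      (Real.hasDerivAt_rpow_const (p := -β) (Or.inl one_ne_zero))).div_const (β * μ)
    convert! h3 using 1
    simp
  have h4 : deriv e 1 ≠ 0 := by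
    rw [h2.deriv]
    exact div_ne_zero (by norm_num) hβμ
  have h5 : e 1 = 0 := by simp [he]
  obtain ⟨σ, hσ, hσ1, hσe⟩ := exists_analytic_inverse h1 h4
  rw [h5] at hσ hσ1 hσe
  refine ⟨σ, hσ, hσ1, ?_⟩
  have h6 : ∀ᶠ ε in 𝓝 (0 : ℝ), 0 < σ ε := by
    have h7 := hσ.continuousAt.tendsto
    rw [hσ1] at h7
    exact h7.eventually (lt_mem_nhds one_pos)
  filter_upwards [h6, hσe] with ε h7 h8
  refine ⟨h7, ?_⟩
  have h9 : σ ε ^ (-β) * σ ε ^ β = 1 := by rw [← Real.rpow_add h7]; simp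
  rw [he, div_eq_iff hβμ] at h8
  have h10 : 1 - σ ε = ε * β * μ * σ ε ^ β := by
    calc 1 - σ ε = (1 - σ ε) * (σ ε ^ (-β) * σ ε ^ β) := by rw [h9, mul_one]
      _ = (1 - σ ε) * σ ε ^ (-β) * σ ε ^ β := by ring
      _ = _ := by rw [h8]; ring
  linarith

theorem exists_critical_branch_G (hβ : 0 < β) (hμ : 0 < μ) : ∃ σ : ℝ → ℝ,
    AnalyticAt ℝ σ 0 ∧ ∀ᶠ ε in 𝓝 (0 : ℝ), IsCriticalG β μ ε (σ ε) := by
  set e : ℝ → ℝ := fun s => s⁻¹ - β * μ * s ^ (β - 1) with he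
  have hβμ : 0 < β * μ := mul_pos hβ hμ
  set a := (β * μ)⁻¹ ^ β⁻¹ with ha
  have ha0 : 0 < a := by positivity
  have haβ : β * μ * a ^ β = 1 := by
    rw [ha, ← Real.rpow_mul (by positivity), inv_mul_cancel₀ hβ.ne', Real.rpow_one,
      mul_inv_cancel₀ hβμ.ne']
  have hmul : ∀ s : ℝ, 0 < s → e s * s = 1 - β * μ * s ^ β := fun s hs => by
    rw [he]
    dsimp only
    rw [Real.rpow_sub_one hs.ne']
    field_simp
  have h1 : AnalyticAt ℝ e a :=
    (analyticAt_inv ha0.ne').sub (analyticAt_const.mul (analyticAt_rpow ha0 _))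
  have h5 : e a = 0 := by
    have := hmul a ha0
    rw [haβ, sub_self] at this
    exact (mul_eq_zero.1 this).resolve_right ha0.ne'
  have h4 : deriv e a ≠ 0 := by
    intro h0
    -- As `e a = 0`, a vanishing derivative of `e` would make that of `e s * s = 1 - β μ s ^ β`
    -- vanish too, which it does not.
    have h6 : HasDerivAt (fun s => e s * s) (0 * a + e a * 1) a := by
      have h7 := h1.differentiableAt.hasDerivAt
      rw [h0] at h7
      exact h7.mul (hasDerivAt_id a)
    have h8 : HasDerivAt (fun s : ℝ => 1 - β * μ * s ^ β) (-(β * μ * (β * a ^ (β - 1)))) a :=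
      ((Real.hasDerivAt_rpow_const (Or.inl ha0.ne')).const_mul _).const_sub 1
    have h9 := h8.congr_of_eventuallyEq (f₁ := fun s => e s * s) (by
      filter_upwards [lt_mem_nhds ha0] with s hs
      exact hmul s hs)
    have h10 := h6.unique h9
    rw [h5] at h10
    have : 0 < β * μ * (β * a ^ (β - 1)) := by positivity
    linarith
  obtain ⟨σ, hσ, hσ1, hσe⟩ := exists_analytic_inverse h1 h4
  rw [h5] at hσ hσ1 hσe
  refine ⟨σ, hσ, ?_⟩
  have h6 : ∀ᶠ ε in 𝓝 (0 : ℝ), 0 < σ ε := by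
    have h7 := hσ.continuousAt.tendsto
    rw [hσ1] at h7
    exact h7.eventually (lt_mem_nhds ha0)
  filter_upwards [h6, hσe] with ε h7 h8
  refine ⟨h7, ?_⟩
  have h9 := hmul _ h7
  rw [h8] at h9
  linarith

theorem eventually_existsUnique_isCriticalF (hβ : 0 < β) (hβ1 : β < 1) (hμ : 0 < μ) :
    ∀ᶠ ε in 𝓝 (0 : ℝ), ∃! s, IsCriticalF β μ ε s := by
  obtain ⟨σ, -, -, h⟩ := exists_critical_branch_F hβ hμ
  filter_upwards [h] with ε hε
  exact ⟨σ ε, hε, fun t ht => IsCriticalF.eq hβ hβ1 ht hε⟩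

theorem eventually_existsUnique_isCriticalG (hβ1 : 1 < β) (hμ : 0 < μ) :
    ∀ᶠ ε in 𝓝 (0 : ℝ), ∃! s, IsCriticalG β μ ε s := by
  obtain ⟨σ, -, h⟩ := exists_critical_branch_G (by linarith : 0 < β) hμ
  filter_upwards [h] with ε hε
  exact ⟨σ ε, hε, fun t ht => IsCriticalG.eq hβ1 hμ ht hε⟩

theorem analyticAt_critF (hβ : 0 < β) (hβ1 : β < 1) (hμ : 0 < μ) :
    AnalyticAt ℝ (critF β μ) 0 := by
  obtain ⟨σ, h1, h2, h3⟩ := exists_critical_branch_F hβ hμ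
  have h4 : 0 < σ 0 := by rw [h2]; exact one_pos
  have h5 : AnalyticAt ℝ (fun ε => phaseF β μ (σ ε) ε) 0 :=
    (h1.sub (h1.log h4)).add ((analyticAt_id.mul analyticAt_const).mul
      ((analyticAt_rpow h4 β).comp h1))
  refine h5.congr ?_
  filter_upwards [h3] with ε hε
  exact (hε.critF_eq hβ hβ1).symm

theorem analyticAt_critG (hβ1 : 1 < β) (hμ : 0 < μ) : AnalyticAt ℝ (critG β μ) 0 := by
  obtain ⟨σ, h1, h3⟩ := exists_critical_branch_G (by linarith : 0 < β) hμ
  have h4 : 0 < σ 0 := h3.self_of_nhds.1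
  have h5 : AnalyticAt ℝ (fun ε => phaseG β μ (σ ε) ε) 0 :=
    ((analyticAt_const.mul ((analyticAt_rpow h4 β).comp h1)).sub (h1.log h4)).add
      (analyticAt_id.mul h1)
  refine h5.congr ?_
  filter_upwards [h3] with ε hε
  exact (hε.critG_eq hβ1 hμ).symm

/-- Envelope principle: `s - ln s` is stationary at `s = 1`, so only the explicit dependence on `ε`
contributes. -/
theorem coeffF_one (hβ : 0 < β) (hβ1 : β < 1) (hμ : 0 < μ) : coeffF β μ 1 = μ := by
  obtain ⟨σ, h1, h2, h3⟩ := exists_critical_branch_F hβ hμ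
  have h4 : HasDerivAt σ (deriv σ 0) 0 := h1.differentiableAt.hasDerivAt
  have hσ : σ 0 ≠ 0 := by rw [h2]; exact one_ne_zero
  have h5 := (h4.sub (h4.log hσ)).add (((hasDerivAt_id (0 : ℝ)).mul_const μ).mul
    (h4.rpow_const (p := β) (Or.inl hσ)))
  have h6 : HasDerivAt (critF β μ) μ 0 := by
    refine HasDerivAt.congr_of_eventuallyEq ?_ (f₁ := critF β μ)
      (f := fun ε => phaseF β μ (σ ε) ε) (by
        filter_upwards [h3] with ε hε
        exact hε.critF_eq hβ hβ1)
    convert! h5 using 1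
    simp [h2]
  rw [coeffF, iteratedDeriv_one, h6.deriv]
  simp

theorem coeffF_zero (hβ : 0 < β) (hβ1 : β < 1) : coeffF β μ 0 = 1 := by
  have h : IsCriticalF β μ 0 1 := ⟨one_pos, by simp⟩
  rw [coeffF, iteratedDeriv_zero, h.critF_eq hβ hβ1]
  simp [phaseF]

theorem coeffG_zero (hβ1 : 1 < β) (hμ : 0 < μ) :
    coeffG β μ 0 = (1 + Real.log (μ * β)) / β := by
  have hβ : 0 < β := by linarith
  have hβμ : 0 < μ * β := by positivity
  set a := (μ * β)⁻¹ ^ β⁻¹ with ha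
  have haβ : a ^ β = (μ * β)⁻¹ := by
    rw [ha, ← Real.rpow_mul (by positivity), inv_mul_cancel₀ hβ.ne', Real.rpow_one]
  have h : IsCriticalG β μ 0 a := by
    refine ⟨by positivity, ?_⟩
    rw [haβ, mul_comm β, mul_inv_cancel₀ hβμ.ne']
    simp
  rw [coeffG, iteratedDeriv_zero, h.critG_eq hβ1 hμ, phaseG, haβ, ha,
    Real.log_rpow (by positivity), Real.log_inv]
  simp only [Nat.factorial_zero, Nat.cast_one, div_one, zero_mul, add_zero]
  field_simp
  ring

/-- With `t = k s` the saddle equation becomes the critical equation at `ε = k ^ (β - 1)`. -/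
theorem saddleMax_eq_critF (hβ : 0 < β) (hβ1 : β < 1) (hμ : 0 < μ) {k : ℝ} (hk : 0 < k) :
    saddleMax β μ k = k * Real.log k - k * critF β μ (k ^ (β - 1)) := by
  have ht := saddle_pos hβ hμ hk
  have h1 := saddle_eq hβ hμ hk
  rw [saddleMax, saddlePhase]
  set t := saddle β μ k
  have h2 : t = k * (t / k) := by field_simp
  have h3 : 0 < t / k := by positivity
  set s := t / k
  have h4 : t ^ β = k * k ^ (β - 1) * s ^ β := by
    rw [h2, Real.mul_rpow hk.le h3.le, Real.rpow_sub_one hk.ne']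
    field_simp
  have h5 : IsCriticalF β μ (k ^ (β - 1)) s := by
    refine ⟨h3, ?_⟩
    rw [h4] at h1
    have h6 : k * (s + k ^ (β - 1) * β * μ * s ^ β) = k * 1 := by
      rw [mul_one, mul_add, ← h2]
      linarith
    have h7 := mul_left_cancel₀ hk.ne' h6
    linarith
  rw [h5.critF_eq hβ hβ1, phaseF, h4, h2, Real.log_mul hk.ne' h3.ne']
  ring

/-- For `β > 1` the term `μ t ^ β` dominates, so the natural scale is `t = k ^ (1 / β) s`, with `ε =
k ^ (1 / β - 1)`. -/
theorem saddleMax_eq_critG (hβ1 : 1 < β) (hμ : 0 < μ) {k : ℝ} (hk : 0 < k) :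
    saddleMax β μ k = 1 / β * (k * Real.log k) - k * critG β μ (k ^ (1 / β - 1)) := by
  have hβ : 0 < β := by linarith
  have ht := saddle_pos hβ hμ hk
  have h1 := saddle_eq hβ hμ hk
  rw [saddleMax, saddlePhase]
  set t := saddle β μ k
  set r := k ^ (1 / β) with hr
  have hr0 : 0 < r := by positivity
  have h2 : t = r * (t / r) := by field_simp
  have h3 : 0 < t / r := by positivity
  set s := t / r
  have hrβ : r ^ β = k := by
    rw [hr, ← Real.rpow_mul hk.le, one_div_mul_cancel hβ.ne', Real.rpow_one]
  have h4 : t ^ β = k * s ^ β := by rw [h2, Real.mul_rpow hr0.le h3.le, hrβ]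
  have h5 : r = k * k ^ (1 / β - 1) := by
    rw [Real.rpow_sub_one hk.ne', hr]
    field_simp
  have h6 : IsCriticalG β μ (k ^ (1 / β - 1)) s := by
    refine ⟨h3, ?_⟩
    rw [h4] at h1
    have h7 : k * (β * μ * s ^ β + k ^ (1 / β - 1) * s) = k * 1 := by
      rw [mul_one, mul_add, ← mul_assoc k (k ^ (1 / β - 1)), ← h5, ← h2]
      linarith
    have h8 := mul_left_cancel₀ hk.ne' h7
    linarith
  have h9 : Real.log t = 1 / β * Real.log k + Real.log s := by
    rw [h2, Real.log_mul hr0.ne' h3.ne', hr, Real.log_rpow hk]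
  have h10 : t = k * k ^ (1 / β - 1) * s := by rw [← h5, ← h2]
  rw [h6.critG_eq hβ1 hμ, phaseG, h4, h9]
  linear_combination -h10

theorem saddleMax_eq_of_beta_eq_one (hμ : 0 < μ) {k : ℝ} (hk : 0 < k) :
    saddleMax 1 μ k = k * Real.log k - k * Real.log (1 + μ) - k := by
  have h1 : saddle 1 μ k = k / (1 + μ) := by
    refine saddle_unique one_pos hμ (by positivity) ?_
    rw [Real.rpow_one]
    field_simp
  rw [saddleMax, saddlePhase, h1, Real.rpow_one, Real.log_div hk.ne' (by positivity)]
  field_simp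
  ring

theorem logAsymptotics_of_isBigO (hβ : 0 < β) (hμ : 0 < μ) {d : ℕ → ℝ}
    (h : (fun k => Real.log (d k) - logMoment β μ k) =O[atTop] fun k : ℕ => Real.log (k : ℝ)) :
    LogAsymptotics β μ d := by
  have hst := log_factorial_isBigO
  refine ⟨fun hβ1 => ?_, fun hβ1 => ?_, fun hβ1 => ?_⟩
  · set J := ⌈1 / (1 - β)⌉₊ with hJ
    have hb1 : 0 < 1 - β := by linarith
    have hJ0 : 0 < J := Nat.ceil_pos.2 (by positivity)
    have hJ1 : (β - 1) * J + 1 ≤ 0 := by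
      have := Nat.le_ceil (1 / (1 - β))
      rw [← hJ, div_le_iff₀ hb1] at this
      linarith
    have h1 := isBigO_one_log (isBigO_taylor (analyticAt_critF hβ hβ1 hμ) (by linarith) hJ1)
    refine ((h.sub h1).sub hst).congr' ?_ EventuallyEq.rfl
    filter_upwards [eventually_gt_atTop 0] with k hk
    have hk0 : (0 : ℝ) < k := by exact_mod_cast hk
    -- The zeroth coefficient is `1`; its contribution `-k` cancels the `+k` from Stirling's
    -- formula, and the two terms `k ln k` cancel as well.
    rw [Finset.range_eq_Ico, Finset.sum_eq_sum_Ico_succ_bot hJ0, logMoment,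
      saddleMax_eq_critF hβ hβ1 hμ hk0]
    have h2 := coeffF_zero (μ := μ) hβ hβ1
    simp only [coeffF] at h2 ⊢
    rw [h2]
    simp only [Nat.cast_zero, mul_zero, zero_add, Real.rpow_one]
    ring
  · subst hβ1
    refine (h.sub hst).congr' ?_ EventuallyEq.rfl
    filter_upwards [eventually_gt_atTop 0] with k hk
    have hk0 : (0 : ℝ) < k := by exact_mod_cast hk
    rw [logMoment, saddleMax_eq_of_beta_eq_one hμ hk0]
    ring
  · set J := ⌈β / (β - 1)⌉₊ with hJ
    have hb1 : 0 < β - 1 := by linarith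
    have hJ0 : 0 < J := Nat.ceil_pos.2 (by positivity)
    have hJ1 : (1 / β - 1) * J + 1 ≤ 0 := by
      have h3 := Nat.le_ceil (β / (β - 1))
      rw [← hJ, div_le_iff₀ hb1] at h3
      have h4 : (1 / β - 1) * J + 1 = (β - J * (β - 1)) / β := by
        field_simp
        ring
      rw [h4]
      exact div_nonpos_of_nonpos_of_nonneg (by linarith) hβ.le
    have ha : 1 / β - 1 < 0 := by
      rw [sub_neg, div_lt_one hβ]; exact hβ1
    have h1 := isBigO_one_log (isBigO_taylor (analyticAt_critG hβ1 hμ) ha hJ1)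
    refine ((h.sub h1).sub hst).congr' ?_ EventuallyEq.rfl
    filter_upwards [eventually_gt_atTop 0] with k hk
    have hk0 : (0 : ℝ) < k := by exact_mod_cast hk
    -- The zeroth coefficient together with Stirling's `+k` produces the linear term; `k ln k`
    -- survives with the factor `1 / β - 1`.
    rw [Finset.range_eq_Ico, Finset.sum_eq_sum_Ico_succ_bot hJ0, logMoment,
      saddleMax_eq_critG hβ1 hμ hk0]
    have h2 := coeffG_zero hβ1 hμ
    simp only [coeffG] at h2 ⊢
    rw [h2]
    simp only [Nat.cast_zero, mul_zero, zero_add, Real.rpow_one]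
    field_simp
    ring

end CriticalPoints
end MetricLandau

/-! ### Conclusion -/

namespace MetricLandau

theorem levelBounds_of_eigenvalue_asymptotics {b : ℝ} (hb : 0 < b)
    {m : Plane → Matrix (Fin 2) (Fin 2) ℂ} (hsmooth : ∀ j k, SmoothBounded fun x => m x j k)
    (hpos : ∀ x, (m x).PosSemidef) {β γ μ : ℝ} (hβ : 0 < β) (hγ : 0 < γ)
    (hμ : μ = γ * (2 / b) ^ β)
    (hmin : (fun x => Real.log (minEigenvalue (m x)) - (-γ * ‖x‖ ^ (2 * β)))
      =O[Bornology.cobounded Plane] fun x => Real.log ‖x‖)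
    (hmax : (fun x => Real.log (maxEigenvalue (m x)) - (-γ * ‖x‖ ^ (2 * β)))
      =O[Bornology.cobounded Plane] fun x => Real.log ‖x‖) :
    LevelBounds hb (metricForm hb m fun j k => (hsmooth j k).memLp) (logMoment β μ) := by
  have hμ0 : 0 < μ := by rw [hμ]; positivity
  obtain ⟨A₁, B₁, N₁, ρ₁, h1, h2, h3⟩ := exists_upper_weight hb hsmooth hpos hβ hμ0 hμ hmax
  obtain ⟨A₂, B₂, c, t₀, N₂, ρ₂, h4, h5, h6, h7, h8⟩ :=
    exists_lower_weight hb hpos hβ hγ hμ0 hμ hmin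
  exact levelBounds_metricForm hb m _ hβ hμ0 h1 h4 h2 h5 h6 h7 h3 h8

end MetricLandau

theorem theorem2p2 (b : ℝ) (hb : 0 < b)
    (m : MetricLandau.Plane → Matrix (Fin 2) (Fin 2) ℂ)
    (hsmooth : ∀ j k, MetricLandau.SmoothBounded fun x => m x j k)
    (hpos : ∀ x, (m x).PosSemidef)
    (β γ μ : ℝ) (hβ : 0 < β) (hγ : 0 < γ) (hμ : μ = γ * (2 / b) ^ β)
    (hmin : (fun x => Real.log (MetricLandau.minEigenvalue (m x)) - (-γ * ‖x‖ ^ (2 * β)))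
      =O[Bornology.cobounded MetricLandau.Plane] fun x => Real.log ‖x‖)
    (hmax : (fun x => Real.log (MetricLandau.maxEigenvalue (m x)) - (-γ * ‖x‖ ^ (2 * β)))
      =O[Bornology.cobounded MetricLandau.Plane] fun x => Real.log ‖x‖) :
    (β < 1 →
      (∀ᶠ ε in 𝓝 (0 : ℝ), ∃! s, MetricLandau.IsCriticalF β μ ε s) ∧
      AnalyticAt ℝ (MetricLandau.critF β μ) 0 ∧ MetricLandau.coeffF β μ 1 = μ) ∧
    (1 < β →
      (∀ᶠ ε in 𝓝 (0 : ℝ), ∃! s, MetricLandau.IsCriticalG β μ ε s) ∧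
      AnalyticAt ℝ (MetricLandau.critG β μ) 0) ∧
    ∀ q : ℕ,
      (∃ lam : ℕ → ℝ, Antitone lam ∧
        MetricLandau.ListsEigenvalues (MetricLandau.HPlus b m) (MetricLandau.gapAbove b q) lam ∧
        MetricLandau.LogAsymptotics β μ fun k => lam k - MetricLandau.landauLevel b q) ∧
      ((∃ c : ℝ, c < 1 ∧ ∀ x, MetricLandau.maxEigenvalue (m x) ≤ c) →
        ∃ lam : ℕ → ℝ, Monotone lam ∧
          MetricLandau.ListsEigenvalues (MetricLandau.HMinus b m) (MetricLandau.gapBelow b q) lam ∧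
          MetricLandau.LogAsymptotics β μ fun k => -(lam k - MetricLandau.landauLevel b q)) := by
  have hμ0 : 0 < μ := by rw [hμ]; positivity
  have hW := MetricLandau.levelBounds_of_eigenvalue_asymptotics hb hsmooth hpos hβ hγ hμ hmin hmax
  refine ⟨fun hβ1 => ⟨MetricLandau.eventually_existsUnique_isCriticalF hβ hβ1 hμ0,
    MetricLandau.analyticAt_critF hβ hβ1 hμ0, MetricLandau.coeffF_one hβ hβ1 hμ0⟩,
    fun hβ1 => ⟨MetricLandau.eventually_existsUnique_isCriticalG hβ1 hμ0,
    MetricLandau.analyticAt_critG hβ1 hμ0⟩, fun q => ⟨?_, ?_⟩⟩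
  · obtain ⟨C, hC⟩ := MetricLandau.exists_norm_entry_le hsmooth
    obtain ⟨lam, h1, h2, h3⟩ := MetricLandau.exists_listing_HPlus hb m _ hW hpos
      (fun x w => MetricLandau.re_matForm_le (hC x) w) q
    exact ⟨lam, h1, h2, MetricLandau.logAsymptotics_of_isBigO hβ hμ0 h3⟩
  · rintro ⟨c, hc1, hc⟩
    obtain ⟨lam, h1, h2, h3⟩ := MetricLandau.exists_listing_HMinus hb m _ hW hpos hc1
      (fun x w => (MetricLandau.le_maxEigenvalue_mul (hpos x).isHermitian w).trans
        (mul_le_mul_of_nonneg_right (hc x) (Finset.sum_nonneg fun j _ => sq_nonneg _))) q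
    exact ⟨lam, h1, h2, MetricLandau.logAsymptotics_of_isBigO hβ hμ0 h3⟩
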